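/- **Setting.** A *chart* around a point $x$ of a Hausdorff space $X$ is an open neighbourhood $U$ of $x$ together with a family of relatively closed subsets $A_i\subseteq U$ containing $x$ (the branches), with $U=\bigcup_i A_i$, and homeomorphisms $\phi_i$ of $A_i$ onto open intervals of $\mathbb R$, such that, whenever $A_i\cap A_j\neq\{x\}$, $\phi_i=\phi_j$ on $A_i\cap A_j$ and $A_i\cap A_j$ corresponds to a (relatively closed) interval. A *vertex space* is a Hausdorff space $X$ with a collection of charts, at least one around every point, that is coherent: near each of its points $p$, a branch of any chart coincides, as an oriented curve, with a branch of any given chart around $p$. An *elementary interval* is a subset of a branch $A_i$ corresponding to some $(a,b]$ with $a<b$ and $[a,b]\subset\phi_i(A_i)$. An *interval* is a union $\alpha_1\cup\dots\cup\alpha_n$ ($n\ge 1$) of elementary intervals such that for each $1\le i<n$ the set $\alpha_{i+1}$ is disjoint from $\alpha_1\cup\dots\cup\alpha_i$, and $\alpha_1\cup\dots\cup\alpha_{i+1}$ is connected and, near every point $x$, meets each branch through $x$ of each chart around $x$ in the empty set or in an open–closed interval. Write $\alpha\oplus\beta=\alpha\cup\beta$ if $\alpha\cap\beta=\emptyset$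 and the union is an interval, and $\alpha\ominus\beta=\alpha\setminus\beta$ if $\beta\subseteq\alpha$ and the difference is an interval. Let $F_X$ be the $\mathbb Z$-span of the characteristic functions $1_\alpha$ of intervals, and for $f,g\in F_X$ let $\langle f,g\rangle=\sum_{p\in X}\big(\sum_e f_e g_e-\sum_{(e,o)} f_e g_o\big)$, where $e$ runs over the half-branches arriving at $p$, $(e,o)$ over the pairs of an arriving and a leaving half-branch at $p$ that lie on a common branch through $p$, and $f_e,g_o$ are the limits of $f,g$ at $p$ along them (on a single branch this is $\sum_p f_-(p)(g_-(p)-g_+(p))$). The *Euler form* is $(f,g)=\langle f,g\rangle+\langle g,f\rangle$; write $\langle\alpha,\beta\rangle=\langle 1_\alpha,1_\beta\rangle$, $(\alpha,\beta)=(1_\alpha,1_\beta)$, and $c(\alpha,\beta)=(-1)^{\langle\alpha,\beta\rangle}(\alpha,\beta)$. **Assume that the Euler form is non-degenerate on $F_X$.** Let $k$ be a field of characteristic zero (e.g. $\mathbb C$). Let $\tilde{\mathfrak g}_X$ be the Lie $k$-algebra generated by $F_X$ (additively, with $\xi_\alpha=1_\alpha$) and elements $x^\pm_\alpha$, one for each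 interval $\alpha$ and each sign, with relations $[\xi_\alpha,\xi_\beta]=0$, $[\xi_\alpha,x^\pm_\beta]=\pm(\alpha,\beta)x^\pm_\beta$, $[x^+_\alpha,x^-_\beta]=\delta_{\alpha\beta}\xi_\alpha+c(\alpha,\beta)(x^+_{\alpha\ominus\beta}-x^-_{\beta\ominus\alpha})$, undefined terms being zero. It is graded by $F_X$, with $\deg\xi_\alpha=0$, $\deg x^\pm_\alpha=\pm1_\alpha$. The *continuum Kac–Moody algebra* $\mathfrak g_X$ is the quotient of $\tilde{\mathfrak g}_X$ by the sum of all graded ideals meeting the span of $F_X$ trivially. Let $\mathfrak h$ be the span of $F_X$ in $\mathfrak g_X$, $\mathfrak n^\pm$ the subalgebra generated by the $x^\pm_\alpha$, and $\mathfrak b^\pm_X$ the one generated by $\mathfrak h$ and the $x^\pm_\alpha$. Write $\mathfrak g_X\hat\otimes\mathfrak g_X=\bigoplus_{\chi}\prod_{\phi+\psi=\chi}\mathfrak g_\phi\otimes\mathfrak g_\psi$ and $x\wedge y=\tfrac12(x\otimes y-y\otimes x)$. **Theorem.** 1. There is a unique invariant symmetric bilinear form on $\mathfrak g_X$ with $(\xi_\alpha,\xi_\beta)=(\alpha,\beta)$,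 $(x^\pm_\alpha,\xi_\beta)=0$, $(x^\pm_\alpha,x^\pm_\beta)=0$, $(x^+_\alpha,x^-_\beta)=\delta_{\alpha\beta}$. It is non-degenerate. 2. There is a unique linear map $\delta:\mathfrak g_X\to\mathfrak g_X\hat\otimes\mathfrak g_X$ satisfying the cocycle condition $\delta([x,y])=x\cdot\delta(y)-y\cdot\delta(x)$ and $$\delta(\xi_\alpha)=0,\qquad \delta(x^\pm_\alpha)=\xi_\alpha\wedge x^\pm_\alpha+\sum_{\beta\oplus\gamma=\alpha}c(\beta,\beta\oplus\gamma)\,x^\pm_\beta\wedge x^\pm_\gamma$$ (sum over ordered pairs). It is of degree zero, antisymmetric and satisfies the co-Jacobi identity, so $\mathfrak g_X$ is a topological Lie bialgebra; and $\mathfrak b^+_X$, $\mathfrak b^-_X$ are Lie sub-bialgebras. 3. The form of (1) restricts to a non-degenerate pairing of $\mathfrak b^+_X$ and $\mathfrak b^-_X$. Renormalize it to the pairing $\kappa:\mathfrak b^+_X\times\mathfrak b^-_X\to k$ given by $\kappa(h+x,h'+y)=-2(h,h')-(x,y)$ for $h,h'\in\mathfrak h$, $x\in\mathfrak n^+$,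 $y\in\mathfrak n^-$. Then $\kappa$ is well defined, and is a non-degenerate pairing of Lie bialgebras $\mathfrak b^+_X\otimes(\mathfrak b^-_X)^{\mathrm{cop}}\to k$, where $(\mathfrak b^-_X)^{\mathrm{cop}}$ has cobracket $-\delta$: that is, $\kappa([x,y],z)=-(\kappa\otimes\kappa)(x\otimes y,\delta(z))$ for $x,y\in\mathfrak b_X^+$, $z\in\mathfrak b_X^-$ and $\kappa(x,[y,z])=(\kappa\otimes\kappa)(\delta(x),y\otimes z)$ for $x\in\mathfrak b_X^+$, $y,z\in\mathfrak b_X^-$. In the weak completion of $\mathfrak g_X\otimes\mathfrak g_X$ with respect to the form of (1) (that is, the space of bilinear forms on $\mathfrak g_X$, where $u\otimes v$ is identified with $(a,b)\mapsto(u,a)(v,b)$), there is a unique canonical element $r_X\in\mathfrak b^+_X\hat\otimes\mathfrak b^-_X$ of $\kappa$, and it is a quasi-triangular structure on $(\mathfrak g_X,\delta)$: $r_X+r_X^{21}$ is $\mathfrak g_X$-invariant, $[r_{12},r_{13}]+[r_{12},r_{23}]+[r_{13},r_{23}]=0$ for $r=r_X$ (the partial contractions of $r_X$ with elements of $\mathfrak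 g_X$ lie in $\mathfrak g_X$, so this makes sense in the weak completion of $\mathfrak g_X^{\otimes3}$), and $\delta(x)=[x\otimes1+1\otimes x,r_X]$ for all $x\in\mathfrak g_X$. -/

import Mathlib

open Filter Topology TensorProduct

noncomputable section

namespace ContinuumKM

universe u v w

/-! ### Vertex spaces -/

/-- A chart around a point `x` of a topological space `X`: an open neighbourhood `U` of `x`, a
family of closed subsets `A ⊆ U` (the branches) through `x` which cover `U`, and for every branch
a coordinate `coord A`, a homeomorphism of `A` onto an open interval of `ℝ`; if two branches
meet in more than the point `x`, their coordinates agree on the intersection, which is an interval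
in these coordinates. (The intersection is automatically closed in both branches.) -/
structure Chart (X : Type u) [TopologicalSpace X] (x : X) where
  U : Set X
  isOpen_U : IsOpen U
  mem_U : x ∈ U
  branches : Set (Set X)
  coord : Set X → X → ℝ
  sUnion_branches : ⋃₀ branches = U
  mem_branch : ∀ A ∈ branches, x ∈ A
  closed_branch : ∀ A ∈ branches, ∃ C : Set X, IsClosed C ∧ A = C ∩ U
  coord_embedding : ∀ A ∈ branches, IsEmbedding (A.domRestrict (coord A))
  coord_open : ∀ A ∈ branches, IsOpen (coord A '' A)
  coord_interval : ∀ A ∈ branches, (coord A '' A).OrdConnected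
  coord_agree : ∀ A ∈ branches, ∀ B ∈ branches, A ∩ B ≠ {x} →
    Set.EqOn (coord A) (coord B) (A ∩ B) ∧ (coord A '' (A ∩ B)).OrdConnected

/-- The structure of a vertex space on `X`: a collection of charts, with at least one chart around
every point, which induce the same oriented branches at every point. The last condition says that
near each of its points `p`, a branch `A` of any chart coincides, together with the orientation
given by its coordinate, with some branch of any given chart around `p`. -/
structure VertexSpace (X : Type u) [TopologicalSpace X] where
  atlas : ∀ x : X, Set (Chart X x)
  exists_chart : ∀ x, (atlas x).Nonempty
  coherent : ∀ (x : X), ∀ c ∈ atlas x, ∀ A ∈ c.branches, ∀ p ∈ A, ∀ c' ∈ atlas p,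
    ∃ A' ∈ c'.branches, ∃ W ∈ 𝓝 p, A ∩ W = A' ∩ W ∧
      ∀ y ∈ A ∩ W, ∀ z ∈ A ∩ W, (c.coord A y < c.coord A z ↔ c'.coord A' y < c'.coord A' z)

/-! ### Intervals -/

section Intervals

variable {X : Type u} [TopologicalSpace X] (V : VertexSpace X)

/-- Elementary intervals: subsets of a branch `A` of a chart which correspond to an open-closed
interval `(a, b]` of `ℝ`, with both endpoints in the image of `A`. -/
def IsElementary (α : Set X) : Prop :=
  ∃ x : X, ∃ c ∈ V.atlas x, ∃ A ∈ c.branches, ∃ a b : ℝ, a < b ∧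
    Set.Icc a b ⊆ c.coord A '' A ∧ α = {y ∈ A | c.coord A y ∈ Set.Ioc a b}

/-- `α` is locally open-closed along the branches: near every point `x`, the trace of `α` on any
branch through `x` of a chart around `x` is empty or an open-closed interval
(it is empty when `b ≤ a`). -/
def LocallyOpenClosed (α : Set X) : Prop :=
  ∀ x : X, ∀ c ∈ V.atlas x, ∀ A ∈ c.branches, ∃ W ∈ 𝓝 x, ∃ a b : ℝ,
    α ∩ A ∩ W = {y ∈ A ∩ W | c.coord A y ∈ Set.Ioc a b}

/-- Intervals of `X`: unions `α₁ ∪ ⋯ ∪ αₙ`, `n ≥ 1`, of admissible sequences of elementary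
intervals, i.e. such that for `1 ≤ i < n` the set `αᵢ₊₁` is disjoint from `α₁ ∪ ⋯ ∪ αᵢ`, and
`α₁ ∪ ⋯ ∪ αᵢ₊₁` is connected and locally open-closed along the branches. -/
inductive IsInterval : Set X → Prop
  | elementary {α : Set X} : IsElementary V α → IsInterval α
  | join {α β : Set X} : IsInterval α → IsElementary V β → Disjoint α β →
      IsConnected (α ∪ β) → LocallyOpenClosed V (α ∪ β) → IsInterval (α ∪ β)

/-- The set `Int(X)` of intervals of `X`. -/
def Interval : Type u := {α : Set X // IsInterval V α}

variable {V}

/-- `α ⊕ β` is defined and equal to `γ`. -/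
def IsSum (α β γ : Interval V) : Prop :=
  Disjoint α.1 β.1 ∧ α.1 ∪ β.1 = γ.1

/-- `α ⊖ β` is defined. -/
def DiffDefined (α β : Interval V) : Prop :=
  β.1 ⊆ α.1 ∧ IsInterval V (α.1 \ β.1)

/-- `α ⊖ β`, when it is defined. -/
def diff (α β : Interval V) (h : DiffDefined α β) : Interval V := ⟨α.1 \ β.1, h.2⟩

variable (V)

/-- `Fun(X)`: the `ℤ`-span of the characteristic functions of the intervals of `X`. -/
def funX : Submodule ℤ (X → ℤ) :=
  Submodule.span ℤ (Set.range fun α : Interval V => α.1.indicator fun _ => (1 : ℤ))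

variable {V}

/-- The characteristic function of an interval, as an element of `Fun(X)`. -/
def cf (α : Interval V) : funX V :=
  ⟨α.1.indicator fun _ => (1 : ℤ), Submodule.subset_span ⟨α, rfl⟩⟩

/-! ### The Euler form -/

/-- The half-branch arriving at `p` along a branch `A` through `p`, as the filter of
one-sided neighbourhoods of `p`: limits along it are left limits at `p` along `A`. -/
def leftEnd {x : X} (c : Chart X x) (A : Set X) (p : X) : Filter X :=
  𝓝[{y ∈ A | c.coord A y < c.coord A p}] p

/-- The half-branch leaving `p` along a branch `A` through `p`: limits along it are right limits
at `p` along `A`. -/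
def rightEnd {x : X} (c : Chart X x) (A : Set X) (p : X) : Filter X :=
  𝓝[{y ∈ A | c.coord A p < c.coord A y}] p

variable (V)

/-- The half-branches arriving at `p`; branches which agree near `p` to the left of `p` give the
same half-branch. -/
def leftEnds (p : X) : Set (Filter X) :=
  {e | ∃ c ∈ V.atlas p, ∃ A ∈ c.branches, e = leftEnd c A p}

/-- The pairs (arriving half-branch, leaving half-branch) of the branches through `p`. -/
def passages (p : X) : Set (Filter X × Filter X) :=
  {q | ∃ c ∈ V.atlas p, ∃ A ∈ c.branches, q = (leftEnd c A p, rightEnd c A p)}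

/-- The non-symmetric form `⟨f, g⟩` on `Fun(X)`. If only one branch passes through `p`, the
contribution of `p` is `f₋(p) (g₋(p) - g₊(p))`; in general the products `f₋ g₋` are summed over the
half-branches arriving at `p`, and the products `f₋ g₊` over the pairs of an arriving and a leaving
half-branch which lie on a common branch, so that pieces without a common branch are orthogonal. -/
def euler (f g : funX V) : ℤ :=
  ∑ᶠ p : X, ((∑ᶠ e ∈ leftEnds V p, limUnder e f.1 * limUnder e g.1)
    - ∑ᶠ q ∈ passages V p, limUnder q.1 f.1 * limUnder q.2 g.1)

/-- The Euler form `(f, g) = ⟨f, g⟩ + ⟨g, f⟩`. -/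
def eulerSym (f g : funX V) : ℤ := euler V f g + euler V g f

/-- The Euler form is non-degenerate on `Fun(X)`. -/
def EulerNondegenerate : Prop :=
  ∀ f : funX V, (∀ g : funX V, eulerSym V f g = 0) → f = 0

variable {V}

/-- The coefficient `c(α, β) = (-1) ^ ⟨α, β⟩ (α, β)`. -/
def ca (α β : Interval V) : ℤ :=
  (Int.negOnePow (euler V (cf α) (cf β)) : ℤ) * eulerSym V (cf α) (cf β)

end Intervals

/-! ### Continuum Kac–Moody algebras -/

section Algebra

variable {X : Type u} [TopologicalSpace X] (V : VertexSpace X)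

/-- Generators: the elements of `Fun(X)`, and `x⁺_α`, `x⁻_α` for the intervals `α`. -/
inductive Gen : Type u
  | cartan : funX V → Gen
  | pos : Interval V → Gen
  | neg : Interval V → Gen

variable {V}

/-- The degree of a generator: `0` on `Fun(X)`, and `± 1_α` on `x^±_α`. -/
def Gen.deg : Gen V → funX V
  | .cartan _ => 0
  | .pos α => cf α
  | .neg α => -cf α

variable (k : Type v) [Field k]

open Gen in
open scoped Classical in
/-- The right-hand side of the relation for `[x⁺_α, x⁻_β]`, in the free Lie algebra. -/
def crossTerm (α β : Interval V) : FreeLieAlgebra k (Gen V) :=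
  (if α = β then FreeLieAlgebra.of k (cartan (cf α)) else 0) +
    (ca α β : k) • ((if h : DiffDefined α β then FreeLieAlgebra.of k (pos (diff α β h)) else 0)
      - (if h : DiffDefined β α then FreeLieAlgebra.of k (neg (diff β α h)) else 0))

open Gen in
/-- The defining relations; each element of this set is put to zero. -/
inductive Rel : FreeLieAlgebra k (Gen V) → Prop
  | add (f g : funX V) : Rel (FreeLieAlgebra.of k (cartan (f + g))
      - FreeLieAlgebra.of k (cartan f) - FreeLieAlgebra.of k (cartan g))
  | comm (α β : Interval V) :
      Rel ⁅FreeLieAlgebra.of k (cartan (cf α)), FreeLieAlgebra.of k (cartan (cf β))⁆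
  | weight_pos (α β : Interval V) :
      Rel (⁅FreeLieAlgebra.of k (cartan (cf α)), FreeLieAlgebra.of k (pos β)⁆
        - (eulerSym V (cf α) (cf β) : k) • FreeLieAlgebra.of k (pos β))
  | weight_neg (α β : Interval V) :
      Rel (⁅FreeLieAlgebra.of k (cartan (cf α)), FreeLieAlgebra.of k (neg β)⁆
        + (eulerSym V (cf α) (cf β) : k) • FreeLieAlgebra.of k (neg β))
  | cross (α β : Interval V) :
      Rel (⁅FreeLieAlgebra.of k (pos α), FreeLieAlgebra.of k (neg β)⁆ - crossTerm k α β)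

variable (V)

/-- The Lie algebra freely generated by `Fun(X)` and the `x^±_α`, modulo the relations. -/
abbrev TildeG : Type (max u v) :=
  FreeLieAlgebra k (Gen V) ⧸ LieSubmodule.lieSpan k (FreeLieAlgebra k (Gen V))
    {r | Rel (V := V) k r}

/-- The generators of `TildeG`. -/
def tildeGen (g : Gen V) : TildeG V k :=
  LieSubmodule.Quotient.mk (FreeLieAlgebra.of k g)

variable {V}

/-- `IsMonomial γ φ x`: `x` is an iterated bracket of generators of total degree `φ`, in a
Lie algebra with generators `γ`. -/
inductive IsMonomial {L : Type w} [LieRing L] (γ : Gen V → L) : funX V → L → Prop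
  | gen (g : Gen V) : IsMonomial γ g.deg (γ g)
  | lie {φ ψ : funX V} {x y : L} :
      IsMonomial γ φ x → IsMonomial γ ψ y → IsMonomial γ (φ + ψ) ⁅x, y⁆

/-- The homogeneous component of degree `φ`. -/
def homog {L : Type w} [LieRing L] [LieAlgebra k L] (γ : Gen V → L) (φ : funX V) :
    Submodule k L :=
  Submodule.span k {x | IsMonomial γ φ x}

/-- The span of `Fun(X)`. -/
def cartanSpan {L : Type w} [LieRing L] [LieAlgebra k L] (γ : Gen V → L) : Submodule k L :=
  Submodule.span k (Set.range fun f : funX V => γ (.cartan f))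

variable (V)

/-- The sum of all graded two-sided ideals of `TildeG` which meet `Fun(X)` trivially. -/
def radical : LieIdeal k (TildeG V k) :=
  sSup {I | I.toSubmodule ≤ ⨆ φ : funX V, I.toSubmodule ⊓ homog k (tildeGen V k) φ ∧
    Disjoint I.toSubmodule (cartanSpan k (tildeGen V k))}

/-- The continuum Kac–Moody algebra of `X`. -/
abbrev ContKM : Type (max u v) := TildeG V k ⧸ radical V k

/-- The generators of the continuum Kac–Moody algebra. -/
def kmGen (g : Gen V) : ContKM V k := LieSubmodule.Quotient.mk (tildeGen V k g)

variable {V}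

/-- `ξ_α`. -/
def xi (α : Interval V) : ContKM V k := kmGen V k (.cartan (cf α))

/-- `x⁺_α`. -/
def xp (α : Interval V) : ContKM V k := kmGen V k (.pos α)

/-- `x⁻_α`. -/
def xm (α : Interval V) : ContKM V k := kmGen V k (.neg α)

variable (V)

/-- The homogeneous component of degree `φ` of the continuum Kac–Moody algebra. -/
def comp (φ : funX V) : Submodule k (ContKM V k) := homog k (kmGen V k) φ

/-- The Cartan subalgebra, as a subspace. -/
def cartan : Submodule k (ContKM V k) := cartanSpan k (kmGen V k)

/-- The subalgebra generated by the `x⁺_α`. -/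
def nPos : LieSubalgebra k (ContKM V k) :=
  LieSubalgebra.lieSpan k _ (Set.range (xp k : Interval V → ContKM V k))

/-- The subalgebra generated by the `x⁻_α`. -/
def nNeg : LieSubalgebra k (ContKM V k) :=
  LieSubalgebra.lieSpan k _ (Set.range (xm k : Interval V → ContKM V k))

/-- The positive Borel subalgebra. -/
def bPos : LieSubalgebra k (ContKM V k) :=
  LieSubalgebra.lieSpan k _ ((cartan V k : Set (ContKM V k)) ∪
    Set.range (xp k : Interval V → ContKM V k))

/-- The negative Borel subalgebra. -/
def bNeg : LieSubalgebra k (ContKM V k) :=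
  LieSubalgebra.lieSpan k _ ((cartan V k : Set (ContKM V k)) ∪
    Set.range (xm k : Interval V → ContKM V k))

/-! ### Invariant forms -/

/-- `B` is an invariant symmetric bilinear form with the prescribed values on the generators. -/
structure IsEulerExtension (B : LinearMap.BilinForm k (ContKM V k)) : Prop where
  symm : ∀ x y, B x y = B y x
  invariant : ∀ x y z, B ⁅x, y⁆ z = B x ⁅y, z⁆
  xi_xi : ∀ α β : Interval V, B (xi k α) (xi k β) = (eulerSym V (cf α) (cf β) : k)
  xp_xi : ∀ α β : Interval V, B (xp k α) (xi k β) = 0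
  xm_xi : ∀ α β : Interval V, B (xm k α) (xi k β) = 0
  xp_xp : ∀ α β : Interval V, B (xp k α) (xp k β) = 0
  xm_xm : ∀ α β : Interval V, B (xm k α) (xm k β) = 0
  xp_xm_self : ∀ α : Interval V, B (xp k α) (xm k α) = 1
  xp_xm_ne : ∀ α β : Interval V, α ≠ β → B (xp k α) (xm k β) = 0

/-- Non-degeneracy of a pairing between two subspaces. -/
def PairsNondegenerately {L : Type w} [AddCommGroup L] [Module k L]
    (P : LinearMap.BilinForm k L) (S T : Submodule k L) : Prop :=
  (∀ x ∈ S, (∀ y ∈ T, P x y = 0) → x = 0) ∧ (∀ y ∈ T, (∀ x ∈ S, P x y = 0) → y = 0)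

/-! ### The completed tensor product and topological Lie bialgebras -/

/-- The completed tensor square `⨁_χ ∏_{φ + ψ = χ} 𝔤_φ ⊗ 𝔤_ψ` of the continuum Kac–Moody algebra
`𝔤`: families `t` of elements `t φ ψ ∈ 𝔤_φ ⊗ 𝔤_ψ` such that only finitely many total degrees
`φ + ψ` occur. -/
def ComplTensor : Submodule k (funX V → funX V → ContKM V k ⊗[k] ContKM V k) where
  carrier := {t | (∀ φ ψ, t φ ψ ∈
      LinearMap.range (TensorProduct.mapIncl (comp V k φ) (comp V k ψ))) ∧
    {χ | ∃ φ ψ, φ + ψ = χ ∧ t φ ψ ≠ 0}.Finite}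
  add_mem' := by
    rintro s t ⟨hs, hs'⟩ ⟨ht, ht'⟩
    refine ⟨fun φ ψ => Submodule.add_mem _ (hs φ ψ) (ht φ ψ), (hs'.union ht').subset ?_⟩
    rintro χ ⟨φ, ψ, h, hne⟩
    by_cases h0 : s φ ψ = 0
    · refine Or.inr ⟨φ, ψ, h, fun h1 => hne ?_⟩
      simp [h0, h1]
    · exact Or.inl ⟨φ, ψ, h, h0⟩
  zero_mem' := ⟨fun φ ψ => Submodule.zero_mem _, by simp⟩
  smul_mem' := by
    rintro a t ⟨ht, ht'⟩
    refine ⟨fun φ ψ => Submodule.smul_mem _ a (ht φ ψ), ht'.subset ?_⟩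
    rintro χ ⟨φ, ψ, h, hne⟩
    refine ⟨φ, ψ, h, fun h1 => hne ?_⟩
    simp [h1]

variable {V}

open scoped Classical in
/-- `x ∧ y = (x ⊗ y - y ⊗ x) / 2`, for `x` of degree `φ₀` and `y` of degree `ψ₀`, as a family
indexed by pairs of degrees. -/
def wedge (φ₀ ψ₀ : funX V) (x y : ContKM V k) :
    funX V → funX V → ContKM V k ⊗[k] ContKM V k := fun φ ψ =>
  (2⁻¹ : k) • ((if φ = φ₀ ∧ ψ = ψ₀ then x ⊗ₜ[k] y else 0)
    - (if φ = ψ₀ ∧ ψ = φ₀ then y ⊗ₜ[k] x else 0))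

/-- `δ(ξ_α) = 0` and `δ(x^±_α) = ξ_α ∧ x^±_α + ∑_{β ⊕ γ = α} c(β, β ⊕ γ) x^±_β ∧ x^±_γ`. The sum runs
over all ordered pairs `(β, γ)` and may be infinite, but at most two of its terms contribute
to a given pair of degrees. -/
structure HasGeneratorValues (δ : ContKM V k →ₗ[k] ComplTensor V k) : Prop where
  on_cartan : ∀ α : Interval V, δ (xi k α) = 0
  on_pos : ∀ (α : Interval V) (φ ψ : funX V), (δ (xp k α)).1 φ ψ =
    wedge k 0 (cf α) (xi k α) (xp k α) φ ψ +
      ∑ᶠ p ∈ {p : Interval V × Interval V | IsSum p.1 p.2 α},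
        (ca p.1 α : k) • wedge k (cf p.1) (cf p.2) (xp k p.1) (xp k p.2) φ ψ
  on_neg : ∀ (α : Interval V) (φ ψ : funX V), (δ (xm k α)).1 φ ψ =
    wedge k 0 (-cf α) (xi k α) (xm k α) φ ψ +
      ∑ᶠ p ∈ {p : Interval V × Interval V | IsSum p.1 p.2 α},
        (ca p.1 α : k) • wedge k (-cf p.1) (-cf p.2) (xm k p.1) (xm k p.2) φ ψ

/-- The adjoint action of an element `x` of degree `χ` on the completed tensor square. -/
def adAct (χ : funX V) (x : ContKM V k)
    (t : funX V → funX V → ContKM V k ⊗[k] ContKM V k) :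
    funX V → funX V → ContKM V k ⊗[k] ContKM V k := fun φ ψ =>
  LinearMap.rTensor _ (LieAlgebra.ad k (ContKM V k) x) (t (φ - χ) ψ)
    + LinearMap.lTensor _ (LieAlgebra.ad k (ContKM V k) x) (t φ (ψ - χ))

/-- The cocycle condition `δ[x, y] = x · δ(y) - y · δ(x)`, for homogeneous `x` and `y` (these span
the algebra). -/
def IsCocycle (δ : ContKM V k →ₗ[k] ComplTensor V k) : Prop :=
  ∀ χ χ' : funX V, ∀ x ∈ comp V k χ, ∀ y ∈ comp V k χ',
    (δ ⁅x, y⁆).1 = adAct k χ x (δ y).1 - adAct k χ' y (δ x).1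

/-- The component `𝔤 → 𝔤 ⊗ 𝔤` of bidegree `(φ, ψ)` of a map into the completed tensor square. -/
def component (δ : ContKM V k →ₗ[k] ComplTensor V k) (φ ψ : funX V) :
    ContKM V k →ₗ[k] ContKM V k ⊗[k] ContKM V k :=
  (LinearMap.proj ψ ∘ₗ LinearMap.proj φ) ∘ₗ (ComplTensor V k).subtype ∘ₗ δ

/-- The component of tridegree `(φ₁, φ₂, φ₃)` of `(id ⊗ δ)(δ(x))`. -/
def idTensorDelta (δ : ContKM V k →ₗ[k] ComplTensor V k) (x : ContKM V k) (φ₁ φ₂ φ₃ : funX V) :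
    ContKM V k ⊗[k] (ContKM V k ⊗[k] ContKM V k) :=
  LinearMap.lTensor _ (component k δ φ₂ φ₃) ((δ x).1 φ₁ (φ₂ + φ₃))

/-- The cyclic permutation `a ⊗ (b ⊗ c) ↦ c ⊗ (a ⊗ b)`. -/
def cyc {M : Type w} [AddCommGroup M] [Module k M] : M ⊗[k] (M ⊗[k] M) ≃ₗ[k] M ⊗[k] (M ⊗[k] M) :=
  (TensorProduct.assoc k M M M).symm ≪≫ₗ TensorProduct.comm k (M ⊗[k] M) M

/-- `δ` is a cobracket making the continuum Kac–Moody algebra a topological Lie bialgebra: it is of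
degree zero, antisymmetric, and satisfies the co-Jacobi identity and the cocycle condition. -/
structure IsTopLieBialgebra (δ : ContKM V k →ₗ[k] ComplTensor V k) : Prop where
  degree_zero : ∀ χ : funX V, ∀ x ∈ comp V k χ, ∀ φ ψ : funX V, φ + ψ ≠ χ → (δ x).1 φ ψ = 0
  antisymm : ∀ x (φ ψ : funX V),
    (δ x).1 φ ψ = -TensorProduct.comm k (ContKM V k) (ContKM V k) ((δ x).1 ψ φ)
  coJacobi : ∀ x (φ₁ φ₂ φ₃ : funX V),
    idTensorDelta k δ x φ₁ φ₂ φ₃ + cyc k (idTensorDelta k δ x φ₂ φ₃ φ₁)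
      + cyc k (cyc k (idTensorDelta k δ x φ₃ φ₁ φ₂)) = 0
  cocycle : IsCocycle k δ

/-- The Lie subalgebra `b` is a Lie sub-bialgebra: `δ` maps `b` to the completion of `b ⊗ b`. -/
def IsSubBialgebra (δ : ContKM V k →ₗ[k] ComplTensor V k)
    (b : LieSubalgebra k (ContKM V k)) : Prop :=
  ∀ x ∈ b, ∀ φ ψ : funX V,
    (δ x).1 φ ψ ∈ LinearMap.range (TensorProduct.mapIncl b.toSubmodule b.toSubmodule)

/-! ### Pairings of Lie bialgebras and quasi-triangularity -/

/-- The linear form `x ⊗ y ↦ f x * g y` on a tensor square. -/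
def tensorForm {L : Type w} [AddCommGroup L] [Module k L] (f g : L →ₗ[k] k) : L ⊗[k] L →ₗ[k] k :=
  LinearMap.mul' k k ∘ₗ TensorProduct.map f g

/-- The pairing `κ` of `b⁺` and `b⁻` obtained from the form `B`: it is `-B` on `n⁺ × n⁻` and `-2 B` on
the Cartan subalgebra, which is orthogonal to `n^±`. As a form on the whole algebra it is
extended by zero along `n⁻` in the first variable and along `n⁺` in the second. -/
structure IsBorelPairing (B κ : LinearMap.BilinForm k (ContKM V k)) : Prop where
  cartan_cartan : ∀ h ∈ cartan V k, ∀ h' ∈ cartan V k, κ h h' = -2 * B h h'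
  pos_neg : ∀ x ∈ nPos V k, ∀ y ∈ nNeg V k, κ x y = -B x y
  pos_cartan : ∀ x ∈ nPos V k, ∀ h ∈ cartan V k, κ x h = 0
  cartan_neg : ∀ h ∈ cartan V k, ∀ y ∈ nNeg V k, κ h y = 0
  left_neg : ∀ y ∈ nNeg V k, ∀ z, κ y z = 0
  right_pos : ∀ z, ∀ x ∈ nPos V k, κ z x = 0

/-- `κ` is a pairing of Lie bialgebras `b⁺ ⊗ (b⁻)^cop → k`, where the cobracket of `(b⁻)^cop`
is `-δ`:
`κ([x, y], z) = (κ ⊗ κ)(x ⊗ y, -δ(z))` for `x, y ∈ b⁺`, `z ∈ b⁻`, and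
`κ(x, [y, z]) = (κ ⊗ κ)(δ(x), y ⊗ z)` for `x ∈ b⁺`, `y, z ∈ b⁻`. Elements of `b⁺` and `b⁻`
which are paired with the components of `δ` are taken homogeneous; only the components
of opposite degrees contribute. -/
def IsLieBialgebraPairing (δ : ContKM V k →ₗ[k] ComplTensor V k)
    (κ : LinearMap.BilinForm k (ContKM V k)) : Prop :=
  (∀ φ ψ : funX V, ∀ x ∈ bPos V k, x ∈ comp V k φ → ∀ y ∈ bPos V k, y ∈ comp V k ψ →
    ∀ z ∈ bNeg V k, κ ⁅x, y⁆ z = -tensorForm k (κ x) (κ y) ((δ z).1 (-φ) (-ψ))) ∧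
  (∀ φ ψ : funX V, ∀ y ∈ bNeg V k, y ∈ comp V k φ → ∀ z ∈ bNeg V k, z ∈ comp V k ψ →
    ∀ x ∈ bPos V k, κ x ⁅y, z⁆ = tensorForm k (κ.flip y) (κ.flip z) ((δ x).1 (-φ) (-ψ)))

/-- Elements of the weak completion of `L ⊗ L` with respect to a non-degenerate form `B` are
bilinear forms `R` on `L`, where `u ⊗ v` corresponds to `(a, b) ↦ B u a * B v b`.

`R` is the canonical element `∑ eᵢ ⊗ fᵢ` (dual bases for `κ`) of the weak completion of `S ⊗ T`
for a pairing `κ` of `S` and `T`: it lies in the completion of `S ⊗ T`, i.e. it vanishes on the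
annihilators of `S` and `T`, and satisfies `∑ κ(eᵢ, y) κ(x, fᵢ) = κ(x, y)` for `x ∈ S`, `y ∈ T`;
here `κ(·, y)` on `S` is written as `B(·, a)`, and `κ(x, ·)` on `T` as `B(·, b)`. -/
structure IsCanonicalElement {L : Type w} [AddCommGroup L] [Module k L]
    (B κ : LinearMap.BilinForm k L) (S T : Submodule k L) (R : LinearMap.BilinForm k L) :
    Prop where
  left_supp : ∀ a, (∀ u ∈ S, B u a = 0) → ∀ b, R a b = 0
  right_supp : ∀ b, (∀ v ∈ T, B v b = 0) → ∀ a, R a b = 0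
  canonical : ∀ x ∈ S, ∀ y ∈ T, ∀ a b,
    (∀ u ∈ S, B u a = κ u y) → (∀ v ∈ T, B v b = κ x v) → R a b = κ x y

/-- The element `R = ∑ eᵢ ⊗ fᵢ` of the weak completion of `𝔤 ⊗ 𝔤` with respect to the invariant form
`B` is a quasi-triangular structure for `δ`.

In the classical Yang–Baxter equation, `ρ b = ∑ eᵢ B(fᵢ, b)` and `ρ' a = ∑ B(eᵢ, a) fᵢ` are the two
partial contractions, and the three terms are the values of `[r₁₂, r₁₃]`, `[r₁₂, r₂₃]`,
`[r₁₃, r₂₃]` on `(a, b, c)`. The action of `x` on the weak completion is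
`(x · R)(a, b) = -R([x, a], b) - R(a, [x, b])`. -/
structure IsQuasiTriangular (B : LinearMap.BilinForm k (ContKM V k))
    (δ : ContKM V k →ₗ[k] ComplTensor V k) (R : LinearMap.BilinForm k (ContKM V k)) : Prop where
  invariant : ∀ x a b : ContKM V k, R ⁅x, a⁆ b + R b ⁅x, a⁆ + (R a ⁅x, b⁆ + R ⁅x, b⁆ a) = 0
  yangBaxter : ∃ ρ ρ' : ContKM V k →ₗ[k] ContKM V k,
    (∀ a b, R a b = B (ρ b) a) ∧ (∀ a b, R a b = B (ρ' a) b) ∧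
    ∀ a b c : ContKM V k, B ⁅ρ b, ρ c⁆ a + B ⁅ρ' a, ρ c⁆ b + B ⁅ρ' a, ρ' b⁆ c = 0
  coboundary : ∀ (x : ContKM V k) (φ ψ : funX V), ∀ a ∈ comp V k (-φ), ∀ b ∈ comp V k (-ψ),
    tensorForm k (B.flip a) (B.flip b) ((δ x).1 φ ψ) = -R ⁅x, a⁆ b - R a ⁅x, b⁆

end Algebra

end ContinuumKM

end

/-!
The proof has a topological part, about intervals and the Euler form, and an algebraic part, which
uses of the topology only a few numerical facts.

*Intervals.* An interval `β` either contains or avoids a given half-branch near its end, so `1_β`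
has limits along all half-branches (`IsTame`). Let the jump of `g` at `p` be the sum of the limits
of `g` along the half-branches arriving at `p` minus the sum along those leaving it. The jumps of
`g` are finite in number, and their sum is zero (`jump_support_sum`). For subintervals `β`, `γ` of
one interval, `⟨β, γ⟩` is the sum of the jumps of `γ` over the points of `β` (`euler_eq_sum_jump`).
Hence for disjoint `β` and `γ` one has `0 ≤ -⟨β, γ⟩ ≤ ⟨γ, γ⟩ ≤ 1`, and if `β ∪ γ` is not an
interval, then `⟨β, γ⟩ = 0`. So the signs `c(β, β ⊕ γ)` equal `ω(β, γ) = ⟨γ, β⟩ - ⟨β, γ⟩`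
(`ca_of_isSum`), which is antisymmetric and biadditive; this makes `[E_β, E_γ] = ω(β, γ) E_{β ⊕ γ}`
a Lie bracket on the vector space with basis the intervals (`nb_jacobi`). It is the nilpotent Lie
algebra on which the coefficients of `δ` live.

*The invariant form.* On the Lie algebra `L` given by the relations, the form is built from the
functionals `B(γ, ·)` for the generators `γ`. These are constructed directly: `L` acts on the free
vector space on words in the intervals, the negative generators by prepending a letter (`wordRep`);
words are mapped to the Lie algebra of the `E_β`, and the value of an element of `L` on the empty
word gives the required functionals (`theta`). Consider the submodule of `L × L*` generated by the
pairs of a generator and its functional. The triangular decomposition of `L` shows that in each of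
its elements `(y, f)` the values of `f` on the generators are determined by `y`
(`formGraph_le_compatible`), and it follows that the submodule is isotropic for the natural pairing
(`formGraph_isotropic`). Hence it is the graph of a linear map `L → L*`, which is an invariant
symmetric form (`tildeForm`). Since the Euler form is non-degenerate, the kernel of this form is the
largest graded ideal which meets the Cartan subalgebra trivially (`radical_eq`), so the form
descends to a non-degenerate form `kmForm` on the continuum Kac–Moody algebra `𝔤`.

*The cobracket.* Every degree of `𝔤` is positive, negative or zero. Let `R` be half the sign of the
degree. It satisfies the modified Yang–Baxter equation, a statement about numbers attached to two
degrees (`halfSign_smul_lie`), so that `{a, b} = [Ra, b] + [a, Rb]` is a Lie bracket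
(`rBracket_jacobi`). The cobracket is its dual: `(δ(x), a ⊗ b) = (x, {a, b})`. Antisymmetry and the
co-Jacobi identity of `δ` are those of `{ , }`, and the cocycle condition is an identity for
`(x, {a, b})` (`kmForm_lie_rBracket`). Since homogeneous components need not be finite-dimensional,
it has to be shown that the form `(x, {a, b})` is represented by an element of the completed tensor
square. For a generator this follows from the formula for `(x_α, [a, b])` with `a` and `b` of the
same sign (`kmForm_pos_lie`, `IsSignedFamily.represents`), which at the same time gives the required
value of `δ`; the elements `x` whose forms are so represented
constitute a Lie subalgebra.

*The pairing and the canonical element.* Both `κ` and `r` arise from the invariant form by scaling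
each homogeneous component by a number (`borelForm`, `canonicalElement`); the operator which belongs
to `r` is `-(1/2 + R)`. Thus `κ` is a pairing of Lie bialgebras because `δ` is dual to `{ , }`, the
symmetric part of `r` is a multiple of the invariant form, `δ(x) = [x ⊗ 1 + 1 ⊗ x, r]` is the
definition of `{ , }`, and the classical Yang–Baxter equation for `r` is the modified one for `R`.
-/

noncomputable section

namespace ContinuumKM

universe u v w

attribute [local instance] LieRing.ofAssociativeRing

/-! ### Half-branches -/

section Germs

variable {X : Type u} [TopologicalSpace X]

namespace Chart

variable {x : X} (c : Chart X x) {A B : Set X} {p : X}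

lemma injOn_coord (hA : A ∈ c.branches) : Set.InjOn (c.coord A) A :=
  fun _ hy _ hz h => congrArg Subtype.val
    ((c.coord_embedding A hA).injective (a₁ := ⟨_, hy⟩) (a₂ := ⟨_, hz⟩) h)

lemma continuousOn_coord (hA : A ∈ c.branches) : ContinuousOn (c.coord A) A :=
  continuousOn_iff_continuous_domRestrict.2 (c.coord_embedding A hA).continuous

lemma nhdsWithin_branch (hA : A ∈ c.branches) (hp : p ∈ A) :
    𝓝[A] p = (𝓝 (c.coord A p)).comap (c.coord A) ⊓ 𝓟 A := by
  have h := (c.coord_embedding A hA).nhds_eq_comap ⟨p, hp⟩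
  have h1 : 𝓝[A] p = map Subtype.val (𝓝 (⟨p, hp⟩ : A)) := by
    rw [nhdsWithin_eq_map_subtype_coe hp]
  rw [h1, h]
  have : A.domRestrict (c.coord A) = c.coord A ∘ Subtype.val := rfl
  rw [this, ← comap_comap, subtype_coe_map_comap]
  rfl

lemma eventually_nhdsWithin_branch (hA : A ∈ c.branches) (hp : p ∈ A) (P : X → Prop) :
    (∀ᶠ y in 𝓝[A] p, P y) ↔ ∃ l u, l < c.coord A p ∧ c.coord A p < u ∧
      ∀ y ∈ A, c.coord A y ∈ Set.Ioo l u → P y := by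
  rw [c.nhdsWithin_branch hA hp, eventually_inf_principal, eventually_comap]
  constructor
  · intro h
    obtain ⟨l, u, hlu, h⟩ := mem_nhds_iff_exists_Ioo_subset.1 h
    exact ⟨l, u, hlu.1, hlu.2, fun y hy hyI => h hyI y rfl hy⟩
  · rintro ⟨l, u, hl, hu, h⟩
    filter_upwards [Ioo_mem_nhds hl hu] with t ht y hy hyA
    exact h y hyA (hy ▸ ht)

lemma eventually_leftEnd (hA : A ∈ c.branches) (hp : p ∈ A) (P : X → Prop) :
    (∀ᶠ y in leftEnd c A p, P y) ↔ ∃ l, l < c.coord A p ∧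
      ∀ y ∈ A, c.coord A y ∈ Set.Ioo l (c.coord A p) → P y := by
  have : leftEnd c A p = 𝓝[A] p ⊓ 𝓟 {y | c.coord A y < c.coord A p} := by
    rw [leftEnd, Set.ofPred_and, nhdsWithin_inter']
    rfl
  rw [this, eventually_inf_principal, c.eventually_nhdsWithin_branch hA hp]
  constructor
  · rintro ⟨l, u, hl, hu, h⟩
    exact ⟨l, hl, fun y hy hyI => h y hy ⟨hyI.1, hyI.2.trans hu⟩ hyI.2⟩
  · rintro ⟨l, hl, h⟩
    exact ⟨l, c.coord A p + 1, hl, by linarith, fun y hy hyI hyp => h y hy ⟨hyI.1, hyp⟩⟩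

lemma eventually_rightEnd (hA : A ∈ c.branches) (hp : p ∈ A) (P : X → Prop) :
    (∀ᶠ y in rightEnd c A p, P y) ↔ ∃ u, c.coord A p < u ∧
      ∀ y ∈ A, c.coord A y ∈ Set.Ioo (c.coord A p) u → P y := by
  have : rightEnd c A p = 𝓝[A] p ⊓ 𝓟 {y | c.coord A p < c.coord A y} := by
    rw [rightEnd, Set.ofPred_and, nhdsWithin_inter']
    rfl
  rw [this, eventually_inf_principal, c.eventually_nhdsWithin_branch hA hp]
  constructor
  · rintro ⟨l, u, hl, hu, h⟩
    exact ⟨u, hu, fun y hy hyI => h y hy ⟨hl.trans hyI.1, hyI.2⟩ hyI.1⟩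
  · rintro ⟨u, hu, h⟩
    exact ⟨c.coord A p - 1, u, by linarith, hu, fun y hy hyI hyp => h y hy ⟨hyp, hyI.2⟩⟩

lemma leftEnd_le (A : Set X) (p : X) : leftEnd c A p ≤ 𝓝 p := nhdsWithin_le_nhds

lemma rightEnd_le (A : Set X) (p : X) : rightEnd c A p ≤ 𝓝 p := nhdsWithin_le_nhds

lemma leftEnd_neBot (hA : A ∈ c.branches) (hp : p ∈ A) : (leftEnd c A p).NeBot := by
  rw [← frequently_true_iff_neBot]
  intro h
  obtain ⟨l, hl, h⟩ := (c.eventually_leftEnd hA hp _).1 h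
  obtain ⟨l', u', hp', h'⟩ := mem_nhds_iff_exists_Ioo_subset.1
    ((c.coord_open A hA).mem_nhds ⟨p, hp, rfl⟩)
  obtain ⟨t, ht, ht'⟩ := exists_between (max_lt hl hp'.1)
  obtain ⟨y, hy, rfl⟩ := h' ⟨(le_max_right _ _).trans_lt ht, ht'.trans hp'.2⟩
  exact h y hy ⟨(le_max_left _ _).trans_lt ht, ht'⟩ trivial

lemma rightEnd_neBot (hA : A ∈ c.branches) (hp : p ∈ A) : (rightEnd c A p).NeBot := by
  rw [← frequently_true_iff_neBot]
  intro h
  obtain ⟨l, hl, h⟩ := (c.eventually_rightEnd hA hp _).1 h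
  obtain ⟨l', u', hp', h'⟩ := mem_nhds_iff_exists_Ioo_subset.1
    ((c.coord_open A hA).mem_nhds ⟨p, hp, rfl⟩)
  obtain ⟨t, ht, ht'⟩ := exists_between (lt_min hl hp'.2)
  obtain ⟨y, hy, rfl⟩ := h' ⟨hp'.1.trans ht, ht'.trans_le (min_le_right _ _)⟩
  exact h y hy ⟨ht, ht'.trans_le (min_le_left _ _)⟩ trivial

/-- Two branches with a common point to the left of `p` arrive at `p` along the same
half-branch. -/
lemma leftEnd_eq_of_mem (hA : A ∈ c.branches) (hB : B ∈ c.branches) (hpA : p ∈ A) (hpB : p ∈ B)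
    {y : X} (hyA : y ∈ A) (hyB : y ∈ B) (hy : c.coord A y < c.coord A p) :
    leftEnd c A p = leftEnd c B p := by
  have hne : A ∩ B ≠ {x} := by
    intro h
    have h1 : p = x := by simpa [h] using (show p ∈ A ∩ B from ⟨hpA, hpB⟩)
    have h2 : y = x := by simpa [h] using (show y ∈ A ∩ B from ⟨hyA, hyB⟩)
    exact hy.ne (by rw [h1, h2])
  obtain ⟨hEq, hJ⟩ := c.coord_agree A hA B hB hne
  have hne' : B ∩ A ≠ {x} := by rwa [Set.inter_comm]
  obtain ⟨hEq', hJ'⟩ := c.coord_agree B hB A hA hne'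
  have hyB' : c.coord B y < c.coord B p := by
    rwa [← hEq ⟨hyA, hyB⟩, ← hEq ⟨hpA, hpB⟩]
  have key : ∀ z, (z ∈ A ∧ c.coord A z ∈ Set.Ioo (c.coord A y) (c.coord A p)) ↔
      (z ∈ B ∧ c.coord B z ∈ Set.Ioo (c.coord A y) (c.coord A p)) := by
    intro z
    constructor
    · rintro ⟨hz, hzI⟩
      obtain ⟨z', hz', hzz⟩ := hJ.out ⟨y, ⟨hyA, hyB⟩, rfl⟩ ⟨p, ⟨hpA, hpB⟩, rfl⟩
        (Set.Ioo_subset_Icc_self hzI)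
      obtain rfl := c.injOn_coord hA hz'.1 hz hzz
      exact ⟨hz'.2, by rwa [← hEq hz']⟩
    · rintro ⟨hz, hzI⟩
      rw [hEq ⟨hyA, hyB⟩, hEq ⟨hpA, hpB⟩] at hzI
      obtain ⟨z', hz', hzz⟩ := hJ'.out ⟨y, ⟨hyB, hyA⟩, rfl⟩ ⟨p, ⟨hpB, hpA⟩, rfl⟩
        (Set.Ioo_subset_Icc_self hzI)
      obtain rfl := c.injOn_coord hB hz'.1 hz hzz
      refine ⟨hz'.2, ?_⟩
      rwa [hEq ⟨hyA, hyB⟩, hEq ⟨hpA, hpB⟩, hEq ⟨hz'.2, hz'.1⟩]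
  ext S
  change (∀ᶠ z in leftEnd c A p, z ∈ S) ↔ (∀ᶠ z in leftEnd c B p, z ∈ S)
  rw [c.eventually_leftEnd hA hpA, c.eventually_leftEnd hB hpB]
  constructor
  · rintro ⟨l, hl, h⟩
    refine ⟨max l (c.coord A y), by rw [← hEq ⟨hpA, hpB⟩]; exact max_lt hl hy, ?_⟩
    intro z hz hzI
    rw [← hEq ⟨hpA, hpB⟩] at hzI
    have := (key z).2 ⟨hz, (le_max_right _ _).trans_lt hzI.1, hzI.2⟩
    exact h z this.1 (by
      rw [hEq ⟨this.1, hz⟩]; exact ⟨(le_max_left _ _).trans_lt hzI.1, hzI.2⟩)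
  · rintro ⟨l, hl, h⟩
    rw [← hEq ⟨hpA, hpB⟩] at hl
    refine ⟨max l (c.coord A y), max_lt hl hy, ?_⟩
    intro z hz hzI
    have := (key z).1 ⟨hz, (le_max_right _ _).trans_lt hzI.1, hzI.2⟩
    exact h z this.1 (by
      rw [← hEq ⟨hz, this.1⟩, ← hEq ⟨hpA, hpB⟩]
      exact ⟨(le_max_left _ _).trans_lt hzI.1, hzI.2⟩)

/-- Two branches with a common point to the right of `p` leave `p` along the same
half-branch. -/
lemma rightEnd_eq_of_mem (hA : A ∈ c.branches) (hB : B ∈ c.branches) (hpA : p ∈ A) (hpB : p ∈ B)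
    {y : X} (hyA : y ∈ A) (hyB : y ∈ B) (hy : c.coord A p < c.coord A y) :
    rightEnd c A p = rightEnd c B p := by
  have hne : A ∩ B ≠ {x} := by
    intro h
    have h1 : p = x := by simpa [h] using (show p ∈ A ∩ B from ⟨hpA, hpB⟩)
    have h2 : y = x := by simpa [h] using (show y ∈ A ∩ B from ⟨hyA, hyB⟩)
    exact hy.ne (by rw [h1, h2])
  obtain ⟨hEq, hJ⟩ := c.coord_agree A hA B hB hne
  have hne' : B ∩ A ≠ {x} := by rwa [Set.inter_comm]
  obtain ⟨hEq', hJ'⟩ := c.coord_agree B hB A hA hne'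
  have hyB' : c.coord B p < c.coord B y := by
    rwa [← hEq ⟨hyA, hyB⟩, ← hEq ⟨hpA, hpB⟩]
  have key : ∀ z, (z ∈ A ∧ c.coord A z ∈ Set.Ioo (c.coord A p) (c.coord A y)) ↔
      (z ∈ B ∧ c.coord B z ∈ Set.Ioo (c.coord A p) (c.coord A y)) := by
    intro z
    constructor
    · rintro ⟨hz, hzI⟩
      obtain ⟨z', hz', hzz⟩ := hJ.out ⟨p, ⟨hpA, hpB⟩, rfl⟩ ⟨y, ⟨hyA, hyB⟩, rfl⟩
        (Set.Ioo_subset_Icc_self hzI)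
      obtain rfl := c.injOn_coord hA hz'.1 hz hzz
      exact ⟨hz'.2, by rwa [← hEq hz']⟩
    · rintro ⟨hz, hzI⟩
      rw [hEq ⟨hyA, hyB⟩, hEq ⟨hpA, hpB⟩] at hzI
      obtain ⟨z', hz', hzz⟩ := hJ'.out ⟨p, ⟨hpB, hpA⟩, rfl⟩ ⟨y, ⟨hyB, hyA⟩, rfl⟩
        (Set.Ioo_subset_Icc_self hzI)
      obtain rfl := c.injOn_coord hB hz'.1 hz hzz
      refine ⟨hz'.2, ?_⟩
      rwa [hEq ⟨hyA, hyB⟩, hEq ⟨hpA, hpB⟩, hEq ⟨hz'.2, hz'.1⟩]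
  ext S
  change (∀ᶠ z in rightEnd c A p, z ∈ S) ↔ (∀ᶠ z in rightEnd c B p, z ∈ S)
  rw [c.eventually_rightEnd hA hpA, c.eventually_rightEnd hB hpB]
  constructor
  · rintro ⟨l, hl, h⟩
    refine ⟨min l (c.coord A y), by rw [← hEq ⟨hpA, hpB⟩]; exact lt_min hl hy, ?_⟩
    intro z hz hzI
    rw [← hEq ⟨hpA, hpB⟩] at hzI
    have := (key z).2 ⟨hz, hzI.1, hzI.2.trans_le (min_le_right _ _)⟩
    exact h z this.1 (by
      rw [hEq ⟨this.1, hz⟩]; exact ⟨hzI.1, hzI.2.trans_le (min_le_left _ _)⟩)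
  · rintro ⟨l, hl, h⟩
    rw [← hEq ⟨hpA, hpB⟩] at hl
    refine ⟨min l (c.coord A y), lt_min hl hy, ?_⟩
    intro z hz hzI
    have := (key z).1 ⟨hz, hzI.1, hzI.2.trans_le (min_le_right _ _)⟩
    exact h z this.1 (by
      rw [← hEq ⟨hz, this.1⟩, ← hEq ⟨hpA, hpB⟩]
      exact ⟨hzI.1, hzI.2.trans_le (min_le_left _ _)⟩)

lemma leftEnd_eq_or_notMem (hA : A ∈ c.branches) (hB : B ∈ c.branches) (hpA : p ∈ A)
    (hpB : p ∈ B) : leftEnd c A p = leftEnd c B p ∨ ∀ᶠ y in leftEnd c A p, y ∉ B := by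
  by_cases h : ∃ y ∈ A, y ∈ B ∧ c.coord A y < c.coord A p
  · obtain ⟨y, hyA, hyB, hy⟩ := h
    exact Or.inl (c.leftEnd_eq_of_mem hA hB hpA hpB hyA hyB hy)
  · push Not at h
    refine Or.inr ((c.eventually_leftEnd hA hpA _).2 ⟨c.coord A p - 1, by linarith, ?_⟩)
    exact fun y hy hyI hyB => (h y hy hyB).not_gt hyI.2

lemma rightEnd_eq_or_notMem (hA : A ∈ c.branches) (hB : B ∈ c.branches) (hpA : p ∈ A)
    (hpB : p ∈ B) : rightEnd c A p = rightEnd c B p ∨ ∀ᶠ y in rightEnd c A p, y ∉ B := by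
  by_cases h : ∃ y ∈ A, y ∈ B ∧ c.coord A p < c.coord A y
  · obtain ⟨y, hyA, hyB, hy⟩ := h
    exact Or.inl (c.rightEnd_eq_of_mem hA hB hpA hpB hyA hyB hy)
  · push Not at h
    refine Or.inr ((c.eventually_rightEnd hA hpA _).2 ⟨c.coord A p + 1, by linarith, ?_⟩)
    exact fun y hy hyI hyB => (h y hy hyB).not_gt hyI.1

/-- The compact arc of a branch between two coordinates. -/
lemma isCompact_arc (hA : A ∈ c.branches) {a b : ℝ} (hI : Set.Icc a b ⊆ c.coord A '' A) :
    IsCompact {y ∈ A | c.coord A y ∈ Set.Icc a b} := by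
  have h1 : IsCompact ((A.domRestrict (c.coord A)) ⁻¹' Set.Icc a b) := by
    refine ((c.coord_embedding A hA).isInducing.isCompact_preimage_iff ?_).2 isCompact_Icc
    rintro t ht
    obtain ⟨y, hy, rfl⟩ := hI ht
    exact ⟨⟨y, hy⟩, rfl⟩
  have h2 := h1.image continuous_subtype_val
  convert h2 using 1
  ext y
  constructor
  · rintro ⟨hy, hyI⟩
    exact ⟨⟨y, hy⟩, hyI, rfl⟩
  · rintro ⟨y, hyI, rfl⟩
    exact ⟨y.2, hyI⟩

end Chart

/-- Near a point of a branch `A`, the branch coincides, as an oriented curve, with some branch of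
any given chart around that point; in an open neighbourhood `W`, all half-branches agree. -/
lemma VertexSpace.exists_branch (V : VertexSpace X) {x : X} {c : Chart X x} (hc : c ∈ V.atlas x)
    {A : Set X} (hA : A ∈ c.branches) {q : X} (hq : q ∈ A) {c' : Chart X q}
    (hc' : c' ∈ V.atlas q) :
    ∃ A' ∈ c'.branches, ∃ W : Set X, IsOpen W ∧ q ∈ W ∧ A ∩ W = A' ∩ W ∧
      ∀ p ∈ A ∩ W, leftEnd c A p = leftEnd c' A' p ∧ rightEnd c A p = rightEnd c' A' p := by
  obtain ⟨A', hA', W₀, hW₀, hAW, hlt⟩ := V.coherent x c hc A hA q hq c' hc'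
  obtain ⟨W, hWW, hWo, hqW⟩ := mem_nhds_iff.1 hW₀
  have hAW' : A ∩ W = A' ∩ W := by
    ext y
    have := Set.ext_iff.1 hAW y
    constructor
    · rintro ⟨h1, h2⟩
      exact ⟨(this.1 ⟨h1, hWW h2⟩).1, h2⟩
    · rintro ⟨h1, h2⟩
      exact ⟨(this.2 ⟨h1, hWW h2⟩).1, h2⟩
  refine ⟨A', hA', W, hWo, hqW, hAW', ?_⟩
  intro p hp
  have hpW : W ∈ 𝓝 p := hWo.mem_nhds hp.2
  constructor
  · rw [leftEnd, leftEnd, ← nhdsWithin_inter_of_mem' (mem_nhdsWithin_of_mem_nhds hpW),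
      ← nhdsWithin_inter_of_mem' (s := {y | y ∈ A' ∧ _}) (mem_nhdsWithin_of_mem_nhds hpW)]
    congr 1
    ext y
    constructor
    · rintro ⟨⟨hy, hyp⟩, hyW⟩
      exact ⟨⟨((Set.ext_iff.1 hAW' y).1 ⟨hy, hyW⟩).1,
        (hlt y ⟨hy, hWW hyW⟩ p ⟨hp.1, hWW hp.2⟩).1 hyp⟩, hyW⟩
    · rintro ⟨⟨hy, hyp⟩, hyW⟩
      have hyA := ((Set.ext_iff.1 hAW' y).2 ⟨hy, hyW⟩).1
      exact ⟨⟨hyA, (hlt y ⟨hyA, hWW hyW⟩ p ⟨hp.1, hWW hp.2⟩).2 hyp⟩, hyW⟩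
  · rw [rightEnd, rightEnd, ← nhdsWithin_inter_of_mem' (mem_nhdsWithin_of_mem_nhds hpW),
      ← nhdsWithin_inter_of_mem' (s := {y | y ∈ A' ∧ _}) (mem_nhdsWithin_of_mem_nhds hpW)]
    congr 1
    ext y
    constructor
    · rintro ⟨⟨hy, hyp⟩, hyW⟩
      exact ⟨⟨((Set.ext_iff.1 hAW' y).1 ⟨hy, hyW⟩).1,
        (hlt p ⟨hp.1, hWW hp.2⟩ y ⟨hy, hWW hyW⟩).1 hyp⟩, hyW⟩
    · rintro ⟨⟨hy, hyp⟩, hyW⟩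
      have hyA := ((Set.ext_iff.1 hAW' y).2 ⟨hy, hyW⟩).1
      exact ⟨⟨hyA, (hlt p ⟨hp.1, hWW hp.2⟩ y ⟨hyA, hWW hyW⟩).2 hyp⟩, hyW⟩

variable (V : VertexSpace X)

/-- The half-branches leaving `p`. -/
def rightEnds (p : X) : Set (Filter X) :=
  {o | ∃ c ∈ V.atlas p, ∃ A ∈ c.branches, o = rightEnd c A p}

variable {V} {p : X}

lemma leftEnds_neBot {e : Filter X} (he : e ∈ leftEnds V p) : e.NeBot := by
  obtain ⟨c, _, A, hA, rfl⟩ := he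
  exact c.leftEnd_neBot hA (c.mem_branch A hA)

lemma rightEnds_neBot {o : Filter X} (ho : o ∈ rightEnds V p) : o.NeBot := by
  obtain ⟨c, _, A, hA, rfl⟩ := ho
  exact c.rightEnd_neBot hA (c.mem_branch A hA)

lemma leftEnds_le {e : Filter X} (he : e ∈ leftEnds V p) : e ≤ 𝓝 p := by
  obtain ⟨c, _, A, hA, rfl⟩ := he
  exact c.leftEnd_le A p

lemma rightEnds_le {o : Filter X} (ho : o ∈ rightEnds V p) : o ≤ 𝓝 p := by
  obtain ⟨c, _, A, hA, rfl⟩ := ho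
  exact c.rightEnd_le A p

lemma passages_mem {q : Filter X × Filter X} (hq : q ∈ passages V p) :
    q.1 ∈ leftEnds V p ∧ q.2 ∈ rightEnds V p := by
  obtain ⟨c, hc, A, hA, rfl⟩ := hq
  exact ⟨⟨c, hc, A, hA, rfl⟩, ⟨c, hc, A, hA, rfl⟩⟩

section

variable {x : X} {c : Chart X x} {A : Set X}

lemma passage_mem (hc : c ∈ V.atlas x) (hA : A ∈ c.branches) (hp : p ∈ A) :
    (leftEnd c A p, rightEnd c A p) ∈ passages V p := by
  obtain ⟨c', hc'⟩ := V.exists_chart p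
  obtain ⟨A', hA', W, _, hpW, _, h⟩ := V.exists_branch hc hA hp hc'
  exact ⟨c', hc', A', hA', by rw [(h p ⟨hp, hpW⟩).1, (h p ⟨hp, hpW⟩).2]⟩

lemma leftEnd_mem (hc : c ∈ V.atlas x) (hA : A ∈ c.branches) (hp : p ∈ A) :
    leftEnd c A p ∈ leftEnds V p := (passages_mem (passage_mem hc hA hp)).1

lemma rightEnd_mem (hc : c ∈ V.atlas x) (hA : A ∈ c.branches) (hp : p ∈ A) :
    rightEnd c A p ∈ rightEnds V p := (passages_mem (passage_mem hc hA hp)).2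

/-- An arriving half-branch at `p` is that of the branch `A`, or avoids `A`. -/
lemma leftEnds_eq_or_notMem (hc : c ∈ V.atlas x) (hA : A ∈ c.branches) (hp : p ∈ A)
    {e : Filter X} (he : e ∈ leftEnds V p) : e = leftEnd c A p ∨ ∀ᶠ y in e, y ∉ A := by
  have he' := leftEnds_le he
  obtain ⟨c', hc', B, hB, rfl⟩ := he
  obtain ⟨A', hA', W, hW, hpW, hAW, h⟩ := V.exists_branch hc hA hp hc'
  rw [(h p ⟨hp, hpW⟩).1]
  rcases c'.leftEnd_eq_or_notMem hB hA' (c'.mem_branch B hB) (c'.mem_branch A' hA') with h1 | h1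
  · exact Or.inl h1
  · refine Or.inr ?_
    filter_upwards [h1, he' (hW.mem_nhds hpW)] with y hy hyW hyA
    exact hy ((Set.ext_iff.1 hAW y).1 ⟨hyA, hyW⟩).1

/-- A leaving half-branch at `p` is that of the branch `A`, or avoids `A`. -/
lemma rightEnds_eq_or_notMem (hc : c ∈ V.atlas x) (hA : A ∈ c.branches) (hp : p ∈ A)
    {o : Filter X} (ho : o ∈ rightEnds V p) : o = rightEnd c A p ∨ ∀ᶠ y in o, y ∉ A := by
  have ho' := rightEnds_le ho
  obtain ⟨c', hc', B, hB, rfl⟩ := ho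
  obtain ⟨A', hA', W, hW, hpW, hAW, h⟩ := V.exists_branch hc hA hp hc'
  rw [(h p ⟨hp, hpW⟩).2]
  rcases c'.rightEnd_eq_or_notMem hB hA' (c'.mem_branch B hB) (c'.mem_branch A' hA') with h1 | h1
  · exact Or.inl h1
  · refine Or.inr ?_
    filter_upwards [h1, ho' (hW.mem_nhds hpW)] with y hy hyW hyA
    exact hy ((Set.ext_iff.1 hAW y).1 ⟨hyA, hyW⟩).1

end

end Germs

/-! ### Intervals along half-branches -/

section Arcs

variable {X : Type u} [TopologicalSpace X] {V : VertexSpace X}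

/-- The subset of a branch which corresponds to `(a, b]`. -/
def arc {x : X} (c : Chart X x) (A : Set X) (a b : ℝ) : Set X :=
  {y ∈ A | c.coord A y ∈ Set.Ioc a b}

section

variable {x : X} {c : Chart X x} {A : Set X} {a b : ℝ}

lemma isPreconnected_arc (hA : A ∈ c.branches)
    (hI : Set.Icc a b ⊆ c.coord A '' A) : IsPreconnected (arc c A a b) := by
  have h0 : A.domRestrict (c.coord A) '' ((A.domRestrict (c.coord A)) ⁻¹' Set.Ioc a b)
      = Set.Ioc a b := by
    refine Set.image_preimage_eq_of_subset fun t ht => ?_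
    obtain ⟨y, hy, rfl⟩ := hI (Set.Ioc_subset_Icc_self ht)
    exact ⟨⟨y, hy⟩, rfl⟩
  have h1 : IsPreconnected ((A.domRestrict (c.coord A)) ⁻¹' Set.Ioc a b) := by
    rw [← (c.coord_embedding A hA).isInducing.isPreconnected_image, h0]
    exact isPreconnected_Ioc
  have h2 := h1.image _ continuous_subtype_val.continuousOn
  convert h2 using 1
  ext y
  constructor
  · rintro ⟨hy, hyI⟩
    exact ⟨⟨y, hy⟩, hyI, rfl⟩
  · rintro ⟨y, hyI, rfl⟩
    exact ⟨y.2, hyI⟩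

variable [T2Space X]

lemma mem_branch_of_mem_closure_arc (hA : A ∈ c.branches)
    (hI : Set.Icc a b ⊆ c.coord A '' A) {p : X} (hp : p ∈ closure (arc c A a b)) :
    p ∈ A ∧ c.coord A p ∈ Set.Icc a b :=
  closure_minimal (t := {y ∈ A | c.coord A y ∈ Set.Icc a b})
    (fun _ hy => ⟨hy.1, Set.Ioc_subset_Icc_self hy.2⟩) (c.isCompact_arc hA hI).isClosed hp

lemma eventually_notMem_arc (hA : A ∈ c.branches)
    (hI : Set.Icc a b ⊆ c.coord A '' A) {p : X} (hp : ¬(p ∈ A ∧ c.coord A p ∈ Set.Icc a b)) :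
    ∀ᶠ y in 𝓝 p, y ∉ arc c A a b := by
  have h := (c.isCompact_arc hA hI).isClosed.isOpen_compl.mem_nhds hp
  filter_upwards [h] with y hy hyE
  exact hy ⟨hyE.1, Set.Ioc_subset_Icc_self hyE.2⟩

/-- Along an arriving half-branch at `p`, an elementary interval is eventually full or
empty. -/
lemma arc_left (hc : c ∈ V.atlas x) (hA : A ∈ c.branches)
    (hI : Set.Icc a b ⊆ c.coord A '' A) {p : X} {e : Filter X} (he : e ∈ leftEnds V p) :
    ((p ∈ arc c A a b ∧ e = leftEnd c A p) ∧ ∀ᶠ y in e, y ∈ arc c A a b) ∨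
      (¬(p ∈ arc c A a b ∧ e = leftEnd c A p) ∧ ∀ᶠ y in e, y ∉ arc c A a b) := by
  by_cases hp : p ∈ A ∧ c.coord A p ∈ Set.Icc a b
  · rcases leftEnds_eq_or_notMem hc hA hp.1 he with rfl | h
    · by_cases ha : c.coord A p = a
      · refine Or.inr ⟨fun h => h.1.2.1.ne' ha, ?_⟩
        refine (c.eventually_leftEnd hA hp.1 _).2 ⟨a - 1, by linarith, ?_⟩
        intro y hy hyI hyE
        exact (hyI.2.trans_le ha.le).not_gt hyE.2.1
      · have ha' := lt_of_le_of_ne hp.2.1 (Ne.symm ha)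
        refine Or.inl ⟨⟨⟨hp.1, ha', hp.2.2⟩, rfl⟩, ?_⟩
        refine (c.eventually_leftEnd hA hp.1 _).2 ⟨a, ha', ?_⟩
        intro y hy hyI
        exact ⟨hy, hyI.1, hyI.2.le.trans hp.2.2⟩
    · have h' : ∀ᶠ y in e, y ∉ arc c A a b := h.mono fun y hy hyE => hy hyE.1
      refine Or.inr ⟨?_, h'⟩
      rintro ⟨hpE, rfl⟩
      have : ∀ᶠ y in leftEnd c A p, y ∈ A := by
        refine (c.eventually_leftEnd hA hp.1 _).2 ⟨c.coord A p - 1, by linarith, ?_⟩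
        exact fun y hy _ => hy
      have := leftEnds_neBot he
      obtain ⟨y, h1, h2⟩ := (h.and ‹∀ᶠ y in leftEnd c A p, y ∈ A›).exists
      exact h1 h2
  · refine Or.inr ⟨fun h => hp ⟨h.1.1, Set.Ioc_subset_Icc_self h.1.2⟩, ?_⟩
    exact leftEnds_le he (eventually_notMem_arc hA hI hp)

/-- Along a leaving half-branch at `p`, an elementary interval is eventually full or empty. -/
lemma arc_right (hc : c ∈ V.atlas x) (hA : A ∈ c.branches)
    (hI : Set.Icc a b ⊆ c.coord A '' A) {p : X} {o : Filter X} (ho : o ∈ rightEnds V p) :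
    (((p ∈ A ∧ c.coord A p ∈ Set.Ico a b) ∧ o = rightEnd c A p) ∧ ∀ᶠ y in o, y ∈ arc c A a b) ∨
      (¬((p ∈ A ∧ c.coord A p ∈ Set.Ico a b) ∧ o = rightEnd c A p) ∧
        ∀ᶠ y in o, y ∉ arc c A a b) := by
  by_cases hp : p ∈ A ∧ c.coord A p ∈ Set.Icc a b
  · rcases rightEnds_eq_or_notMem hc hA hp.1 ho with rfl | h
    · by_cases hb : c.coord A p = b
      · refine Or.inr ⟨fun h => h.1.2.2.ne hb, ?_⟩
        refine (c.eventually_rightEnd hA hp.1 _).2 ⟨b + 1, by linarith, ?_⟩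
        intro y hy hyI hyE
        exact (hb.symm.le.trans_lt hyI.1).not_ge hyE.2.2
      · have hb' := lt_of_le_of_ne hp.2.2 hb
        refine Or.inl ⟨⟨⟨hp.1, hp.2.1, hb'⟩, rfl⟩, ?_⟩
        refine (c.eventually_rightEnd hA hp.1 _).2 ⟨b, hb', ?_⟩
        intro y hy hyI
        exact ⟨hy, hp.2.1.trans_lt hyI.1, hyI.2.le⟩
    · have h' : ∀ᶠ y in o, y ∉ arc c A a b := h.mono fun y hy hyE => hy hyE.1
      refine Or.inr ⟨?_, h'⟩
      rintro ⟨hpE, rfl⟩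
      have : ∀ᶠ y in rightEnd c A p, y ∈ A := by
        refine (c.eventually_rightEnd hA hp.1 _).2 ⟨c.coord A p + 1, by linarith, ?_⟩
        exact fun y hy _ => hy
      have := rightEnds_neBot ho
      obtain ⟨y, h1, h2⟩ := (h.and ‹∀ᶠ y in rightEnd c A p, y ∈ A›).exists
      exact h1 h2
  · refine Or.inr ⟨fun h => hp ⟨h.1.1, Set.Ico_subset_Icc_self h.1.2⟩, ?_⟩
    exact rightEnds_le ho (eventually_notMem_arc hA hI hp)

end

lemma isElementary_iff {α : Set X} : IsElementary V α ↔ ∃ x : X, ∃ c ∈ V.atlas x,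
    ∃ A ∈ c.branches, ∃ a b : ℝ, a < b ∧ Set.Icc a b ⊆ c.coord A '' A ∧ α = arc c A a b :=
  Iff.rfl

/-- The local structure of a set along the half-branches: it is eventually full or empty along
each half-branch, it contains a point `p` exactly if it is full along an arriving half-branch at
`p`, which is then unique, and a boundary point outside the set has a leaving half-branch along
which the set is full. All intervals have these properties. -/
structure IsTame (V : VertexSpace X) (α : Set X) : Prop where
  left : ∀ p, ∀ e ∈ leftEnds V p, (∀ᶠ y in e, y ∈ α) ∨ ∀ᶠ y in e, y ∉ α
  mem : ∀ p, ∀ e ∈ leftEnds V p, (∀ᶠ y in e, y ∈ α) → p ∈ α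
  exists_left : ∀ p ∈ α, ∃ e ∈ leftEnds V p, ∀ᶠ y in e, y ∈ α
  unique_left : ∀ p, ∀ e ∈ leftEnds V p, ∀ e' ∈ leftEnds V p, (∀ᶠ y in e, y ∈ α) →
    (∀ᶠ y in e', y ∈ α) → e = e'
  right : ∀ p, ∀ o ∈ rightEnds V p, (∀ᶠ y in o, y ∈ α) ∨ ∀ᶠ y in o, y ∉ α
  finite_right : ∀ p, {o ∈ rightEnds V p | ∀ᶠ y in o, y ∈ α}.Finite
  exists_right : ∀ p ∈ closure α, p ∉ α → ∃ o ∈ rightEnds V p, ∀ᶠ y in o, y ∈ α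
  isConnected : IsConnected α

/-- Tameness passes to disjoint unions: by disjointness, a half-branch along which the union is full
is full for exactly one of the two sets. -/
lemma IsTame.union {α β : Set X} (hα : IsTame V α) (hβ : IsTame V β) (hd : Disjoint α β)
    (hc : IsConnected (α ∪ β)) : IsTame V (α ∪ β) := by
  have hl {p : X} {e : Filter X} (he : e ∈ leftEnds V p) (h : ∀ᶠ y in e, y ∈ α ∪ β) :
      (p ∈ α ∧ ∀ᶠ y in e, y ∈ α) ∨ (p ∈ β ∧ ∀ᶠ y in e, y ∈ β) := by
    rcases hα.left p e he with h1 | h1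
    · exact Or.inl ⟨hα.mem p e he h1, h1⟩
    · have h2 : ∀ᶠ y in e, y ∈ β := (h.and h1).mono fun y hy => hy.1.resolve_left hy.2
      exact Or.inr ⟨hβ.mem p e he h2, h2⟩
  refine ⟨fun p e he => ?_, fun p e he h => ?_, fun p hp => ?_,
    fun p e he e' he' h h' => ?_, fun p o ho => ?_,
    fun p => ?_, fun p hp hpα => ?_, hc⟩
  · rcases hα.left p e he with h1 | h1
    · exact Or.inl (h1.mono fun y hy => Or.inl hy)
    · rcases hβ.left p e he with h2 | h2
      · exact Or.inl (h2.mono fun y hy => Or.inr hy)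
      · exact Or.inr ((h1.and h2).mono fun y hy h => h.elim hy.1 hy.2)
  · exact (hl he h).imp And.left And.left
  · rcases hp with hp | hp
    · obtain ⟨e, he, h⟩ := hα.exists_left p hp
      exact ⟨e, he, h.mono fun y hy => Or.inl hy⟩
    · obtain ⟨e, he, h⟩ := hβ.exists_left p hp
      exact ⟨e, he, h.mono fun y hy => Or.inr hy⟩
  · rcases hl he h with ⟨h1, h2⟩ | ⟨h1, h2⟩ <;> rcases hl he' h' with ⟨h3, h4⟩ | ⟨h3, h4⟩
    · exact hα.unique_left p e he e' he' h2 h4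
    · exact (Set.disjoint_left.1 hd h1 h3).elim
    · exact (Set.disjoint_left.1 hd h3 h1).elim
    · exact hβ.unique_left p e he e' he' h2 h4
  · rcases hα.right p o ho with h1 | h1
    · exact Or.inl (h1.mono fun y hy => Or.inl hy)
    · rcases hβ.right p o ho with h2 | h2
      · exact Or.inl (h2.mono fun y hy => Or.inr hy)
      · exact Or.inr ((h1.and h2).mono fun y hy h => h.elim hy.1 hy.2)
  · refine ((hα.finite_right p).union (hβ.finite_right p)).subset ?_
    rintro o ⟨ho, h⟩
    rcases hα.right p o ho with h1 | h1
    · exact Or.inl ⟨ho, h1⟩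
    · exact Or.inr ⟨ho, (h.and h1).mono fun y hy => hy.1.resolve_left hy.2⟩
  · rw [closure_union] at hp
    rcases hp with hp | hp
    · obtain ⟨o, ho, h⟩ := hα.exists_right p hp fun h => hpα (Or.inl h)
      exact ⟨o, ho, h.mono fun y hy => Or.inl hy⟩
    · obtain ⟨o, ho, h⟩ := hβ.exists_right p hp fun h => hpα (Or.inr h)
      exact ⟨o, ho, h.mono fun y hy => Or.inr hy⟩

variable [T2Space X]

lemma IsElementary.isTame {α : Set X} (hα : IsElementary V α) : IsTame V α := by
  obtain ⟨x, c, hc, A, hA, a, b, hab, hI, rfl⟩ := isElementary_iff.1 hα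
  have hl {p : X} {e : Filter X} (he : e ∈ leftEnds V p) (h : ∀ᶠ y in e, y ∈ arc c A a b) :
      p ∈ arc c A a b ∧ e = leftEnd c A p := by
    rcases arc_left hc hA hI he with h1 | h1
    · exact h1.1
    · have := leftEnds_neBot he
      obtain ⟨y, h2, h3⟩ := (h.and h1.2).exists
      exact (h3 h2).elim
  have hr {p : X} {o : Filter X} (ho : o ∈ rightEnds V p) (h : ∀ᶠ y in o, y ∈ arc c A a b) :
      o = rightEnd c A p := by
    rcases arc_right hc hA hI ho with h1 | h1
    · exact h1.1.2
    · have := rightEnds_neBot ho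
      obtain ⟨y, h2, h3⟩ := (h.and h1.2).exists
      exact (h3 h2).elim
  refine ⟨fun p e he => ?_, fun p e he h => (hl he h).1, fun p hp => ?_,
    fun p e he e' he' h h' => (hl he h).2.trans (hl he' h').2.symm, fun p o ho => ?_,
    fun p => ?_, fun p hp hpα => ?_, ?_⟩
  · rcases arc_left hc hA hI he with h | h
    exacts [Or.inl h.2, Or.inr h.2]
  · have he := leftEnd_mem hc hA hp.1
    refine ⟨_, he, ?_⟩
    rcases arc_left hc hA hI he with h | h
    exacts [h.2, (h.1 ⟨hp, rfl⟩).elim]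
  · rcases arc_right hc hA hI ho with h | h
    exacts [Or.inl h.2, Or.inr h.2]
  · exact (Set.finite_singleton (rightEnd c A p)).subset fun o ho => hr ho.1 ho.2
  · obtain ⟨hpA, hpI⟩ := mem_branch_of_mem_closure_arc hA hI hp
    have hpa : c.coord A p = a := by
      by_contra h
      exact hpα ⟨hpA, lt_of_le_of_ne hpI.1 (Ne.symm h), hpI.2⟩
    have ho := rightEnd_mem hc hA hpA
    refine ⟨_, ho, ?_⟩
    rcases arc_right hc hA hI ho with h | h
    exacts [h.2, (h.1 ⟨⟨hpA, hpa.ge, by rwa [hpa]⟩, rfl⟩).elim]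
  · obtain ⟨y, hy, hyb⟩ := hI ⟨hab.le, le_rfl⟩
    exact ⟨⟨y, hy, by rw [hyb]; exact ⟨hab, le_rfl⟩⟩, isPreconnected_arc hA hI⟩

lemma IsInterval.isTame {α : Set X} (hα : IsInterval V α) : IsTame V α := by
  induction hα with
  | elementary h => exact h.isTame
  | join _ hβ hd hc _ ih => exact ih.union hβ.isTame hd hc

/-- An arriving and a leaving half-branch along which an interval is full belong to a common
branch. -/
lemma IsInterval.passage {α : Set X} (hα : IsInterval V α) {p : X} {e o : Filter X}
    (he : e ∈ leftEnds V p) (ho : o ∈ rightEnds V p) (h : ∀ᶠ y in e, y ∈ α)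
    (h' : ∀ᶠ y in o, y ∈ α) : (e, o) ∈ passages V p := by
  have ht := hα.isTame
  have hp := ht.mem p e he h
  cases hα with
  | elementary hα =>
    obtain ⟨x, c, hc, A, hA, a, b, hab, hI, rfl⟩ := isElementary_iff.1 hα
    have h1 : e = leftEnd c A p := by
      rcases arc_left hc hA hI he with h1 | h1
      · exact h1.1.2
      · have := leftEnds_neBot he
        obtain ⟨y, h2, h3⟩ := (h.and h1.2).exists
        exact (h3 h2).elim
    have h2 : o = rightEnd c A p := by
      rcases arc_right hc hA hI ho with h1 | h1
      · exact h1.1.2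
      · have := rightEnds_neBot ho
        obtain ⟨y, h2, h3⟩ := (h'.and h1.2).exists
        exact (h3 h2).elim
    rw [h1, h2]
    exact passage_mem hc hA hp.1
  | join _ _ _ _ hoc =>
    obtain ⟨c, hc, A, hA, rfl⟩ := ho
    have hpA := c.mem_branch A hA
    obtain ⟨W, hW, a, b, hWab⟩ := hoc p c hc A hA
    have hpI : c.coord A p ∈ Set.Ioc a b :=
      ((Set.ext_iff.1 hWab p).1 ⟨⟨hp, hpA⟩, mem_of_mem_nhds hW⟩).2
    have hmem : leftEnd c A p ∈ leftEnds V p := ⟨c, hc, A, hA, rfl⟩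
    have hev : ∀ᶠ y in leftEnd c A p, y ∈ A ∧ c.coord A y ∈ Set.Ioc a b := by
      refine (c.eventually_leftEnd hA hpA _).2 ⟨a, hpI.1, ?_⟩
      exact fun y hy hyI => ⟨hy, hyI.1, hyI.2.le.trans hpI.2⟩
    have hα' := (hev.and (c.leftEnd_le A p hW)).mono fun y hy =>
      ((Set.ext_iff.1 hWab y).2 ⟨⟨hy.1.1, hy.2⟩, hy.1.2⟩).1.1
    rw [ht.unique_left p e he _ hmem h hα']
    exact ⟨c, hc, A, hA, rfl⟩

end Arcs

/-! ### The Euler form is biadditive -/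

section Euler

variable {X : Type u} [TopologicalSpace X] {V : VertexSpace X}

omit [TopologicalSpace X] in
lemma limUnder_eq_of_eventually {e : Filter X} [e.NeBot] {f : X → ℤ} {n : ℤ}
    (h : ∀ᶠ y in e, f y = n) : limUnder e f = n :=
  (tendsto_const_nhds.congr' (h.mono fun _ hy => hy.symm)).limUnder_eq

omit [TopologicalSpace X] in
open scoped Classical in
lemma limUnder_indicator {e : Filter X} [e.NeBot] {α : Set X}
    (h : (∀ᶠ y in e, y ∈ α) ∨ ∀ᶠ y in e, y ∉ α) :
    limUnder e (α.indicator fun _ => (1 : ℤ)) = if ∀ᶠ y in e, y ∈ α then 1 else 0 := by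
  split_ifs with h1
  · exact limUnder_eq_of_eventually (h1.mono fun y hy => by simp [hy])
  · exact limUnder_eq_of_eventually ((h.resolve_left h1).mono fun y hy => by simp [hy])

lemma finsum_mem_eq_of_forall_ne {ι : Type*} {S : Set ι} {F : ι → ℤ} {i : ι} (hi : i ∈ S)
    (h : ∀ j ∈ S, j ≠ i → F j = 0) : ∑ᶠ j ∈ S, F j = F i := by
  rw [finsum_mem_def, finsum_eq_single _ i]
  · simp [hi]
  · intro j hj
    by_cases hjS : j ∈ S
    · simp [hjS, h j hjS hj]
    · simp [hjS]

/-- The limit of a function along a half-branch. -/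
def lv (f : funX V) (e : Filter X) : ℤ := limUnder e f.1

/-- The sum of the limits along the arriving half-branches, minus the sum of the limits along the
leaving ones. -/
def jump (f : funX V) (p : X) : ℤ :=
  ∑ᶠ e ∈ leftEnds V p, lv f e - ∑ᶠ o ∈ rightEnds V p, lv f o

/-- The contribution of a point to the Euler form. -/
def localTerm (f g : funX V) (p : X) : ℤ :=
  (∑ᶠ e ∈ leftEnds V p, lv f e * lv g e) - ∑ᶠ q ∈ passages V p, lv f q.1 * lv g q.2

lemma euler_eq_finsum (f g : funX V) : euler V f g = ∑ᶠ p, localTerm f g p := rfl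

lemma cf_union {α β γ : Interval V} (hd : Disjoint α.1 β.1) (h : α.1 ∪ β.1 = γ.1) :
    cf γ = cf α + cf β := by
  apply Subtype.ext
  change γ.1.indicator _ = α.1.indicator _ + β.1.indicator _
  rw [← h, Set.indicator_union_of_disjoint hd]
  rfl

/-- Induction from the characteristic functions of intervals. -/
lemma funX_induction_interval {P : funX V → Prop} (interval : ∀ α : Interval V, P (cf α))
    (zero : P 0) (add : ∀ f g, P f → P g → P (f + g)) (neg : ∀ f, P f → P (-f)) (f : funX V) :
    P f := by
  obtain ⟨f, hf⟩ := f
  have hf' : f ∈ AddSubgroup.closure (Set.range fun α : Interval V =>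
      α.1.indicator fun _ => (1 : ℤ)) := by
    have := hf
    rw [funX, ← Submodule.mem_toAddSubgroup, Submodule.span_int_eq_addSubgroupClosure] at this
    exact this
  have key : ∃ h : f ∈ funX V, P ⟨f, h⟩ := by
    induction hf' using AddSubgroup.closure_induction with
    | mem x hx =>
      obtain ⟨α, rfl⟩ := hx
      exact ⟨Submodule.subset_span ⟨α, rfl⟩, interval α⟩
    | zero => exact ⟨Submodule.zero_mem _, zero⟩
    | add x y hx hy ihx ihy =>
      have hsp : ∀ z, z ∈ AddSubgroup.closure (Set.range fun α : Interval V =>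
          α.1.indicator fun _ => (1 : ℤ)) → z ∈ funX V := by
        intro z hz
        rw [funX, ← Submodule.mem_toAddSubgroup, Submodule.span_int_eq_addSubgroupClosure]
        exact hz
      obtain ⟨h1, h2⟩ := ihx (hsp x hx)
      obtain ⟨h3, h4⟩ := ihy (hsp y hy)
      exact ⟨Submodule.add_mem _ h1 h3, add _ _ h2 h4⟩
    | neg x hx ihx =>
      have hsp : x ∈ funX V := by
        rw [funX, ← Submodule.mem_toAddSubgroup, Submodule.span_int_eq_addSubgroupClosure]
        exact hx
      obtain ⟨h1, h2⟩ := ihx hsp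
      exact ⟨Submodule.neg_mem _ h1, neg _ h2⟩
  exact key.2

/-- Induction from the characteristic functions of elementary intervals. -/
lemma funX_induction {P : funX V → Prop}
    (elem : ∀ (α : Interval V), IsElementary V α.1 → P (cf α))
    (zero : P 0) (add : ∀ f g, P f → P g → P (f + g)) (neg : ∀ f, P f → P (-f)) (f : funX V) :
    P f := by
  refine funX_induction_interval (fun α => ?_) zero add neg f
  obtain ⟨α, hα⟩ := α
  induction hα with
  | elementary h => exact elem ⟨_, .elementary h⟩ h
  | @join α β hα hβ hd hc hoc ih =>
    rw [cf_union (α := ⟨α, hα⟩) (β := ⟨β, .elementary hβ⟩)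
      (γ := ⟨α ∪ β, .join hα hβ hd hc hoc⟩) hd rfl]
    exact add _ _ ih (elem _ hβ)

variable [T2Space X]

open scoped Classical in
lemma lv_cf_left (α : Interval V) {p : X} {e : Filter X} (he : e ∈ leftEnds V p) :
    lv (cf α) e = if ∀ᶠ y in e, y ∈ α.1 then 1 else 0 :=
  have := leftEnds_neBot he
  limUnder_indicator (α.2.isTame.left p e he)

open scoped Classical in
lemma lv_cf_right (α : Interval V) {p : X} {o : Filter X} (ho : o ∈ rightEnds V p) :
    lv (cf α) o = if ∀ᶠ y in o, y ∈ α.1 then 1 else 0 :=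
  have := rightEnds_neBot ho
  limUnder_indicator (α.2.isTame.right p o ho)

/-- Functions in `Fun(X)` are eventually constant along half-branches, so that `lv` is a true limit.
-/
lemma eventually_lv (f : funX V) {p : X} {e : Filter X}
    (he : e ∈ leftEnds V p ∪ rightEnds V p) : ∀ᶠ y in e, f.1 y = lv f e := by
  have hne : e.NeBot := he.elim leftEnds_neBot rightEnds_neBot
  suffices h : ∃ n, ∀ᶠ y in e, f.1 y = n by
    obtain ⟨n, hn⟩ := h
    rw [lv, limUnder_eq_of_eventually hn]
    exact hn
  induction f using funX_induction_interval with
  | interval α =>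
    have hd : (∀ᶠ y in e, y ∈ α.1) ∨ ∀ᶠ y in e, y ∉ α.1 :=
      he.elim (α.2.isTame.left p e) (α.2.isTame.right p e)
    rcases hd with h | h
    · exact ⟨1, h.mono fun y hy => by simp [cf, hy]⟩
    · exact ⟨0, h.mono fun y hy => by simp [cf, hy]⟩
  | zero => exact ⟨0, Eventually.of_forall fun y => rfl⟩
  | add f g hf hg =>
    obtain ⟨m, hm⟩ := hf
    obtain ⟨n, hn⟩ := hg
    exact ⟨m + n, (hm.and hn).mono fun y hy => by
      change f.1 y + g.1 y = m + n
      rw [hy.1, hy.2]⟩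
  | neg f hf =>
    obtain ⟨m, hm⟩ := hf
    exact ⟨-m, hm.mono fun y hy => by
      change -f.1 y = -m
      rw [hy]⟩

lemma lv_add (f g : funX V) {p : X} {e : Filter X}
    (he : e ∈ leftEnds V p ∪ rightEnds V p) : lv (f + g) e = lv f e + lv g e := by
  have hne : e.NeBot := he.elim leftEnds_neBot rightEnds_neBot
  exact limUnder_eq_of_eventually (((eventually_lv f he).and (eventually_lv g he)).mono
    fun y hy => by rw [← hy.1, ← hy.2]; rfl)

lemma lv_neg (f : funX V) {p : X} {e : Filter X}
    (he : e ∈ leftEnds V p ∪ rightEnds V p) : lv (-f) e = -lv f e := by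
  have hne : e.NeBot := he.elim leftEnds_neBot rightEnds_neBot
  exact limUnder_eq_of_eventually ((eventually_lv f he).mono fun y hy => by rw [← hy]; rfl)

omit [T2Space X] in
lemma lv_zero {p : X} {e : Filter X}
    (he : e ∈ leftEnds V p ∪ rightEnds V p) : lv (0 : funX V) e = 0 := by
  have hne : e.NeBot := he.elim leftEnds_neBot rightEnds_neBot
  exact limUnder_eq_of_eventually (Eventually.of_forall fun y => rfl)

lemma finite_left (f : funX V) (p : X) : {e ∈ leftEnds V p | lv f e ≠ 0}.Finite := by
  induction f using funX_induction_interval with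
  | interval α =>
    refine Set.Subsingleton.finite fun e he e' he' => ?_
    refine α.2.isTame.unique_left p e he.1 e' he'.1 ?_ ?_
    · by_contra h
      exact he.2 (by rw [lv_cf_left α he.1, if_neg h])
    · by_contra h
      exact he'.2 (by rw [lv_cf_left α he'.1, if_neg h])
  | zero =>
    refine Set.finite_empty.subset ?_
    rintro e ⟨he, h⟩
    exact h (lv_zero (Or.inl he))
  | add f g hf hg =>
    refine (hf.union hg).subset ?_
    rintro e ⟨he, h⟩
    by_contra hn
    simp only [Set.mem_union, Set.mem_ofPred_eq, not_or, not_and, not_not] at hn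
    exact h (by rw [lv_add f g (Or.inl he), hn.1 he, hn.2 he, add_zero])
  | neg f hf =>
    refine hf.subset ?_
    rintro e ⟨he, h⟩
    exact ⟨he, fun h0 => h (by rw [lv_neg f (Or.inl he), h0, neg_zero])⟩

lemma finite_right (f : funX V) (p : X) : {o ∈ rightEnds V p | lv f o ≠ 0}.Finite := by
  induction f using funX_induction_interval with
  | interval α =>
    refine (α.2.isTame.finite_right p).subset fun o ho => ⟨ho.1, ?_⟩
    by_contra h
    exact ho.2 (by rw [lv_cf_right α ho.1, if_neg h])
  | zero =>
    refine Set.finite_empty.subset ?_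
    rintro e ⟨he, h⟩
    exact h (lv_zero (Or.inr he))
  | add f g hf hg =>
    refine (hf.union hg).subset ?_
    rintro e ⟨he, h⟩
    by_contra hn
    simp only [Set.mem_union, Set.mem_ofPred_eq, not_or, not_and, not_not] at hn
    exact h (by rw [lv_add f g (Or.inr he), hn.1 he, hn.2 he, add_zero])
  | neg f hf =>
    refine hf.subset ?_
    rintro e ⟨he, h⟩
    exact ⟨he, fun h0 => h (by rw [lv_neg f (Or.inr he), h0, neg_zero])⟩

lemma finsum_mem_add_int {ι : Type*} {S : Set ι} {F G : ι → ℤ} (hF : {i ∈ S | F i ≠ 0}.Finite)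
    (hG : {i ∈ S | G i ≠ 0}.Finite) :
    ∑ᶠ i ∈ S, (F i + G i) = ∑ᶠ i ∈ S, F i + ∑ᶠ i ∈ S, G i :=
  finsum_mem_add_distrib' hF hG

lemma finite_left_mul (f g : funX V) (p : X) :
    {e ∈ leftEnds V p | lv f e * lv g e ≠ 0}.Finite :=
  (finite_left f p).subset fun _ he => ⟨he.1, left_ne_zero_of_mul he.2⟩

lemma finite_passages_mul (f g : funX V) (p : X) :
    {q ∈ passages V p | lv f q.1 * lv g q.2 ≠ 0}.Finite :=
  ((finite_left f p).prod (finite_right g p)).subset fun _ hq =>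
    ⟨⟨(passages_mem hq.1).1, left_ne_zero_of_mul hq.2⟩,
      ⟨(passages_mem hq.1).2, right_ne_zero_of_mul hq.2⟩⟩

lemma localTerm_add_left (f f' g : funX V) (p : X) :
    localTerm (f + f') g p = localTerm f g p + localTerm f' g p := by
  have h1 : ∑ᶠ e ∈ leftEnds V p, lv (f + f') e * lv g e
      = ∑ᶠ e ∈ leftEnds V p, lv f e * lv g e + ∑ᶠ e ∈ leftEnds V p, lv f' e * lv g e := by
    rw [← finsum_mem_add_int (finite_left_mul f g p) (finite_left_mul f' g p)]
    exact finsum_mem_congr rfl fun e he => by rw [lv_add f f' (Or.inl he), add_mul]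
  have h2 : ∑ᶠ q ∈ passages V p, lv (f + f') q.1 * lv g q.2
      = ∑ᶠ q ∈ passages V p, lv f q.1 * lv g q.2
        + ∑ᶠ q ∈ passages V p, lv f' q.1 * lv g q.2 := by
    rw [← finsum_mem_add_int (finite_passages_mul f g p) (finite_passages_mul f' g p)]
    exact finsum_mem_congr rfl fun q hq => by
      rw [lv_add f f' (Or.inl (passages_mem hq).1), add_mul]
  rw [localTerm, h1, h2, localTerm, localTerm]
  ring

lemma localTerm_add_right (f g g' : funX V) (p : X) :
    localTerm f (g + g') p = localTerm f g p + localTerm f g' p := by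
  have h1 : ∑ᶠ e ∈ leftEnds V p, lv f e * lv (g + g') e
      = ∑ᶠ e ∈ leftEnds V p, lv f e * lv g e + ∑ᶠ e ∈ leftEnds V p, lv f e * lv g' e := by
    rw [← finsum_mem_add_int (finite_left_mul f g p) (finite_left_mul f g' p)]
    exact finsum_mem_congr rfl fun e he => by rw [lv_add g g' (Or.inl he), mul_add]
  have h2 : ∑ᶠ q ∈ passages V p, lv f q.1 * lv (g + g') q.2
      = ∑ᶠ q ∈ passages V p, lv f q.1 * lv g q.2
        + ∑ᶠ q ∈ passages V p, lv f q.1 * lv g' q.2 := by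
    rw [← finsum_mem_add_int (finite_passages_mul f g p) (finite_passages_mul f g' p)]
    exact finsum_mem_congr rfl fun q hq => by
      rw [lv_add g g' (Or.inr (passages_mem hq).2), mul_add]
  rw [localTerm, h1, h2, localTerm, localTerm]
  ring

lemma localTerm_zero_left (g : funX V) (p : X) : localTerm 0 g p = 0 := by
  have := localTerm_add_left 0 0 g p
  rw [add_zero] at this
  omega

lemma localTerm_zero_right (f : funX V) (p : X) : localTerm f 0 p = 0 := by
  have := localTerm_add_right f 0 0 p
  rw [add_zero] at this
  omega

lemma localTerm_neg_left (f g : funX V) (p : X) : localTerm (-f) g p = -localTerm f g p := by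
  have := localTerm_add_left f (-f) g p
  rw [add_neg_cancel, localTerm_zero_left] at this
  omega

lemma localTerm_neg_right (f g : funX V) (p : X) : localTerm f (-g) p = -localTerm f g p := by
  have := localTerm_add_right f g (-g) p
  rw [add_neg_cancel, localTerm_zero_right] at this
  omega

lemma jump_add (f g : funX V) (p : X) : jump (f + g) p = jump f p + jump g p := by
  have h1 : ∑ᶠ e ∈ leftEnds V p, lv (f + g) e
      = ∑ᶠ e ∈ leftEnds V p, lv f e + ∑ᶠ e ∈ leftEnds V p, lv g e := by
    rw [← finsum_mem_add_int (finite_left f p) (finite_left g p)]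
    exact finsum_mem_congr rfl fun e he => lv_add f g (Or.inl he)
  have h2 : ∑ᶠ e ∈ rightEnds V p, lv (f + g) e
      = ∑ᶠ e ∈ rightEnds V p, lv f e + ∑ᶠ e ∈ rightEnds V p, lv g e := by
    rw [← finsum_mem_add_int (finite_right f p) (finite_right g p)]
    exact finsum_mem_congr rfl fun e he => lv_add f g (Or.inr he)
  rw [jump, h1, h2, jump, jump]
  ring

lemma jump_zero (p : X) : jump (0 : funX V) p = 0 := by
  have := jump_add (0 : funX V) 0 p
  rw [add_zero] at this
  omega

lemma jump_neg (f : funX V) (p : X) : jump (-f) p = -jump f p := by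
  have := jump_add f (-f) p
  rw [add_neg_cancel, jump_zero] at this
  omega

section Elementary

variable {x : X} {c : Chart X x} {A : Set X} {a b : ℝ} {E : Interval V}

open scoped Classical in
lemma lv_arc_left (hc : c ∈ V.atlas x) (hA : A ∈ c.branches)
    (hI : Set.Icc a b ⊆ c.coord A '' A) (hE : E.1 = arc c A a b) {p : X} {e : Filter X}
    (he : e ∈ leftEnds V p) :
    lv (cf E) e = if p ∈ arc c A a b ∧ e = leftEnd c A p then 1 else 0 := by
  have hne := leftEnds_neBot he
  rw [lv_cf_left E he, hE]
  rcases arc_left hc hA hI he with h | h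
  · rw [if_pos h.2, if_pos h.1]
  · rw [if_neg h.1, if_neg fun h' => ?_]
    obtain ⟨y, h2, h3⟩ := (h'.and h.2).exists
    exact h3 h2

open scoped Classical in
lemma lv_arc_right (hc : c ∈ V.atlas x) (hA : A ∈ c.branches)
    (hI : Set.Icc a b ⊆ c.coord A '' A) (hE : E.1 = arc c A a b) {p : X} {o : Filter X}
    (ho : o ∈ rightEnds V p) :
    lv (cf E) o = if (p ∈ A ∧ c.coord A p ∈ Set.Ico a b) ∧ o = rightEnd c A p then 1 else 0 := by
  have hne := rightEnds_neBot ho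
  rw [lv_cf_right E ho, hE]
  rcases arc_right hc hA hI ho with h | h
  · rw [if_pos h.2, if_pos h.1]
  · rw [if_neg h.1, if_neg fun h' => ?_]
    obtain ⟨y, h2, h3⟩ := (h'.and h.2).exists
    exact h3 h2

open scoped Classical in
/-- An elementary interval `(a, b]` has jump `1` at its right and `-1` at its left end point. -/
lemma jump_arc (hc : c ∈ V.atlas x) (hA : A ∈ c.branches)
    (hI : Set.Icc a b ⊆ c.coord A '' A) (hE : E.1 = arc c A a b) (p : X) :
    jump (cf E) p = (if p ∈ arc c A a b then 1 else 0)
      - if p ∈ A ∧ c.coord A p ∈ Set.Ico a b then 1 else 0 := by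
  rw [jump]
  congr 1
  · split_ifs with h
    · rw [finsum_mem_eq_of_forall_ne (leftEnd_mem hc hA h.1) fun e he hne => ?_,
        lv_arc_left hc hA hI hE (leftEnd_mem hc hA h.1), if_pos ⟨h, rfl⟩]
      rw [lv_arc_left hc hA hI hE he, if_neg fun h' => hne h'.2]
    · refine finsum_mem_eq_zero_of_forall_eq_zero fun e he => ?_
      rw [lv_arc_left hc hA hI hE he, if_neg fun h' => h h'.1]
  · split_ifs with h
    · rw [finsum_mem_eq_of_forall_ne (rightEnd_mem hc hA h.1) fun e he hne => ?_,
        lv_arc_right hc hA hI hE (rightEnd_mem hc hA h.1), if_pos ⟨h, rfl⟩]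
      rw [lv_arc_right hc hA hI hE he, if_neg fun h' => hne h'.2]
    · refine finsum_mem_eq_zero_of_forall_eq_zero fun e he => ?_
      rw [lv_arc_right hc hA hI hE he, if_neg fun h' => h h'.1]

lemma jump_arc_eq_zero (hc : c ∈ V.atlas x) (hA : A ∈ c.branches)
    (hI : Set.Icc a b ⊆ c.coord A '' A) (hE : E.1 = arc c A a b) {p : X}
    (ha : ¬(p ∈ A ∧ c.coord A p = a)) (hb : ¬(p ∈ A ∧ c.coord A p = b)) :
    jump (cf E) p = 0 := by
  classical
  rw [jump_arc hc hA hI hE]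
  by_cases hp : p ∈ A
  · have ha' : c.coord A p ≠ a := fun h => ha ⟨hp, h⟩
    have hb' : c.coord A p ≠ b := fun h => hb ⟨hp, h⟩
    have : p ∈ arc c A a b ↔ p ∈ A ∧ c.coord A p ∈ Set.Ico a b := by
      constructor
      · rintro ⟨_, h⟩
        exact ⟨hp, h.1.le, lt_of_le_of_ne h.2 hb'⟩
      · rintro ⟨_, h⟩
        exact ⟨hp, lt_of_le_of_ne h.1 ha'.symm, h.2.le⟩
    rw [if_congr this rfl rfl, sub_self]
  · rw [if_neg fun h => hp h.1, if_neg fun h => hp h.1, sub_self]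

end Elementary

/-- The jumps of a function are finite in number and sum up to zero. -/
lemma jump_support_sum (f : funX V) : (Function.support (jump f)).Finite ∧ ∑ᶠ p, jump f p = 0 := by
  classical
  induction f using funX_induction with
  | elem E hE =>
    obtain ⟨x, c, hc, A, hA, a, b, hab, hI, hE⟩ := isElementary_iff.1 hE
    obtain ⟨pa, hpa, hpa'⟩ := hI ⟨le_rfl, hab.le⟩
    obtain ⟨pb, hpb, hpb'⟩ := hI ⟨hab.le, le_rfl⟩
    have hsub : Function.support (jump (cf E)) ⊆ ({pa, pb} : Finset X) := by
      intro p hp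
      by_contra hn
      simp only [Finset.coe_insert, Finset.coe_singleton, Set.mem_insert_iff,
        Set.mem_singleton_iff, not_or] at hn
      refine hp (jump_arc_eq_zero hc hA hI hE ?_ ?_)
      · rintro ⟨h, h'⟩
        exact hn.1 (c.injOn_coord hA h hpa (h'.trans hpa'.symm))
      · rintro ⟨h, h'⟩
        exact hn.2 (c.injOn_coord hA h hpb (h'.trans hpb'.symm))
    refine ⟨(Finset.finite_toSet _).subset hsub, ?_⟩
    have hne : pa ≠ pb := fun h => hab.ne (by rw [← hpa', ← hpb', h])
    rw [finsum_eq_sum_of_support_subset _ hsub, Finset.sum_pair hne,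
      jump_arc hc hA hI hE, jump_arc hc hA hI hE]
    have h1 : pa ∉ arc c A a b := fun h => h.2.1.ne' hpa'
    have h2 : pb ∈ arc c A a b := ⟨hpb, by rw [hpb']; exact ⟨hab, le_rfl⟩⟩
    rw [if_neg h1, if_pos h2, if_pos ⟨hpa, by rw [hpa']; exact ⟨le_rfl, hab⟩⟩,
      if_neg fun h => h.2.2.ne hpb']
    rfl
  | zero =>
    have : jump (0 : funX V) = fun _ => 0 := funext jump_zero
    rw [this]
    simp
  | add f g hf hg =>
    have : jump (f + g) = fun p => jump f p + jump g p := funext (jump_add f g)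
    rw [this]
    refine ⟨(hf.1.union hg.1).subset (Function.support_add _ _), ?_⟩
    rw [finsum_add_distrib hf.1 hg.1, hf.2, hg.2, add_zero]
  | neg f hf =>
    have : jump (-f) = fun p => -jump f p := funext (jump_neg f)
    rw [this]
    refine ⟨by rw [Function.support_fun_neg]; exact hf.1, ?_⟩
    rw [finsum_neg_distrib, hf.2, neg_zero]

/-- Two elementary intervals interact at finitely many points only: where their branches coincide
on both sides of a point which is not an endpoint, the arriving and the leaving contributions
cancel, and the other points do not accumulate. -/
lemma finite_localTerm_elementary {E F : Interval V} (hE : IsElementary V E.1)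
    (hF : IsElementary V F.1) : (Function.support (localTerm (cf E) (cf F))).Finite := by
  classical
  obtain ⟨x, c, hc, A, hA, a, b, hab, hI, hE⟩ := isElementary_iff.1 hE
  obtain ⟨x', d, hd, B, hB, a', b', hab', hI', hF⟩ := isElementary_iff.1 hF
  set S := Function.support (localTerm (cf E) (cf F)) with hS
  set KE := {y ∈ A | c.coord A y ∈ Set.Icc a b} with hKE
  set KF := {y ∈ B | d.coord B y ∈ Set.Icc a' b'} with hKF
  have hSE : S ⊆ arc c A a b := by
    intro p hp
    by_contra hpE
    refine hp ?_
    have : ∀ e ∈ leftEnds V p, lv (cf E) e = 0 := fun e he => by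
      rw [lv_arc_left hc hA hI hE he, if_neg fun h => hpE h.1]
    rw [localTerm, finsum_mem_eq_zero_of_forall_eq_zero fun e he => by rw [this e he, zero_mul],
      finsum_mem_eq_zero_of_forall_eq_zero fun q hq => by
        rw [this q.1 (passages_mem hq).1, zero_mul], sub_zero]
  have hSF : S ⊆ KF := by
    intro p hp
    by_contra hpF
    refine hp ?_
    rw [localTerm, finsum_mem_eq_zero_of_forall_eq_zero fun e he => by
        rw [lv_arc_left hd hB hI' hF he,
          if_neg fun h => hpF ⟨h.1.1, Set.Ioc_subset_Icc_self h.1.2⟩, mul_zero],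
      finsum_mem_eq_zero_of_forall_eq_zero fun q hq => by
        rw [lv_arc_right hd hB hI' hF (passages_mem hq).2,
          if_neg fun h => hpF ⟨h.1.1, Set.Ico_subset_Icc_self h.1.2⟩, mul_zero], sub_zero]
  have hSK : S ⊆ KE := fun p hp => ⟨(hSE hp).1, Set.Ioc_subset_Icc_self (hSE hp).2⟩
  -- the endpoints of the two arcs
  set Z : Set X := {p | p ∈ A ∧ c.coord A p = b} ∪
    ({p | p ∈ B ∧ d.coord B p = a'} ∪ {p | p ∈ B ∧ d.coord B p = b'}) with hZ
  have hZf : Z.Finite := by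
    refine Set.Finite.union ?_ (Set.Finite.union ?_ ?_)
    · exact Set.Subsingleton.finite fun y hy z hz =>
        c.injOn_coord hA hy.1 hz.1 (hy.2.trans hz.2.symm)
    · exact Set.Subsingleton.finite fun y hy z hz =>
        d.injOn_coord hB hy.1 hz.1 (hy.2.trans hz.2.symm)
    · exact Set.Subsingleton.finite fun y hy z hz =>
        d.injOn_coord hB hy.1 hz.1 (hy.2.trans hz.2.symm)
  -- away from the endpoints, there is no contribution where the half-branches agree
  have hreg : ∀ p ∈ S, p ∉ Z → leftEnd c A p = leftEnd d B p →
      rightEnd c A p = rightEnd d B p → False := by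
    intro p hpS hpZ hl hr
    have hpE := hSE hpS
    have hpF := hSF hpS
    refine hpS ?_
    have hb : c.coord A p < b :=
      lt_of_le_of_ne hpE.2.2 fun h => hpZ (Or.inl ⟨hpE.1, h⟩)
    have ha' : a' < d.coord B p :=
      lt_of_le_of_ne hpF.2.1 fun h => hpZ (Or.inr (Or.inl ⟨hpF.1, h.symm⟩))
    have hb' : d.coord B p < b' :=
      lt_of_le_of_ne hpF.2.2 fun h => hpZ (Or.inr (Or.inr ⟨hpF.1, h⟩))
    have hpF' : p ∈ arc d B a' b' := ⟨hpF.1, ha', hb'.le⟩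
    have hm := passage_mem hc hA hpE.1
    rw [localTerm, finsum_mem_eq_of_forall_ne (passages_mem hm).1 fun e he hne => by
        rw [lv_arc_left hc hA hI hE he, if_neg fun h => hne h.2, zero_mul],
      finsum_mem_eq_of_forall_ne hm fun q hq hne => ?_]
    · rw [lv_arc_left hc hA hI hE (passages_mem hm).1, if_pos ⟨hpE, rfl⟩,
        lv_arc_left hd hB hI' hF (passages_mem hm).1, if_pos ⟨hpF', hl⟩,
        lv_arc_right hd hB hI' hF (passages_mem hm).2, if_pos ⟨⟨hpF.1, ha'.le, hb'⟩, hr⟩]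
      rfl
    · rw [lv_arc_left hc hA hI hE (passages_mem hq).1,
        lv_arc_right hd hB hI' hF (passages_mem hq).2]
      by_cases h1 : q.1 = leftEnd c A p
      · rw [if_neg (c := (p ∈ B ∧ _) ∧ _), mul_zero]
        rintro ⟨_, h2⟩
        exact hne (Prod.ext h1 (h2.trans hr.symm))
      · rw [if_neg fun h => h1 h.2, zero_mul]
  have hloc : ∀ q ∈ KE, ∃ t ∈ 𝓝[KE] q, (t ∩ S).Finite := by
    intro q hq
    by_cases hqF : q ∈ KF
    · obtain ⟨c₀, hc₀⟩ := V.exists_chart q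
      obtain ⟨A', hA', W₁, hW₁, hqW₁, hAW, hends⟩ := V.exists_branch hc hA hq.1 hc₀
      obtain ⟨B', hB', W₂, hW₂, hqW₂, hBW, hends'⟩ := V.exists_branch hd hB hqF.1 hc₀
      have hqA' := c₀.mem_branch A' hA'
      have hqB' := c₀.mem_branch B' hB'
      -- a neighbourhood of `q` in `A'` on which points of `A' ∩ B'` on the left of `q` are
      -- not extremal in `A' ∩ B'`
      obtain ⟨l, u, hl, hu, hlu⟩ : ∃ l u, l < c₀.coord A' q ∧ c₀.coord A' q < u ∧
          ((∃ y ∈ A' ∩ B', c₀.coord A' y < c₀.coord A' q) →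
            ∃ y ∈ A' ∩ B', c₀.coord A' y = l) ∧
          ((∃ y ∈ A' ∩ B', c₀.coord A' q < c₀.coord A' y) →
            ∃ y ∈ A' ∩ B', c₀.coord A' y = u) := by
        by_cases h1 : ∃ y ∈ A' ∩ B', c₀.coord A' y < c₀.coord A' q <;>
          by_cases h2 : ∃ y ∈ A' ∩ B', c₀.coord A' q < c₀.coord A' y
        · obtain ⟨y, hy, hy'⟩ := h1
          obtain ⟨z, hz, hz'⟩ := h2
          exact ⟨_, _, hy', hz', fun _ => ⟨y, hy, rfl⟩, fun _ => ⟨z, hz, rfl⟩⟩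
        · obtain ⟨y, hy, hy'⟩ := h1
          exact ⟨_, c₀.coord A' q + 1, hy', by linarith, fun _ => ⟨y, hy, rfl⟩,
            fun h => (h2 h).elim⟩
        · obtain ⟨z, hz, hz'⟩ := h2
          exact ⟨c₀.coord A' q - 1, _, by linarith, hz', fun h => (h1 h).elim,
            fun _ => ⟨z, hz, rfl⟩⟩
        · exact ⟨c₀.coord A' q - 1, c₀.coord A' q + 1, by linarith, by linarith,
            fun h => (h1 h).elim, fun h => (h2 h).elim⟩
      have hev := (c₀.eventually_nhdsWithin_branch hA' hqA'
        (fun y => c₀.coord A' y ∈ Set.Ioo l u)).2 ⟨l, u, hl, hu, fun y _ hy => hy⟩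
      obtain ⟨W₃, hW₃, hW₃'⟩ := mem_nhdsWithin_iff_exists_mem_nhds_inter.1 hev
      refine ⟨W₁ ∩ W₂ ∩ W₃, mem_nhdsWithin_of_mem_nhds
        (inter_mem (inter_mem (hW₁.mem_nhds hqW₁) (hW₂.mem_nhds hqW₂)) hW₃), ?_⟩
      refine (hZf.insert q).subset ?_
      rintro p ⟨⟨⟨hp1, hp2⟩, hp3⟩, hpS⟩
      by_contra hn
      rw [Set.mem_insert_iff, not_or] at hn
      have hpA := (hSE hpS).1
      have hpB := (hSF hpS).1
      have hpA' := ((Set.ext_iff.1 hAW p).1 ⟨hpA, hp1⟩).1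
      have hpB' := ((Set.ext_iff.1 hBW p).1 ⟨hpB, hp2⟩).1
      have hpI : c₀.coord A' p ∈ Set.Ioo l u := hW₃' ⟨hp3, hpA'⟩
      have hne : c₀.coord A' p ≠ c₀.coord A' q := fun h =>
        hn.1 (c₀.injOn_coord hA' hpA' hqA' h)
      obtain ⟨y, hy, hyp⟩ : ∃ y ∈ A' ∩ B', c₀.coord A' y < c₀.coord A' p := by
        rcases lt_or_gt_of_ne hne with h | h
        · obtain ⟨y, hy, rfl⟩ := hlu.1 ⟨p, ⟨hpA', hpB'⟩, h⟩
          exact ⟨y, hy, hpI.1⟩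
        · exact ⟨q, ⟨hqA', hqB'⟩, h⟩
      obtain ⟨z, hz, hzp⟩ : ∃ y ∈ A' ∩ B', c₀.coord A' p < c₀.coord A' y := by
        rcases lt_or_gt_of_ne hne with h | h
        · exact ⟨q, ⟨hqA', hqB'⟩, h⟩
        · obtain ⟨y, hy, rfl⟩ := hlu.2 ⟨p, ⟨hpA', hpB'⟩, h⟩
          exact ⟨y, hy, hpI.2⟩
      refine hreg p hpS hn.2 ?_ ?_
      · rw [(hends p ⟨hpA, hp1⟩).1, (hends' p ⟨hpB, hp2⟩).1]
        exact c₀.leftEnd_eq_of_mem hA' hB' hpA' hpB' hy.1 hy.2 hyp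
      · rw [(hends p ⟨hpA, hp1⟩).2, (hends' p ⟨hpB, hp2⟩).2]
        exact c₀.rightEnd_eq_of_mem hA' hB' hpA' hpB' hz.1 hz.2 hzp
    · refine ⟨KFᶜ, mem_nhdsWithin_of_mem_nhds
        ((d.isCompact_arc hB hI').isClosed.isOpen_compl.mem_nhds hqF), ?_⟩
      refine Set.finite_empty.subset ?_
      rintro p ⟨hp, hpS⟩
      exact hp (hSF hpS)
  have hfin : (KE ∩ S).Finite := by
    refine (c.isCompact_arc hA hI).induction_on (p := fun s => (s ∩ S).Finite) ?_ ?_ ?_ hloc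
    · simp
    · exact fun s t hst ht => ht.subset (Set.inter_subset_inter_left _ hst)
    · intro s t hs ht
      rw [Set.union_inter_distrib_right]
      exact hs.union ht
  exact hfin.subset fun p hp => ⟨hSK hp, hp⟩

/-- Only finitely many points contribute to the Euler form: locally, the summands for elementary
intervals change only at end points, and elementary intervals are relatively compact. -/
lemma finite_localTerm (f g : funX V) : (Function.support (localTerm f g)).Finite := by
  induction f using funX_induction with
  | elem E hE =>
    induction g using funX_induction with
    | elem F hF => exact finite_localTerm_elementary hE hF
    | zero =>
      have : localTerm (cf E) 0 = fun _ => 0 := funext (localTerm_zero_right _)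
      rw [this]
      simp
    | add g g' h h' =>
      have : localTerm (cf E) (g + g') = fun p => localTerm (cf E) g p + localTerm (cf E) g' p :=
        funext (localTerm_add_right _ g g')
      rw [this]
      exact (h.union h').subset (Function.support_add _ _)
    | neg g h =>
      have : localTerm (cf E) (-g) = fun p => -localTerm (cf E) g p :=
        funext (localTerm_neg_right _ g)
      rw [this, Function.support_fun_neg]
      exact h
  | zero =>
    have : localTerm 0 g = fun _ => 0 := funext (localTerm_zero_left g)
    rw [this]
    simp
  | add f f' h h' =>
    have : localTerm (f + f') g = fun p => localTerm f g p + localTerm f' g p :=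
      funext (localTerm_add_left f f' g)
    rw [this]
    exact (h.union h').subset (Function.support_add _ _)
  | neg f h =>
    have : localTerm (-f) g = fun p => -localTerm f g p := funext (localTerm_neg_left f g)
    rw [this, Function.support_fun_neg]
    exact h

lemma euler_add_left (f f' g : funX V) : euler V (f + f') g = euler V f g + euler V f' g := by
  simp only [euler_eq_finsum]
  rw [← finsum_add_distrib (finite_localTerm f g) (finite_localTerm f' g)]
  exact finsum_congr (localTerm_add_left f f' g)

lemma euler_add_right (f g g' : funX V) : euler V f (g + g') = euler V f g + euler V f g' := by
  simp only [euler_eq_finsum]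
  rw [← finsum_add_distrib (finite_localTerm f g) (finite_localTerm f g')]
  exact finsum_congr (localTerm_add_right f g g')

end Euler

/-! ### Values of the Euler form on intervals -/

section Values

variable {X : Type u} [TopologicalSpace X] {V : VertexSpace X}

lemma isConnected_union_of_mem_closure {S T : Set X} (hS : IsConnected S) (hT : IsConnected T)
    {p : X} (hp : p ∈ S) (hpT : p ∈ closure T) : IsConnected (S ∪ T) := by
  have h1 : IsConnected (insert p T) := hT.subset_closure
    (Set.subset_insert _ _) (Set.insert_subset hpT subset_closure)
  have h2 := IsConnected.union ⟨p, hp, Set.mem_insert p T⟩ hS h1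
  have h3 : S ∪ insert p T = S ∪ T := by
    rw [Set.union_insert, Set.insert_eq_of_mem (Set.mem_union_left _ hp)]
  rwa [h3] at h2

/-- Tame subsets of a tame set which is locally open-closed are locally open-closed. -/
lemma IsTame.locallyOpenClosed {α S : Set X} (hα : IsTame V α) (hoc : LocallyOpenClosed V α)
    (hS : IsTame V S) (hSα : S ⊆ α) : LocallyOpenClosed V S := by
  intro p c hc A hA
  have hpA := c.mem_branch A hA
  have he : leftEnd c A p ∈ leftEnds V p := ⟨c, hc, A, hA, rfl⟩
  have ho : rightEnd c A p ∈ rightEnds V p := ⟨c, hc, A, hA, rfl⟩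
  have hL : p ∈ S → ∀ᶠ y in leftEnd c A p, y ∈ S := by
    intro hp
    obtain ⟨W, hW, a, b, hWab⟩ := hoc p c hc A hA
    have hpI : c.coord A p ∈ Set.Ioc a b :=
      ((Set.ext_iff.1 hWab p).1 ⟨⟨hSα hp, hpA⟩, mem_of_mem_nhds hW⟩).2
    have hev : ∀ᶠ y in leftEnd c A p, y ∈ A ∧ c.coord A y ∈ Set.Ioc a b := by
      refine (c.eventually_leftEnd hA hpA _).2 ⟨a, hpI.1, ?_⟩
      exact fun y hy hyI => ⟨hy, hyI.1, hyI.2.le.trans hpI.2⟩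
    have hα' := (hev.and (c.leftEnd_le A p hW)).mono fun y hy =>
      ((Set.ext_iff.1 hWab y).2 ⟨⟨hy.1.1, hy.2⟩, hy.1.2⟩).1.1
    obtain ⟨e, he', h⟩ := hS.exists_left p hp
    rwa [hα.unique_left p _ he e he' hα' (h.mono fun y hy => hSα hy)]
  -- the trace on the branch is determined by the behaviour on both sides of the point
  obtain ⟨a, b, hab⟩ : ∃ a b : ℝ, ∀ᶠ y in 𝓝[A] p, (y ∈ S ↔ c.coord A y ∈ Set.Ioc a b) := by
    by_cases hp : p ∈ S
    · obtain ⟨l, hl, hl'⟩ := (c.eventually_leftEnd hA hpA _).1 (hL hp)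
      rcases hS.right p _ ho with hR | hR <;>
        obtain ⟨u, hu, hu'⟩ := (c.eventually_rightEnd hA hpA _).1 hR
      · refine ⟨l, u, (c.eventually_nhdsWithin_branch hA hpA _).2 ⟨l, u, hl, hu, ?_⟩⟩
        intro y hy hyI
        refine ⟨fun _ => ⟨hyI.1, hyI.2.le⟩, fun _ => ?_⟩
        rcases lt_trichotomy (c.coord A y) (c.coord A p) with h | h | h
        · exact hl' y hy ⟨hyI.1, h⟩
        · rwa [c.injOn_coord hA hy hpA h]
        · exact hu' y hy ⟨h, hyI.2⟩
      · refine ⟨l, c.coord A p, (c.eventually_nhdsWithin_branch hA hpA _).2 ⟨l, u, hl, hu, ?_⟩⟩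
        intro y hy hyI
        rcases lt_trichotomy (c.coord A y) (c.coord A p) with h | h | h
        · exact ⟨fun _ => ⟨hyI.1, h.le⟩, fun _ => hl' y hy ⟨hyI.1, h⟩⟩
        · refine ⟨fun _ => ⟨hyI.1, h.le⟩, fun _ => ?_⟩
          rwa [c.injOn_coord hA hy hpA h]
        · exact ⟨fun hyS => (hu' y hy ⟨h, hyI.2⟩ hyS).elim, fun h' => (h.not_ge h'.2).elim⟩
    · have hL' := (hS.left p _ he).resolve_left fun h => hp (hS.mem p _ he h)
      obtain ⟨l, hl, hl'⟩ := (c.eventually_leftEnd hA hpA _).1 hL'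
      rcases hS.right p _ ho with hR | hR <;>
        obtain ⟨u, hu, hu'⟩ := (c.eventually_rightEnd hA hpA _).1 hR
      · refine ⟨c.coord A p, u, (c.eventually_nhdsWithin_branch hA hpA _).2 ⟨l, u, hl, hu, ?_⟩⟩
        intro y hy hyI
        rcases lt_trichotomy (c.coord A y) (c.coord A p) with h | h | h
        · exact ⟨fun hyS => (hl' y hy ⟨hyI.1, h⟩ hyS).elim, fun h' => (h.not_gt h'.1).elim⟩
        · refine ⟨fun hyS => (hp ?_).elim, fun h' => (h'.1.ne' h).elim⟩
          rwa [← c.injOn_coord hA hy hpA h]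
        · exact ⟨fun _ => ⟨h, hyI.2.le⟩, fun _ => hu' y hy ⟨h, hyI.2⟩⟩
      · refine ⟨1, 0, (c.eventually_nhdsWithin_branch hA hpA _).2 ⟨l, u, hl, hu, ?_⟩⟩
        intro y hy hyI
        refine ⟨fun hyS => ?_, fun h' => absurd (h'.1.trans_le h'.2) (by norm_num)⟩
        rcases lt_trichotomy (c.coord A y) (c.coord A p) with h | h | h
        · exact (hl' y hy ⟨hyI.1, h⟩ hyS).elim
        · rw [c.injOn_coord hA hy hpA h] at hyS
          exact (hp hyS).elim
        · exact (hu' y hy ⟨h, hyI.2⟩ hyS).elim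
  obtain ⟨W, hW, hW'⟩ := mem_nhdsWithin_iff_exists_mem_nhds_inter.1 hab
  refine ⟨W, hW, a, b, ?_⟩
  ext y
  constructor
  · rintro ⟨⟨hyS, hyA⟩, hyW⟩
    exact ⟨⟨hyA, hyW⟩, (hW' ⟨hyW, hyA⟩).1 hyS⟩
  · rintro ⟨⟨hyA, hyW⟩, hyI⟩
    exact ⟨⟨(hW' ⟨hyW, hyA⟩).2 hyI, hyA⟩, hyW⟩

/-- The antisymmetrized Euler form, up to a sign. -/
def om (β γ : Interval V) : ℤ := euler V (cf γ) (cf β) - euler V (cf β) (cf γ)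

lemma om_swap (β γ : Interval V) : om γ β = -om β γ := by
  rw [om, om]
  ring

/-- An interval decomposes into finitely many disjoint elementary intervals. -/
lemma IsInterval.exists_pieces {γ : Set X} (hγ : IsInterval V γ) :
    ∃ s : Finset (Set X), (∀ E ∈ s, IsElementary V E) ∧
      (∀ E ∈ s, ∀ F ∈ s, E ≠ F → Disjoint E F) ∧ ⋃₀ (s : Set (Set X)) = γ := by
  classical
  induction hγ with
  | @elementary α h => exact ⟨{α}, by simpa using h, by simp, by simp⟩
  | @join α β _ hβ hd _ _ ih =>
    obtain ⟨s, hs, hs', rfl⟩ := ih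
    have hdE : ∀ E ∈ s, Disjoint E β := fun E hE =>
      hd.mono_left (Set.subset_sUnion_of_mem (by exact_mod_cast hE))
    refine ⟨insert β s, ?_, ?_, ?_⟩
    · intro E hE
      rcases Finset.mem_insert.1 hE with rfl | hE
      exacts [hβ, hs E hE]
    · intro E hE F hF hne
      rcases Finset.mem_insert.1 hE with hEβ | hE' <;>
        rcases Finset.mem_insert.1 hF with hFβ | hF'
      · exact (hne (hEβ.trans hFβ.symm)).elim
      · exact hEβ ▸ (hdE F hF').symm
      · exact hFβ ▸ hdE E hE'
      · exact hs' E hE' F hF' hne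
    · rw [Finset.coe_insert, Set.sUnion_insert, Set.union_comm]

variable [T2Space X]

open scoped Classical in
lemma finsum_lv_left (α : Interval V) (p : X) :
    ∑ᶠ e ∈ leftEnds V p, lv (cf α) e = if p ∈ α.1 then 1 else 0 := by
  have ht := α.2.isTame
  split_ifs with hp
  · obtain ⟨e, he, h⟩ := ht.exists_left p hp
    rw [finsum_mem_eq_of_forall_ne he fun e' he' hne => ?_, lv_cf_left α he, if_pos h]
    rw [lv_cf_left α he', if_neg fun h' => hne (ht.unique_left p e' he' e he h' h)]
  · refine finsum_mem_eq_zero_of_forall_eq_zero fun e he => ?_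
    rw [lv_cf_left α he, if_neg fun h => hp (ht.mem p e he h)]

lemma lv_cf_right_nonneg (α : Interval V) {p : X} {o : Filter X} (ho : o ∈ rightEnds V p) :
    0 ≤ lv (cf α) o := by
  rw [lv_cf_right α ho]
  split_ifs <;> norm_num

lemma finsum_lv_right_nonneg (α : Interval V) (p : X) :
    0 ≤ ∑ᶠ o ∈ rightEnds V p, lv (cf α) o :=
  finsum_nonneg fun _ => finsum_nonneg fun ho => lv_cf_right_nonneg α ho

lemma jump_nonpos (α : Interval V) {p : X} (hp : p ∉ α.1) : jump (cf α) p ≤ 0 := by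
  have := finsum_lv_right_nonneg α p
  rw [jump, finsum_lv_left, if_neg hp]
  omega

/-- Outside of an interval, only the points where it begins have a jump. -/
lemma jump_neg_iff (α : Interval V) {p : X} (hp : p ∉ α.1) :
    jump (cf α) p < 0 ↔ p ∈ closure α.1 := by
  have h0 := finsum_lv_right_nonneg α p
  rw [jump, finsum_lv_left, if_neg hp]
  constructor
  · intro h
    by_contra hcl
    rw [finsum_mem_eq_zero_of_forall_eq_zero] at h
    · omega
    · intro o ho
      have := rightEnds_neBot ho
      rw [lv_cf_right α ho, if_neg]
      intro h1
      exact hcl (mem_closure_iff_clusterPt.2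
        ((ClusterPt.mono (x := p) (f := o) (ClusterPt.of_le_nhds (rightEnds_le ho)))
          (le_principal_iff.2 h1)))
  · intro hcl
    obtain ⟨o, ho, h1⟩ := α.2.isTame.exists_right p hcl hp
    have h2 : lv (cf α) o ≤ ∑ᶠ o ∈ rightEnds V p, lv (cf α) o := by
      rw [finsum_mem_def]
      have h3 := single_le_finsum (f := (rightEnds V p).indicator (lv (cf α))) o
        ((finite_right (cf α) p).subset fun q hq => by
          simpa [Set.indicator_apply] using hq) fun q => by
          by_cases hq : q ∈ rightEnds V p
          · simpa [hq] using lv_cf_right_nonneg α hq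
          · simp [hq]
      simpa [ho] using h3
    rw [lv_cf_right α ho, if_pos h1] at h2
    omega

open scoped Classical in
/-- Inside an interval there is only one arriving half-branch at each point, and all leaving
ones continue it. -/
lemma localTerm_eq {α β γ : Interval V} (hβ : β.1 ⊆ α.1) (hγ : γ.1 ⊆ α.1) (p : X) :
    localTerm (cf β) (cf γ) p = if p ∈ β.1 then jump (cf γ) p else 0 := by
  have htα := α.2.isTame
  have htβ := β.2.isTame
  have htγ := γ.2.isTame
  split_ifs with hp
  · obtain ⟨e, he, h⟩ := htβ.exists_left p hp
    have heα : ∀ᶠ y in e, y ∈ α.1 := h.mono fun y hy => hβ hy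
    have hβe : lv (cf β) e = 1 := by rw [lv_cf_left β he, if_pos h]
    have hβ0 : ∀ e' ∈ leftEnds V p, e' ≠ e → lv (cf β) e' = 0 := fun e' he' hne => by
      rw [lv_cf_left β he', if_neg fun h' => hne (htβ.unique_left p e' he' e he h' h)]
    have hγ0 : ∀ e' ∈ leftEnds V p, e' ≠ e → lv (cf γ) e' = 0 := fun e' he' hne => by
      rw [lv_cf_left γ he', if_neg fun h' => hne
        (htα.unique_left p e' he' e he (h'.mono fun y hy => hγ hy) heα)]
    rw [localTerm, jump, finsum_mem_eq_of_forall_ne he fun e' he' hne => by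
      rw [hβ0 e' he' hne, zero_mul], finsum_mem_eq_of_forall_ne he hγ0, hβe, one_mul]
    congr 1
    have h1 : ∑ᶠ q ∈ passages V p, lv (cf β) q.1 * lv (cf γ) q.2
        = ∑ᶠ q ∈ (fun o => (e, o)) '' rightEnds V p, lv (cf β) q.1 * lv (cf γ) q.2 := by
      refine finsum_mem_inter_support_eq' _ _ _ fun q hq => ?_
      have hq' := Function.mem_support.1 hq
      constructor
      · intro hqP
        have h2 := passages_mem hqP
        have h3 : q.1 = e := by
          by_contra hne
          exact hq' (by rw [hβ0 q.1 h2.1 hne, zero_mul])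
        exact ⟨q.2, h2.2, by rw [← h3]⟩
      · rintro ⟨o, ho, rfl⟩
        refine α.2.passage he ho heα ?_
        by_contra hn
        refine hq' ?_
        rw [lv_cf_right γ ho, if_neg fun h' => hn (h'.mono fun y hy => hγ hy), mul_zero]
    rw [h1, finsum_mem_image (fun o _ o' _ h => (Prod.ext_iff.1 h).2)]
    exact finsum_mem_congr rfl fun o ho => by rw [hβe, one_mul]
  · have : ∀ e ∈ leftEnds V p, lv (cf β) e = 0 := fun e he => by
      rw [lv_cf_left β he, if_neg fun h => hp (htβ.mem p e he h)]
    rw [localTerm, finsum_mem_eq_zero_of_forall_eq_zero fun e he => by rw [this e he, zero_mul],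
      finsum_mem_eq_zero_of_forall_eq_zero fun q hq => by
        rw [this q.1 (passages_mem hq).1, zero_mul], sub_zero]

open scoped Classical in
/-- For subintervals `β`, `γ` of one interval, `⟨β, γ⟩` is the sum of the jumps of `1_γ` in `β`. -/
lemma euler_eq_sum_jump {α β γ : Interval V} (hβ : β.1 ⊆ α.1) (hγ : γ.1 ⊆ α.1) :
    euler V (cf β) (cf γ) =
      ∑ p ∈ (jump_support_sum (cf γ)).1.toFinset, if p ∈ β.1 then jump (cf γ) p else 0 := by
  rw [euler_eq_finsum, finsum_congr (localTerm_eq hβ hγ)]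
  refine finsum_eq_sum_of_support_subset _ fun p hp => ?_
  rw [Set.Finite.coe_toFinset]
  intro h0
  exact hp (by simp only [h0, ite_self])

section Disjoint

variable {α β γ : Interval V}

lemma euler_nonpos (hβ : β.1 ⊆ α.1) (hγ : γ.1 ⊆ α.1) (hd : Disjoint β.1 γ.1) :
    euler V (cf β) (cf γ) ≤ 0 := by
  classical
  rw [euler_eq_sum_jump hβ hγ]
  refine Finset.sum_nonpos fun p _ => ?_
  split_ifs with hp
  · exact jump_nonpos γ (Set.disjoint_left.1 hd hp)
  · exact le_rfl

/-- The jumps of an interval outside of it are non-positive, and they add up to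
`-⟨γ, γ⟩`; those in a disjoint interval `β` add up to `⟨β, γ⟩`. -/
lemma neg_euler_le_self (hβ : β.1 ⊆ α.1) (hγ : γ.1 ⊆ α.1) (hd : Disjoint β.1 γ.1) :
    -euler V (cf β) (cf γ) ≤ euler V (cf γ) (cf γ) := by
  classical
  have h0 : ∑ p ∈ (jump_support_sum (cf γ)).1.toFinset, jump (cf γ) p = 0 := by
    exact (finsum_eq_sum_of_support_subset _ (by rw [Set.Finite.coe_toFinset])).symm.trans
      (jump_support_sum (cf γ)).2
  suffices h : 0 ≤ euler V (cf β) (cf γ) + euler V (cf γ) (cf γ) by omega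
  rw [euler_eq_sum_jump hβ hγ, euler_eq_sum_jump hγ hγ, ← Finset.sum_add_distrib]
  refine h0.symm.le.trans (Finset.sum_le_sum fun p _ => ?_)
  by_cases hpβ : p ∈ β.1
  · rw [if_pos hpβ, if_neg (Set.disjoint_left.1 hd hpβ), add_zero]
  · rw [if_neg hpβ, zero_add]
    split_ifs with hpγ
    · exact le_rfl
    · exact jump_nonpos γ hpγ

/-- Disjoint intervals in a common interval interact in the Euler form only where one of them begins
at a point of the other. -/
lemma euler_neg_iff (hβ : β.1 ⊆ α.1) (hγ : γ.1 ⊆ α.1) (hd : Disjoint β.1 γ.1) :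
    euler V (cf β) (cf γ) < 0 ↔ (β.1 ∩ closure γ.1).Nonempty := by
  classical
  rw [euler_eq_sum_jump hβ hγ]
  constructor
  · intro h
    by_contra hn
    refine h.not_ge (Finset.sum_nonneg fun p _ => ?_)
    split_ifs with hp
    · by_contra hj
      exact hn ⟨p, hp, (jump_neg_iff γ (Set.disjoint_left.1 hd hp)).1 (not_le.1 hj)⟩
    · exact le_rfl
  · rintro ⟨p, hp, hpγ⟩
    have hj := (jump_neg_iff γ (Set.disjoint_left.1 hd hp)).2 hpγ
    refine Finset.sum_neg' (fun q _ => ?_) ⟨p, ?_, ?_⟩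
    · split_ifs with hq
      · exact jump_nonpos γ (Set.disjoint_left.1 hd hq)
      · exact le_rfl
    · rw [Set.Finite.mem_toFinset]
      exact hj.ne
    · rwa [if_pos hp]

lemma euler_neg_of_isConnected (hβ : β.1 ⊆ α.1) (hγ : γ.1 ⊆ α.1) (hd : Disjoint β.1 γ.1)
    (hc : IsConnected (β.1 ∪ γ.1)) :
    euler V (cf β) (cf γ) < 0 ∨ euler V (cf γ) (cf β) < 0 := by
  rw [euler_neg_iff hβ hγ hd, euler_neg_iff hγ hβ hd.symm]
  by_contra hn
  rw [not_or, Set.not_nonempty_iff_eq_empty, Set.not_nonempty_iff_eq_empty] at hn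
  -- the complements of the closures separate `β` and `γ`
  have hsub : β.1 ∪ γ.1 ⊆ (closure γ.1)ᶜ ∪ (closure β.1)ᶜ := by
    rintro p (hp | hp)
    · exact Or.inl fun h => (Set.ext_iff.1 hn.1 p).1 ⟨hp, h⟩
    · exact Or.inr fun h => (Set.ext_iff.1 hn.2 p).1 ⟨hp, h⟩
  obtain ⟨p, hp⟩ := β.2.isTame.isConnected.nonempty
  obtain ⟨q, hq⟩ := γ.2.isTame.isConnected.nonempty
  obtain ⟨y, hy, hy'⟩ := hc.isPreconnected _ _ isClosed_closure.isOpen_compl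
    isClosed_closure.isOpen_compl hsub
    ⟨p, Or.inl hp, fun h => (Set.ext_iff.1 hn.1 p).1 ⟨hp, h⟩⟩
    ⟨q, Or.inr hq, fun h => (Set.ext_iff.1 hn.2 q).1 ⟨hq, h⟩⟩
  rcases hy with h | h
  · exact hy'.2 (subset_closure h)
  · exact hy'.1 (subset_closure h)

lemma isConnected_of_euler_ne_zero (hβ : β.1 ⊆ α.1) (hγ : γ.1 ⊆ α.1) (hd : Disjoint β.1 γ.1)
    (h : euler V (cf β) (cf γ) ≠ 0) : IsConnected (β.1 ∪ γ.1) := by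
  obtain ⟨p, hp, hpγ⟩ := (euler_neg_iff hβ hγ hd).1 (lt_of_le_of_ne (euler_nonpos hβ hγ hd) h)
  exact isConnected_union_of_mem_closure β.2.isTame.isConnected γ.2.isTame.isConnected hp hpγ

end Disjoint

/-- For every interval, `⟨α, α⟩ ≤ 1`: an elementary interval has exactly one source, and joining
pieces only removes sources. -/
lemma euler_self_le_one (α : Interval V) : euler V (cf α) (cf α) ≤ 1 := by
  classical
  obtain ⟨α, hα⟩ := α
  induction hα with
  | @elementary α h =>
    set E : Interval V := ⟨α, .elementary h⟩
    obtain ⟨x, c, hc, A, hA, a, b, hab, hI, hE⟩ := isElementary_iff.1 h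
    obtain ⟨pb, hpb, hpb'⟩ := hI ⟨hab.le, le_rfl⟩
    have hE' : E.1 = arc c A a b := hE
    have hbE : pb ∈ E.1 := by
      rw [hE']
      exact ⟨hpb, by rw [hpb']; exact ⟨hab, le_rfl⟩⟩
    rw [euler_eq_finsum, finsum_eq_single _ pb, localTerm_eq subset_rfl subset_rfl, if_pos hbE,
      jump_arc hc hA hI hE']
    · split_ifs <;> norm_num
    · intro p hp
      rw [localTerm_eq subset_rfl subset_rfl]
      split_ifs with hpE
      · rw [hE'] at hpE
        exact jump_arc_eq_zero hc hA hI hE' (fun h => hpE.2.1.ne' h.2) fun h =>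
          hp (c.injOn_coord hA h.1 hpb (h.2.trans hpb'.symm))
      · rfl
  | @join α β hα hβ hd hc hoc ih =>
    set a : Interval V := ⟨α, hα⟩
    set b : Interval V := ⟨β, .elementary hβ⟩
    set u : Interval V := ⟨α ∪ β, .join hα hβ hd hc hoc⟩
    have hb : euler V (cf b) (cf b) ≤ 1 := by
      obtain ⟨x, c, hc, A, hA, a', b', hab, hI, hE⟩ := isElementary_iff.1 hβ
      obtain ⟨pb, hpb, hpb'⟩ := hI ⟨hab.le, le_rfl⟩
      have hE' : b.1 = arc c A a' b' := hE
      rw [euler_eq_finsum, finsum_eq_single _ pb, localTerm_eq subset_rfl subset_rfl]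
      · rw [jump_arc hc hA hI hE']
        split_ifs <;> norm_num
      · intro p hp
        rw [localTerm_eq subset_rfl subset_rfl]
        split_ifs with hpE
        · rw [hE'] at hpE
          exact jump_arc_eq_zero hc hA hI hE' (fun h => hpE.2.1.ne' h.2) fun h =>
            hp (c.injOn_coord hA h.1 hpb (h.2.trans hpb'.symm))
        · rfl
    have hau : a.1 ⊆ u.1 := Set.subset_union_left
    have hbu : b.1 ⊆ u.1 := Set.subset_union_right
    have h1 := euler_neg_of_isConnected hau hbu hd hc
    have h2 := euler_nonpos hau hbu hd
    have h3 := euler_nonpos hbu hau hd.symm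
    rw [cf_union (α := a) (β := b) (γ := u) hd rfl, euler_add_left, euler_add_right,
      euler_add_right]
    omega

lemma om_eq_of_isSum_right {β γ δ : Interval V} (h : IsSum β γ δ) (ε : Interval V) :
    om ε δ = om ε β + om ε γ := by
  simp only [om, cf_union h.1 h.2, euler_add_left, euler_add_right]
  ring

/-- For `α = β ⊕ γ` the coefficients `c(β, α)` and `c(α, β)` are the values of the
antisymmetrized Euler form. -/
lemma ca_of_isSum {α β γ : Interval V} (h : IsSum β γ α) : ca β α = om β γ ∧ ca α β = -om β γ := by
  have hβ : β.1 ⊆ α.1 := h.2 ▸ Set.subset_union_left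
  have hγ : γ.1 ⊆ α.1 := h.2 ▸ Set.subset_union_right
  have h1 := euler_nonpos hβ hγ h.1
  have h2 := euler_nonpos hγ hβ h.1.symm
  have h3 := neg_euler_le_self hβ hγ h.1
  have h4 := neg_euler_le_self hγ hβ h.1.symm
  have h5 := euler_self_le_one β
  have h6 := euler_self_le_one γ
  have hc : IsConnected (β.1 ∪ γ.1) := by
    rw [h.2]
    exact α.2.isTame.isConnected
  have h7 := euler_neg_of_isConnected hβ hγ h.1 hc
  unfold ca eulerSym om
  rw [cf_union h.1 h.2, euler_add_left, euler_add_right]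
  generalize euler V (cf β) (cf γ) = n at *
  generalize euler V (cf γ) (cf β) = n' at *
  generalize euler V (cf β) (cf β) = s at *
  generalize euler V (cf γ) (cf γ) = s' at *
  have hn : n = 0 ∨ n = -1 := by omega
  have hn' : n' = 0 ∨ n' = -1 := by omega
  have hs : s = 0 ∨ s = 1 := by omega
  rcases hn with rfl | rfl <;> rcases hn' with rfl | rfl <;> rcases hs with rfl | rfl <;>
    first | omega | simp

/-! ### Unions of intervals -/

/-- Inside a locally open-closed interval, every connected disjoint union of an interval and
finitely many elementary intervals is an interval: the pieces can be added one at a time,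
such that each partial union is connected. -/
lemma isInterval_union_pieces {α : Set X} (hα : IsTame V α) (hoc : LocallyOpenClosed V α)
    (n : ℕ) : ∀ (β : Set X) (s : Finset (Set X)), s.card = n → IsInterval V β → β ⊆ α →
      (∀ E ∈ s, IsElementary V E ∧ E ⊆ α ∧ Disjoint β E) →
      (∀ E ∈ s, ∀ F ∈ s, E ≠ F → Disjoint E F) → IsConnected (β ∪ ⋃₀ (s : Set (Set X))) →
      IsInterval V (β ∪ ⋃₀ (s : Set (Set X))) := by
  classical
  induction n with
  | zero =>
    intro β s hs hβ _ _ _ _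
    rw [Finset.card_eq_zero.1 hs]
    simpa using hβ
  | succ n ih =>
    intro β s hs hβ hβα hsE hdis hconn
    obtain ⟨E, hE, hEconn⟩ : ∃ E ∈ s, IsConnected (β ∪ E) := by
      by_contra hn
      push Not at hn
      -- otherwise `β` and the union of the pieces are separated
      set R := ⋃₀ (s : Set (Set X)) with hR
      have hclR : closure R = ⋃ E ∈ s, closure E := by
        rw [hR, Set.sUnion_eq_biUnion]
        exact s.finite_toSet.closure_biUnion _
      have h1 : ∀ p ∈ β, p ∉ closure R := by
        intro p hp hpR
        rw [hclR] at hpR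
        obtain ⟨E, hE, hpE⟩ := Set.mem_iUnion₂.1 hpR
        exact hn E hE (isConnected_union_of_mem_closure hβ.isTame.isConnected
          (hsE E hE).1.isTame.isConnected hp hpE)
      have h2 : ∀ p ∈ R, p ∉ closure β := by
        rintro p ⟨E, hE, hp⟩ hpβ
        refine hn E hE ?_
        rw [Set.union_comm]
        exact isConnected_union_of_mem_closure (hsE E hE).1.isTame.isConnected
          hβ.isTame.isConnected hp hpβ
      obtain ⟨E, hE⟩ : s.Nonempty := Finset.card_pos.1 (by omega)
      obtain ⟨p, hp⟩ := hβ.isTame.isConnected.nonempty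
      obtain ⟨q, hq⟩ := (hsE E hE).1.isTame.isConnected.nonempty
      have hqR : q ∈ R := ⟨E, hE, hq⟩
      obtain ⟨y, hy, hy'⟩ := hconn.isPreconnected _ _
        (isClosed_closure (s := R)).isOpen_compl (isClosed_closure (s := β)).isOpen_compl
        (by
          rintro y (hy | hy)
          · exact Or.inl (h1 y hy)
          · exact Or.inr (h2 y hy))
        ⟨p, Or.inl hp, h1 p hp⟩ ⟨q, Or.inr hqR, h2 q hqR⟩
      rcases hy with h | h
      · exact hy'.2 (subset_closure h)
      · exact hy'.1 (subset_closure h)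
    have hE' := hsE E hE
    have hunion : β ∪ ⋃₀ (s : Set (Set X)) = (β ∪ E) ∪ ⋃₀
        ((s.erase E : Finset (Set X)) : Set (Set X)) := by
      conv_lhs => rw [← Finset.insert_erase hE]
      rw [Finset.coe_insert, Set.sUnion_insert, Set.union_assoc]
    have htame : IsTame V (β ∪ E) := hβ.isTame.union hE'.1.isTame hE'.2.2 hEconn
    have hsub : β ∪ E ⊆ α := Set.union_subset hβα hE'.2.1
    rw [hunion]
    refine ih (β ∪ E) (s.erase E) (by rw [Finset.card_erase_of_mem hE]; omega)
      (.join hβ hE'.1 hE'.2.2 hEconn (hα.locallyOpenClosed hoc htame hsub)) hsub ?_ ?_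
      (hunion ▸ hconn)
    · intro F hF
      have hF' := Finset.mem_erase.1 hF
      refine ⟨(hsE F hF'.2).1, (hsE F hF'.2).2.1, ?_⟩
      exact Set.disjoint_union_left.2 ⟨(hsE F hF'.2).2.2, hdis E hE F hF'.2 hF'.1.symm⟩
    · intro F hF G hG
      exact hdis F (Finset.mem_of_mem_erase hF) G (Finset.mem_of_mem_erase hG)

/-- Tame subsets of an elementary interval are elementary. -/
lemma IsTame.isElementary {α S : Set X} (hα : IsElementary V α) (hS : IsTame V S) (hSα : S ⊆ α) :
    IsElementary V S := by
  obtain ⟨x, c, hc, A, hA, a, b, hab, hI, rfl⟩ := isElementary_iff.1 hα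
  have hSA : S ⊆ A := fun y hy => (hSα hy).1
  set J := c.coord A '' S with hJ
  have hJab : J ⊆ Set.Ioc a b := by
    rintro _ ⟨y, hy, rfl⟩
    exact (hSα hy).2
  have hJc : J.OrdConnected := (hS.isConnected.isPreconnected.image _
    ((c.continuousOn_coord hA).mono hSA)).ordConnected
  have hJne : J.Nonempty := hS.isConnected.nonempty.image _
  have hbb : BddBelow J := ⟨a, fun t ht => (hJab ht).1.le⟩
  have hba : BddAbove J := ⟨b, fun t ht => (hJab ht).2⟩
  have hleft : ∀ p ∈ A, c.coord A p ∈ Set.Ioc a b → ∀ e ∈ leftEnds V p, (∀ᶠ y in e, y ∈ S) →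
      e = leftEnd c A p := by
    intro p hp hpI e he h
    rcases arc_left hc hA hI he with h1 | h1
    · exact h1.1.2
    · have := leftEnds_neBot he
      obtain ⟨y, h2, h3⟩ := (h.and h1.2).exists
      exact (h3 (hSα h2)).elim
  have hinf : sInf J ∉ J := by
    rintro ⟨p, hp, hpi⟩
    have hpI := (hSα hp).2
    obtain ⟨e, he, h⟩ := hS.exists_left p hp
    have h' := h
    rw [hleft p (hSA hp) hpI e he h] at h'
    have hne := leftEnd_mem hc hA (hSA hp)
    have := leftEnds_neBot hne
    have hlt : ∀ᶠ y in leftEnd c A p, c.coord A y < c.coord A p :=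
      (c.eventually_leftEnd hA (hSA hp) _).2 ⟨c.coord A p - 1, by linarith, fun y _ hy => hy.2⟩
    obtain ⟨y, hy, hy'⟩ := (h'.and hlt).exists
    exact (csInf_le hbb ⟨y, hy, rfl⟩).not_gt (hpi ▸ hy')
  have hmem_of : ∀ t, sInf J < t → t < sSup J → t ∈ J := by
    intro t h1 h2
    obtain ⟨s, hs, hst⟩ := exists_lt_of_csInf_lt hJne h1
    obtain ⟨r, hr, htr⟩ := exists_lt_of_lt_csSup hJne h2
    exact hJc.out hs hr ⟨hst.le, htr.le⟩
  obtain ⟨t₀, ht₀⟩ := hJne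
  have hlt : sInf J < sSup J := by
    refine lt_of_lt_of_le (lt_of_le_of_ne (csInf_le hbb ht₀) ?_) (le_csSup hba ht₀)
    rintro h
    exact hinf (h ▸ ht₀)
  have ha' : a ≤ sInf J := le_csInf ⟨t₀, ht₀⟩ fun t ht => (hJab ht).1.le
  have hb' : sSup J ≤ b := csSup_le ⟨t₀, ht₀⟩ fun t ht => (hJab ht).2
  have hsup : sSup J ∈ J := by
    obtain ⟨p, hp, hpb⟩ := hI ⟨ha'.trans hlt.le, hb'⟩
    have hpb' : c.coord A p = sSup J := hpb
    refine ⟨p, hS.mem p _ (leftEnd_mem hc hA hp) ?_, hpb⟩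
    refine (c.eventually_leftEnd hA hp _).2 ⟨sInf J, by rw [hpb']; exact hlt, ?_⟩
    intro y hy hyI
    rw [hpb'] at hyI
    obtain ⟨z, hz, hzy⟩ := hmem_of _ hyI.1 hyI.2
    rwa [← c.injOn_coord hA (hSA hz) hy hzy]
  refine isElementary_iff.2 ⟨x, c, hc, A, hA, sInf J, sSup J, hlt,
    (Set.Icc_subset_Icc ha' hb').trans hI, ?_⟩
  ext y
  constructor
  · intro hy
    have hyJ : c.coord A y ∈ J := ⟨y, hy, rfl⟩
    refine ⟨hSA hy, lt_of_le_of_ne (csInf_le hbb hyJ) ?_, le_csSup hba hyJ⟩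
    intro h
    exact hinf (h ▸ hyJ)
  · rintro ⟨hy, hyI⟩
    have hyJ : c.coord A y ∈ J := by
      rcases hyI.2.lt_or_eq with h | h
      · exact hmem_of _ hyI.1 h
      · rw [h]
        exact hsup
    obtain ⟨z, hz, hzy⟩ := hyJ
    rwa [← c.injOn_coord hA (hSA hz) hy hzy]

/-- Inside an interval, disjoint intervals with a connected union add up to an interval. -/
lemma isInterval_union {α β γ : Interval V} (hβ : β.1 ⊆ α.1) (hγ : γ.1 ⊆ α.1)
    (hd : Disjoint β.1 γ.1) (hc : IsConnected (β.1 ∪ γ.1)) : IsInterval V (β.1 ∪ γ.1) := by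
  have hsub := Set.union_subset hβ hγ
  have ht := α.2.isTame
  obtain ⟨α, hα⟩ := α
  cases hα with
  | elementary h =>
    exact IsInterval.elementary (IsTame.isElementary h (β.2.isTame.union γ.2.isTame hd hc) hsub)
  | join _ _ _ _ hoc =>
    obtain ⟨s, hs, hs', hsγ⟩ := γ.2.exists_pieces
    rw [← hsγ] at hc ⊢
    refine isInterval_union_pieces ht hoc _ _ s rfl β.2 hβ (fun E hE => ?_) hs' hc
    have hEγ : E ⊆ γ.1 := hsγ ▸ Set.subset_sUnion_of_mem (by exact_mod_cast hE)
    exact ⟨hs E hE, hEγ.trans hγ, hd.mono_right hEγ⟩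

/-- If the union of two disjoint subintervals of an interval is not an interval, it is disconnected,
so no jump of either of them lies in the other. -/
lemma om_eq_zero_of_not_isInterval {α β γ : Interval V} (hβ : β.1 ⊆ α.1) (hγ : γ.1 ⊆ α.1)
    (hd : Disjoint β.1 γ.1) (h : ¬IsInterval V (β.1 ∪ γ.1)) : om β γ = 0 := by
  have h1 : euler V (cf β) (cf γ) = 0 := by
    by_contra hne
    exact h (isInterval_union hβ hγ hd (isConnected_of_euler_ne_zero hβ hγ hd hne))
  have h2 : euler V (cf γ) (cf β) = 0 := by
    by_contra hne
    have := isConnected_of_euler_ne_zero hγ hβ hd.symm hne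
    rw [Set.union_comm] at this
    exact h (isInterval_union hβ hγ hd this)
  rw [om, h1, h2, sub_zero]

end Values

/-! ### Combinatorics of sums and differences -/

section Combinatorics

variable {X : Type u} [TopologicalSpace X] {V : VertexSpace X}

lemma IsSum.symm {α β γ : Interval V} (h : IsSum α β γ) : IsSum β α γ :=
  ⟨h.1.symm, by rw [Set.union_comm]; exact h.2⟩

lemma isSum_diff {α β : Interval V} (h : DiffDefined α β) : IsSum β (diff α β h) α :=
  ⟨Set.disjoint_sdiff_right, Set.union_sdiff_cancel h.1⟩

lemma IsSum.diff_eq {α β γ : Interval V} (h : IsSum β γ α) : α.1 \ β.1 = γ.1 := by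
  rw [← h.2, Set.union_sdiff_left]
  exact sdiff_eq_left.2 h.1.symm

lemma IsSum.diffDefined {α β γ : Interval V} (h : IsSum β γ α) : DiffDefined α β :=
  ⟨h.2 ▸ Set.subset_union_left, by rw [h.diff_eq]; exact γ.2⟩

lemma eulerSym_comm (f g : funX V) : eulerSym V f g = eulerSym V g f := add_comm _ _

lemma cf_apply_of_mem {α : Interval V} {p : X} (hp : p ∈ α.1) : (cf α).1 p = 1 := by
  simp [cf, hp]

lemma cf_apply_of_notMem {α : Interval V} {p : X} (hp : p ∉ α.1) : (cf α).1 p = 0 := by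
  simp [cf, hp]

lemma cf_injective : Function.Injective (cf : Interval V → funX V) := by
  intro α β h
  refine Subtype.ext (Set.ext fun p => ?_)
  have h1 : (cf α).1 p = (cf β).1 p := by rw [h]
  by_cases hα : p ∈ α.1 <;> by_cases hβ : p ∈ β.1
  · exact iff_of_true hα hβ
  · rw [cf_apply_of_mem hα, cf_apply_of_notMem hβ] at h1
    exact absurd h1 one_ne_zero
  · rw [cf_apply_of_notMem hα, cf_apply_of_mem hβ] at h1
    exact absurd h1 zero_ne_one
  · exact iff_of_false hα hβ

lemma cf_apply_nonneg (α : Interval V) (p : X) : 0 ≤ (cf α).1 p := by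
  by_cases hα : p ∈ α.1
  · rw [cf_apply_of_mem hα]
    exact zero_le_one
  · rw [cf_apply_of_notMem hα]

variable [T2Space X]

lemma Interval.nonempty (α : Interval V) : α.1.Nonempty := α.2.isTame.isConnected.nonempty

/-- Positivity in `Fun(X)`: non-negative and non-zero functions. -/
def Pos (f : funX V) : Prop := (∀ p, 0 ≤ f.1 p) ∧ f ≠ 0

lemma pos_cf (α : Interval V) : Pos (cf α) := by
  refine ⟨cf_apply_nonneg α, fun h => ?_⟩
  obtain ⟨p, hp⟩ := α.nonempty
  have h1 := cf_apply_of_mem hp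
  rw [h] at h1
  exact zero_ne_one h1

omit [T2Space X] in
lemma Pos.add {f g : funX V} (hf : Pos f) (hg : ∀ p, 0 ≤ g.1 p) : Pos (f + g) := by
  refine ⟨fun p => add_nonneg (hf.1 p) (hg p), fun h => hf.2 (Subtype.ext (funext fun p => ?_))⟩
  have h1 : f.1 p + g.1 p = 0 := congrFun (congrArg Subtype.val h) p
  have := hf.1 p
  have := hg p
  change f.1 p = 0
  omega

omit [T2Space X] in
lemma not_pos_neg {f : funX V} (hf : Pos f) : ¬Pos (-f) := by
  intro h
  refine hf.2 (Subtype.ext (funext fun p => ?_))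
  have h1 := hf.1 p
  have h2 : 0 ≤ -f.1 p := h.1 p
  change f.1 p = 0
  omega

omit [T2Space X] in
lemma not_pos_zero : ¬Pos (0 : funX V) := fun h => h.2 rfl

/-- A sum `β ⊕ γ` consists of different intervals. -/
lemma IsSum.ne {α β γ : Interval V} (h : IsSum β γ α) : β ≠ γ := by
  rintro rfl
  obtain ⟨p, hp⟩ := β.nonempty
  exact Set.disjoint_left.1 h.1 hp hp

lemma ca_swap {α β : Interval V} (h : DiffDefined α β) : ca β α = -ca α β := by
  have := ca_of_isSum (isSum_diff h)
  rw [this.1, this.2, neg_neg]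

lemma eulerSym_add_left (f f' g : funX V) :
    eulerSym V (f + f') g = eulerSym V f g + eulerSym V f' g := by
  simp only [eulerSym, euler_add_left, euler_add_right]
  ring

/-- The Euler form as a biadditive map. -/
def eulerHom : funX V →+ funX V →+ ℤ :=
  AddMonoidHom.mk' (fun f => AddMonoidHom.mk' (fun g => eulerSym V f g) fun g g' => by
      rw [eulerSym_comm, eulerSym_add_left, eulerSym_comm, eulerSym_comm g'])
    fun f f' => by
      ext g
      exact eulerSym_add_left f f' g

lemma eulerHom_apply (f g : funX V) : eulerHom f g = eulerSym V f g := rfl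

lemma eulerSym_add_right (f g g' : funX V) :
    eulerSym V f (g + g') = eulerSym V f g + eulerSym V f g' := (eulerHom f).map_add g g'

lemma eulerSym_neg_left (f g : funX V) : eulerSym V (-f) g = -eulerSym V f g := by
  rw [← eulerHom_apply, map_neg]
  rfl

lemma eulerSym_neg_right (f g : funX V) : eulerSym V f (-g) = -eulerSym V f g :=
  (eulerHom f).map_neg g

lemma eulerSym_zero_left (g : funX V) : eulerSym V 0 g = 0 := by
  rw [← eulerHom_apply, map_zero]
  rfl

lemma eulerSym_zero_right (f : funX V) : eulerSym V f 0 = 0 := (eulerHom f).map_zero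

end Combinatorics

/-! ### The nilpotent Lie bracket on intervals -/

section NilBracket

variable {X : Type u} [TopologicalSpace X] {V : VertexSpace X}
variable (k : Type v) [Field k]

open scoped Classical in
/-- The bracket `[E_β, E_γ] = ω(β, γ) E_{β ⊕ γ}` of basis elements. -/
def nbBasis (β γ : Interval V) : Interval V →₀ k :=
  if h : Disjoint β.1 γ.1 ∧ IsInterval V (β.1 ∪ γ.1) then
    Finsupp.single ⟨_, h.2⟩ (om β γ : k) else 0

/-- The Lie bracket on the space with basis `E_α`, for the intervals `α`, given by
`[E_β, E_γ] = ω(β, γ) E_{β ⊕ γ}`. It is dual to the part of the cobracket which does not involve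
the Cartan subalgebra. -/
def nb : (Interval V →₀ k) →ₗ[k] (Interval V →₀ k) →ₗ[k] (Interval V →₀ k) :=
  Finsupp.linearCombination k fun β => Finsupp.linearCombination k fun γ => nbBasis k β γ

variable {k}

lemma nb_single (β γ : Interval V) (a b : k) :
    nb k (Finsupp.single β a) (Finsupp.single γ b) = (a * b) • nbBasis k β γ := by
  simp [nb, Finsupp.linearCombination_single, smul_smul]

lemma nbBasis_of_isSum {α β γ : Interval V} (h : IsSum β γ α) :
    nbBasis k β γ = Finsupp.single α (om β γ : k) := by
  have h' : Disjoint β.1 γ.1 ∧ IsInterval V (β.1 ∪ γ.1) := ⟨h.1, h.2 ▸ α.2⟩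
  rw [nbBasis, dif_pos h']
  congr 1
  exact Subtype.ext h.2

lemma nbBasis_of_not {β γ : Interval V} (h : ¬∃ α, IsSum β γ α) : nbBasis k β γ = 0 := by
  rw [nbBasis, dif_neg]
  exact fun h' => h ⟨⟨_, h'.2⟩, h'.1, rfl⟩

lemma nbBasis_swap (β γ : Interval V) : nbBasis k γ β = -nbBasis k β γ := by
  by_cases h : ∃ α, IsSum β γ α
  · obtain ⟨α, h⟩ := h
    rw [nbBasis_of_isSum h, nbBasis_of_isSum h.symm, om_swap, ← Finsupp.single_neg, Int.cast_neg]
  · rw [nbBasis_of_not h, nbBasis_of_not fun ⟨α, h'⟩ => h ⟨α, h'.symm⟩, neg_zero]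

lemma nb_skew (x y : Interval V →₀ k) : nb k y x = -nb k x y := by
  induction x using Finsupp.induction_linear with
  | zero => simp
  | add x x' hx hx' => rw [map_add, hx, hx', map_add, LinearMap.add_apply, neg_add]
  | single β a =>
    induction y using Finsupp.induction_linear with
    | zero => simp
    | add y y' hy hy' => rw [map_add, LinearMap.add_apply, hy, hy', map_add, neg_add]
    | single γ b => rw [nb_single, nb_single, nbBasis_swap, smul_neg, mul_comm]

variable [T2Space X]

/-- The triple bracket, if the three intervals are disjoint and add up to an interval; if two of
them do not add up to an interval, both sides vanish. -/
lemma nb_nb_of_interval {β γ ε α : Interval V} (h1 : Disjoint β.1 γ.1) (h2 : Disjoint β.1 ε.1)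
    (h3 : Disjoint γ.1 ε.1) (h : β.1 ∪ (γ.1 ∪ ε.1) = α.1) :
    nb k (Finsupp.single β 1) (nbBasis k γ ε) =
      Finsupp.single α ((om γ ε : k) * (om β γ + om β ε)) := by
  have hγ : γ.1 ⊆ α.1 := by
    rw [← h]
    exact Set.subset_union_left.trans Set.subset_union_right
  have hε : ε.1 ⊆ α.1 := by
    rw [← h]
    exact Set.subset_union_right.trans Set.subset_union_right
  by_cases hs : IsInterval V (γ.1 ∪ ε.1)
  · obtain ⟨δ, hδ⟩ : ∃ δ : Interval V, δ.1 = γ.1 ∪ ε.1 := ⟨⟨_, hs⟩, rfl⟩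
    have hs1 : IsSum γ ε δ := ⟨h3, hδ.symm⟩
    have hs2 : IsSum β δ α :=
      ⟨by rw [hδ]; exact Set.disjoint_union_right.2 ⟨h1, h2⟩, by rw [hδ]; exact h⟩
    rw [nbBasis_of_isSum hs1, nb_single, nbBasis_of_isSum hs2, Finsupp.smul_single,
      om_eq_of_isSum_right hs1, one_mul, smul_eq_mul, Int.cast_add]
  · rw [om_eq_zero_of_not_isInterval hγ hε h3 hs, nbBasis_of_not]
    · simp
    · rintro ⟨δ, hδ⟩
      exact hs (hδ.2 ▸ δ.2)

omit [T2Space X] in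
lemma nb_nb_of_not {β γ ε : Interval V} (h : ¬(Disjoint β.1 γ.1 ∧ Disjoint β.1 ε.1 ∧
    Disjoint γ.1 ε.1 ∧ IsInterval V (β.1 ∪ (γ.1 ∪ ε.1)))) :
    nb k (Finsupp.single β 1) (nbBasis k γ ε) = 0 := by
  by_cases hs : ∃ δ, IsSum γ ε δ
  · obtain ⟨δ, hδ⟩ := hs
    rw [nbBasis_of_isSum hδ, nb_single, nbBasis_of_not, smul_zero]
    rintro ⟨α, hα⟩
    have hd := hα.1
    rw [← hδ.2, Set.disjoint_union_right] at hd
    refine h ⟨hd.1, hd.2, hδ.1, ?_⟩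
    rw [hδ.2, hα.2]
    exact α.2
  · rw [nbBasis_of_not hs, map_zero]

/-- The Jacobi identity reduces to the fact that `ω` is biadditive and antisymmetric. -/
lemma nb_jacobi_basis (β γ ε : Interval V) :
    nb k (Finsupp.single β 1) (nbBasis k γ ε) + nb k (Finsupp.single γ 1) (nbBasis k ε β)
      + nb k (Finsupp.single ε 1) (nbBasis k β γ) = 0 := by
  by_cases h : Disjoint β.1 γ.1 ∧ Disjoint β.1 ε.1 ∧ Disjoint γ.1 ε.1 ∧
      IsInterval V (β.1 ∪ (γ.1 ∪ ε.1))
  · obtain ⟨h1, h2, h3, h4⟩ := h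
    obtain ⟨α, hα⟩ : ∃ α : Interval V, β.1 ∪ (γ.1 ∪ ε.1) = α.1 := ⟨⟨_, h4⟩, rfl⟩
    rw [nb_nb_of_interval h1 h2 h3 hα,
      nb_nb_of_interval h3 h1.symm h2.symm
        (by rw [← hα, ← Set.union_assoc, Set.union_comm _ β.1]),
      nb_nb_of_interval h2.symm h3.symm h1
        (by rw [← hα, Set.union_comm, Set.union_assoc]),
      ← Finsupp.single_add, ← Finsupp.single_add, om_swap β γ, om_swap β ε, om_swap γ ε]
    rw [Finsupp.single_eq_zero]
    push_cast
    ring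
  · rw [nb_nb_of_not h, nb_nb_of_not, nb_nb_of_not]
    · simp
    · rintro ⟨h1, h2, h3, h4⟩
      exact h ⟨h3, h1.symm, h2.symm, by rwa [← Set.union_assoc, Set.union_comm]⟩
    · rintro ⟨h1, h2, h3, h4⟩
      exact h ⟨h2.symm, h3.symm, h1, by rwa [Set.union_comm, Set.union_assoc, Set.union_comm ε.1,
        Set.union_assoc] at h4⟩

lemma nb_jacobi (x y z : Interval V →₀ k) :
    nb k x (nb k y z) + nb k y (nb k z x) + nb k z (nb k x y) = 0 := by
  induction x using Finsupp.induction_linear with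
  | zero => simp
  | add x x' hx hx' =>
    have := congrArg₂ (· + ·) hx hx'
    simp only [map_add, LinearMap.add_apply, add_zero] at this ⊢
    rw [← this]
    abel
  | single β a =>
    induction y using Finsupp.induction_linear with
    | zero => simp
    | add y y' hy hy' =>
      have := congrArg₂ (· + ·) hy hy'
      simp only [map_add, LinearMap.add_apply, add_zero] at this ⊢
      rw [← this]
      abel
    | single γ b =>
      induction z using Finsupp.induction_linear with
      | zero => simp
      | add z z' hz hz' =>
        have := congrArg₂ (· + ·) hz hz'
        simp only [map_add, LinearMap.add_apply, add_zero] at this ⊢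
        rw [← this]
        abel
      | single ε d =>
        have key : ∀ (δ : Interval V) (e : k) (v : Interval V →₀ k),
            nb k (Finsupp.single δ e) v = e • nb k (Finsupp.single δ 1) v := by
          intro δ e v
          rw [← LinearMap.smul_apply, ← map_smul, Finsupp.smul_single, smul_eq_mul, mul_one]
        rw [nb_single, nb_single, nb_single, map_smul, map_smul, map_smul, key β a, key γ b,
          key ε d, smul_smul, smul_smul, smul_smul]
        have := congrArg (fun v => (a * b * d) • v) (nb_jacobi_basis (k := k) β γ ε)
        simp only [smul_add, smul_zero] at this
        rw [← this]
        congr 1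
        · congr 1
          · congr 1
            ring
          · congr 1
            ring

/-- The Jacobi identity in derivation form. -/
lemma nb_leibniz (x y z : Interval V →₀ k) :
    nb k (nb k x y) z = nb k x (nb k y z) - nb k y (nb k x z) := by
  have h := nb_jacobi x y z
  rw [nb_skew x z, map_neg, nb_skew (nb k x y) z] at h
  rw [← sub_eq_zero, ← neg_eq_zero, ← h]
  abel

end NilBracket

/-! ### Lie algebras with generators satisfying the relations -/

section Relations

variable {X : Type u} [TopologicalSpace X] {V : VertexSpace X}
variable (k : Type v) [Field k]

open scoped Classical in
/-- The right-hand side of the relation for `[x⁺_α, x⁻_β]`, for a family of elements of a vector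
space indexed by the generators. -/
def crossIn {M : Type w} [AddCommGroup M] [Module k M] (γ : Gen V → M) (α β : Interval V) : M :=
  (if α = β then γ (.cartan (cf α)) else 0) +
    (ca α β : k) • ((if h : DiffDefined α β then γ (.pos (diff α β h)) else 0)
      - (if h : DiffDefined β α then γ (.neg (diff β α h)) else 0))

lemma map_crossIn {M : Type*} {N : Type*} [AddCommGroup M] [Module k M] [AddCommGroup N]
    [Module k N] (f : M →ₗ[k] N) (γ : Gen V → M) (α β : Interval V) :
    f (crossIn k γ α β) = crossIn k (fun g => f (γ g)) α β := by
  simp only [crossIn, map_add, map_smul, map_sub, apply_ite f, apply_dite f, map_zero]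

/-- The defining relations of the continuum Kac–Moody algebra, for elements of a Lie algebra. -/
structure SatisfiesRel {L : Type w} [LieRing L] [LieAlgebra k L] (γ : Gen V → L) : Prop where
  add : ∀ f g, γ (.cartan (f + g)) = γ (.cartan f) + γ (.cartan g)
  comm : ∀ α β, ⁅γ (.cartan (cf α)), γ (.cartan (cf β))⁆ = 0
  weight_pos : ∀ α β, ⁅γ (.cartan (cf α)), γ (.pos β)⁆ = (eulerSym V (cf α) (cf β) : k) • γ (.pos β)
  weight_neg : ∀ α β,
    ⁅γ (.cartan (cf α)), γ (.neg β)⁆ = -((eulerSym V (cf α) (cf β) : k) • γ (.neg β))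
  cross : ∀ α β, ⁅γ (.pos α), γ (.neg β)⁆ = crossIn k γ α β

lemma crossTerm_eq (α β : Interval V) : crossTerm k α β = crossIn k (FreeLieAlgebra.of k) α β :=
  rfl

variable {k} in
lemma SatisfiesRel.map {L : Type*} {M : Type*} [LieRing L] [LieAlgebra k L] [LieRing M]
    [LieAlgebra k M] {γ : Gen V → L} (h : SatisfiesRel k γ) (F : L →ₗ⁅k⁆ M) :
    SatisfiesRel k fun g => F (γ g) where
  add f g := by rw [h.add, map_add]
  comm α β := by rw [← LieHom.map_lie, h.comm, map_zero]
  weight_pos α β := by rw [← LieHom.map_lie, h.weight_pos, map_smul]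
  weight_neg α β := by rw [← LieHom.map_lie, h.weight_neg, map_neg, map_smul]
  cross α β := by
    rw [← LieHom.map_lie, h.cross]
    exact map_crossIn k F.toLinearMap γ α β

variable (V)

lemma satisfiesRel_tildeGen : SatisfiesRel k (tildeGen V k) := by
  set I := LieSubmodule.lieSpan k (FreeLieAlgebra k (Gen V)) {r | Rel (V := V) k r} with hI
  have key : ∀ r, Rel (V := V) k r → LieSubmodule.Quotient.mk' I r = 0 := fun r hr =>
    (LieSubmodule.Quotient.mk_eq_zero I).2 (LieSubmodule.subset_lieSpan hr)
  have hb : ∀ a b : FreeLieAlgebra k (Gen V), LieSubmodule.Quotient.mk' I ⁅a, b⁆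
      = ⁅(LieSubmodule.Quotient.mk' I a : TildeG V k),
        (LieSubmodule.Quotient.mk' I b : TildeG V k)⁆ :=
    fun a b => LieSubmodule.Quotient.mk_bracket I a b
  have hg : ∀ g, tildeGen V k g = LieSubmodule.Quotient.mk' I (FreeLieAlgebra.of k g) :=
    fun g => rfl
  refine ⟨fun f g => ?_, fun α β => ?_, fun α β => ?_, fun α β => ?_, fun α β => ?_⟩
  · have := key _ (.add f g)
    rw [map_sub, map_sub, sub_sub, sub_eq_zero] at this
    exact this
  · have := key _ (.comm α β)
    rwa [hb] at this
  · have := key _ (.weight_pos α β)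
    rw [map_sub, hb, sub_eq_zero, map_smul] at this
    exact this
  · have := key _ (.weight_neg α β)
    rw [map_add, hb, map_smul] at this
    exact eq_neg_of_add_eq_zero_left this
  · have := key _ (.cross α β)
    rw [map_sub, hb, sub_eq_zero, crossTerm_eq] at this
    exact this.trans (map_crossIn k (LieSubmodule.Quotient.mk' I).toLinearMap _ α β)

variable {V}

/-- The homomorphism from a quotient by an ideal induced by a homomorphism vanishing on it. -/
def quotLift {L : Type*} {M : Type*} [LieRing L] [LieAlgebra k L] [LieRing M]
    [LieAlgebra k M] (I : LieIdeal k L) (F : L →ₗ⁅k⁆ M) (h : ∀ x ∈ I, F x = 0) : L ⧸ I →ₗ⁅k⁆ M :=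
  { I.toSubmodule.liftQ (F : L →ₗ[k] M) (fun x hx => h x hx) with
    map_lie' := by
      intro x y
      obtain ⟨x, rfl⟩ := LieSubmodule.Quotient.surjective_mk' I x
      obtain ⟨y, rfl⟩ := LieSubmodule.Quotient.surjective_mk' I y
      exact F.map_lie x y }

variable {k} in
lemma SatisfiesRel.lift_eq_zero {M : Type*} [LieRing M] [LieAlgebra k M] {γ : Gen V → M}
    (h : SatisfiesRel k γ) : ∀ x ∈ LieSubmodule.lieSpan k (FreeLieAlgebra k (Gen V))
      {r | Rel (V := V) k r}, FreeLieAlgebra.lift k γ x = 0 := by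
  have hle : LieSubmodule.lieSpan k (FreeLieAlgebra k (Gen V)) {r | Rel (V := V) k r} ≤
      (FreeLieAlgebra.lift k γ).ker := by
    rw [LieSubmodule.lieSpan_le]
    intro r hr
    change r ∈ (FreeLieAlgebra.lift k γ).ker
    rw [LieHom.mem_ker]
    cases hr with
    | add f g =>
      simp only [map_sub, FreeLieAlgebra.lift_of_apply, h.add]
      abel
    | comm α β => simp only [LieHom.map_lie, FreeLieAlgebra.lift_of_apply, h.comm]
    | weight_pos α β =>
      simp only [LieHom.map_lie, map_sub, map_smul, FreeLieAlgebra.lift_of_apply, h.weight_pos,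
        sub_self]
    | weight_neg α β =>
      simp only [LieHom.map_lie, map_add, map_smul, FreeLieAlgebra.lift_of_apply, h.weight_neg,
        neg_add_cancel]
    | cross α β =>
      have h1 := map_crossIn k (FreeLieAlgebra.lift k γ).toLinearMap (FreeLieAlgebra.of k) α β
      rw [LieHom.coe_toLinearMap, ← crossTerm_eq] at h1
      simp only [FreeLieAlgebra.lift_of_apply] at h1
      rw [map_sub, LieHom.map_lie, FreeLieAlgebra.lift_of_apply, FreeLieAlgebra.lift_of_apply,
        h.cross, h1, sub_self]
  exact fun x hx => (LieHom.mem_ker).1 (hle hx)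

/-- The universal property of `TildeG`. -/
def tildeLift {M : Type*} [LieRing M] [LieAlgebra k M] {γ : Gen V → M}
    (h : SatisfiesRel k γ) : TildeG V k →ₗ⁅k⁆ M :=
  quotLift k _ (FreeLieAlgebra.lift k γ) h.lift_eq_zero

lemma tildeLift_gen {M : Type*} [LieRing M] [LieAlgebra k M] {γ : Gen V → M}
    (h : SatisfiesRel k γ) (g : Gen V) : tildeLift k h (tildeGen V k g) = γ g :=
  FreeLieAlgebra.lift_of_apply γ g

lemma lieSpan_freeGen {Y : Type*} :
    LieSubalgebra.lieSpan k (FreeLieAlgebra k Y) (Set.range (FreeLieAlgebra.of k)) = ⊤ := by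
  set S := LieSubalgebra.lieSpan k (FreeLieAlgebra k Y) (Set.range (FreeLieAlgebra.of k))
  let F : FreeLieAlgebra k Y →ₗ⁅k⁆ S := FreeLieAlgebra.lift k fun y =>
    ⟨FreeLieAlgebra.of k y, LieSubalgebra.subset_lieSpan ⟨y, rfl⟩⟩
  have h : S.incl.comp F = LieHom.id := by
    refine FreeLieAlgebra.hom_ext fun y => ?_
    simp [F]
  rw [eq_top_iff]
  intro x _
  have := LieHom.congr_fun h x
  rw [LieHom.comp_apply, LieHom.id_apply] at this
  rw [← this]
  exact (F x).2

/-- An induction principle for quotients of the free Lie algebra: a subspace containing the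
generators and closed under brackets is everything. -/
lemma induction_of_surjective {Y : Type*} {L : Type*} [LieRing L] [LieAlgebra k L]
    (F : FreeLieAlgebra k Y →ₗ⁅k⁆ L) (hF : Function.Surjective F) {P : L → Prop}
    (gen : ∀ y, P (F (FreeLieAlgebra.of k y))) (zero : P 0)
    (add : ∀ x y, P x → P y → P (x + y)) (smul : ∀ (a : k) x, P x → P (a • x))
    (lie : ∀ x y, P x → P y → P ⁅x, y⁆) (x : L) : P x := by
  let S : LieSubalgebra k (FreeLieAlgebra k Y) :=
    { carrier := {x | P (F x)}
      add_mem' := fun {a b} ha hb => by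
        change P (F (a + b))
        rw [map_add]
        exact add _ _ ha hb
      zero_mem' := by
        change P (F 0)
        rwa [map_zero]
      smul_mem' := fun a x hx => by
        change P (F (a • x))
        rw [map_smul]
        exact smul a _ hx
      lie_mem' := fun {a b} ha hb => by
        change P (F ⁅a, b⁆)
        rw [LieHom.map_lie]
        exact lie _ _ ha hb }
  have hS : (⊤ : LieSubalgebra k (FreeLieAlgebra k Y)) ≤ S := by
    rw [← lieSpan_freeGen k, LieSubalgebra.lieSpan_le]
    rintro _ ⟨y, rfl⟩
    exact gen y
  obtain ⟨y, rfl⟩ := hF x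
  exact hS (LieSubalgebra.mem_top y)

lemma tilde_induction {P : TildeG V k → Prop} (gen : ∀ g, P (tildeGen V k g)) (zero : P 0)
    (add : ∀ x y, P x → P y → P (x + y)) (smul : ∀ (a : k) x, P x → P (a • x))
    (lie : ∀ x y, P x → P y → P ⁅x, y⁆) (x : TildeG V k) : P x :=
  induction_of_surjective k
    ({ (LieSubmodule.Quotient.mk' (LieSubmodule.lieSpan k (FreeLieAlgebra k (Gen V))
        {r | Rel (V := V) k r})).toLinearMap with
      map_lie' := fun {a b} => LieSubmodule.Quotient.mk_bracket _ a b } :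
      FreeLieAlgebra k (Gen V) →ₗ⁅k⁆ TildeG V k)
    (LieSubmodule.Quotient.surjective_mk' _) gen zero add smul lie x

/-- The images of the generators under the Chevalley involution. -/
def chevGen : Gen V → TildeG V k
  | .cartan f => -tildeGen V k (.cartan f)
  | .pos α => -tildeGen V k (.neg α)
  | .neg α => -tildeGen V k (.pos α)

variable [T2Space X]

open scoped Classical in
/-- The relations are symmetric under `x⁺ ↔ -x⁻`, `ξ ↦ -ξ`, as `c(α, β) = -c(β, α)` whenever a
difference of `α` and `β` is defined. -/
lemma satisfiesRel_chevGen : SatisfiesRel k (chevGen (V := V) k) := by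
  have h := satisfiesRel_tildeGen V k
  refine ⟨fun f g => ?_, fun α β => ?_, fun α β => ?_, fun α β => ?_, fun α β => ?_⟩
  · simp only [chevGen, h.add]
    abel
  · simp only [chevGen, neg_lie, lie_neg, h.comm, neg_zero]
  · simp only [chevGen, neg_lie, lie_neg, h.weight_neg, neg_neg, smul_neg]
  · simp only [chevGen, neg_lie, lie_neg, h.weight_pos, neg_neg, smul_neg]
  · have h1 : ⁅chevGen k (.pos α), chevGen k (.neg β)⁆ = -crossIn k (tildeGen V k) β α := by
      simp only [chevGen, neg_lie, lie_neg, neg_neg]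
      rw [← lie_skew, h.cross]
    rw [h1]
    have hd : (if β = α then tildeGen V k (.cartan (cf β)) else 0)
        = if α = β then tildeGen V k (.cartan (cf α)) else 0 := by
      by_cases hαβ : α = β
      · subst hαβ
        rfl
      · rw [if_neg hαβ, if_neg (Ne.symm hαβ)]
    simp only [crossIn, chevGen]
    rw [hd, neg_add]
    congr 1
    · split_ifs <;> simp
    · by_cases h1 : DiffDefined α β
      · have h3 := ca_swap h1
        rw [h3]
        by_cases h2 : DiffDefined β α
        · simp only [dif_pos h1, dif_pos h2]
          push_cast
          module
        · simp only [dif_pos h1, dif_neg h2]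
          push_cast
          module
      · by_cases h2 : DiffDefined β α
        · have h3 := ca_swap h2
          rw [h3]
          simp only [dif_neg h1, dif_pos h2]
          push_cast
          module
        · simp only [dif_neg h1, dif_neg h2]
          simp

/-- The Chevalley involution of `TildeG`. -/
def chev : TildeG V k →ₗ⁅k⁆ TildeG V k := tildeLift k (satisfiesRel_chevGen k)

lemma chev_gen (g : Gen V) : chev k (tildeGen V k g) = chevGen k g := tildeLift_gen k _ g

end Relations

/-! ### The modules freely generated by the negative generators -/

section WordModule

variable {X : Type u} [TopologicalSpace X] {V : VertexSpace X}
variable {k : Type v} [Field k]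

/-- The degree of a word. -/
def wt : List (Interval V) → funX V
  | [] => 0
  | β :: w => cf β + wt w

variable (k) in
/-- The action of `x⁻_β` on words, by left concatenation. -/
def fAct (β : Interval V) : Module.End k (List (Interval V) →₀ k) :=
  Finsupp.lmapDomain k k (List.cons β)

lemma fAct_single (β : Interval V) (w : List (Interval V)) (a : k) :
    fAct k β (Finsupp.single w a) = Finsupp.single (β :: w) a := by
  simp [fAct, Finsupp.lmapDomain_apply]

/-- The weight of a word with respect to `ξ_f`, if the highest weight is `l`. -/
def wtVal (l : funX V →+ k) (f : funX V) (w : List (Interval V)) : k :=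
  l f - (eulerSym V f (wt w) : k)

/-- The action of `ξ_f` on words. -/
def xiAct (l : funX V →+ k) (f : funX V) : Module.End k (List (Interval V) →₀ k) :=
  Finsupp.linearCombination k fun w => Finsupp.single w (wtVal l f w)

lemma xiAct_single (l : funX V →+ k) (f : funX V) (w : List (Interval V)) (a : k) :
    xiAct l f (Finsupp.single w a) = wtVal l f w • Finsupp.single w a := by
  simp [xiAct, mul_comm]

/-- The images of a word `w` under the generators, if those under the `x⁺_α` are given. -/
def genWord (l : funX V →+ k) (w : List (Interval V)) (e : Interval V → List (Interval V) →₀ k) :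
    Gen V → List (Interval V) →₀ k
  | .cartan f => Finsupp.single w (wtVal l f w)
  | .pos α => e α
  | .neg β => Finsupp.single (β :: w) 1

/-- The image of a word under `x⁺_α`, which annihilates the empty word. -/
def eWord (l : funX V →+ k) : List (Interval V) → Interval V → List (Interval V) →₀ k
  | [], _ => 0
  | β :: w, α => fAct k β (eWord l w α) + crossIn k (genWord l w (eWord l w)) α β

/-- The action of `x⁺_α` on words. -/
def eAct (l : funX V →+ k) (α : Interval V) : Module.End k (List (Interval V) →₀ k) :=
  Finsupp.linearCombination k fun w => eWord l w α

/-- The action of the generators on words. -/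
def wordAct (l : funX V →+ k) : Gen V → Module.End k (List (Interval V) →₀ k)
  | .cartan f => xiAct l f
  | .pos α => eAct l α
  | .neg β => fAct k β

lemma wordAct_single (l : funX V →+ k) (w : List (Interval V)) :
    (fun g => wordAct l g (Finsupp.single w 1)) = genWord l w (eWord l w) := by
  funext g
  cases g with
  | cartan f => simp [wordAct, genWord, xiAct]
  | pos α => simp [wordAct, genWord, eAct]
  | neg β => simp [wordAct, genWord, fAct_single]

lemma eAct_nil (l : funX V →+ k) (α : Interval V) (a : k) : eAct l α (Finsupp.single [] a) = 0 := by
  simp [eAct, eWord]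

lemma crossIn_apply {M : Type*} {N : Type*} [AddCommGroup M] [Module k M] [AddCommGroup N]
    [Module k N] (γ : Gen V → M →ₗ[k] N) (m : M) (α β : Interval V) :
    crossIn k γ α β m = crossIn k (fun g => γ g m) α β :=
  map_crossIn k (LinearMap.applyₗ m) γ α β

lemma eAct_fAct (l : funX V →+ k) (α β : Interval V) (p : List (Interval V) →₀ k) :
    eAct l α (fAct k β p) = fAct k β (eAct l α p) + crossIn k (fun g => wordAct l g p) α β := by
  induction p using Finsupp.induction_linear with
  | zero =>
    have := map_crossIn k (0 : k →ₗ[k] (List (Interval V) →₀ k)) (fun _ => 0) α β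
    simp only [map_zero]
    simpa using this
  | add p q hp hq =>
    simp only [← crossIn_apply] at hp hq ⊢
    simp only [map_add, hp, hq]
    abel
  | single w a =>
    have h1 : (Finsupp.single w a : List (Interval V) →₀ k) = a • Finsupp.single w 1 := by simp
    rw [h1]
    simp only [← crossIn_apply]
    simp only [map_smul, ← smul_add]
    rw [crossIn_apply, wordAct_single, fAct_single]
    simp [eAct, eWord]

lemma lie_eAct_fAct (l : funX V →+ k) (α β : Interval V) :
    eAct l α * fAct k β - fAct k β * eAct l α = crossIn k (wordAct l) α β := by
  refine LinearMap.ext fun p => ?_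
  rw [crossIn_apply]
  simp only [LinearMap.sub_apply, Module.End.mul_apply]
  rw [eAct_fAct]
  abel

variable [T2Space X]

lemma wtVal_cons (l : funX V →+ k) (f : funX V) (β : Interval V) (w : List (Interval V)) :
    wtVal l f (β :: w) = wtVal l f w - (eulerSym V f (cf β) : k) := by
  simp only [wtVal, wt, eulerSym_add_right]
  push_cast
  ring

lemma wtVal_add (l : funX V →+ k) (f g : funX V) (w : List (Interval V)) :
    wtVal l (f + g) w = wtVal l f w + wtVal l g w := by
  simp only [wtVal, eulerSym_add_left, map_add]
  push_cast
  ring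

lemma xiAct_fAct (l : funX V →+ k) (f : funX V) (β : Interval V) (p : List (Interval V) →₀ k) :
    xiAct l f (fAct k β p) = fAct k β (xiAct l f p) - (eulerSym V f (cf β) : k) • fAct k β p := by
  induction p using Finsupp.induction_linear with
  | zero => simp
  | add p q hp hq =>
    simp only [map_add, hp, hq, smul_add]
    abel
  | single w a =>
    rw [fAct_single, xiAct_single, xiAct_single, map_smul, fAct_single, wtVal_cons, sub_smul]

omit [T2Space X] in
lemma cf_diff {α β : Interval V} (h : DiffDefined α β) : cf (diff α β h) = cf α - cf β := by
  have h1 := isSum_diff h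
  rw [cf_union h1.1 h1.2]
  abel

open scoped Classical in
/-- A family of vectors for the generators whose members have the right weights for an operator
has a value of the right weight on the right-hand side of the relation for `[x⁺_α, x⁻_β]`. -/
lemma crossIn_weight {M : Type*} [AddCommGroup M] [Module k M] (γ : Gen V → M)
    (A : M →ₗ[k] M) (f : funX V) (c : k) (hc : ∀ g, A (γ (.cartan g)) = c • γ (.cartan g))
    (hp : ∀ α, A (γ (.pos α)) = (c + eulerSym V f (cf α)) • γ (.pos α))
    (hn : ∀ α, A (γ (.neg α)) = (c - eulerSym V f (cf α)) • γ (.neg α)) (α β : Interval V) :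
    A (crossIn k γ α β) = (c + eulerSym V f (cf α) - eulerSym V f (cf β)) • crossIn k γ α β := by
  have key : ∀ {φ ψ : Interval V} (h : DiffDefined φ ψ),
      (eulerSym V f (cf (diff φ ψ h)) : k) = eulerSym V f (cf φ) - eulerSym V f (cf ψ) := by
    intro φ ψ h
    rw [cf_diff, sub_eq_add_neg, eulerSym_add_right, eulerSym_neg_right]
    push_cast
    ring
  have h0 : A (if α = β then γ (.cartan (cf α)) else 0) =
      (c + eulerSym V f (cf α) - eulerSym V f (cf β)) •
        (if α = β then γ (.cartan (cf α)) else 0) := by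
    split_ifs with h
    · subst h
      rw [hc]
      congr 1
      ring
    · simp
  have h1 : A (if h : DiffDefined α β then γ (.pos (diff α β h)) else 0) =
      (c + eulerSym V f (cf α) - eulerSym V f (cf β)) •
        (if h : DiffDefined α β then γ (.pos (diff α β h)) else 0) := by
    split_ifs with h
    · rw [hp, key]
      congr 1
      ring
    · simp
  have h2 : A (if h : DiffDefined β α then γ (.neg (diff β α h)) else 0) =
      (c + eulerSym V f (cf α) - eulerSym V f (cf β)) •
        (if h : DiffDefined β α then γ (.neg (diff β α h)) else 0) := by
    split_ifs with h
    · rw [hn, key]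
      congr 1
      ring
    · simp
  rw [crossIn, map_add, map_smul, map_sub, h0, h1, h2]
  module

lemma xiAct_eWord (l : funX V →+ k) (f : funX V) (w : List (Interval V)) :
    ∀ α, xiAct l f (eWord l w α) = (wtVal l f w + eulerSym V f (cf α)) • eWord l w α := by
  induction w with
  | nil => simp [eWord]
  | cons β w ih =>
    intro α
    have h1 := crossIn_weight (genWord l w (eWord l w)) (xiAct l f) f (wtVal l f w)
      (fun g => by simp only [genWord, xiAct_single]) ih
      (fun β => by simp only [genWord, xiAct_single, wtVal_cons]) α β
    rw [eWord, map_add, h1, xiAct_fAct, ih, map_smul, wtVal_cons]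
    module

lemma lie_xiAct_eAct (l : funX V →+ k) (f : funX V) (α : Interval V) :
    xiAct l f * eAct l α - eAct l α * xiAct l f = (eulerSym V f (cf α) : k) • eAct l α := by
  refine Finsupp.lhom_ext fun w a => ?_
  simp only [LinearMap.sub_apply, Module.End.mul_apply, LinearMap.smul_apply, xiAct_single,
    map_smul]
  simp only [eAct, Finsupp.linearCombination_single, map_smul, xiAct_eWord]
  module

lemma lie_xiAct_fAct (l : funX V →+ k) (f : funX V) (β : Interval V) :
    xiAct l f * fAct k β - fAct k β * xiAct l f = -((eulerSym V f (cf β) : k) • fAct k β) := by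
  refine LinearMap.ext fun p => ?_
  simp only [LinearMap.sub_apply, Module.End.mul_apply, LinearMap.smul_apply, LinearMap.neg_apply,
    xiAct_fAct]
  abel

lemma satisfiesRel_wordAct (l : funX V →+ k) : SatisfiesRel k (wordAct l) where
  add f g := by
    refine Finsupp.lhom_ext fun w a => ?_
    simp only [wordAct, LinearMap.add_apply, xiAct_single, wtVal_add, add_smul]
  comm α β := by
    refine Finsupp.lhom_ext fun w a => ?_
    rw [LieRing.of_associative_ring_bracket]
    simp only [wordAct, LinearMap.sub_apply, Module.End.mul_apply, xiAct_single, map_smul,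
      LinearMap.zero_apply]
    rw [smul_comm, sub_self]
  weight_pos α β := lie_xiAct_eAct l _ _
  weight_neg α β := lie_xiAct_fAct l _ _
  cross α β := lie_eAct_fAct l α β

/-- The representation of `TildeG` on the space of words: the module freely generated, over the
`x⁻_β`, by a vector of weight `l` which is annihilated by the `x⁺_α`. -/
def wordRep (l : funX V →+ k) : TildeG V k →ₗ⁅k⁆ Module.End k (List (Interval V) →₀ k) :=
  tildeLift k (satisfiesRel_wordAct l)

lemma wordRep_gen (l : funX V →+ k) (g : Gen V) : wordRep l (tildeGen V k g) = wordAct l g :=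
  tildeLift_gen k _ g

lemma wordRep_lie (l : funX V →+ k) (x y : TildeG V k) (p : List (Interval V) →₀ k) :
    wordRep l ⁅x, y⁆ p = wordRep l x (wordRep l y p) - wordRep l y (wordRep l x p) := by
  rw [LieHom.map_lie]
  rfl

end WordModule

/-! ### Triangular decompositions -/

section Hull

variable {k : Type v} [Field k] {M : Type w} [AddCommGroup M] [Module k M]

/-- The smallest subspace which contains `W` and is stable under a set of operators. -/
def hull (A : Set (Module.End k M)) (W : Submodule k M) : Submodule k M :=
  sInf {S | W ≤ S ∧ ∀ a ∈ A, ∀ m ∈ S, a m ∈ S}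

variable {A : Set (Module.End k M)} {W : Submodule k M}

lemma le_hull : W ≤ hull A W := le_sInf fun _ hS => hS.1

lemma hull_stable {a : Module.End k M} (ha : a ∈ A) {m : M} (hm : m ∈ hull A W) :
    a m ∈ hull A W := by
  rw [hull, Submodule.mem_sInf] at hm ⊢
  exact fun S hS => hS.2 a ha m (hm S hS)

lemma hull_le {S : Submodule k M} (h : W ≤ S) (h' : ∀ a ∈ A, ∀ m ∈ S, a m ∈ S) : hull A W ≤ S :=
  sInf_le ⟨h, h'⟩

lemma hull_induction {P : (m : M) → m ∈ hull A W → Prop} (base : ∀ m (hm : m ∈ W), P m (le_hull hm))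
    (zero : P 0 (zero_mem _))
    (add : ∀ x y (hx : x ∈ hull A W) (hy : y ∈ hull A W), P x hx → P y hy →
      P (x + y) (add_mem hx hy))
    (smul : ∀ (c : k) x (hx : x ∈ hull A W), P x hx → P (c • x) (Submodule.smul_mem _ c hx))
    (step : ∀ a (ha : a ∈ A), ∀ m (hm : m ∈ hull A W), P m hm → P (a m) (hull_stable ha hm))
    {m : M} (hm : m ∈ hull A W) : P m hm := by
  let S : Submodule k M :=
    { carrier := {m | ∃ hm : m ∈ hull A W, P m hm}
      add_mem' := fun ⟨hx, hx'⟩ ⟨hy, hy'⟩ => ⟨add_mem hx hy, add _ _ hx hy hx' hy'⟩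
      zero_mem' := ⟨zero_mem _, zero⟩
      smul_mem' := fun c x ⟨hx, hx'⟩ => ⟨Submodule.smul_mem _ c hx, smul c x hx hx'⟩ }
  have h : hull A W ≤ S := hull_le (fun m hm => ⟨le_hull hm, base m hm⟩)
    fun a ha m ⟨hm, hm'⟩ => ⟨hull_stable ha hm, step a ha m hm hm'⟩
  exact (h hm).2

lemma span_apply_mem {a : Module.End k M} (ha : a ∈ Submodule.span k A) {S : Submodule k M} {m : M}
    (h : ∀ a ∈ A, a m ∈ S) : a m ∈ S := by
  induction ha using Submodule.span_induction with
  | mem a ha => exact h a ha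
  | zero => exact S.zero_mem
  | add a b _ _ ha hb => exact S.add_mem ha hb
  | smul c a _ ha => exact S.smul_mem c ha

/-- Sets `P`, `H`, `N` of operators, and subspaces `Vp`, `Vh`, `Vn`, which behave like the
raising, diagonal and lowering operators defined by the generators of a Kac–Moody algebra, acting on
the spans of the generators. -/
structure HalfTriangular (P H N : Set (Module.End k M)) (Vp Vh Vn : Submodule k M) : Prop where
  comm_lower : ∀ b ∈ N, ∀ a ∈ P, b * a - a * b ∈ Submodule.span k (P ∪ H ∪ N)
  comm_diag : ∀ h ∈ H, ∀ a ∈ P, h * a - a * h ∈ Submodule.span k P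
  raise_neg : ∀ a ∈ P, ∀ m ∈ Vn, a m ∈ Vn ⊔ Vh ⊔ Vp
  raise_zero : ∀ a ∈ P, ∀ m ∈ Vh, a m ∈ Vp
  lower_pos : ∀ b ∈ N, ∀ m ∈ Vp, b m ∈ Vn ⊔ Vh ⊔ Vp
  diag_pos : ∀ h ∈ H, ∀ m ∈ Vp, h m ∈ Vp

variable {P H N : Set (Module.End k M)} {Vp Vh Vn : Submodule k M}

lemma mem_sup3 {S T U : Submodule k M} {P : M → Prop} {m : M} (hm : m ∈ S ⊔ T ⊔ U)
    (add : ∀ x y, P x → P y → P (x + y)) (hS : ∀ x ∈ S, P x) (hT : ∀ x ∈ T, P x)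
    (hU : ∀ x ∈ U, P x) : P m := by
  obtain ⟨y, hy, u, hu, rfl⟩ := Submodule.mem_sup.1 hm
  obtain ⟨s, hs, t, ht, rfl⟩ := Submodule.mem_sup.1 hy
  exact add _ _ (add _ _ (hS s hs) (hT t ht)) (hU u hu)

lemma HalfTriangular.diag_hull (T : HalfTriangular P H N Vp Vh Vn) {h : Module.End k M}
    (hh : h ∈ H) {m : M} (hm : m ∈ hull P Vp) : h m ∈ hull P Vp := by
  induction hm using hull_induction with
  | base m hm => exact le_hull (T.diag_pos h hh m hm)
  | zero => simp
  | add x y _ _ hx hy =>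
    rw [map_add]
    exact add_mem hx hy
  | smul c x _ hx =>
    rw [map_smul]
    exact Submodule.smul_mem _ c hx
  | step a ha m hm ih =>
    have h1 : h (a m) = a (h m) + (h * a - a * h) m := by simp
    rw [h1]
    exact add_mem (hull_stable ha ih)
      (span_apply_mem (T.comm_diag h hh a ha) fun a ha => hull_stable ha hm)

/-- Lowering operators leave the part generated by the raising operators only through the span
of the generators. -/
lemma HalfTriangular.lower_hull (T : HalfTriangular P H N Vp Vh Vn) {m : M} (hm : m ∈ hull P Vp) :
    ∀ b ∈ N, b m ∈ Vn ⊔ Vh ⊔ hull P Vp := by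
  have hle : Vn ⊔ Vh ⊔ Vp ≤ Vn ⊔ Vh ⊔ hull P Vp := sup_le_sup_left le_hull _
  induction hm using hull_induction with
  | base m hm => exact fun b hb => hle (T.lower_pos b hb m hm)
  | zero => simp
  | add x y _ _ hx hy =>
    intro b hb
    rw [map_add]
    exact add_mem (hx b hb) (hy b hb)
  | smul c x _ hx =>
    intro b hb
    rw [map_smul]
    exact Submodule.smul_mem _ c (hx b hb)
  | step a ha m hm ih =>
    intro b hb
    have h1 : b (a m) = a (b m) + (b * a - a * b) m := by simp
    rw [h1]
    refine add_mem ?_ (span_apply_mem (T.comm_lower b hb a ha) ?_)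
    · refine mem_sup3 (P := fun x => a x ∈ Vn ⊔ Vh ⊔ hull P Vp) (ih b hb) ?_ ?_ ?_ ?_
      · intro x y hx hy
        rw [map_add]
        exact add_mem hx hy
      · exact fun x hx => hle (T.raise_neg a ha x hx)
      · exact fun x hx => hle (Submodule.mem_sup_right (T.raise_zero a ha x hx))
      · exact fun x hx => Submodule.mem_sup_right (hull_stable ha hx)
    · rintro c ((hc | hc) | hc)
      · exact Submodule.mem_sup_right (hull_stable hc hm)
      · exact Submodule.mem_sup_right (T.diag_hull hc hm)
      · exact ih c hc

lemma HalfTriangular.raise_mem (T : HalfTriangular P H N Vp Vh Vn)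
    (T' : HalfTriangular N H P Vn Vh Vp) {a : Module.End k M} (ha : a ∈ P) {m : M}
    (hm : m ∈ hull N Vn ⊔ Vh ⊔ hull P Vp) : a m ∈ hull N Vn ⊔ Vh ⊔ hull P Vp := by
  refine mem_sup3 (P := fun x => a x ∈ hull N Vn ⊔ Vh ⊔ hull P Vp) hm ?_ ?_ ?_ ?_
  · intro x y hx hy
    rw [map_add]
    exact add_mem hx hy
  · intro x hx
    have h1 := T'.lower_hull hx a ha
    refine (?_ : Vp ⊔ Vh ⊔ hull N Vn ≤ _) h1
    refine sup_le (sup_le ?_ ?_) ?_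
    · exact le_hull.trans le_sup_right
    · exact le_sup_right.trans le_sup_left
    · exact le_sup_left.trans le_sup_left
  · exact fun x hx => Submodule.mem_sup_right (le_hull (T.raise_zero a ha x hx))
  · exact fun x hx => Submodule.mem_sup_right (hull_stable ha hx)

lemma HalfTriangular.diag_mem (T : HalfTriangular P H N Vp Vh Vn)
    (T' : HalfTriangular N H P Vn Vh Vp) (h0 : ∀ h ∈ H, ∀ m ∈ Vh, h m ∈ Vh)
    {h : Module.End k M} (hh : h ∈ H) {m : M}
    (hm : m ∈ hull N Vn ⊔ Vh ⊔ hull P Vp) : h m ∈ hull N Vn ⊔ Vh ⊔ hull P Vp := by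
  refine mem_sup3 (P := fun x => h x ∈ hull N Vn ⊔ Vh ⊔ hull P Vp) hm ?_ ?_ ?_ ?_
  · intro x y hx hy
    rw [map_add]
    exact add_mem hx hy
  · exact fun x hx => Submodule.mem_sup_left (Submodule.mem_sup_left (T'.diag_hull hh hx))
  · exact fun x hx => Submodule.mem_sup_left (Submodule.mem_sup_right (h0 h hh x hx))
  · exact fun x hx => Submodule.mem_sup_right (T.diag_hull hh hx)

end Hull

section Equivariant

variable {X : Type u} [TopologicalSpace X] {V : VertexSpace X}
variable {k : Type v} [Field k]

section

variable {L : Type w} [LieRing L] [LieAlgebra k L] {γ : Gen V → L}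

lemma SatisfiesRel.cartan_zero (h : SatisfiesRel k γ) : γ (.cartan 0) = 0 := by
  have := h.add 0 0
  rwa [add_zero, left_eq_add] at this

lemma SatisfiesRel.cartan_neg (h : SatisfiesRel k γ) (f : funX V) :
    γ (.cartan (-f)) = -γ (.cartan f) := by
  have := h.add f (-f)
  rw [add_neg_cancel, h.cartan_zero] at this
  exact (neg_eq_of_add_eq_zero_right this.symm).symm

variable [T2Space X]

omit [T2Space X] in
lemma SatisfiesRel.comm' (h : SatisfiesRel k γ) (f g : funX V) :
    ⁅γ (.cartan f), γ (.cartan g)⁆ = 0 := by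
  induction f using funX_induction_interval with
  | interval α =>
    induction g using funX_induction_interval with
    | interval β => exact h.comm α β
    | zero => rw [h.cartan_zero, lie_zero]
    | add f g hf hg => rw [h.add, lie_add, hf, hg, add_zero]
    | neg f hf => rw [h.cartan_neg, lie_neg, hf, neg_zero]
  | zero => rw [h.cartan_zero, zero_lie]
  | add f g hf hg => rw [h.add, add_lie, hf, hg, add_zero]
  | neg f hf => rw [h.cartan_neg, neg_lie, hf, neg_zero]

lemma SatisfiesRel.weight_pos' (h : SatisfiesRel k γ) (f : funX V) (β : Interval V) :
    ⁅γ (.cartan f), γ (.pos β)⁆ = (eulerSym V f (cf β) : k) • γ (.pos β) := by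
  induction f using funX_induction_interval with
  | interval α => exact h.weight_pos α β
  | zero => rw [h.cartan_zero, zero_lie, eulerSym_zero_left, Int.cast_zero, zero_smul]
  | add f g hf hg => rw [h.add, add_lie, hf, hg, eulerSym_add_left, Int.cast_add, add_smul]
  | neg f hf => rw [h.cartan_neg, neg_lie, hf, eulerSym_neg_left, Int.cast_neg, neg_smul]

lemma SatisfiesRel.weight_neg' (h : SatisfiesRel k γ) (f : funX V) (β : Interval V) :
    ⁅γ (.cartan f), γ (.neg β)⁆ = -((eulerSym V f (cf β) : k) • γ (.neg β)) := by
  induction f using funX_induction_interval with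
  | interval α => exact h.weight_neg α β
  | zero => rw [h.cartan_zero, zero_lie, eulerSym_zero_left, Int.cast_zero, zero_smul, neg_zero]
  | add f g hf hg =>
    rw [h.add, add_lie, hf, hg, eulerSym_add_left, Int.cast_add, add_smul, neg_add]
  | neg f hf => rw [h.cartan_neg, neg_lie, hf, eulerSym_neg_left, Int.cast_neg, neg_smul]

end

variable {M : Type w} [AddCommGroup M] [Module k M]

/-- Vectors indexed by the generators which transform under operators indexed by the generators
as prescribed by the relations between generators of different kinds. -/
structure EquivariantRel (A : Gen V → Module.End k M) (v : Gen V → M) : Prop where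
  comm : ∀ f g, A (.cartan f) (v (.cartan g)) = 0
  cartan_pos : ∀ f β, A (.cartan f) (v (.pos β)) = (eulerSym V f (cf β) : k) • v (.pos β)
  pos_cartan : ∀ f β, A (.pos β) (v (.cartan f)) = -((eulerSym V f (cf β) : k) • v (.pos β))
  cartan_neg : ∀ f β, A (.cartan f) (v (.neg β)) = -((eulerSym V f (cf β) : k) • v (.neg β))
  neg_cartan : ∀ f β, A (.neg β) (v (.cartan f)) = (eulerSym V f (cf β) : k) • v (.neg β)
  pos_neg : ∀ α β, A (.pos α) (v (.neg β)) = crossIn k v α β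
  neg_pos : ∀ α β, A (.neg β) (v (.pos α)) = -crossIn k v α β

/-- The span of the vectors of a family which belong to the `x⁺_α`. -/
def posSpan (v : Gen V → M) : Submodule k M := Submodule.span k (Set.range fun α => v (.pos α))

/-- The span of the vectors of a family which belong to the `ξ_f`. -/
def zeroSpan (v : Gen V → M) : Submodule k M := Submodule.span k (Set.range fun f => v (.cartan f))

/-- The span of the vectors of a family which belong to the `x⁻_α`. -/
def negSpan (v : Gen V → M) : Submodule k M := Submodule.span k (Set.range fun α => v (.neg α))

lemma mem_posSpan (v : Gen V → M) (α : Interval V) : v (.pos α) ∈ posSpan (k := k) v :=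
  Submodule.subset_span ⟨α, rfl⟩

lemma mem_zeroSpan (v : Gen V → M) (f : funX V) : v (.cartan f) ∈ zeroSpan (k := k) v :=
  Submodule.subset_span ⟨f, rfl⟩

lemma mem_negSpan (v : Gen V → M) (α : Interval V) : v (.neg α) ∈ negSpan (k := k) v :=
  Submodule.subset_span ⟨α, rfl⟩

lemma crossIn_mem (v : Gen V → M) {S : Submodule k M} (h0 : ∀ f, v (.cartan f) ∈ S)
    (hp : ∀ α, v (.pos α) ∈ S) (hn : ∀ α, v (.neg α) ∈ S) (α β : Interval V) :
    crossIn k v α β ∈ S := by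
  rw [crossIn]
  refine add_mem ?_ (Submodule.smul_mem _ _ (sub_mem ?_ ?_))
  all_goals split_ifs
  all_goals first | exact h0 _ | exact hp _ | exact hn _ | exact zero_mem _

lemma apply_mem_of_span {Y : Type*} {v : Y → M} {S : Submodule k M} (a : Module.End k M)
    (h : ∀ y, a (v y) ∈ S) {m : M} (hm : m ∈ Submodule.span k (Set.range v)) : a m ∈ S := by
  have : Submodule.span k (Set.range v) ≤ S.comap a := by
    rw [Submodule.span_le]
    rintro _ ⟨y, rfl⟩
    exact h y
  exact this hm

variable [T2Space X] {A : Gen V → Module.End k M} {v : Gen V → M}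

omit [T2Space X] in
lemma crossIn_mem_sup (v : Gen V → M) (α β : Interval V) :
    crossIn k v α β ∈ negSpan (k := k) v ⊔ zeroSpan v ⊔ posSpan v :=
  crossIn_mem v
    (fun f => Submodule.mem_sup_left (Submodule.mem_sup_right (mem_zeroSpan v f)))
    (fun α => Submodule.mem_sup_right (mem_posSpan v α))
    (fun α => Submodule.mem_sup_left (Submodule.mem_sup_left (mem_negSpan v α))) α β

/-- The raising operators are the `x⁺_α`. -/
lemma halfTriangular_pos (hA : SatisfiesRel k A) (hv : EquivariantRel A v) :
    HalfTriangular (Set.range fun α => A (.pos α)) (Set.range fun f => A (.cartan f))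
      (Set.range fun α => A (.neg α)) (posSpan v) (zeroSpan v) (negSpan v) where
  comm_lower := by
    rintro _ ⟨β, rfl⟩ _ ⟨α, rfl⟩
    rw [← neg_sub]
    refine neg_mem ?_
    have h1 : A (.pos α) * A (.neg β) - A (.neg β) * A (.pos α) = crossIn k A α β := hA.cross α β
    rw [h1]
    exact crossIn_mem A (fun f => Submodule.subset_span (Or.inl (Or.inr ⟨f, rfl⟩)))
      (fun f => Submodule.subset_span (Or.inl (Or.inl ⟨f, rfl⟩)))
      (fun f => Submodule.subset_span (Or.inr ⟨f, rfl⟩)) α β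
  comm_diag := by
    rintro _ ⟨f, rfl⟩ _ ⟨α, rfl⟩
    have h1 : A (.cartan f) * A (.pos α) - A (.pos α) * A (.cartan f)
      = (eulerSym V f (cf α) : k) • A (.pos α) := hA.weight_pos' f α
    rw [h1]
    exact Submodule.smul_mem _ _ (Submodule.subset_span ⟨α, rfl⟩)
  raise_neg := by
    rintro _ ⟨α, rfl⟩ m hm
    refine apply_mem_of_span _ (fun β => ?_) hm
    rw [hv.pos_neg]
    exact crossIn_mem_sup v α β
  raise_zero := by
    rintro _ ⟨α, rfl⟩ m hm
    refine apply_mem_of_span _ (fun f => ?_) hm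
    rw [hv.pos_cartan]
    exact neg_mem (Submodule.smul_mem _ _ (Submodule.subset_span ⟨α, rfl⟩))
  lower_pos := by
    rintro _ ⟨α, rfl⟩ m hm
    refine apply_mem_of_span _ (fun β => ?_) hm
    rw [hv.neg_pos]
    exact neg_mem (crossIn_mem_sup v β α)
  diag_pos := by
    rintro _ ⟨f, rfl⟩ m hm
    refine apply_mem_of_span _ (fun β => ?_) hm
    rw [hv.cartan_pos]
    exact Submodule.smul_mem _ _ (Submodule.subset_span ⟨β, rfl⟩)

/-- The raising operators are the `x⁻_α`. -/
lemma halfTriangular_neg (hA : SatisfiesRel k A) (hv : EquivariantRel A v) :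
    HalfTriangular (Set.range fun α => A (.neg α)) (Set.range fun f => A (.cartan f))
      (Set.range fun α => A (.pos α)) (negSpan v) (zeroSpan v) (posSpan v) where
  comm_lower := by
    rintro _ ⟨α, rfl⟩ _ ⟨β, rfl⟩
    have h1 : A (.pos α) * A (.neg β) - A (.neg β) * A (.pos α) = crossIn k A α β := hA.cross α β
    rw [h1]
    exact crossIn_mem A (fun f => Submodule.subset_span (Or.inl (Or.inr ⟨f, rfl⟩)))
      (fun f => Submodule.subset_span (Or.inr ⟨f, rfl⟩))
      (fun f => Submodule.subset_span (Or.inl (Or.inl ⟨f, rfl⟩))) α β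
  comm_diag := by
    rintro _ ⟨f, rfl⟩ _ ⟨α, rfl⟩
    have h1 : A (.cartan f) * A (.neg α) - A (.neg α) * A (.cartan f)
      = -((eulerSym V f (cf α) : k) • A (.neg α)) := hA.weight_neg' f α
    rw [h1]
    exact neg_mem (Submodule.smul_mem _ _ (Submodule.subset_span ⟨α, rfl⟩))
  raise_neg := by
    rintro _ ⟨β, rfl⟩ m hm
    refine apply_mem_of_span _ (fun α => ?_) hm
    rw [hv.neg_pos, sup_comm, sup_comm (posSpan v), ← sup_assoc]
    exact neg_mem (crossIn_mem_sup v α β)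
  raise_zero := by
    rintro _ ⟨α, rfl⟩ m hm
    refine apply_mem_of_span _ (fun f => ?_) hm
    rw [hv.neg_cartan]
    exact Submodule.smul_mem _ _ (Submodule.subset_span ⟨α, rfl⟩)
  lower_pos := by
    rintro _ ⟨α, rfl⟩ m hm
    refine apply_mem_of_span _ (fun β => ?_) hm
    rw [hv.pos_neg, sup_comm, sup_comm (posSpan v), ← sup_assoc]
    exact crossIn_mem_sup v α β
  diag_pos := by
    rintro _ ⟨f, rfl⟩ m hm
    refine apply_mem_of_span _ (fun β => ?_) hm
    rw [hv.cartan_neg]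
    exact neg_mem (Submodule.smul_mem _ _ (Submodule.subset_span ⟨β, rfl⟩))

variable (A v) in
/-- The subspace generated from the vectors for the `x⁺_α` by the operators for the `x⁺_α`. -/
def posHull : Submodule k M := hull (Set.range fun α => A (.pos α)) (posSpan v)

variable (A v) in
/-- The subspace generated from the vectors for the `x⁻_α` by the operators for the `x⁻_α`. -/
def negHull : Submodule k M := hull (Set.range fun α => A (.neg α)) (negSpan v)

/-- The sum of the negative, the diagonal and the positive part is stable under all generators. -/
lemma triangular_stable (hA : SatisfiesRel k A) (hv : EquivariantRel A v) (g : Gen V) {m : M}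
    (hm : m ∈ negHull A v ⊔ zeroSpan v ⊔ posHull A v) :
    A g m ∈ negHull A v ⊔ zeroSpan v ⊔ posHull A v := by
  have hp := halfTriangular_pos hA hv
  have hn := halfTriangular_neg hA hv
  cases g with
  | cartan f =>
    refine hp.diag_mem hn ?_ ⟨f, rfl⟩ hm
    rintro _ ⟨g, rfl⟩ m hm
    refine apply_mem_of_span _ (fun β => ?_) hm
    rw [hv.comm]
    exact zero_mem _
  | pos α => exact hp.raise_mem hn ⟨α, rfl⟩ hm
  | neg α =>
    have hm' : m ∈ posHull A v ⊔ zeroSpan v ⊔ negHull A v := by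
      rwa [sup_comm, sup_comm (posHull A v), ← sup_assoc]
    have := hn.raise_mem hp ⟨α, rfl⟩ hm'
    rwa [sup_comm, sup_comm (hull _ (posSpan v)), ← sup_assoc] at this

/-- Generators of a Lie algebra transform in the right way under the adjoint representation. -/
lemma SatisfiesRel.equivariant_ad {L : Type w} [LieRing L] [LieAlgebra k L] {γ : Gen V → L}
    (h : SatisfiesRel k γ) : EquivariantRel (fun g => LieAlgebra.ad k L (γ g)) γ where
  comm f g := h.comm' f g
  cartan_pos f β := h.weight_pos' f β
  pos_cartan f β := by rw [LieAlgebra.ad_apply, ← lie_skew, h.weight_pos']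
  cartan_neg f β := h.weight_neg' f β
  neg_cartan f β := by rw [LieAlgebra.ad_apply, ← lie_skew, h.weight_neg', neg_neg]
  pos_neg α β := h.cross α β
  neg_pos α β := by rw [LieAlgebra.ad_apply, ← lie_skew, h.cross]

end Equivariant

section Generated

variable {k : Type v} [Field k] {L : Type w} [LieRing L] [LieAlgebra k L]

/-- If a Lie algebra is generated by the elements `γ y`, then a subspace which contains these
generators and is stable under them is everything. -/
lemma eq_top_of_stable {Y : Type*} {γ : Y → L}
    (hγ : LieSubalgebra.lieSpan k L (Set.range γ) = ⊤) {S : Submodule k L} (h : ∀ y, γ y ∈ S)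
    (h' : ∀ y, ∀ m ∈ S, ⁅γ y, m⁆ ∈ S) : S = ⊤ := by
  let T : LieSubalgebra k L :=
    { carrier := {x | x ∈ S ∧ ∀ m ∈ S, ⁅x, m⁆ ∈ S}
      add_mem' := fun hx hy => ⟨add_mem hx.1 hy.1, fun m hm => by
        rw [add_lie]
        exact add_mem (hx.2 m hm) (hy.2 m hm)⟩
      zero_mem' := ⟨zero_mem _, fun m _ => by simp⟩
      smul_mem' := fun c x hx => ⟨Submodule.smul_mem _ c hx.1, fun m hm => by
        rw [smul_lie]
        exact Submodule.smul_mem _ c (hx.2 m hm)⟩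
      lie_mem' := fun {x y} hx hy => ⟨hx.2 y hy.1, fun m hm => by
        rw [lie_lie]
        exact sub_mem (hx.2 _ (hy.2 m hm)) (hy.2 _ (hx.2 m hm))⟩ }
  have hT : (⊤ : LieSubalgebra k L) ≤ T := by
    rw [← hγ, LieSubalgebra.lieSpan_le]
    rintro _ ⟨y, rfl⟩
    exact ⟨h y, h' y⟩
  rw [eq_top_iff]
  exact fun x _ => (hT (LieSubalgebra.mem_top x)).1

variable {X : Type u} [TopologicalSpace X] {V : VertexSpace X} [T2Space X] {γ : Gen V → L}

/-- The triangular decomposition of a Lie algebra with generators which satisfy the relations. -/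
lemma SatisfiesRel.triangular (h : SatisfiesRel k γ)
    (hγ : LieSubalgebra.lieSpan k L (Set.range γ) = ⊤) :
    negHull (fun g => LieAlgebra.ad k L (γ g)) γ ⊔ zeroSpan γ ⊔
      posHull (fun g => LieAlgebra.ad k L (γ g)) γ = ⊤ := by
  refine eq_top_of_stable hγ (fun g => ?_) fun g m hm => ?_
  · cases g with
    | cartan f => exact Submodule.mem_sup_left (Submodule.mem_sup_right
        (Submodule.subset_span ⟨f, rfl⟩))
    | pos α => exact Submodule.mem_sup_right (le_hull (Submodule.subset_span ⟨α, rfl⟩))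
    | neg α => exact Submodule.mem_sup_left (Submodule.mem_sup_left
        (le_hull (Submodule.subset_span ⟨α, rfl⟩)))
  · exact triangular_stable (A := fun g => LieAlgebra.ad k L (γ g)) (h.map (LieAlgebra.ad k L))
      h.equivariant_ad g hm

end Generated

/-! ### Linear functionals dual to the generators -/

section Functionals

variable {X : Type u} [TopologicalSpace X] {V : VertexSpace X}
variable {k : Type v} [Field k]

lemma IsSum.right_unique {α β γ γ' : Interval V} (h : IsSum β γ α) (h' : IsSum β γ' α) : γ = γ' :=
  Subtype.ext (h.diff_eq.symm.trans h'.diff_eq)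

lemma nb_single_apply_of_isSum {α β γ : Interval V} (h : IsSum β γ α) (v : Interval V →₀ k) :
    nb k (Finsupp.single β 1) v α = (om β γ : k) * v γ := by
  induction v using Finsupp.induction_linear with
  | zero => simp
  | add x y hx hy => rw [map_add, Finsupp.add_apply, hx, hy, Finsupp.add_apply, mul_add]
  | single ε a =>
    rw [nb_single, one_mul]
    by_cases hε : ε = γ
    · subst hε
      simp [nbBasis_of_isSum h, mul_comm]
    · rw [Finsupp.single_eq_of_ne (Ne.symm hε), mul_zero]
      by_cases hs : ∃ δ, IsSum β ε δ
      · obtain ⟨δ, hδ⟩ := hs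
        have hne : α ≠ δ := by
          rintro rfl
          exact hε (hδ.right_unique h)
        simp [nbBasis_of_isSum hδ, Finsupp.single_eq_of_ne hne]
      · simp [nbBasis_of_not hs]

lemma nb_single_apply_of_not {α β : Interval V} (h : ¬∃ γ, IsSum β γ α) (v : Interval V →₀ k) :
    nb k (Finsupp.single β 1) v α = 0 := by
  induction v using Finsupp.induction_linear with
  | zero => simp
  | add x y hx hy => rw [map_add, Finsupp.add_apply, hx, hy, add_zero]
  | single ε a =>
    rw [nb_single, one_mul]
    by_cases hs : ∃ δ, IsSum β ε δ
    · obtain ⟨δ, hδ⟩ := hs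
      have hne : α ≠ δ := by
        rintro rfl
        exact h ⟨ε, hδ⟩
      simp [nbBasis_of_isSum hδ, Finsupp.single_eq_of_ne hne]
    · simp [nbBasis_of_not hs]

/-- The derivation of the bracket `nb` which is defined by an additive function on `Fun(X)`. -/
def der (d : funX V →+ k) : (Interval V →₀ k) →ₗ[k] (Interval V →₀ k) :=
  Finsupp.linearCombination k fun β => Finsupp.single β (d (cf β))

lemma der_single (d : funX V →+ k) (β : Interval V) (a : k) :
    der d (Finsupp.single β a) = d (cf β) • Finsupp.single β a := by
  simp [der, mul_comm]

lemma der_apply (d : funX V →+ k) (z : Interval V →₀ k) (α : Interval V) :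
    der d z α = d (cf α) * z α := by
  induction z using Finsupp.induction_linear with
  | zero => simp
  | add x y hx hy => rw [map_add, Finsupp.add_apply, hx, hy, Finsupp.add_apply, mul_add]
  | single β a =>
    rw [der_single]
    by_cases h : α = β
    · subst h
      simp
    · simp [Finsupp.single_eq_of_ne h]

lemma der_nb (d : funX V →+ k) (x y : Interval V →₀ k) :
    der d (nb k x y) = nb k (der d x) y + nb k x (der d y) := by
  induction x using Finsupp.induction_linear with
  | zero => simp
  | add x x' hx hx' =>
    simp only [map_add, LinearMap.add_apply, hx, hx']
    abel
  | single β a =>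
    induction y using Finsupp.induction_linear with
    | zero => simp
    | add y y' hy hy' =>
      simp only [map_add, hy, hy']
      abel
    | single γ b =>
      rw [der_single, der_single, map_smul, map_smul, LinearMap.smul_apply, nb_single, map_smul]
      by_cases hs : ∃ δ, IsSum β γ δ
      · obtain ⟨δ, hδ⟩ := hs
        rw [nbBasis_of_isSum hδ, der_single, cf_union hδ.1 hδ.2, map_add]
        module
      · simp [nbBasis_of_not hs]

/-- The image of a word under the map `sig`. -/
def sigWord (d : funX V →+ k) : List (Interval V) → Interval V →₀ k
  | [] => 0
  | β :: w => -nb k (Finsupp.single β 1) (sigWord d w)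
      - Finsupp.single w (1 : k) [] • Finsupp.single β (d (cf β))

/-- The map from words to the Lie algebra with the bracket `nb` under which `x⁻_β` corresponds to
`-E_β`, acting by the adjoint representation, and by the derivation `d` on the empty word. -/
def sig (d : funX V →+ k) : (List (Interval V) →₀ k) →ₗ[k] (Interval V →₀ k) :=
  Finsupp.linearCombination k (sigWord d)

lemma sig_single (d : funX V →+ k) (w : List (Interval V)) :
    sig d (Finsupp.single w 1) = sigWord d w := by
  simp [sig]

lemma sig_fAct (d : funX V →+ k) (β : Interval V) (p : List (Interval V) →₀ k) :
    sig d (fAct k β p) = -nb k (Finsupp.single β 1) (sig d p)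
      - p [] • Finsupp.single β (d (cf β)) := by
  induction p using Finsupp.induction_linear with
  | zero => simp
  | add p q hp hq =>
    simp only [map_add, hp, hq, Finsupp.add_apply, add_smul]
    abel
  | single w a =>
    have h1 : (Finsupp.single w a : List (Interval V) →₀ k) = a • Finsupp.single w 1 := by simp
    rw [h1, map_smul, map_smul, map_smul, map_smul, fAct_single, sig_single, sig_single, sigWord,
      Finsupp.smul_apply]
    module

lemma fAct_apply_nil (β : Interval V) (p : List (Interval V) →₀ k) : fAct k β p [] = 0 := by
  induction p using Finsupp.induction_linear with
  | zero => simp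
  | add p q hp hq => rw [map_add, Finsupp.add_apply, hp, hq, add_zero]
  | single w a => simp [fAct_single]

variable [T2Space X]

open scoped Classical in
/-- The contraction of a word to the empty word by `x⁺_α` does not depend on the highest weight
except through the derivation, and is given by the bracket `nb`. -/
lemma eAct_apply_nil (l : funX V →+ k) (p : List (Interval V) →₀ k) (α : Interval V) :
    eAct l α p [] = -sig l p α := by
  have key : ∀ (w : List (Interval V)) (α : Interval V), eWord l w α [] = -sigWord l w α := by
    intro w
    induction w with
    | nil => simp [eWord, sigWord]
    | cons β w ih =>
      intro α
      rw [eWord, Finsupp.add_apply, fAct_apply_nil, zero_add]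
      have h1 := map_crossIn k (Finsupp.lapply (R := k) (M := k) ([] : List (Interval V)))
        (genWord l w (eWord l w)) α β
      simp only [Finsupp.lapply_apply] at h1
      rw [h1, sigWord, Finsupp.sub_apply, Finsupp.neg_apply, neg_sub, sub_neg_eq_add, crossIn]
      congr 1
      · by_cases hαβ : α = β
        · subst hαβ
          rw [if_pos rfl]
          cases w with
          | nil =>
            simp [genWord, wtVal, wt, eulerSym_zero_right]
          | cons γ w => simp [genWord]
        · rw [if_neg hαβ, Finsupp.smul_apply, Finsupp.single_eq_of_ne hαβ, smul_zero]
      · have h2 :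
            (if h : DiffDefined β α then genWord l w (eWord l w) (.neg (diff β α h)) [] else 0)
            = 0 := by
          split_ifs <;> simp [genWord]
        rw [h2, sub_zero]
        by_cases h : DiffDefined α β
        · rw [dif_pos h, nb_single_apply_of_isSum (isSum_diff h), genWord, ih]
          rw [(ca_of_isSum (isSum_diff h)).2]
          push_cast
          rw [smul_eq_mul, neg_mul_neg]
        · rw [dif_neg h, nb_single_apply_of_not fun ⟨γ, hγ⟩ => h hγ.diffDefined, smul_zero]
  induction p using Finsupp.induction_linear with
  | zero => simp
  | add p q hp hq =>
    rw [map_add, map_add, Finsupp.add_apply, Finsupp.add_apply, hp, hq, neg_add]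
  | single w a => simp [eAct, sig, key]

lemma xiAct_apply_nil (l : funX V →+ k) (f : funX V) (p : List (Interval V) →₀ k) :
    xiAct l f p [] = l f * p [] := by
  induction p using Finsupp.induction_linear with
  | zero => simp
  | add p q hp hq => rw [map_add, Finsupp.add_apply, hp, hq, Finsupp.add_apply, mul_add]
  | single w a =>
    rw [xiAct_single]
    cases w with
    | nil => simp [wtVal, wt, eulerSym_zero_right]
    | cons β w => simp

/-- The map `sig` preserves degrees. -/
lemma wt_of_sigWord_ne_zero (d : funX V →+ k) (w : List (Interval V)) :
    ∀ α, sigWord d w α ≠ 0 → wt w = cf α := by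
  induction w with
  | nil => simp [sigWord]
  | cons β w ih =>
    intro α hα
    by_cases h : ∃ γ, IsSum β γ α
    · obtain ⟨γ, h⟩ := h
      have hne : β ≠ α := by
        rintro rfl
        obtain ⟨p, hp⟩ := γ.nonempty
        exact Set.disjoint_left.1 h.1 (h.2 ▸ Or.inr hp) hp
      rw [sigWord, Finsupp.sub_apply, Finsupp.neg_apply, nb_single_apply_of_isSum h,
        Finsupp.smul_apply, Finsupp.single_eq_of_ne hne.symm, smul_zero, sub_zero] at hα
      rw [wt, ih γ fun h0 => hα (by rw [h0, mul_zero, neg_zero]), cf_union h.1 h.2]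
    · rw [sigWord, Finsupp.sub_apply, Finsupp.neg_apply, nb_single_apply_of_not h] at hα
      by_cases hβ : α = β
      · subst hβ
        cases w with
        | nil => simp [wt]
        | cons γ w => simp at hα
      · simp [Finsupp.single_eq_of_ne hβ] at hα

lemma sig_xiAct (l d : funX V →+ k) (f : funX V) (p : List (Interval V) →₀ k) (α : Interval V) :
    sig d (xiAct l f p) α = (l f - eulerSym V f (cf α)) * sig d p α := by
  induction p using Finsupp.induction_linear with
  | zero => simp
  | add p q hp hq =>
    rw [map_add, map_add, Finsupp.add_apply, hp, hq, map_add, Finsupp.add_apply, mul_add]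
  | single w a =>
    have h1 : (Finsupp.single w a : List (Interval V) →₀ k) = a • Finsupp.single w 1 := by simp
    rw [xiAct_single, h1, map_smul, map_smul, sig_single, Finsupp.smul_apply, Finsupp.smul_apply]
    by_cases h : sigWord d w α = 0
    · simp [h]
    · rw [wtVal, wt_of_sigWord_ne_zero d w α h]
      simp only [smul_eq_mul]

/-- The element `z` of the Lie algebra with the bracket `nb` corresponds to the element `y` of the
negative part of `TildeG`: under `sig`, the action of `y` on words becomes the adjoint action of
`z`, up to the derivation of `z` which is contributed by the empty word; and words in the image of
`y` are not empty. These conditions are stable under brackets. -/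
def Corresponds (y : TildeG V k) (z : Interval V →₀ k) : Prop :=
  ∀ (l d : funX V →+ k) (p : List (Interval V) →₀ k),
    sig d (wordRep l y p) = nb k z (sig d p) + p [] • der d z ∧ wordRep l y p [] = 0

lemma corresponds_neg (β : Interval V) :
    Corresponds (tildeGen V k (.neg β)) (-Finsupp.single β 1) := by
  intro l d p
  rw [wordRep_gen, wordAct]
  refine ⟨?_, fAct_apply_nil β p⟩
  rw [sig_fAct, map_neg, map_neg, der_single, LinearMap.neg_apply, smul_neg,
    ← Finsupp.smul_single_one β (d (cf β))]
  module

lemma Corresponds.lie {y y' : TildeG V k} {z z' : Interval V →₀ k} (h : Corresponds y z)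
    (h' : Corresponds y' z') : Corresponds ⁅y, y'⁆ (nb k z z') := by
  intro l d p
  rw [wordRep_lie]
  refine ⟨?_, ?_⟩
  · rw [map_sub, (h l d (wordRep l y' p)).1, (h' l d (wordRep l y p)).1, (h' l d p).1,
      (h l d p).1, (h l d p).2, (h' l d p).2, map_add, map_add, nb_leibniz, der_nb, map_smul,
      map_smul, nb_skew z' (der d z)]
    module
  · rw [Finsupp.sub_apply, (h l d _).2, (h' l d _).2, sub_zero]

lemma Corresponds.add {y y' : TildeG V k} {z z' : Interval V →₀ k} (h : Corresponds y z)
    (h' : Corresponds y' z') : Corresponds (y + y') (z + z') := by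
  intro l d p
  rw [map_add, LinearMap.add_apply]
  refine ⟨?_, ?_⟩
  · rw [map_add, (h l d p).1, (h' l d p).1, map_add, map_add, LinearMap.add_apply]
    module
  · rw [Finsupp.add_apply, (h l d _).2, (h' l d _).2, add_zero]

lemma Corresponds.smul {y : TildeG V k} {z : Interval V →₀ k} (c : k) (h : Corresponds y z) :
    Corresponds (c • y) (c • z) := by
  intro l d p
  rw [map_smul, LinearMap.smul_apply]
  refine ⟨?_, ?_⟩
  · rw [map_smul, (h l d p).1, map_smul, map_smul, LinearMap.smul_apply]
    module
  · rw [Finsupp.smul_apply, (h l d _).2, smul_zero]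

lemma corresponds_zero : Corresponds (0 : TildeG V k) 0 := by
  intro l d p
  simp

variable (V k) in
/-- The negative part of `TildeG`. -/
def tildeNeg : Submodule k (TildeG V k) :=
  negHull (fun g => LieAlgebra.ad k _ (tildeGen V k g)) (tildeGen V k)

variable (V k) in
/-- The positive part of `TildeG`. -/
def tildePos : Submodule k (TildeG V k) :=
  posHull (fun g => LieAlgebra.ad k _ (tildeGen V k g)) (tildeGen V k)

omit [T2Space X] in
lemma tildeNeg_le {S : Submodule k (TildeG V k)} (h : ∀ β, tildeGen V k (.neg β) ∈ S)
    (h' : ∀ β, ∀ m ∈ S, ⁅tildeGen V k (.neg β), m⁆ ∈ S) : tildeNeg V k ≤ S := by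
  refine hull_le ?_ ?_
  · rw [negSpan, Submodule.span_le]
    rintro _ ⟨β, rfl⟩
    exact h β
  · rintro _ ⟨β, rfl⟩ m hm
    exact h' β m hm

omit [T2Space X] in
lemma tildePos_le {S : Submodule k (TildeG V k)} (h : ∀ β, tildeGen V k (.pos β) ∈ S)
    (h' : ∀ β, ∀ m ∈ S, ⁅tildeGen V k (.pos β), m⁆ ∈ S) : tildePos V k ≤ S := by
  refine hull_le ?_ ?_
  · rw [posSpan, Submodule.span_le]
    rintro _ ⟨β, rfl⟩
    exact h β
  · rintro _ ⟨β, rfl⟩ m hm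
    exact h' β m hm

omit [T2Space X] in
lemma neg_mem_tildeNeg (β : Interval V) : tildeGen V k (.neg β) ∈ tildeNeg V k :=
  le_hull (mem_negSpan _ β)

omit [T2Space X] in
lemma pos_mem_tildePos (β : Interval V) : tildeGen V k (.pos β) ∈ tildePos V k :=
  le_hull (mem_posSpan _ β)

omit [T2Space X] in
lemma neg_lie_mem_tildeNeg (β : Interval V) {m : TildeG V k} (hm : m ∈ tildeNeg V k) :
    ⁅tildeGen V k (.neg β), m⁆ ∈ tildeNeg V k :=
  hull_stable (A := Set.range fun α => LieAlgebra.ad k _ (tildeGen V k (.neg α))) ⟨β, rfl⟩ hm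

omit [T2Space X] in
lemma pos_lie_mem_tildePos (β : Interval V) {m : TildeG V k} (hm : m ∈ tildePos V k) :
    ⁅tildeGen V k (.pos β), m⁆ ∈ tildePos V k :=
  hull_stable (A := Set.range fun α => LieAlgebra.ad k _ (tildeGen V k (.pos α))) ⟨β, rfl⟩ hm

lemma exists_corresponds {y : TildeG V k} (hy : y ∈ tildeNeg V k) : ∃ z, Corresponds y z := by
  let S : Submodule k (TildeG V k) :=
    { carrier := {y | ∃ z, Corresponds y z}
      add_mem' := fun ⟨z, hz⟩ ⟨z', hz'⟩ => ⟨_, hz.add hz'⟩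
      zero_mem' := ⟨0, corresponds_zero⟩
      smul_mem' := fun c y ⟨z, hz⟩ => ⟨_, hz.smul c⟩ }
  exact tildeNeg_le (S := S) (fun β => ⟨_, corresponds_neg β⟩)
    (fun β m ⟨z, hz⟩ => ⟨_, (corresponds_neg β).lie hz⟩) hy

lemma chev_mem_tildeNeg {y : TildeG V k} (hy : y ∈ tildePos V k) : chev k y ∈ tildeNeg V k := by
  refine tildePos_le (S := (tildeNeg V k).comap (chev k).toLinearMap) (fun β => ?_)
    (fun β m hm => ?_) hy
  · rw [Submodule.mem_comap, LieHom.coe_toLinearMap]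
    rw [chev_gen]
    exact neg_mem (neg_mem_tildeNeg β)
  · rw [Submodule.mem_comap, LieHom.coe_toLinearMap] at hm ⊢
    rw [LieHom.map_lie, chev_gen, chevGen, neg_lie]
    exact neg_mem (neg_lie_mem_tildeNeg β hm)

lemma chev_mem_tildePos {y : TildeG V k} (hy : y ∈ tildeNeg V k) : chev k y ∈ tildePos V k := by
  refine tildeNeg_le (S := (tildePos V k).comap (chev k).toLinearMap) (fun β => ?_)
    (fun β m hm => ?_) hy
  · rw [Submodule.mem_comap, LieHom.coe_toLinearMap]
    rw [chev_gen]
    exact neg_mem (pos_mem_tildePos β)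
  · rw [Submodule.mem_comap, LieHom.coe_toLinearMap] at hm ⊢
    rw [LieHom.map_lie, chev_gen, chevGen, neg_lie]
    exact neg_mem (pos_lie_mem_tildePos β hm)

lemma chev_chev (y : TildeG V k) : chev k (chev k y) = y := by
  induction y using tilde_induction k with
  | gen g => cases g <;> simp [chev_gen, chevGen]
  | zero => simp
  | add x y hx hy => rw [map_add, map_add, hx, hy]
  | smul c x hx => rw [map_smul, map_smul, hx]
  | lie x y hx hy => rw [LieHom.map_lie, LieHom.map_lie, hx, hy]

/-- The empty word is a highest weight vector. -/
lemma wordRep_pos_nil (l : funX V →+ k) {y : TildeG V k} (hy : y ∈ tildePos V k) (a : k) :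
    wordRep l y (Finsupp.single [] a) = 0 := by
  let S : Submodule k (TildeG V k) :=
    { carrier := {y | wordRep l y (Finsupp.single [] a) = 0}
      add_mem' := fun {x y} hx hy => by
        have hx : wordRep l x (Finsupp.single [] a) = 0 := hx
        have hy : wordRep l y (Finsupp.single [] a) = 0 := hy
        change wordRep l (x + y) (Finsupp.single [] a) = 0
        rw [map_add, LinearMap.add_apply, hx, hy, add_zero]
      zero_mem' := by simp
      smul_mem' := fun c x hx => by
        have hx : wordRep l x (Finsupp.single [] a) = 0 := hx
        change wordRep l (c • x) (Finsupp.single [] a) = 0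
        rw [map_smul, LinearMap.smul_apply, hx, smul_zero] }
  have h1 : ∀ β, wordRep l (tildeGen V k (.pos β)) (Finsupp.single [] a) = 0 := fun β => by
    rw [wordRep_gen]
    exact eAct_nil l β a
  refine tildePos_le (S := S) h1 (fun β m hm => ?_) hy
  have hm : wordRep l m (Finsupp.single [] a) = 0 := hm
  change wordRep l ⁅_, m⁆ (Finsupp.single [] a) = 0
  rw [wordRep_lie, hm, h1, map_zero, map_zero, sub_zero]

end Functionals

section Coadjoint

variable {X : Type u} [TopologicalSpace X] {V : VertexSpace X}
variable {k : Type v} [Field k]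

variable (V k) in
/-- The words of length one. -/
def letter : (Interval V →₀ k) →ₗ[k] (List (Interval V) →₀ k) :=
  Finsupp.lmapDomain k k fun β => [β]

lemma letter_single (β : Interval V) (a : k) :
    letter V k (Finsupp.single β a) = Finsupp.single [β] a := by
  simp [letter, Finsupp.lmapDomain_apply]

lemma sig_letter (d : funX V →+ k) (v : Interval V →₀ k) : sig d (letter V k v) = -der d v := by
  induction v using Finsupp.induction_linear with
  | zero => simp
  | add x y hx hy => rw [map_add, map_add, hx, hy, map_add, neg_add]
  | single β a => simp [letter_single, sig, sigWord, der]

variable (V k) in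
/-- The standard pairing of finitely supported functions on the intervals. -/
def dot : (Interval V →₀ k) →ₗ[k] (Interval V →₀ k) →ₗ[k] k :=
  Finsupp.linearCombination k fun β => Finsupp.lapply β

lemma dot_single (β : Interval V) (a : k) (u : Interval V →₀ k) :
    dot V k (Finsupp.single β a) u = a * u β := by
  simp [dot]

lemma dot_single_right (v : Interval V →₀ k) (β : Interval V) :
    dot V k v (Finsupp.single β 1) = v β := by
  induction v using Finsupp.induction_linear with
  | zero => simp
  | add x y hx hy => rw [map_add, LinearMap.add_apply, hx, hy, Finsupp.add_apply]
  | single γ a =>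
    rw [dot_single]
    by_cases h : γ = β
    · subst h
      simp
    · rw [Finsupp.single_eq_of_ne h, Finsupp.single_eq_of_ne (Ne.symm h), mul_zero]

variable [T2Space X]

/-- The element `y` acts on the words of length one by the coadjoint action of `z`, for
the bracket `nb`. -/
def ActsByCoadjoint (y : TildeG V k) (z : Interval V →₀ k) : Prop :=
  ∀ v, ∃ w, wordRep 0 y (letter V k v) = letter V k w ∧ ∀ u, dot V k w u = -dot V k v (nb k z u)

lemma ActsByCoadjoint.add {y y' : TildeG V k} {z z' : Interval V →₀ k} (h : ActsByCoadjoint y z)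
    (h' : ActsByCoadjoint y' z') : ActsByCoadjoint (y + y') (z + z') := by
  intro v
  obtain ⟨w, hw, hw'⟩ := h v
  obtain ⟨t, ht, ht'⟩ := h' v
  refine ⟨w + t, by rw [map_add, LinearMap.add_apply, hw, ht, map_add], fun u => ?_⟩
  rw [map_add, LinearMap.add_apply, hw', ht', map_add, LinearMap.add_apply, map_add, neg_add]

lemma ActsByCoadjoint.smul {y : TildeG V k} {z : Interval V →₀ k} (c : k)
    (h : ActsByCoadjoint y z) : ActsByCoadjoint (c • y) (c • z) := by
  intro v
  obtain ⟨w, hw, hw'⟩ := h v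
  refine ⟨c • w, by rw [map_smul, LinearMap.smul_apply, hw, map_smul], fun u => ?_⟩
  rw [map_smul, LinearMap.smul_apply, hw', map_smul, LinearMap.smul_apply, map_smul, smul_neg]

lemma actsByCoadjoint_zero : ActsByCoadjoint (0 : TildeG V k) 0 := fun v =>
  ⟨0, by simp, fun u => by simp⟩

lemma ActsByCoadjoint.lie {y y' : TildeG V k} {z z' : Interval V →₀ k} (h : ActsByCoadjoint y z)
    (h' : ActsByCoadjoint y' z') : ActsByCoadjoint ⁅y, y'⁆ (nb k z z') := by
  intro v
  obtain ⟨w, hw, hw'⟩ := h v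
  obtain ⟨t, ht, ht'⟩ := h' v
  obtain ⟨w2, hw2, hw2'⟩ := h t
  obtain ⟨t2, ht2, ht2'⟩ := h' w
  refine ⟨w2 - t2, by rw [wordRep_lie, hw, ht, hw2, ht2, map_sub], fun u => ?_⟩
  rw [map_sub, LinearMap.sub_apply, hw2', ht2', ht', hw', nb_leibniz, map_sub]
  ring

open scoped Classical in
/-- On words of length one and for highest weight zero, `x⁺_α` maps `x⁻_β` to a multiple of
`x⁻_{β ⊖ α}`. -/
lemma actsByCoadjoint_pos (α : Interval V) :
    ActsByCoadjoint (tildeGen V k (.pos α)) (Finsupp.single α 1) := by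
  have key : ∀ β, ∃ w, wordRep 0 (tildeGen V k (.pos α)) (letter V k (Finsupp.single β 1))
      = letter V k w ∧ ∀ u, dot V k w u =
        -dot V k (Finsupp.single β 1) (nb k (Finsupp.single α 1) u) := by
    intro β
    have h1 : wordRep 0 (tildeGen V k (.pos α)) (letter V k (Finsupp.single β 1))
        = -((ca α β : k) • if h : DiffDefined β α then Finsupp.single [diff β α h] 1 else 0) := by
      rw [wordRep_gen, letter_single]
      simp only [wordAct, eAct, Finsupp.linearCombination_single, one_smul, eWord, map_zero,
        zero_add, crossIn, genWord]
      simp [wtVal, wt, eulerSym_zero_right]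
    rw [h1]
    by_cases h : DiffDefined β α
    · refine ⟨-((ca α β : k) • Finsupp.single (diff β α h) 1), ?_, fun u => ?_⟩
      · rw [dif_pos h, map_neg, map_smul, letter_single]
      · rw [map_neg, map_smul, LinearMap.neg_apply, LinearMap.smul_apply, dot_single, dot_single,
          nb_single_apply_of_isSum (isSum_diff h), (ca_of_isSum (isSum_diff h)).1, smul_eq_mul,
          one_mul, one_mul]
    · refine ⟨0, ?_, fun u => ?_⟩
      · rw [dif_neg h]
        simp
      · rw [dot_single, nb_single_apply_of_not fun ⟨γ, hγ⟩ => h hγ.diffDefined]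
        simp
  intro v
  induction v using Finsupp.induction_linear with
  | zero => exact ⟨0, by simp, by simp⟩
  | add x y hx hy =>
    obtain ⟨w, hw, hw'⟩ := hx
    obtain ⟨t, ht, ht'⟩ := hy
    refine ⟨w + t, by rw [map_add, map_add, map_add, hw, ht], fun u => ?_⟩
    rw [map_add, map_add, LinearMap.add_apply, LinearMap.add_apply, hw', ht', neg_add]
  | single β a =>
    obtain ⟨w, hw, hw'⟩ := key β
    refine ⟨a • w, ?_, fun u => ?_⟩
    · rw [← Finsupp.smul_single_one, map_smul, map_smul, map_smul, hw]
    · rw [← Finsupp.smul_single_one, map_smul, map_smul, LinearMap.smul_apply, LinearMap.smul_apply,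
        hw', smul_neg]

/-- The action of the positive part on words of length one factors through the bracket `nb`, and is
dual to the description of the negative part. -/
lemma exists_actsByCoadjoint {y : TildeG V k} (hy : y ∈ tildePos V k) :
    ∃ z, Corresponds (chev k y) z ∧ ActsByCoadjoint y z := by
  let S : Submodule k (TildeG V k) :=
    { carrier := {y | ∃ z, Corresponds (chev k y) z ∧ ActsByCoadjoint y z}
      add_mem' := fun ⟨z, hz⟩ ⟨z', hz'⟩ => ⟨z + z', by
        rw [map_add]
        exact hz.1.add hz'.1, hz.2.add hz'.2⟩
      zero_mem' := ⟨0, by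
        rw [map_zero]
        exact corresponds_zero, actsByCoadjoint_zero⟩
      smul_mem' := fun c y ⟨z, hz⟩ => ⟨c • z, by
        rw [map_smul]
        exact hz.1.smul c, hz.2.smul c⟩ }
  have h1 : ∀ β, Corresponds (chev k (tildeGen V k (.pos β))) (Finsupp.single β 1) := by
    intro β
    have h := (corresponds_neg (k := k) β).smul (-1)
    rw [neg_one_smul, neg_one_smul, neg_neg] at h
    rwa [chev_gen]
  refine tildePos_le (S := S) (fun β => ⟨_, h1 β, actsByCoadjoint_pos β⟩) ?_ hy
  rintro β m ⟨z, hz⟩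
  refine ⟨_, ?_, (actsByCoadjoint_pos β).lie hz.2⟩
  rw [LieHom.map_lie]
  exact (h1 β).lie hz.1

end Coadjoint

section Theta

variable {X : Type u} [TopologicalSpace X] [T2Space X] {V : VertexSpace X}
variable {k : Type v} [Field k]

variable (k) in
/-- Evaluation at a point of `α`. -/
def evalAt (α : Interval V) : funX V →+ k :=
  (Int.castAddHom k).comp
    ((Pi.evalAddMonoidHom (fun _ : X => ℤ) α.nonempty.choose).comp (funX V).subtype.toAddMonoidHom)

lemma evalAt_self (α : Interval V) : evalAt k α (cf α) = 1 := by
  have h : (evalAt k α (cf α)) = (((cf α).1 α.nonempty.choose : ℤ) : k) := rfl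
  rw [h, cf_apply_of_mem α.nonempty.choose_spec, Int.cast_one]

variable (k) in
/-- The functional `(f, ·)` with values in the ground field. -/
def eulerAdd (f : funX V) : funX V →+ k := (Int.castAddHom k).comp (eulerHom f)

variable (k) in
/-- The functional on `TildeG` which is dual to `x⁺_α` for the invariant form. -/
def thPos (α : Interval V) : Module.Dual k (TildeG V k) :=
  -(Finsupp.lapply α ∘ₗ sig (evalAt k α) ∘ₗ LinearMap.applyₗ (Finsupp.single [] 1) ∘ₗ
    (wordRep 0).toLinearMap)

variable (k) in
/-- The functional on `TildeG` which is dual to `x⁻_α` for the invariant form. -/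
def thNeg (α : Interval V) : Module.Dual k (TildeG V k) :=
  -(thPos k α ∘ₗ (chev k).toLinearMap)

variable (k) in
/-- The functional on `TildeG` which is dual to `ξ_f` for the invariant form. -/
def nu (f : funX V) : Module.Dual k (TildeG V k) :=
  Finsupp.lapply [] ∘ₗ LinearMap.applyₗ (Finsupp.single [] 1) ∘ₗ
    (wordRep (eulerAdd k f)).toLinearMap

lemma thPos_apply (α : Interval V) (y : TildeG V k) :
    thPos k α y = -sig (evalAt k α) (wordRep 0 y (Finsupp.single [] 1)) α := rfl

lemma thNeg_apply (α : Interval V) (y : TildeG V k) : thNeg k α y = -thPos k α (chev k y) := rfl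

lemma nu_apply (f : funX V) (y : TildeG V k) :
    nu k f y = wordRep (eulerAdd k f) y (Finsupp.single [] 1) [] := rfl

variable (k) in
/-- The functionals dual to the generators. -/
def theta : Gen V → Module.Dual k (TildeG V k)
  | .cartan f => nu k f
  | .pos α => thPos k α
  | .neg α => thNeg k α

lemma Corresponds.sig_eq {y : TildeG V k} {z : Interval V →₀ k} (h : Corresponds y z)
    (l d : funX V →+ k) (α : Interval V) :
    sig d (wordRep l y (Finsupp.single [] 1)) α = d (cf α) * z α := by
  rw [(h l d _).1, sig_single, sigWord, map_zero, zero_add, Finsupp.single_eq_same, one_smul,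
    der_apply]

lemma Corresponds.thPos {y : TildeG V k} {z : Interval V →₀ k} (h : Corresponds y z)
    (α : Interval V) : thPos k α y = -z α := by
  rw [thPos_apply, h.sig_eq, evalAt_self, one_mul]

lemma nu_neg {y : TildeG V k} (hy : y ∈ tildeNeg V k) (f : funX V) : nu k f y = 0 := by
  obtain ⟨z, hz⟩ := exists_corresponds hy
  exact (hz _ 0 _).2

lemma nu_pos {y : TildeG V k} (hy : y ∈ tildePos V k) (f : funX V) : nu k f y = 0 := by
  rw [nu_apply, wordRep_pos_nil _ hy, Finsupp.zero_apply]

lemma thPos_pos {y : TildeG V k} (hy : y ∈ tildePos V k) (α : Interval V) : thPos k α y = 0 := by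
  rw [thPos_apply, wordRep_pos_nil _ hy, map_zero, Finsupp.zero_apply, neg_zero]

lemma thNeg_neg {y : TildeG V k} (hy : y ∈ tildeNeg V k) (α : Interval V) : thNeg k α y = 0 := by
  rw [thNeg_apply, thPos_pos (chev_mem_tildePos hy), neg_zero]

lemma wordRep_cartan_nil (l : funX V →+ k) (f : funX V) :
    wordRep l (tildeGen V k (.cartan f)) (Finsupp.single [] 1) = l f • Finsupp.single [] 1 := by
  rw [wordRep_gen, wordAct, xiAct_single, wtVal, wt, eulerSym_zero_right, Int.cast_zero, sub_zero]

lemma thPos_cartan (f : funX V) (α : Interval V) : thPos k α (tildeGen V k (.cartan f)) = 0 := by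
  rw [thPos_apply, wordRep_cartan_nil]
  simp

lemma thNeg_cartan (f : funX V) (α : Interval V) : thNeg k α (tildeGen V k (.cartan f)) = 0 := by
  rw [thNeg_apply, chev_gen, chevGen, map_neg, thPos_cartan, neg_zero, neg_zero]

lemma nu_cartan (f g : funX V) : nu k f (tildeGen V k (.cartan g)) = (eulerSym V f g : k) := by
  rw [nu_apply, wordRep_cartan_nil]
  simp [eulerAdd, eulerHom_apply]

omit [T2Space X] in
variable (V k) in
lemma lieSpan_tildeGen :
    LieSubalgebra.lieSpan k (TildeG V k) (Set.range (tildeGen V k)) = ⊤ := by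
  rw [eq_top_iff]
  intro x _
  induction x using tilde_induction k with
  | gen g => exact LieSubalgebra.subset_lieSpan ⟨g, rfl⟩
  | zero => exact zero_mem _
  | add x y hx hy => exact add_mem (hx trivial) (hy trivial)
  | smul c x hx => exact (LieSubalgebra.lieSpan k (TildeG V k) _).smul_mem c (hx trivial)
  | lie x y hx hy => exact LieSubalgebra.lie_mem _ (hx trivial) (hy trivial)

/-- Induction along the triangular decomposition. -/
lemma tilde_decomp {P : TildeG V k → Prop} (add : ∀ x y, P x → P y → P (x + y))
    (smul : ∀ (c : k) x, P x → P (c • x)) (neg : ∀ y ∈ tildeNeg V k, P y)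
    (cartan : ∀ f, P (tildeGen V k (.cartan f))) (pos : ∀ y ∈ tildePos V k, P y)
    (y : TildeG V k) : P y := by
  have hy : y ∈ tildeNeg V k ⊔ zeroSpan (tildeGen V k) ⊔ tildePos V k := by
    have := (satisfiesRel_tildeGen V k).triangular (lieSpan_tildeGen V k)
    rw [tildeNeg, tildePos, this]
    trivial
  refine mem_sup3 hy add neg (fun x hx => ?_) pos
  induction hx using Submodule.span_induction with
  | mem x hx =>
    obtain ⟨f, rfl⟩ := hx
    exact cartan f
  | zero => exact neg 0 (zero_mem _)
  | add x y _ _ hx hy => exact add _ _ hx hy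
  | smul c x _ hx => exact smul c x hx

lemma nu_chev (f : funX V) (y : TildeG V k) : nu k f (chev k y) = -nu k f y := by
  induction y using tilde_decomp with
  | add x y hx hy => rw [map_add, map_add, map_add, hx, hy, neg_add]
  | smul c x hx => rw [map_smul, map_smul, map_smul, hx, smul_neg]
  | neg y hy => rw [nu_neg hy, nu_pos (chev_mem_tildePos hy), neg_zero]
  | cartan g => rw [chev_gen, chevGen, map_neg]
  | pos y hy => rw [nu_pos hy, nu_neg (chev_mem_tildeNeg hy), neg_zero]

lemma thNeg_chev (α : Interval V) (y : TildeG V k) : thNeg k α (chev k y) = -thPos k α y := by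
  rw [thNeg_apply, chev_chev]

lemma thPos_chev (α : Interval V) (y : TildeG V k) : thPos k α (chev k y) = -thNeg k α y := by
  rw [thNeg_apply, neg_neg]

omit [T2Space X] in
lemma tilde_lie_add (x y z : TildeG V k) : ⁅x, y + z⁆ = ⁅x, y⁆ + ⁅x, z⁆ := lie_add x y z

omit [T2Space X] in
lemma tilde_lie_smul (c : k) (x y : TildeG V k) : ⁅x, c • y⁆ = c • ⁅x, y⁆ := lie_smul c x y

open scoped Classical in
/-- The functional dual to `x⁺_α` transforms under `x⁻_β` as `x⁺_α` does. -/
lemma thPos_lie_neg (α β : Interval V) (y : TildeG V k) :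
    thPos k α ⁅tildeGen V k (.neg β), y⁆ = crossIn k (theta k) α β y := by
  induction y using tilde_decomp with
  | add x y hx hy => rw [tilde_lie_add, map_add, map_add, hx, hy]
  | smul c x hx => rw [tilde_lie_smul, map_smul, map_smul, hx]
  | neg y hy =>
    obtain ⟨z, hz⟩ := exists_corresponds hy
    rw [((corresponds_neg β).lie hz).thPos, map_neg, LinearMap.neg_apply, Finsupp.neg_apply,
      neg_neg,
      crossIn_apply, crossIn]
    simp only [theta, nu_neg hy, thNeg_neg hy, hz.thPos]
    by_cases h : DiffDefined α β
    · rw [dif_pos h, nb_single_apply_of_isSum (isSum_diff h), (ca_of_isSum (isSum_diff h)).2]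
      simp
    · rw [dif_neg h, nb_single_apply_of_not fun ⟨γ, hγ⟩ => h hγ.diffDefined]
      simp
  | cartan f =>
    rw [← lie_skew, (satisfiesRel_tildeGen V k).weight_neg', neg_neg, map_smul,
      (corresponds_neg β).thPos, crossIn_apply, crossIn]
    simp only [theta, nu_cartan, thNeg_cartan, thPos_cartan]
    by_cases h : α = β
    · subst h
      simp [eulerSym_comm]
    · simp [h, Finsupp.single_eq_of_ne h]
  | pos y hy =>
    obtain ⟨z, hz, hz'⟩ := exists_actsByCoadjoint hy
    obtain ⟨w, hw, hw'⟩ := hz' (Finsupp.single β 1)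
    have h1 : thPos k α ⁅tildeGen V k (.neg β), y⁆ = nb k z (Finsupp.single α 1) β := by
      have h2 := hw' (Finsupp.single α 1)
      rw [dot_single_right, dot_single, one_mul] at h2
      rw [thPos_apply, wordRep_lie, wordRep_pos_nil _ hy, map_zero, zero_sub,
        wordRep_gen, wordAct, fAct_single, ← letter_single, hw, map_neg, sig_letter, neg_neg,
        der_apply, evalAt_self, one_mul, h2, neg_neg]
    rw [h1, crossIn_apply, crossIn, nb_skew]
    simp only [theta, nu_pos hy, thPos_pos hy]
    have h3 : ∀ γ, thNeg k γ y = z γ := fun γ => by rw [thNeg_apply, hz.thPos, neg_neg]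
    simp only [h3]
    by_cases h : DiffDefined β α
    · rw [dif_pos h, Finsupp.neg_apply, nb_single_apply_of_isSum (isSum_diff h),
        (ca_of_isSum (isSum_diff h)).1]
      simp
    · rw [dif_neg h, Finsupp.neg_apply,
        nb_single_apply_of_not fun ⟨γ, hγ⟩ => h hγ.diffDefined]
      simp

open scoped Classical in
/-- The functional dual to `x⁻_β` transforms under `x⁺_α` as `x⁻_β` does. -/
lemma thNeg_lie_pos (α β : Interval V) (y : TildeG V k) :
    thNeg k β ⁅tildeGen V k (.pos α), y⁆ = -crossIn k (theta k) α β y := by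
  have h1 : thNeg k β ⁅tildeGen V k (.pos α), y⁆ = thPos k β ⁅tildeGen V k (.neg α), chev k y⁆ := by
    rw [thNeg_apply, LieHom.map_lie, chev_gen, chevGen, neg_lie, map_neg, neg_neg]
  rw [h1, thPos_lie_neg, crossIn_apply, crossIn_apply, crossIn, crossIn]
  simp only [theta, nu_chev, thPos_chev, thNeg_chev]
  have hd : (if β = α then -nu k (cf β) y else 0) = -if α = β then nu k (cf α) y else 0 := by
    by_cases hαβ : α = β
    · subst hαβ
      simp
    · rw [if_neg hαβ, if_neg (Ne.symm hαβ), neg_zero]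
  rw [hd, neg_add]
  congr 1
  by_cases h1 : DiffDefined α β
  · have h3 := ca_swap h1
    by_cases h2 : DiffDefined β α
    · simp only [dif_pos h1, dif_pos h2, h3, smul_eq_mul]
      push_cast
      ring
    · simp only [dif_pos h1, dif_neg h2, h3, smul_eq_mul]
      push_cast
      ring
  · by_cases h2 : DiffDefined β α
    · have h3 := ca_swap h2
      simp only [dif_neg h1, dif_pos h2, h3, smul_eq_mul]
      push_cast
      ring
    · simp only [dif_neg h1, dif_neg h2]
      simp

lemma nu_lie_pos (f : funX V) (α : Interval V) (y : TildeG V k) :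
    nu k f ⁅tildeGen V k (.pos α), y⁆ = (eulerSym V f (cf α) : k) * thPos k α y := by
  induction y using tilde_decomp with
  | add x y hx hy => rw [tilde_lie_add, map_add, map_add, hx, hy, mul_add]
  | smul c x hx =>
    rw [tilde_lie_smul, map_smul, map_smul, hx, smul_eq_mul, smul_eq_mul]
    ring
  | neg y hy =>
    obtain ⟨z, hz⟩ := exists_corresponds hy
    rw [nu_apply, wordRep_lie, wordRep_pos_nil _ (pos_mem_tildePos α), map_zero, sub_zero,
      wordRep_gen, wordAct, eAct_apply_nil, hz.sig_eq, hz.thPos]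
    simp [eulerAdd, eulerHom_apply]
  | cartan g =>
    rw [thPos_cartan, mul_zero, ← lie_skew, (satisfiesRel_tildeGen V k).weight_pos', map_neg,
      map_smul, nu_pos (pos_mem_tildePos α), smul_zero, neg_zero]
  | pos y hy => rw [thPos_pos hy, nu_pos (pos_lie_mem_tildePos α hy), mul_zero]

lemma nu_lie_neg (f : funX V) (α : Interval V) (y : TildeG V k) :
    nu k f ⁅tildeGen V k (.neg α), y⁆ = -((eulerSym V f (cf α) : k) * thNeg k α y) := by
  have h1 : nu k f ⁅tildeGen V k (.neg α), y⁆ = nu k f ⁅tildeGen V k (.pos α), chev k y⁆ := by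
    rw [← neg_neg (nu k f ⁅tildeGen V k (.neg α), y⁆), ← nu_chev, LieHom.map_lie, chev_gen, chevGen,
      neg_lie, map_neg, neg_neg]
  rw [h1, nu_lie_pos, thPos_chev, mul_neg]

lemma thPos_lie_cartan (f : funX V) (α : Interval V) (y : TildeG V k) :
    thPos k α ⁅tildeGen V k (.cartan f), y⁆ = -((eulerSym V f (cf α) : k) * thPos k α y) := by
  rw [thPos_apply, thPos_apply, wordRep_lie, wordRep_cartan_nil, wordRep_gen, wordAct, map_sub,
    Finsupp.sub_apply, sig_xiAct]
  simp

lemma thNeg_lie_cartan (f : funX V) (α : Interval V) (y : TildeG V k) :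
    thNeg k α ⁅tildeGen V k (.cartan f), y⁆ = (eulerSym V f (cf α) : k) * thNeg k α y := by
  rw [thNeg_apply, LieHom.map_lie, chev_gen, chevGen, neg_lie, map_neg, thPos_lie_cartan,
    thPos_chev]
  ring

lemma nu_lie_cartan (f g : funX V) (y : TildeG V k) :
    nu k g ⁅tildeGen V k (.cartan f), y⁆ = 0 := by
  rw [nu_apply, wordRep_lie, wordRep_cartan_nil, map_smul, wordRep_gen, wordAct, Finsupp.sub_apply,
    xiAct_apply_nil, Finsupp.smul_apply, smul_eq_mul, sub_self]

end Theta

/-! ### The invariant form on the Lie algebra given by the relations -/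

section DoubleModule

variable {k : Type v} [Field k] {L : Type w} [LieRing L] [LieAlgebra k L]

variable (k L) in
/-- The action of a Lie algebra `L` on `L × L*`. -/
def doubleRep : L →ₗ⁅k⁆ Module.End k (L × Module.Dual k L) where
  toFun x := LinearMap.prodMap (LieAlgebra.ad k L x) (-(LieAlgebra.ad k L x).dualMap)
  map_add' x y := by
    refine LinearMap.ext fun p => Prod.ext ?_ (LinearMap.ext fun m => ?_)
    · simp
    · simp [add_comm]
  map_smul' c x := by
    refine LinearMap.ext fun p => Prod.ext ?_ (LinearMap.ext fun m => ?_)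
    · simp
    · simp
  map_lie' {x y} := by
    rw [LieRing.of_associative_ring_bracket]
    refine LinearMap.ext fun p => Prod.ext ?_ (LinearMap.ext fun m => ?_)
    · simp [LieRing.of_associative_ring_bracket]
    · simp [LieRing.of_associative_ring_bracket]

lemma doubleRep_fst (x : L) (p : L × Module.Dual k L) : (doubleRep k L x p).1 = ⁅x, p.1⁆ := rfl

lemma doubleRep_snd (x : L) (p : L × Module.Dual k L) (m : L) :
    (doubleRep k L x p).2 m = -p.2 ⁅x, m⁆ := rfl

end DoubleModule

section TildeForm

variable {X : Type u} [TopologicalSpace X] [T2Space X] {V : VertexSpace X}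
variable {k : Type v} [Field k]

variable (V k) in
/-- The operators on `L × L*` for the generators of `L = TildeG`. -/
def doubleAct (g : Gen V) : Module.End k (TildeG V k × Module.Dual k (TildeG V k)) :=
  doubleRep k (TildeG V k) (tildeGen V k g)

variable (V k) in
/-- The generators of `L = TildeG`, together with their dual functionals, as elements
of `L × L*`. -/
def doubleGen (g : Gen V) : TildeG V k × Module.Dual k (TildeG V k) := (tildeGen V k g, theta k g)

omit [T2Space X] in
lemma crossIn_fst {M : Type*} {N : Type*} [AddCommGroup M] [Module k M] [AddCommGroup N]
    [Module k N] (γ : Gen V → M × N) (α β : Interval V) :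
    (crossIn k γ α β).1 = crossIn k (fun g => (γ g).1) α β :=
  map_crossIn k (LinearMap.fst k M N) γ α β

omit [T2Space X] in
lemma crossIn_snd {M : Type*} {N : Type*} [AddCommGroup M] [Module k M] [AddCommGroup N]
    [Module k N] (γ : Gen V → M × N) (α β : Interval V) :
    (crossIn k γ α β).2 = crossIn k (fun g => (γ g).2) α β :=
  map_crossIn k (LinearMap.snd k M N) γ α β

/-- The functionals `theta` transform under the generators by the same formulas as the generators
themselves. -/
lemma equivariantRel_double : EquivariantRel (doubleAct V k) (doubleGen V k) where
  comm f g := Prod.ext ((satisfiesRel_tildeGen V k).comm' f g) (LinearMap.ext fun m => by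
    rw [doubleAct, doubleRep_snd]
    exact neg_eq_zero.2 (nu_lie_cartan f g m))
  cartan_pos f β := Prod.ext ((satisfiesRel_tildeGen V k).weight_pos' f β)
    (LinearMap.ext fun m => by
      rw [doubleAct, doubleRep_snd]
      exact neg_eq_iff_eq_neg.2 (thPos_lie_cartan f β m))
  pos_cartan f β := Prod.ext ((satisfiesRel_tildeGen V k).equivariant_ad.pos_cartan f β)
    (LinearMap.ext fun m => by
      rw [doubleAct, doubleRep_snd]
      exact congrArg Neg.neg (nu_lie_pos f β m))
  cartan_neg f β := Prod.ext ((satisfiesRel_tildeGen V k).weight_neg' f β)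
    (LinearMap.ext fun m => by
      rw [doubleAct, doubleRep_snd]
      exact congrArg Neg.neg (thNeg_lie_cartan f β m))
  neg_cartan f β := Prod.ext ((satisfiesRel_tildeGen V k).equivariant_ad.neg_cartan f β)
    (LinearMap.ext fun m => by
      rw [doubleAct, doubleRep_snd]
      exact neg_eq_iff_eq_neg.2 (nu_lie_neg f β m))
  pos_neg α β := Prod.ext
    (((satisfiesRel_tildeGen V k).cross α β).trans (crossIn_fst (doubleGen V k) α β).symm)
    (LinearMap.ext fun m => by
      rw [doubleAct, doubleRep_snd, crossIn_snd]
      exact neg_eq_iff_eq_neg.2 (thNeg_lie_pos α β m))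
  neg_pos α β := Prod.ext
    (((satisfiesRel_tildeGen V k).equivariant_ad.neg_pos α β).trans
      (congrArg Neg.neg (crossIn_fst (doubleGen V k) α β).symm))
    (LinearMap.ext fun m => by
      rw [doubleAct, doubleRep_snd, Prod.snd_neg, crossIn_snd, LinearMap.neg_apply]
      exact congrArg Neg.neg (thPos_lie_neg α β m))

variable (V k) in
/-- The pairs `(y, f)` such that `f` has the same values on the generators as the functional
which belongs to `y`. -/
def compatible : Submodule k (TildeG V k × Module.Dual k (TildeG V k)) where
  carrier := {p | ∀ g, p.2 (tildeGen V k g) = theta k g p.1}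
  add_mem' := fun {p q} hp hq g => by
    rw [Prod.snd_add, LinearMap.add_apply, hp g, hq g, Prod.fst_add, map_add]
  zero_mem' := fun g => by simp
  smul_mem' := fun c p hp g => by
    rw [Prod.smul_snd, LinearMap.smul_apply, hp g, Prod.smul_fst, map_smul]

/-- The matrix of the form on the generators is symmetric. -/
lemma theta_gen_symm (g h : Gen V) :
    theta k g (tildeGen V k h) = theta k h (tildeGen V k g) := by
  have hp : ∀ α β : Interval V, thPos k α (tildeGen V k (.neg β)) = Finsupp.single β 1 α := by
    intro α β
    rw [(corresponds_neg β).thPos, Finsupp.neg_apply, neg_neg]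
  have hn : ∀ α β : Interval V, thNeg k α (tildeGen V k (.pos β)) = Finsupp.single β 1 α := by
    intro α β
    rw [thNeg_apply, chev_gen, chevGen, map_neg, hp, neg_neg]
  have hs : ∀ α β : Interval V, Finsupp.single β (1 : k) α = Finsupp.single α 1 β := by
    intro α β
    by_cases h : α = β
    · rw [h]
    · rw [Finsupp.single_eq_of_ne h, Finsupp.single_eq_of_ne (Ne.symm h)]
  cases g with
  | cartan f =>
    cases h with
    | cartan g => simp only [theta, nu_cartan, eulerSym_comm]
    | pos β => simp only [theta, nu_pos (pos_mem_tildePos β), thPos_cartan]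
    | neg β => simp only [theta, nu_neg (neg_mem_tildeNeg β), thNeg_cartan]
  | pos α =>
    cases h with
    | cartan g => simp only [theta, nu_pos (pos_mem_tildePos α), thPos_cartan]
    | pos β => simp only [theta, thPos_pos (pos_mem_tildePos α), thPos_pos (pos_mem_tildePos β)]
    | neg β => simp only [theta, hp, hn, hs α β]
  | neg α =>
    cases h with
    | cartan g => simp only [theta, nu_neg (neg_mem_tildeNeg α), thNeg_cartan]
    | pos β => simp only [theta, hp, hn, hs α β]
    | neg β => simp only [theta, thNeg_neg (neg_mem_tildeNeg α), thNeg_neg (neg_mem_tildeNeg β)]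

lemma doubleGen_mem_compatible (g : Gen V) : doubleGen V k g ∈ compatible V k := fun h =>
  theta_gen_symm g h

/-- On the positive part, `theta` of `x⁺` vanishes, and the identities for the other generators
follow from the transformation rules of `theta` by induction. -/
lemma posHull_le_compatible : posHull (doubleAct V k) (doubleGen V k) ≤ compatible V k := by
  let S : Submodule k (TildeG V k × Module.Dual k (TildeG V k)) :=
    compatible V k ⊓ (tildePos V k).prod (tildePos V k).dualAnnihilator
  have hle : posHull (doubleAct V k) (doubleGen V k) ≤ S := by
    refine hull_le ?_ ?_
    · rw [posSpan, Submodule.span_le]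
      rintro _ ⟨β, rfl⟩
      refine ⟨doubleGen_mem_compatible _, pos_mem_tildePos β, ?_⟩
      exact (Submodule.mem_dualAnnihilator _).2 fun y hy => thPos_pos hy β
    · rintro _ ⟨α, rfl⟩ p ⟨hc, hp1, hp2⟩
      have hp2 := (Submodule.mem_dualAnnihilator _).1 hp2
      refine ⟨fun g => ?_, pos_lie_mem_tildePos α hp1,
        (Submodule.mem_dualAnnihilator _).2 fun y hy => ?_⟩
      · change -p.2 ⁅tildeGen V k (.pos α), tildeGen V k g⁆ = theta k g ⁅tildeGen V k (.pos α), p.1⁆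
        cases g with
        | cartan f =>
          have h1 := (satisfiesRel_tildeGen V k).equivariant_ad.pos_cartan f α
          rw [LieAlgebra.ad_apply] at h1
          rw [h1, map_neg, neg_neg, map_smul, hc]
          exact (nu_lie_pos f α p.1).symm
        | pos β =>
          rw [hp2 _ (pos_lie_mem_tildePos α (pos_mem_tildePos β)), neg_zero]
          exact (thPos_pos (pos_lie_mem_tildePos α hp1) β).symm
        | neg β =>
          rw [(satisfiesRel_tildeGen V k).cross, map_crossIn]
          have h1 := thNeg_lie_pos α β p.1
          rw [crossIn_apply] at h1
          refine Eq.trans ?_ h1.symm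
          congr 2
          exact funext fun g => hc g
      · change -p.2 ⁅tildeGen V k (.pos α), y⁆ = 0
        rw [hp2 _ (pos_lie_mem_tildePos α hy), neg_zero]
  exact hle.trans inf_le_left

lemma negHull_le_compatible : negHull (doubleAct V k) (doubleGen V k) ≤ compatible V k := by
  let S : Submodule k (TildeG V k × Module.Dual k (TildeG V k)) :=
    compatible V k ⊓ (tildeNeg V k).prod (tildeNeg V k).dualAnnihilator
  have hle : negHull (doubleAct V k) (doubleGen V k) ≤ S := by
    refine hull_le ?_ ?_
    · rw [negSpan, Submodule.span_le]
      rintro _ ⟨β, rfl⟩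
      refine ⟨doubleGen_mem_compatible _, neg_mem_tildeNeg β, ?_⟩
      exact (Submodule.mem_dualAnnihilator _).2 fun y hy => thNeg_neg hy β
    · rintro _ ⟨β, rfl⟩ p ⟨hc, hp1, hp2⟩
      have hp2 := (Submodule.mem_dualAnnihilator _).1 hp2
      refine ⟨fun g => ?_, neg_lie_mem_tildeNeg β hp1,
        (Submodule.mem_dualAnnihilator _).2 fun y hy => ?_⟩
      · change -p.2 ⁅tildeGen V k (.neg β), tildeGen V k g⁆ = theta k g ⁅tildeGen V k (.neg β), p.1⁆
        cases g with
        | cartan f =>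
          have h1 := (satisfiesRel_tildeGen V k).equivariant_ad.neg_cartan f β
          rw [LieAlgebra.ad_apply] at h1
          rw [h1, map_smul, hc]
          exact (nu_lie_neg f β p.1).symm
        | pos α =>
          have h2 := (satisfiesRel_tildeGen V k).equivariant_ad.neg_pos α β
          rw [LieAlgebra.ad_apply] at h2
          rw [h2, map_neg, neg_neg, map_crossIn]
          have h1 := thPos_lie_neg α β p.1
          rw [crossIn_apply] at h1
          refine Eq.trans ?_ h1.symm
          congr 1
          exact funext fun g => hc g
        | neg γ =>
          rw [hp2 _ (neg_lie_mem_tildeNeg β (neg_mem_tildeNeg γ)), neg_zero]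
          exact (thNeg_neg (neg_lie_mem_tildeNeg β hp1) γ).symm
      · change -p.2 ⁅tildeGen V k (.neg β), y⁆ = 0
        rw [hp2 _ (neg_lie_mem_tildeNeg β hy), neg_zero]
  exact hle.trans inf_le_left

variable (V k) in
/-- The submodule of `L × L*`, for `L = TildeG`, which is generated by the generators of `L`
together with their dual functionals. It is the graph of the invariant form. -/
def formGraph : Submodule k (TildeG V k × Module.Dual k (TildeG V k)) :=
  hull (Set.range (doubleAct V k)) (Submodule.span k (Set.range (doubleGen V k)))

lemma formGraph_gen (g : Gen V) : doubleGen V k g ∈ formGraph V k :=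
  le_hull (Submodule.subset_span (Set.mem_range_self g))

lemma formGraph_stable (g : Gen V) {p : TildeG V k × Module.Dual k (TildeG V k)}
    (hp : p ∈ formGraph V k) : doubleAct V k g p ∈ formGraph V k :=
  hull_stable (A := Set.range (doubleAct V k)) (Set.mem_range_self g) hp

/-- By the triangular decomposition of the submodule `formGraph`, its elements need only be
compared with the generators within the positive or the negative part. -/
lemma formGraph_le_compatible : formGraph V k ≤ compatible V k := by
  have h1 : formGraph V k ≤ negHull (doubleAct V k) (doubleGen V k) ⊔ zeroSpan (doubleGen V k) ⊔
      posHull (doubleAct V k) (doubleGen V k) := by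
    refine hull_le ?_ ?_
    · rw [Submodule.span_le]
      rintro _ ⟨g, rfl⟩
      cases g with
      | cartan f => exact Submodule.mem_sup_left (Submodule.mem_sup_right (mem_zeroSpan _ f))
      | pos α => exact Submodule.mem_sup_right (le_hull (mem_posSpan _ α))
      | neg α => exact Submodule.mem_sup_left (Submodule.mem_sup_left (le_hull (mem_negSpan _ α)))
    · rintro _ ⟨g, rfl⟩ m hm
      exact triangular_stable ((satisfiesRel_tildeGen V k).map (doubleRep k (TildeG V k)))
        equivariantRel_double g hm
  refine h1.trans (sup_le (sup_le negHull_le_compatible ?_) posHull_le_compatible)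
  rw [zeroSpan, Submodule.span_le]
  rintro _ ⟨f, rfl⟩
  exact doubleGen_mem_compatible _

/-- The graph of the form is isotropic, i.e. the form is well defined and symmetric. -/
lemma formGraph_isotropic {p q : TildeG V k × Module.Dual k (TildeG V k)}
    (hp : p ∈ formGraph V k) (hq : q ∈ formGraph V k) : q.2 p.1 = p.2 q.1 := by
  induction hp using hull_induction generalizing q with
  | base p hp =>
    induction hp using Submodule.span_induction with
    | mem p hp =>
      obtain ⟨g, rfl⟩ := hp
      exact formGraph_le_compatible hq g
    | zero => simp
    | add x y _ _ hx hy =>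
      rw [Prod.fst_add, map_add, hx, hy, Prod.snd_add, LinearMap.add_apply]
    | smul c x _ hx => rw [Prod.smul_fst, map_smul, hx, Prod.smul_snd, LinearMap.smul_apply]
  | zero => simp
  | add x y _ _ hx hy =>
    rw [Prod.fst_add, map_add, hx hq, hy hq, Prod.snd_add, LinearMap.add_apply]
  | smul c x _ hx => rw [Prod.smul_fst, map_smul, hx hq, Prod.smul_snd, LinearMap.smul_apply]
  | step a ha p hp ih =>
    obtain ⟨g, rfl⟩ := ha
    have h1 := ih (formGraph_stable g hq)
    rw [doubleAct, doubleRep_snd, doubleRep_fst] at h1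
    rw [doubleAct, doubleRep_snd, doubleRep_fst, ← h1, neg_neg]

lemma formGraph_surjective (x : TildeG V k) : ∃ f, (x, f) ∈ formGraph V k := by
  have h : (formGraph V k).map (LinearMap.fst k _ _) = ⊤ := by
    refine eq_top_of_stable (lieSpan_tildeGen V k) (fun g => ?_) ?_
    · exact ⟨_, formGraph_gen g, rfl⟩
    · rintro g _ ⟨p, hp, rfl⟩
      exact ⟨_, formGraph_stable g hp, rfl⟩
  obtain ⟨p, hp, rfl⟩ := h.symm ▸ Submodule.mem_top (x := x)
  exact ⟨p.2, hp⟩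

lemma formGraph_unique {x : TildeG V k} {f f' : Module.Dual k (TildeG V k)}
    (h : (x, f) ∈ formGraph V k) (h' : (x, f') ∈ formGraph V k) : f = f' := by
  refine LinearMap.ext fun y => ?_
  obtain ⟨e, he⟩ := formGraph_surjective y
  rw [← formGraph_isotropic h he, ← formGraph_isotropic h' he]

variable (V k) in
/-- The invariant symmetric bilinear form on `TildeG` which extends the Euler form. -/
def tildeForm : LinearMap.BilinForm k (TildeG V k) where
  toFun x := (formGraph_surjective x).choose
  map_add' x y := formGraph_unique (formGraph_surjective (x + y)).choose_spec
    (add_mem (formGraph_surjective x).choose_spec (formGraph_surjective y).choose_spec)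
  map_smul' c x := formGraph_unique (formGraph_surjective (c • x)).choose_spec
    (Submodule.smul_mem _ c (formGraph_surjective x).choose_spec)

lemma tildeForm_mem (x : TildeG V k) : (x, tildeForm V k x) ∈ formGraph V k :=
  (formGraph_surjective x).choose_spec

lemma tildeForm_gen (g : Gen V) : tildeForm V k (tildeGen V k g) = theta k g :=
  formGraph_unique (tildeForm_mem _) (formGraph_gen g)

lemma tildeForm_symm (x y : TildeG V k) : tildeForm V k x y = tildeForm V k y x :=
  formGraph_isotropic (tildeForm_mem y) (tildeForm_mem x)

lemma tildeForm_lie_left (u x y : TildeG V k) :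
    tildeForm V k ⁅u, x⁆ y = -tildeForm V k x ⁅u, y⁆ := by
  induction u using tilde_induction k generalizing x y with
  | gen g =>
    have h := formGraph_unique (tildeForm_mem ⁅tildeGen V k g, x⁆)
      (formGraph_stable g (tildeForm_mem x))
    rw [h]
    rfl
  | zero =>
    rw [zero_lie, zero_lie]
    simp
  | add u v hu hv =>
    rw [add_lie, add_lie, map_add, LinearMap.add_apply, hu, hv, map_add, neg_add]
  | smul c u hu => rw [smul_lie, smul_lie, map_smul, LinearMap.smul_apply, hu, map_smul, smul_neg]
  | lie u v hu hv =>
    rw [lie_lie, lie_lie, map_sub, LinearMap.sub_apply, hu, hv, hv, hu, map_sub]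
    ring

lemma tildeForm_invariant (x y z : TildeG V k) :
    tildeForm V k ⁅x, y⁆ z = tildeForm V k x ⁅y, z⁆ := by
  rw [← lie_skew, map_neg, LinearMap.neg_apply, tildeForm_lie_left, neg_neg]

/-- The form pairs brackets in the negative part with `x⁺_α` by the bracket `nb`. -/
lemma tildeForm_pos_lie {a b : TildeG V k} (ha : a ∈ tildeNeg V k) (hb : b ∈ tildeNeg V k) :
    ∃ z z' : Interval V →₀ k, (∀ β, tildeForm V k (tildeGen V k (.pos β)) a = -z β) ∧
      (∀ β, tildeForm V k (tildeGen V k (.pos β)) b = -z' β) ∧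
      ∀ α, tildeForm V k (tildeGen V k (.pos α)) ⁅a, b⁆ = -nb k z z' α := by
  obtain ⟨z, hz⟩ := exists_corresponds ha
  obtain ⟨z', hz'⟩ := exists_corresponds hb
  simp only [tildeForm_gen]
  exact ⟨z, z', hz.thPos, hz'.thPos, (hz.lie hz').thPos⟩

/-- The form pairs brackets in the positive part with `x⁻_α` by the bracket `nb`. -/
lemma tildeForm_neg_lie {a b : TildeG V k} (ha : a ∈ tildePos V k) (hb : b ∈ tildePos V k) :
    ∃ z z' : Interval V →₀ k, (∀ β, tildeForm V k (tildeGen V k (.neg β)) a = z β) ∧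
      (∀ β, tildeForm V k (tildeGen V k (.neg β)) b = z' β) ∧
      ∀ α, tildeForm V k (tildeGen V k (.neg α)) ⁅a, b⁆ = nb k z z' α := by
  obtain ⟨z, hz⟩ := exists_corresponds (chev_mem_tildeNeg ha)
  obtain ⟨z', hz'⟩ := exists_corresponds (chev_mem_tildeNeg hb)
  have h := hz.lie hz'
  rw [← LieHom.map_lie] at h
  simp only [tildeForm_gen]
  exact ⟨z, z', fun β => by rw [theta, thNeg_apply, hz.thPos, neg_neg],
    fun β => by rw [theta, thNeg_apply, hz'.thPos, neg_neg],
    fun β => by rw [theta, thNeg_apply, h.thPos, neg_neg]⟩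

end TildeForm

/-! ### Gradings -/

section Grading

variable {X : Type u} [TopologicalSpace X] {V : VertexSpace X}
variable {k : Type v} [Field k] {L : Type w} [LieRing L] [LieAlgebra k L] {γ : Gen V → L}

lemma homog_gen (g : Gen V) : γ g ∈ homog k γ g.deg := Submodule.subset_span (.gen g)

lemma homog_lie {φ ψ : funX V} {x y : L} (hx : x ∈ homog k γ φ) (hy : y ∈ homog k γ ψ) :
    ⁅x, y⁆ ∈ homog k γ (φ + ψ) := by
  induction hx using Submodule.span_induction with
  | mem x hx =>
    induction hy using Submodule.span_induction with
    | mem y hy => exact Submodule.subset_span (.lie hx hy)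
    | zero => simp
    | add y z _ _ hy hz =>
      rw [lie_add]
      exact add_mem hy hz
    | smul c y _ hy =>
      rw [lie_smul]
      exact Submodule.smul_mem _ c hy
  | zero => simp
  | add x z _ _ hx hz =>
    rw [add_lie]
    exact add_mem hx hz
  | smul c x _ hx =>
    rw [smul_lie]
    exact Submodule.smul_mem _ c hx

lemma homog_deg_eq {φ ψ : funX V} {x : L} (h : φ = ψ) (hx : x ∈ homog k γ φ) :
    x ∈ homog k γ ψ := h ▸ hx

lemma iSup_homog (hs : LieSubalgebra.lieSpan k L (Set.range γ) = ⊤) :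
    ⨆ φ, homog k γ φ = ⊤ := by
  refine eq_top_of_stable hs (fun g => Submodule.mem_iSup_of_mem _ (homog_gen g)) fun g m hm => ?_
  refine Submodule.iSup_induction _ (motive := fun m => ⁅γ g, m⁆ ∈ ⨆ φ, homog k γ φ) hm
    (fun φ x hx => Submodule.mem_iSup_of_mem _ (homog_lie (homog_gen g) hx)) (by simp) ?_
  intro x y hx hy
  rw [lie_add]
  exact add_mem hx hy

/-- An induction principle: every element is a sum of homogeneous ones. -/
lemma homog_induction (hs : LieSubalgebra.lieSpan k L (Set.range γ) = ⊤) {P : L → Prop}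
    (homog : ∀ φ, ∀ x ∈ homog k γ φ, P x) (add : ∀ x y, P x → P y → P (x + y)) (x : L) : P x := by
  have hx : x ∈ ⨆ φ, ContinuumKM.homog k γ φ := iSup_homog hs ▸ Submodule.mem_top
  exact Submodule.iSup_induction _ (motive := P) hx homog (homog 0 0 (zero_mem _)) add

variable (k γ) in
/-- The sum of the homogeneous components with degrees in `S`. -/
def gsum (S : Set (funX V)) : Submodule k L := ⨆ φ ∈ S, homog k γ φ

lemma homog_le_gsum {S : Set (funX V)} {φ : funX V} (h : φ ∈ S) : homog k γ φ ≤ gsum k γ S :=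
  le_biSup (homog k γ) h

lemma gsum_le {S : Set (funX V)} {T : Submodule k L} (h : ∀ φ ∈ S, homog k γ φ ≤ T) :
    gsum k γ S ≤ T := iSup₂_le h

lemma gsum_induction {S : Set (funX V)} {P : L → Prop} (homog : ∀ φ ∈ S, ∀ x ∈ homog k γ φ, P x)
    (zero : P 0) (add : ∀ x y, P x → P y → P (x + y)) {x : L} (hx : x ∈ gsum k γ S) : P x := by
  refine Submodule.iSup_induction _ (motive := P) hx (fun φ x hx => ?_) zero add
  exact Submodule.iSup_induction _ (motive := P) hx (fun h x hx => homog φ h x hx) zero add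

lemma gsum_lie_mem {S T U : Set (funX V)} (h : ∀ φ ∈ S, ∀ ψ ∈ T, φ + ψ ∈ U) {x y : L}
    (hx : x ∈ gsum k γ S) (hy : y ∈ gsum k γ T) : ⁅x, y⁆ ∈ gsum k γ U := by
  refine gsum_induction (P := fun x => ⁅x, y⁆ ∈ gsum k γ U) (fun φ hφ x hx => ?_) (by simp) ?_ hx
  · refine gsum_induction (P := fun y => ⁅x, y⁆ ∈ gsum k γ U) (fun ψ hψ y hy => ?_) (by simp) ?_ hy
    · exact homog_le_gsum (h φ hφ ψ hψ) (homog_lie hx hy)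
    · intro y z hy hz
      rw [lie_add]
      exact add_mem hy hz
  · intro x z hx hz
    rw [add_lie]
    exact add_mem hx hz

variable [T2Space X]

lemma homog_weight (hγ : SatisfiesRel k γ) (f : funX V) {φ : funX V} {x : L}
    (hx : x ∈ homog k γ φ) : ⁅γ (.cartan f), x⁆ = (eulerSym V f φ : k) • x := by
  induction hx using Submodule.span_induction with
  | mem x hx =>
    replace hx : IsMonomial γ φ x := hx
    induction hx with
    | gen g =>
      cases g with
      | cartan g => rw [hγ.comm', Gen.deg, eulerSym_zero_right, Int.cast_zero, zero_smul]
      | pos α => exact hγ.weight_pos' f α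
      | neg α => rw [hγ.weight_neg', Gen.deg, eulerSym_neg_right, Int.cast_neg, neg_smul]
    | lie _ _ hx hy =>
      rw [leibniz_lie, hx, hy, smul_lie, lie_smul, eulerSym_add_right, Int.cast_add, add_smul]
  | zero => simp
  | add x y _ _ hx hy => rw [lie_add, hx, hy, smul_add]
  | smul c x _ hx => rw [lie_smul, hx, smul_comm]

omit [T2Space X] in
lemma eulerSym_separates (hV : EulerNondegenerate V) {φ : funX V} (h : φ ≠ 0) :
    ∃ f : funX V, eulerSym V f φ ≠ 0 := by
  by_contra! h'
  exact h (hV φ fun g => by rw [eulerSym_comm, h'])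

variable [CharZero k]

/-- The homogeneous components are independent, since their weights are different. -/
lemma iSupIndep_homog (hγ : SatisfiesRel k γ) (hV : EulerNondegenerate V) :
    iSupIndep (homog k γ) := by
  let W : funX V → Module.End k L := fun f => LieAlgebra.ad k L (γ (.cartan f))
  have h1 : iSupIndep fun χ : funX V → k => ⨅ f, (W f).maxGenEigenspace (χ f) := by
    refine Module.End.independent_iInf_maxGenEigenspace_of_forall_mapsTo W fun f g c => ?_
    refine Module.End.mapsTo_maxGenEigenspace_of_comm ?_ c
    refine LinearMap.ext fun x => ?_
    change ⁅γ (.cartan g), ⁅γ (.cartan f), x⁆⁆ = ⁅γ (.cartan f), ⁅γ (.cartan g), x⁆⁆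
    rw [leibniz_lie, hγ.comm', zero_lie, zero_add]
  have hinj : Function.Injective fun (φ : funX V) (f : funX V) => (eulerSym V f φ : k) := by
    intro φ ψ h
    by_contra hne
    obtain ⟨f, hf⟩ := eulerSym_separates hV (sub_ne_zero.2 hne)
    have h2 : (eulerSym V f φ : k) = eulerSym V f ψ := congrFun h f
    rw [sub_eq_add_neg, eulerSym_add_right, eulerSym_neg_right] at hf
    have h3 : eulerSym V f φ = eulerSym V f ψ := by exact_mod_cast h2
    omega
  refine (h1.comp hinj).mono fun φ x hx => ?_
  simp only [Function.comp_apply, Submodule.mem_iInf]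
  intro f
  rw [Module.End.mem_maxGenEigenspace]
  refine ⟨1, ?_⟩
  rw [pow_one]
  change ⁅γ (.cartan f), x⁆ - (eulerSym V f φ : k) • x = 0
  rw [homog_weight hγ f hx, sub_self]

lemma disjoint_gsum (hγ : SatisfiesRel k γ) (hV : EulerNondegenerate V) {S T : Set (funX V)}
    (h : Disjoint S T) : Disjoint (gsum k γ S) (gsum k γ T) :=
  (iSupIndep_homog hγ hV).disjoint_biSup_biSup h

omit [CharZero k] in
lemma posHull_le_gsum :
    posHull (fun g => LieAlgebra.ad k L (γ g)) γ ≤ gsum k γ {φ | Pos φ} := by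
  refine hull_le ?_ ?_
  · rw [posSpan, Submodule.span_le]
    rintro _ ⟨α, rfl⟩
    exact homog_le_gsum (pos_cf α) (homog_gen (.pos α))
  · rintro _ ⟨α, rfl⟩ m hm
    exact gsum_lie_mem (fun φ hφ ψ hψ => Pos.add hφ hψ.1)
      (homog_le_gsum (pos_cf α) (homog_gen (.pos α))) hm

omit [CharZero k] in
lemma negHull_le_gsum :
    negHull (fun g => LieAlgebra.ad k L (γ g)) γ ≤ gsum k γ {φ | Pos (-φ)} := by
  have h : ∀ α : Interval V, (-cf α : funX V) ∈ {φ : funX V | Pos (-φ)} := fun α => by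
    rw [Set.mem_ofPred_eq, neg_neg]
    exact pos_cf α
  refine hull_le ?_ ?_
  · rw [negSpan, Submodule.span_le]
    rintro _ ⟨α, rfl⟩
    exact homog_le_gsum (h α) (homog_gen (.neg α))
  · rintro _ ⟨α, rfl⟩ m hm
    refine gsum_lie_mem (S := {φ | Pos (-φ)}) (T := {φ | Pos (-φ)}) (fun φ hφ ψ hψ => ?_)
      (homog_le_gsum (h α) (homog_gen (.neg α))) hm
    rw [Set.mem_ofPred_eq, neg_add]
    exact Pos.add hφ hψ.1

omit [CharZero k] [T2Space X] in
lemma zeroSpan_le_homog : zeroSpan γ ≤ homog k γ 0 := by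
  rw [zeroSpan, Submodule.span_le]
  rintro _ ⟨f, rfl⟩
  exact homog_gen (.cartan f)

omit [CharZero k] in
lemma exists_triangular (hγ : SatisfiesRel k γ)
    (hs : LieSubalgebra.lieSpan k L (Set.range γ) = ⊤) (x : L) :
    ∃ n ∈ negHull (fun g => LieAlgebra.ad k L (γ g)) γ, ∃ h ∈ zeroSpan (k := k) γ,
      ∃ p ∈ posHull (fun g => LieAlgebra.ad k L (γ g)) γ, x = n + h + p := by
  have hx := Submodule.mem_top (R := k) (x := x)
  rw [← hγ.triangular hs] at hx
  obtain ⟨y, hy, p, hp, rfl⟩ := Submodule.mem_sup.1 hx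
  obtain ⟨n, hn, h, hh, rfl⟩ := Submodule.mem_sup.1 hy
  exact ⟨n, hn, h, hh, p, hp, rfl⟩

/-- The homogeneous elements of positive degree are generated by the `x⁺_α`. -/
lemma homog_le_posHull (hγ : SatisfiesRel k γ) (hV : EulerNondegenerate V)
    (hs : LieSubalgebra.lieSpan k L (Set.range γ) = ⊤) {φ : funX V} (hφ : Pos φ) :
    homog k γ φ ≤ posHull (fun g => LieAlgebra.ad k L (γ g)) γ := by
  intro x hx
  obtain ⟨n, hn, h, hh, p, hp, rfl⟩ := exists_triangular hγ hs x
  have h1 : n + h ∈ gsum k γ {φ | ¬Pos φ} := by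
    refine add_mem ?_ (homog_le_gsum not_pos_zero (zeroSpan_le_homog hh))
    refine gsum_le (fun ψ hψ => homog_le_gsum (S := {φ | ¬Pos φ}) fun h => ?_) (negHull_le_gsum hn)
    exact not_pos_neg h hψ
  have h2 : n + h ∈ gsum k γ {φ | Pos φ} := by
    have := sub_mem (homog_le_gsum (S := {φ | Pos φ}) hφ hx) (posHull_le_gsum hp)
    rwa [add_sub_cancel_right] at this
  have h3 := (disjoint_gsum hγ hV (S := {φ | Pos φ}) (T := {φ | ¬Pos φ})
    (Set.disjoint_left.2 fun φ h h' => h' h)).le_bot ⟨h2, h1⟩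
  rw [(Submodule.mem_bot k).1 h3, zero_add]
  exact hp

/-- The homogeneous elements of negative degree are generated by the `x⁻_α`. -/
lemma homog_le_negHull (hγ : SatisfiesRel k γ) (hV : EulerNondegenerate V)
    (hs : LieSubalgebra.lieSpan k L (Set.range γ) = ⊤) {φ : funX V} (hφ : Pos (-φ)) :
    homog k γ φ ≤ negHull (fun g => LieAlgebra.ad k L (γ g)) γ := by
  intro x hx
  obtain ⟨n, hn, h, hh, p, hp, rfl⟩ := exists_triangular hγ hs x
  have h1 : h + p ∈ gsum k γ {φ | ¬Pos (-φ)} := by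
    refine add_mem (homog_le_gsum ?_ (zeroSpan_le_homog hh)) ?_
    · rw [Set.mem_ofPred_eq, neg_zero]
      exact not_pos_zero
    · refine gsum_le (fun ψ hψ => homog_le_gsum (S := {φ | ¬Pos (-φ)}) fun h => ?_)
        (posHull_le_gsum hp)
      exact not_pos_neg hψ h
  have h2 : h + p ∈ gsum k γ {φ | Pos (-φ)} := by
    have := sub_mem (homog_le_gsum (S := {φ | Pos (-φ)}) hφ hx) (negHull_le_gsum hn)
    rwa [add_assoc, add_sub_cancel_left] at this
  have h3 := (disjoint_gsum hγ hV (S := {φ | Pos (-φ)}) (T := {φ | ¬Pos (-φ)})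
    (Set.disjoint_left.2 fun φ h h' => h' h)).le_bot ⟨h2, h1⟩
  rw [add_assoc, (Submodule.mem_bot k).1 h3, add_zero]
  exact hn

/-- The homogeneous elements of degree zero form the Cartan subalgebra, and the other degrees are
positive or negative. -/
lemma mem_zeroSpan_of_homog (hγ : SatisfiesRel k γ) (hV : EulerNondegenerate V)
    (hs : LieSubalgebra.lieSpan k L (Set.range γ) = ⊤) {φ : funX V} (hp : ¬Pos φ)
    (hn : ¬Pos (-φ)) {x : L} (hx : x ∈ homog k γ φ) :
    x ∈ zeroSpan (k := k) γ ∧ (φ ≠ 0 → x = 0) := by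
  obtain ⟨n, hn', h, hh, p, hp', rfl⟩ := exists_triangular hγ hs x
  have hle : gsum k γ {φ | Pos (-φ)} ≤ gsum k γ {φ | Pos φ ∨ Pos (-φ)} :=
    gsum_le fun ψ hψ => homog_le_gsum (S := {φ | Pos φ ∨ Pos (-φ)}) (Or.inr hψ)
  have hle' : gsum k γ {φ | Pos φ} ≤ gsum k γ {φ | Pos φ ∨ Pos (-φ)} :=
    gsum_le fun ψ hψ => homog_le_gsum (S := {φ | Pos φ ∨ Pos (-φ)}) (Or.inl hψ)
  have h1 : n + p ∈ gsum k γ {φ | Pos φ ∨ Pos (-φ)} :=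
    add_mem (hle (negHull_le_gsum hn')) (hle' (posHull_le_gsum hp'))
  have h0 : (0 : funX V) ∈ {φ : funX V | ¬(Pos φ ∨ Pos (-φ))} := by
    rintro (h | h)
    · exact not_pos_zero h
    · rw [neg_zero] at h
      exact not_pos_zero h
  have hh' := homog_le_gsum h0 (zeroSpan_le_homog hh)
  have h2 : n + p ∈ gsum k γ {φ | ¬(Pos φ ∨ Pos (-φ))} := by
    have hφ : φ ∈ {φ : funX V | ¬(Pos φ ∨ Pos (-φ))} := fun h => h.elim hp hn
    have := sub_mem (homog_le_gsum hφ hx) hh'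
    rwa [add_right_comm, add_sub_cancel_right] at this
  have h3 := (disjoint_gsum hγ hV (S := {φ | Pos φ ∨ Pos (-φ)}) (T := {φ | ¬(Pos φ ∨ Pos (-φ))})
    (Set.disjoint_left.2 fun φ h h' => h' h)).le_bot ⟨h1, h2⟩
  rw [Submodule.mem_bot] at h3
  rw [add_right_comm, h3, zero_add] at hx ⊢
  refine ⟨hh, fun hne => ?_⟩
  have h4 := ((iSupIndep_homog hγ hV).pairwiseDisjoint hne).le_bot ⟨hx, zeroSpan_le_homog hh⟩
  exact (Submodule.mem_bot k).1 h4

end Grading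

/-! ### The invariant form on the continuum Kac–Moody algebra -/

section CartanNondegenerate

variable {X : Type u} [TopologicalSpace X] [T2Space X] {V : VertexSpace X}
variable {k : Type v} [Field k] [CharZero k]
variable {L : Type w} [LieRing L] [LieAlgebra k L] {γ : Gen V → L}

/-- A rational combination of the `ξ_f` which is orthogonal to all `ξ_g` vanishes: a multiple of it
is some `ξ_f`, for which the Euler form is non-degenerate. -/
lemma rat_cartan_eq_zero (hγ : SatisfiesRel k γ) (hV : EulerNondegenerate V) (s : Finset (funX V))
    (q : funX V → ℚ) (h : ∀ g, ∑ f ∈ s, q f * eulerSym V f g = 0) :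
    ∑ f ∈ s, (q f : k) • γ (.cartan f) = 0 := by
  classical
  obtain ⟨N, hN⟩ := IsLocalization.exist_integer_multiples_of_finset (nonZeroDivisors ℤ) (s.image q)
  have hN' : ∀ f ∈ s, ∃ m : ℤ, (m : ℚ) = (N : ℤ) * q f := by
    intro f hf
    obtain ⟨m, hm⟩ := hN (q f) (Finset.mem_image_of_mem q hf)
    refine ⟨m, ?_⟩
    have hm : (m : ℚ) = (N : ℤ) • q f := hm
    rw [hm, zsmul_eq_mul]
  choose! m hm using hN'
  have hN0 : ((N : ℤ) : ℚ) ≠ 0 := by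
    exact_mod_cast nonZeroDivisors.coe_ne_zero N
  let ξ : funX V →+ L := AddMonoidHom.mk' (fun f => γ (.cartan f)) hγ.add
  have h1 : ∑ f ∈ s, m f • f = 0 := by
    refine hV _ fun g => ?_
    have h2 : eulerSym V (∑ f ∈ s, m f • f) g = ∑ f ∈ s, m f * eulerSym V f g := by
      rw [← eulerHom_apply, map_sum, AddMonoidHom.finsetSum_apply]
      refine Finset.sum_congr rfl fun f _ => ?_
      rw [map_zsmul, AddMonoidHom.zsmul_apply, eulerHom_apply, smul_eq_mul]
    rw [h2]
    have h3 : ((∑ f ∈ s, m f * eulerSym V f g : ℤ) : ℚ) = 0 := by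
      push_cast
      rw [← mul_zero ((N : ℤ) : ℚ), ← h g, Finset.mul_sum]
      refine Finset.sum_congr rfl fun f hf => ?_
      rw [hm f hf, mul_assoc]
    exact_mod_cast h3
  have h4 : ∑ f ∈ s, (m f : k) • γ (.cartan f) = 0 := by
    have h5 := congrArg ξ h1
    rw [map_sum, map_zero] at h5
    rw [← h5]
    refine Finset.sum_congr rfl fun f _ => ?_
    rw [map_zsmul, Int.cast_smul_eq_zsmul]
    rfl
  have h6 : (((N : ℤ) : ℚ) : k) • ∑ f ∈ s, (q f : k) • γ (.cartan f) = 0 := by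
    rw [← h4, Finset.smul_sum]
    refine Finset.sum_congr rfl fun f hf => ?_
    rw [smul_smul, ← Rat.cast_mul, ← hm f hf, Rat.cast_intCast]
  exact (smul_eq_zero.1 h6).resolve_left (by exact_mod_cast hN0)

/-- The Euler form remains non-degenerate on the Cartan subalgebra over the ground field: the
coefficients of a vector are decomposed with respect to a basis of the field over `ℚ`. -/
lemma cartan_eq_zero (hγ : SatisfiesRel k γ) (hV : EulerNondegenerate V)
    (E : funX V → Module.Dual k L) (hE : ∀ f g, E g (γ (.cartan f)) = (eulerSym V f g : k))
    {x : L} (hx : x ∈ zeroSpan (k := k) γ) (h : ∀ g, E g x = 0) : x = 0 := by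
  classical
  obtain ⟨c, rfl⟩ := Finsupp.mem_span_range_iff_exists_finsupp.1 hx
  let b := Module.Basis.ofVectorSpace ℚ k
  let J : Finset (Module.Basis.ofVectorSpaceIndex ℚ k) :=
    c.support.biUnion fun f => (b.repr (c f)).support
  have hc : ∀ f ∈ c.support, c f = ∑ j ∈ J, ((b.repr (c f) j : ℚ) : k) * b j := by
    intro f hf
    conv_lhs => rw [← b.linearCombination_repr (c f), Finsupp.linearCombination_apply]
    rw [Finsupp.sum_of_support_subset _
      (Finset.subset_biUnion_of_mem (fun f => (b.repr (c f)).support) hf) _ (by simp)]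
    refine Finset.sum_congr rfl fun j _ => ?_
    rw [Rat.smul_def]
  have h1 : ∀ j, ∑ f ∈ c.support, ((b.repr (c f) j : ℚ) : k) • γ (.cartan f) = 0 := by
    intro j
    refine rat_cartan_eq_zero hγ hV _ _ fun g => ?_
    have h2 := h g
    rw [Finsupp.sum, map_sum] at h2
    simp only [map_smul, hE, smul_eq_mul] at h2
    have h3 := congrArg (fun y => b.repr y j) h2
    simp only [map_sum, map_zero, Finsupp.coe_zero, Pi.zero_apply, Finsupp.finsetSum_apply] at h3
    rw [← h3]
    refine Finset.sum_congr rfl fun f _ => ?_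
    have h4 : c f * (eulerSym V f g : k) = (eulerSym V f g : ℚ) • c f := by
      rw [Rat.smul_def, Rat.cast_intCast, mul_comm]
    rw [h4, map_smul, Finsupp.smul_apply, smul_eq_mul, mul_comm]
  rw [Finsupp.sum, Finset.sum_congr rfl fun f hf => by rw [hc f hf, Finset.sum_smul],
    Finset.sum_comm]
  refine Finset.sum_eq_zero fun j _ => ?_
  have h5 := congrArg (fun y => b j • y) (h1 j)
  simp only [smul_zero, Finset.smul_sum, smul_smul] at h5
  rw [← h5]
  exact Finset.sum_congr rfl fun f _ => by rw [mul_comm]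

/-- Homogeneous elements are orthogonal for an invariant form unless their degrees are opposite. -/
lemma form_eq_zero_of_degree (hγ : SatisfiesRel k γ) (hV : EulerNondegenerate V)
    {B : LinearMap.BilinForm k L} (hB : ∀ x y z, B ⁅x, y⁆ z = B x ⁅y, z⁆) {φ ψ : funX V}
    (h : φ + ψ ≠ 0) {x y : L} (hx : x ∈ homog k γ φ) (hy : y ∈ homog k γ ψ) : B x y = 0 := by
  obtain ⟨f, hf⟩ := eulerSym_separates hV h
  have h1 : B ⁅x, γ (.cartan f)⁆ y = B x ⁅γ (.cartan f), y⁆ := hB _ _ _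
  rw [← lie_skew, homog_weight hγ f hx, homog_weight hγ f hy, map_neg, map_smul, map_smul,
    LinearMap.neg_apply, LinearMap.smul_apply, smul_eq_mul, smul_eq_mul] at h1
  have h2 : ((eulerSym V f (φ + ψ) : ℤ) : k) * B x y = 0 := by
    rw [eulerSym_add_right, Int.cast_add, add_mul, ← h1]
    ring
  exact (mul_eq_zero.1 h2).resolve_left (by exact_mod_cast hf)

end CartanNondegenerate

section KMForm

variable {X : Type u} [TopologicalSpace X] [T2Space X] {V : VertexSpace X}
variable {k : Type v} [Field k]

variable (V k) in
/-- The kernel of the invariant form of `TildeG`. -/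
def tildeKer : LieIdeal k (TildeG V k) where
  carrier := {x | ∀ y, tildeForm V k x y = 0}
  add_mem' := fun {x y} hx hy z => by rw [map_add, LinearMap.add_apply, hx, hy, add_zero]
  zero_mem' := fun z => by simp
  smul_mem' := fun c x hx z => by rw [map_smul, LinearMap.smul_apply, hx, smul_zero]
  lie_mem := fun {x y} hy z => by
    change tildeForm V k ⁅x, y⁆ z = 0
    rw [tildeForm_lie_left, hy, neg_zero]

lemma mem_tildeKer {x : TildeG V k} : x ∈ tildeKer V k ↔ ∀ y, tildeForm V k x y = 0 := Iff.rfl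

lemma tildeForm_cartan (f g : funX V) : tildeForm V k (tildeGen V k (.cartan f))
    (tildeGen V k (.cartan g)) = (eulerSym V f g : k) := by
  rw [tildeForm_gen]
  exact nu_cartan f g

variable [CharZero k]

lemma tilde_cartan_eq_zero (hV : EulerNondegenerate V) {x : TildeG V k}
    (hx : x ∈ zeroSpan (k := k) (tildeGen V k))
    (h : ∀ g, tildeForm V k x (tildeGen V k (.cartan g)) = 0) : x = 0 := by
  refine cartan_eq_zero (satisfiesRel_tildeGen V k) hV
    (fun g => (tildeForm V k).flip (tildeGen V k (.cartan g))) (fun f g => ?_) hx h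
  exact tildeForm_cartan f g

/-- The kernel of the form is a graded ideal, since the form respects degrees. -/
lemma tildeKer_graded (hV : EulerNondegenerate V) : (tildeKer V k).toSubmodule ≤
    ⨆ φ : funX V, (tildeKer V k).toSubmodule ⊓ homog k (tildeGen V k) φ := by
  intro x hx
  have hx' : x ∈ ⨆ φ, homog k (tildeGen V k) φ := iSup_homog (lieSpan_tildeGen V k) ▸ trivial
  obtain ⟨c, hc, rfl⟩ := (Submodule.mem_iSup_iff_exists_finsupp _ _).1 hx'
  refine Submodule.sum_mem _ fun φ hφ => Submodule.mem_iSup_of_mem φ ⟨?_, hc φ⟩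
  have hdeg := fun {φ ψ : funX V} (h : φ + ψ ≠ 0) {x y : TildeG V k} =>
    form_eq_zero_of_degree (satisfiesRel_tildeGen V k) hV tildeForm_invariant h (x := x) (y := y)
  intro y
  induction y using homog_induction (lieSpan_tildeGen V k) with
  | add y z hy hz => rw [map_add, hy, hz, add_zero]
  | homog ψ y hy =>
    by_cases h : φ + ψ = 0
    · have h1 : tildeForm V k (c.sum fun _ m => m) y = 0 := hx y
      rw [Finsupp.sum, map_sum, LinearMap.sum_apply, Finset.sum_eq_single_of_mem φ hφ] at h1
      · exact h1
      · intro χ _ hne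
        exact hdeg (fun h' => hne (add_right_cancel (h'.trans h.symm))) (hc χ) hy
    · exact hdeg h (hc φ) hy

lemma tildeKer_disjoint (hV : EulerNondegenerate V) :
    Disjoint (tildeKer V k).toSubmodule (cartanSpan k (tildeGen V k)) := by
  rw [Submodule.disjoint_def]
  exact fun x hx hx' => tilde_cartan_eq_zero hV hx' fun g => hx _

/-- A graded ideal which meets the Cartan subalgebra trivially lies in the kernel of the form. -/
lemma le_tildeKer (hV : EulerNondegenerate V) {I : LieIdeal k (TildeG V k)}
    (hI : I.toSubmodule ≤ ⨆ φ : funX V, I.toSubmodule ⊓ homog k (tildeGen V k) φ)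
    (hI' : Disjoint I.toSubmodule (cartanSpan k (tildeGen V k))) : I ≤ tildeKer V k := by
  have hrel := satisfiesRel_tildeGen V k
  have hs := lieSpan_tildeGen V k
  have hdeg := fun {φ ψ : funX V} (h : φ + ψ ≠ 0) {x y : TildeG V k} =>
    form_eq_zero_of_degree hrel hV tildeForm_invariant h (x := x) (y := y)
  have h0 : ∀ x ∈ I, x ∈ homog k (tildeGen V k) 0 → x = 0 := fun x hx hx' =>
    Submodule.disjoint_def.1 hI' x hx (mem_zeroSpan_of_homog hrel hV hs not_pos_zero
      (by rw [neg_zero]; exact not_pos_zero) hx').1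
  -- a homogeneous element of the ideal is orthogonal to the generators
  have h1 : ∀ φ, ∀ x ∈ I, x ∈ homog k (tildeGen V k) φ → ∀ g,
      tildeForm V k x (tildeGen V k g) = 0 := by
    intro φ x hx hx' g
    by_cases h : φ + g.deg = 0
    · by_cases hφ : φ = 0
      · subst hφ
        rw [h0 x hx hx']
        simp
      · have h2 : ⁅x, tildeGen V k g⁆ = 0 := by
          refine h0 _ (lie_mem_left k (TildeG V k) I _ _ hx) ?_
          exact homog_deg_eq h (homog_lie hx' (homog_gen g))
        obtain ⟨f, hf⟩ := eulerSym_separates hV hφ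
        have h3 : tildeForm V k ⁅tildeGen V k (.cartan f), x⁆ (tildeGen V k g) = 0 := by
          rw [tildeForm_invariant, h2, map_zero]
        rw [homog_weight hrel f hx', map_smul, LinearMap.smul_apply] at h3
        exact (smul_eq_zero.1 h3).resolve_left (by exact_mod_cast hf)
    · exact hdeg h hx' (homog_gen g)
  have h2 : ∀ x ∈ I, ∀ g, tildeForm V k x (tildeGen V k g) = 0 := by
    intro x hx g
    refine Submodule.iSup_induction _ (motive := fun x => tildeForm V k x (tildeGen V k g) = 0)
      (hI hx) (fun φ x hx => h1 φ x hx.1 hx.2 g) (by simp) ?_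
    intro x y hx hy
    rw [map_add, LinearMap.add_apply, hx, hy, add_zero]
  let S : Submodule k (TildeG V k) :=
    { carrier := {y | ∀ x ∈ I, tildeForm V k x y = 0}
      add_mem' := fun {y z} hy hz x hx => by rw [map_add, hy x hx, hz x hx, add_zero]
      zero_mem' := fun x _ => by simp
      smul_mem' := fun c y hy x hx => by rw [map_smul, hy x hx, smul_zero] }
  have hS : S = ⊤ := by
    refine eq_top_of_stable hs (fun g x hx => h2 x hx g) fun g y hy x hx => ?_
    rw [← tildeForm_invariant]
    exact hy _ (lie_mem_left k (TildeG V k) I _ _ hx)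
  exact fun x hx y => (hS ▸ Submodule.mem_top (x := y) : y ∈ S) x hx

/-- The ideal which defines the continuum Kac–Moody algebra is the kernel of the form. -/
lemma radical_eq (hV : EulerNondegenerate V) : radical V k = tildeKer V k :=
  le_antisymm (sSup_le fun _ hI => le_tildeKer hV hI.1 hI.2)
    (le_sSup ⟨tildeKer_graded hV, tildeKer_disjoint hV⟩)

variable (k) in
/-- The invariant form of the continuum Kac–Moody algebra. -/
def kmForm (hV : EulerNondegenerate V) : LinearMap.BilinForm k (ContKM V k) :=
  (radical V k).toSubmodule.liftQ
    (LinearMap.flip ((radical V k).toSubmodule.liftQ (tildeForm V k).flip fun y hy =>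
      LinearMap.ext fun x => (tildeForm_symm x y).trans
        (mem_tildeKer.1 (radical_eq (k := k) hV ▸ hy) x)))
    fun x hx => by
      refine LinearMap.ext fun y => ?_
      obtain ⟨y, rfl⟩ := Submodule.Quotient.mk_surjective _ y
      exact mem_tildeKer.1 (radical_eq (k := k) hV ▸ hx) y

variable (V k) in
/-- The projection to the continuum Kac–Moody algebra. -/
def kmProj : TildeG V k →ₗ⁅k⁆ ContKM V k :=
  { (LieSubmodule.Quotient.mk' (radical V k)).toLinearMap with
    map_lie' := fun {a b} => LieSubmodule.Quotient.mk_bracket _ a b }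

omit [T2Space X] [CharZero k] in
lemma kmProj_surjective : Function.Surjective (kmProj V k) :=
  LieSubmodule.Quotient.surjective_mk' _

omit [T2Space X] [CharZero k] in
lemma kmProj_gen (g : Gen V) : kmProj V k (tildeGen V k g) = kmGen V k g := rfl

lemma kmForm_proj (hV : EulerNondegenerate V) (x y : TildeG V k) :
    kmForm k hV (kmProj V k x) (kmProj V k y) = tildeForm V k x y := rfl

omit [T2Space X] [CharZero k] in
variable (V k) in
lemma satisfiesRel_kmGen : SatisfiesRel k (kmGen V k) :=
  (satisfiesRel_tildeGen V k).map (kmProj V k)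

omit [T2Space X] [CharZero k] in
variable (V k) in
lemma lieSpan_kmGen : LieSubalgebra.lieSpan k (ContKM V k) (Set.range (kmGen V k)) = ⊤ := by
  rw [eq_top_iff]
  intro x _
  obtain ⟨x, rfl⟩ := kmProj_surjective x
  induction x using tilde_induction k with
  | gen g => exact LieSubalgebra.subset_lieSpan ⟨g, rfl⟩
  | zero =>
    rw [map_zero]
    exact zero_mem _
  | add x y hx hy =>
    rw [map_add]
    exact add_mem (hx trivial) (hy trivial)
  | smul c x hx =>
    rw [map_smul]
    exact (LieSubalgebra.lieSpan k (ContKM V k) _).smul_mem c (hx trivial)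
  | lie x y hx hy =>
    rw [LieHom.map_lie]
    exact LieSubalgebra.lie_mem _ (hx trivial) (hy trivial)

lemma kmForm_symm (hV : EulerNondegenerate V) (x y : ContKM V k) :
    kmForm k hV x y = kmForm k hV y x := by
  obtain ⟨x, rfl⟩ := kmProj_surjective x
  obtain ⟨y, rfl⟩ := kmProj_surjective y
  exact tildeForm_symm x y

lemma kmForm_invariant (hV : EulerNondegenerate V) (x y z : ContKM V k) :
    kmForm k hV ⁅x, y⁆ z = kmForm k hV x ⁅y, z⁆ := by
  obtain ⟨x, rfl⟩ := kmProj_surjective x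
  obtain ⟨y, rfl⟩ := kmProj_surjective y
  obtain ⟨z, rfl⟩ := kmProj_surjective z
  rw [← LieHom.map_lie, ← LieHom.map_lie]
  exact tildeForm_invariant x y z

lemma kmForm_nondegenerate (hV : EulerNondegenerate V) {x : ContKM V k}
    (h : ∀ y, kmForm k hV x y = 0) : x = 0 := by
  obtain ⟨x, rfl⟩ := kmProj_surjective x
  refine (LieSubmodule.Quotient.mk_eq_zero (radical V k)).2 ?_
  rw [radical_eq hV]
  exact fun y => h (kmProj V k y)

lemma kmForm_gen (hV : EulerNondegenerate V) (g h : Gen V) :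
    kmForm k hV (kmGen V k g) (kmGen V k h) = theta k g (tildeGen V k h) := by
  rw [← kmProj_gen, ← kmProj_gen, kmForm_proj, tildeForm_gen]

lemma isEulerExtension_kmForm (hV : EulerNondegenerate V) :
    IsEulerExtension V k (kmForm k hV) where
  symm := kmForm_symm hV
  invariant := kmForm_invariant hV
  xi_xi α β := (kmForm_gen hV _ _).trans (nu_cartan _ _)
  xp_xi α β := (kmForm_gen hV _ _).trans (thPos_cartan _ _)
  xm_xi α β := (kmForm_gen hV _ _).trans (thNeg_cartan _ _)
  xp_xp α β := (kmForm_gen hV _ _).trans (thPos_pos (pos_mem_tildePos β) α)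
  xm_xm α β := (kmForm_gen hV _ _).trans (thNeg_neg (neg_mem_tildeNeg β) α)
  xp_xm_self α := (kmForm_gen hV _ _).trans (by
    rw [theta, (corresponds_neg α).thPos]
    simp)
  xp_xm_ne α β h := (kmForm_gen hV _ _).trans (by
    rw [theta, (corresponds_neg β).thPos]
    simp [Finsupp.single_eq_of_ne h])

end KMForm

/-! ### Components and scaling operators -/

section Components

variable {X : Type u} [TopologicalSpace X] [T2Space X] {V : VertexSpace X}
variable {k : Type v} [Field k] [CharZero k] (hV : EulerNondegenerate V)

omit [T2Space X] [CharZero k] in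
lemma comp_lie {φ ψ : funX V} {x y : ContKM V k} (hx : x ∈ comp V k φ) (hy : y ∈ comp V k ψ) :
    ⁅x, y⁆ ∈ comp V k (φ + ψ) := homog_lie hx hy

omit [T2Space X] [CharZero k] in
/-- Every element is a sum of homogeneous ones. -/
lemma comp_induction {P : ContKM V k → Prop} (homog : ∀ φ, ∀ x ∈ comp V k φ, P x)
    (add : ∀ x y, P x → P y → P (x + y)) (x : ContKM V k) : P x :=
  homog_induction (lieSpan_kmGen V k) homog add x

omit [CharZero k] in
lemma comp_weight (f : funX V) {φ : funX V} {x : ContKM V k} (hx : x ∈ comp V k φ) :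
    ⁅kmGen V k (.cartan f), x⁆ = (eulerSym V f φ : k) • x :=
  homog_weight (satisfiesRel_kmGen V k) f hx

omit [T2Space X] [CharZero k] in
lemma xp_mem (α : Interval V) : xp k α ∈ comp V k (cf α) := homog_gen (.pos α)

omit [T2Space X] [CharZero k] in
lemma xm_mem (α : Interval V) : xm k α ∈ comp V k (-cf α) := homog_gen (.neg α)

omit [T2Space X] [CharZero k] in
lemma xi_mem (α : Interval V) : xi k α ∈ comp V k 0 := homog_gen (.cartan (cf α))

include hV in
lemma comp_zero : comp V k 0 = cartan V k :=
  le_antisymm (fun _ hx => (mem_zeroSpan_of_homog (satisfiesRel_kmGen V k) hV (lieSpan_kmGen V k)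
    not_pos_zero (by rw [neg_zero]; exact not_pos_zero) hx).1) zeroSpan_le_homog

include hV in
/-- The degrees of non-zero homogeneous elements are zero, positive or negative. -/
lemma comp_trichotomy {φ : funX V} {x : ContKM V k} (hx : x ∈ comp V k φ) :
    x = 0 ∨ φ = 0 ∨ Pos φ ∨ Pos (-φ) := by
  by_cases hp : Pos φ
  · exact Or.inr (Or.inr (Or.inl hp))
  by_cases hn : Pos (-φ)
  · exact Or.inr (Or.inr (Or.inr hn))
  by_cases h0 : φ = 0
  · exact Or.inr (Or.inl h0)
  · exact Or.inl ((mem_zeroSpan_of_homog (satisfiesRel_kmGen V k) hV (lieSpan_kmGen V k) hp hn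
      hx).2 h0)

include hV in
/-- Elements of degree zero commute. -/
lemma lie_eq_zero_of_comp_zero {x y : ContKM V k} (hx : x ∈ comp V k 0) (hy : y ∈ comp V k 0) :
    ⁅x, y⁆ = 0 := by
  rw [comp_zero hV] at hx
  induction hx using Submodule.span_induction with
  | mem x hx =>
    obtain ⟨f, rfl⟩ := hx
    rw [comp_weight f hy, eulerSym_zero_right, Int.cast_zero, zero_smul]
  | zero => rw [zero_lie]
  | add x z _ _ hx hz => rw [add_lie, hx, hz, add_zero]
  | smul c x _ hx => rw [smul_lie, hx, smul_zero]

include hV in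
lemma comp_internal [DecidableEq (funX V)] : DirectSum.IsInternal (comp V k) :=
  DirectSum.isInternal_submodule_of_iSupIndep_of_iSup_eq_top
    (iSupIndep_homog (satisfiesRel_kmGen V k) hV) (iSup_homog (lieSpan_kmGen V k))

open scoped Classical in
/-- The linear map which is given by `F φ` on the component of degree `φ`. -/
def glue {N : Type*} [AddCommGroup N] [Module k N] (F : funX V → ContKM V k →ₗ[k] N) :
    ContKM V k →ₗ[k] N :=
  DirectSum.toModule k (funX V) N (fun φ => F φ ∘ₗ (comp V k φ).subtype) ∘ₗ
    (LinearEquiv.ofBijective (DirectSum.coeLinearMap (comp V k))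
      (comp_internal hV)).symm.toLinearMap

lemma glue_apply {N : Type*} [AddCommGroup N] [Module k N] (F : funX V → ContKM V k →ₗ[k] N)
    {φ : funX V} {x : ContKM V k} (hx : x ∈ comp V k φ) : glue hV F x = F φ x := by
  classical
  have h1 : (LinearEquiv.ofBijective (DirectSum.coeLinearMap (comp V k)) (comp_internal hV)).symm x
      = DirectSum.lof k (funX V) (fun φ => comp V k φ) φ ⟨x, hx⟩ := by
    rw [LinearEquiv.symm_apply_eq]
    exact (DirectSum.coeLinearMap_lof (comp V k) φ ⟨x, hx⟩).symm
  rw [glue, LinearMap.comp_apply, LinearEquiv.coe_coe]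
  convert congrArg _ h1 using 1
  rw [DirectSum.toModule_lof]
  rfl

/-- The operator which is multiplication by `c φ` on the component of degree `φ`. -/
def scale (c : funX V → k) : ContKM V k →ₗ[k] ContKM V k :=
  glue hV fun φ => c φ • LinearMap.id

lemma scale_apply (c : funX V → k) {φ : funX V} {x : ContKM V k} (hx : x ∈ comp V k φ) :
    scale hV c x = c φ • x := glue_apply hV _ hx

lemma scale_mem_comp (c : funX V → k) {φ : funX V} {x : ContKM V k} (hx : x ∈ comp V k φ) :
    scale hV c x ∈ comp V k φ := by
  rw [scale_apply hV c hx]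
  exact Submodule.smul_mem _ _ hx

lemma kmForm_degree {φ ψ : funX V} (h : φ + ψ ≠ 0) {x y : ContKM V k} (hx : x ∈ comp V k φ)
    (hy : y ∈ comp V k ψ) : kmForm k hV x y = 0 :=
  form_eq_zero_of_degree (satisfiesRel_kmGen V k) hV (kmForm_invariant hV) h hx hy

lemma kmForm_lie_left (x y z : ContKM V k) : kmForm k hV ⁅x, y⁆ z = -kmForm k hV y ⁅x, z⁆ := by
  rw [← lie_skew, map_neg, LinearMap.neg_apply, kmForm_invariant]

/-- The adjoint of a scaling operator has the coefficients of the opposite degrees. -/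
lemma scale_adjoint (c : funX V → k) (x y : ContKM V k) :
    kmForm k hV (scale hV c x) y = kmForm k hV x (scale hV (fun φ => c (-φ)) y) := by
  induction x using comp_induction with
  | add x x' hx hx' => simp only [map_add, LinearMap.add_apply, hx, hx']
  | homog φ x hx =>
    induction y using comp_induction with
    | add y y' hy hy' => simp only [map_add, hy, hy']
    | homog ψ y hy =>
      rw [scale_apply hV c hx, scale_apply hV _ hy, map_smul, map_smul, LinearMap.smul_apply]
      by_cases h : φ + ψ = 0
      · rw [eq_neg_of_add_eq_zero_left h]
      · rw [kmForm_degree hV h hx hy, smul_zero, smul_zero]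

lemma scale_scale (c d : funX V → k) (x : ContKM V k) :
    scale hV c (scale hV d x) = scale hV (fun φ => c φ * d φ) x := by
  induction x using comp_induction with
  | add x x' hx hx' => simp only [map_add, hx, hx']
  | homog φ x hx =>
    rw [scale_apply hV d hx, map_smul, scale_apply hV c hx, scale_apply hV _ hx, smul_smul,
      mul_comm]

lemma scale_mem_gsum {S : Set (funX V)} (c : funX V → k) {x : ContKM V k}
    (hx : x ∈ gsum k (kmGen V k) S) : scale hV c x ∈ gsum k (kmGen V k) S := by
  refine gsum_induction (P := fun x => scale hV c x ∈ gsum k (kmGen V k) S) (fun φ hφ x hx => ?_)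
    (by simp) (fun x y hx hy => by rw [map_add]; exact add_mem hx hy) hx
  rw [scale_apply hV c hx]
  exact Submodule.smul_mem _ _ (homog_le_gsum hφ hx)

lemma kmForm_gsum {S T : Set (funX V)} (h : ∀ φ ∈ S, ∀ ψ ∈ T, φ + ψ ≠ 0) {x y : ContKM V k}
    (hx : x ∈ gsum k (kmGen V k) S) (hy : y ∈ gsum k (kmGen V k) T) : kmForm k hV x y = 0 := by
  refine gsum_induction (P := fun x => kmForm k hV x y = 0) (fun φ hφ x hx => ?_) (by simp)
    (fun x z hx hz => by rw [map_add, LinearMap.add_apply, hx, hz, add_zero]) hx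
  refine gsum_induction (P := fun y => kmForm k hV x y = 0) (fun ψ hψ y hy => ?_) (by simp)
    (fun y z hy hz => by rw [map_add, hy, hz, add_zero]) hy
  exact kmForm_degree hV (h φ hφ ψ hψ) hx hy

end Components

section Subalgebras

variable {X : Type u} [TopologicalSpace X] {V : VertexSpace X}

/-- Non-negative elements of `Fun(X)`. -/
def NonNeg (φ : funX V) : Prop := ∀ p, 0 ≤ φ.1 p

lemma nonNeg_zero : NonNeg (0 : funX V) := fun _ => le_refl _

lemma nonNeg_iff {φ : funX V} : NonNeg φ ↔ φ = 0 ∨ Pos φ := by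
  constructor
  · intro h
    by_cases h0 : φ = 0
    · exact Or.inl h0
    · exact Or.inr ⟨h, h0⟩
  · rintro (rfl | h)
    · exact nonNeg_zero
    · exact h.1

lemma NonNeg.add {φ ψ : funX V} (h : NonNeg φ) (h' : NonNeg ψ) : NonNeg (φ + ψ) :=
  fun p => add_nonneg (h p) (h' p)

lemma NonNeg.eq_zero {φ : funX V} (h : NonNeg φ) (h' : NonNeg (-φ)) : φ = 0 := by
  by_contra h0
  exact not_pos_neg ⟨h, h0⟩ ⟨h', neg_ne_zero.2 h0⟩

lemma mem_neg_deg [T2Space X] (α : Interval V) : (-cf α : funX V) ∈ {φ : funX V | Pos (-φ)} := by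
  rw [Set.mem_ofPred_eq, neg_neg]
  exact pos_cf α

variable (k : Type v) [Field k]

/-- The Lie subalgebra of the elements with degrees in a set which is closed under addition. -/
def gradedSubalgebra (S : Set (funX V)) (h : ∀ φ ∈ S, ∀ ψ ∈ S, φ + ψ ∈ S) :
    LieSubalgebra k (ContKM V k) :=
  { gsum k (kmGen V k) S with lie_mem' := fun hx hy => gsum_lie_mem h hx hy }

variable [T2Space X] [CharZero k] (hV : EulerNondegenerate V)

include hV in
lemma nPos_eq : (nPos V k).toSubmodule = gsum k (kmGen V k) {φ | Pos φ} := by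
  refine le_antisymm ?_ (gsum_le fun φ hφ => ?_)
  · have h : nPos V k ≤ gradedSubalgebra k {φ : funX V | Pos φ} fun φ hφ ψ hψ => hφ.add hψ.1 := by
      rw [nPos, LieSubalgebra.lieSpan_le]
      rintro _ ⟨α, rfl⟩
      exact homog_le_gsum (S := {φ : funX V | Pos φ}) (pos_cf α) (xp_mem α)
    exact h
  · refine (homog_le_posHull (satisfiesRel_kmGen V k) hV (lieSpan_kmGen V k) hφ).trans
      (hull_le ?_ ?_)
    · rw [posSpan, Submodule.span_le]
      rintro _ ⟨α, rfl⟩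
      exact LieSubalgebra.subset_lieSpan ⟨α, rfl⟩
    · rintro _ ⟨α, rfl⟩ m hm
      exact (nPos V k).lie_mem (LieSubalgebra.subset_lieSpan ⟨α, rfl⟩) hm

include hV in
lemma nNeg_eq : (nNeg V k).toSubmodule = gsum k (kmGen V k) {φ | Pos (-φ)} := by
  refine le_antisymm ?_ (gsum_le fun φ hφ => ?_)
  · have h : nNeg V k ≤ gradedSubalgebra k {φ : funX V | Pos (-φ)} fun φ hφ ψ hψ => by
        rw [Set.mem_ofPred_eq, neg_add]
        exact hφ.add hψ.1 := by
      rw [nNeg, LieSubalgebra.lieSpan_le]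
      rintro _ ⟨α, rfl⟩
      exact homog_le_gsum (mem_neg_deg α) (xm_mem α)
    exact h
  · refine (homog_le_negHull (satisfiesRel_kmGen V k) hV (lieSpan_kmGen V k) hφ).trans
      (hull_le ?_ ?_)
    · rw [negSpan, Submodule.span_le]
      rintro _ ⟨α, rfl⟩
      exact LieSubalgebra.subset_lieSpan ⟨α, rfl⟩
    · rintro _ ⟨α, rfl⟩ m hm
      exact (nNeg V k).lie_mem (LieSubalgebra.subset_lieSpan ⟨α, rfl⟩) hm

include hV in
lemma bPos_eq : (bPos V k).toSubmodule = gsum k (kmGen V k) {φ | NonNeg φ} := by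
  refine le_antisymm ?_ (gsum_le fun φ hφ => ?_)
  · have h : bPos V k ≤ gradedSubalgebra k {φ : funX V | NonNeg φ} fun φ hφ ψ hψ => hφ.add hψ := by
      rw [bPos, LieSubalgebra.lieSpan_le]
      rintro x (hx | ⟨α, rfl⟩)
      · exact homog_le_gsum (S := {φ : funX V | NonNeg φ}) nonNeg_zero (zeroSpan_le_homog hx)
      · exact homog_le_gsum (S := {φ : funX V | NonNeg φ}) (pos_cf α).1 (xp_mem α)
    exact h
  · rcases nonNeg_iff.1 hφ with rfl | hφ
    · intro x hx
      have hx' : x ∈ cartan V k := by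
        rw [← comp_zero (k := k) hV]
        exact hx
      exact LieSubalgebra.subset_lieSpan (Or.inl hx')
    · have h1 : homog k (kmGen V k) φ ≤ (nPos V k).toSubmodule := by
        rw [nPos_eq k hV]
        exact homog_le_gsum hφ
      exact h1.trans (LieSubalgebra.lieSpan_mono Set.subset_union_right)

include hV in
lemma bNeg_eq : (bNeg V k).toSubmodule = gsum k (kmGen V k) {φ | NonNeg (-φ)} := by
  refine le_antisymm ?_ (gsum_le fun φ hφ => ?_)
  · have h : bNeg V k ≤ gradedSubalgebra k {φ : funX V | NonNeg (-φ)} fun φ hφ ψ hψ => by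
        rw [Set.mem_ofPred_eq, neg_add]
        exact hφ.add hψ := by
      rw [bNeg, LieSubalgebra.lieSpan_le]
      rintro x (hx | ⟨α, rfl⟩)
      · refine homog_le_gsum (S := {φ : funX V | NonNeg (-φ)}) ?_ (zeroSpan_le_homog hx)
        rw [Set.mem_ofPred_eq, neg_zero]
        exact nonNeg_zero
      · exact homog_le_gsum (S := {φ : funX V | NonNeg (-φ)}) (mem_neg_deg α).1 (xm_mem α)
    exact h
  · rcases nonNeg_iff.1 hφ with h0 | hφ
    · intro x hx
      rw [neg_eq_zero] at h0
      subst h0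
      have hx' : x ∈ cartan V k := by
        rw [← comp_zero (k := k) hV]
        exact hx
      exact LieSubalgebra.subset_lieSpan (Or.inl hx')
    · have h1 : homog k (kmGen V k) φ ≤ (nNeg V k).toSubmodule := by
        rw [nNeg_eq k hV]
        exact homog_le_gsum (S := {φ : funX V | Pos (-φ)}) hφ
      exact h1.trans (LieSubalgebra.lieSpan_mono Set.subset_union_right)

end Subalgebras

section Brackets

variable {X : Type u} [TopologicalSpace X] [T2Space X] {V : VertexSpace X}
variable {k : Type v} [Field k] [CharZero k] (hV : EulerNondegenerate V)

omit [T2Space X] [CharZero k] in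
lemma negHull_le_map : negHull (fun g => LieAlgebra.ad k _ (kmGen V k g)) (kmGen V k) ≤
    (tildeNeg V k).map (kmProj V k).toLinearMap := by
  refine hull_le ?_ ?_
  · rw [negSpan, Submodule.span_le]
    rintro _ ⟨α, rfl⟩
    exact ⟨_, neg_mem_tildeNeg α, rfl⟩
  · rintro _ ⟨α, rfl⟩ _ ⟨m, hm, rfl⟩
    exact ⟨_, neg_lie_mem_tildeNeg α hm, rfl⟩

omit [T2Space X] [CharZero k] in
lemma posHull_le_map : posHull (fun g => LieAlgebra.ad k _ (kmGen V k g)) (kmGen V k) ≤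
    (tildePos V k).map (kmProj V k).toLinearMap := by
  refine hull_le ?_ ?_
  · rw [posSpan, Submodule.span_le]
    rintro _ ⟨α, rfl⟩
    exact ⟨_, pos_mem_tildePos α, rfl⟩
  · rintro _ ⟨α, rfl⟩ _ ⟨m, hm, rfl⟩
    exact ⟨_, pos_lie_mem_tildePos α hm, rfl⟩

/-- Brackets of elements of negative degree pair with the `x⁺_α` by the bracket `nb`. -/
lemma kmForm_pos_lie {φ ψ : funX V} (hφ : Pos (-φ)) (hψ : Pos (-ψ)) {a b : ContKM V k}
    (ha : a ∈ comp V k φ) (hb : b ∈ comp V k ψ) :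
    ∃ z z' : Interval V →₀ k, (∀ β, kmForm k hV (xp k β) a = -z β) ∧
      (∀ β, kmForm k hV (xp k β) b = -z' β) ∧
      ∀ α, kmForm k hV (xp k α) ⁅a, b⁆ = -nb k z z' α := by
  obtain ⟨a, ha1, rfl⟩ := negHull_le_map
    (homog_le_negHull (satisfiesRel_kmGen V k) hV (lieSpan_kmGen V k) hφ ha)
  obtain ⟨b, hb1, rfl⟩ := negHull_le_map
    (homog_le_negHull (satisfiesRel_kmGen V k) hV (lieSpan_kmGen V k) hψ hb)
  exact tildeForm_pos_lie ha1 hb1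

/-- Brackets of elements of positive degree pair with the `x⁻_α` by the bracket `nb`. -/
lemma kmForm_neg_lie {φ ψ : funX V} (hφ : Pos φ) (hψ : Pos ψ) {a b : ContKM V k}
    (ha : a ∈ comp V k φ) (hb : b ∈ comp V k ψ) :
    ∃ z z' : Interval V →₀ k, (∀ β, kmForm k hV (xm k β) a = z β) ∧
      (∀ β, kmForm k hV (xm k β) b = z' β) ∧
      ∀ α, kmForm k hV (xm k α) ⁅a, b⁆ = nb k z z' α := by
  obtain ⟨a, ha1, rfl⟩ := posHull_le_map
    (homog_le_posHull (satisfiesRel_kmGen V k) hV (lieSpan_kmGen V k) hφ ha)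
  obtain ⟨b, hb1, rfl⟩ := posHull_le_map
    (homog_le_posHull (satisfiesRel_kmGen V k) hV (lieSpan_kmGen V k) hψ hb)
  exact tildeForm_neg_lie ha1 hb1

end Brackets

section Uniqueness

variable {X : Type u} [TopologicalSpace X] [T2Space X] {V : VertexSpace X}
variable {k : Type v} [Field k] [CharZero k]

/-- An invariant symmetric form which vanishes on pairs of generators is zero. -/
lemma form_eq_zero (hV : EulerNondegenerate V) {D : LinearMap.BilinForm k (ContKM V k)}
    (hsymm : ∀ x y, D x y = D y x) (hinv : ∀ x y z, D ⁅x, y⁆ z = D x ⁅y, z⁆)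
    (hgen : ∀ g h, D (kmGen V k g) (kmGen V k h) = 0) : D = 0 := by
  have hrel := satisfiesRel_kmGen V k
  have hs := lieSpan_kmGen V k
  have hdeg := fun {φ ψ : funX V} (h : φ + ψ ≠ 0) {x y : ContKM V k} =>
    form_eq_zero_of_degree hrel hV hinv h (x := x) (y := y)
  have hinv' : ∀ x y z, D x ⁅y, z⁆ = -D ⁅y, x⁆ z := fun x y z => by
    rw [← hinv, ← lie_skew, map_neg, LinearMap.neg_apply]
  have hgs : ∀ {S T : Set (funX V)}, (∀ φ ∈ S, ∀ ψ ∈ T, φ + ψ ≠ 0) → ∀ {x y : ContKM V k},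
      x ∈ gsum k (kmGen V k) S → y ∈ gsum k (kmGen V k) T → D x y = 0 := by
    intro S T h x y hx hy
    refine gsum_induction (P := fun x => D x y = 0) (fun φ hφ x hx => ?_) (by simp)
      (fun x z hx hz => by rw [map_add, LinearMap.add_apply, hx, hz, add_zero]) hx
    exact gsum_induction (P := fun y => D x y = 0) (fun ψ hψ y hy => hdeg (h φ hφ ψ hψ) hx hy)
      (by simp) (fun y z hy hz => by rw [map_add, hy, hz, add_zero]) hy
  have hne : ∀ φ ∈ {φ : funX V | Pos φ}, ∀ ψ ∈ {ψ : funX V | Pos ψ ∨ ψ = 0}, φ + ψ ≠ 0 := by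
    rintro φ hφ ψ (hψ | rfl)
    · exact (hφ.add hψ.1).2
    · rw [add_zero]
      exact hφ.2
  -- generators are orthogonal to the parts generated by generators of one kind
  have hp : ∀ y ∈ posHull (fun g => LieAlgebra.ad k _ (kmGen V k g)) (kmGen V k),
      ∀ g, D (kmGen V k g) y = 0 := by
    intro y hy
    have hy' := posHull_le_gsum (k := k) hy
    induction hy using hull_induction with
    | base y hy =>
      intro g
      induction hy using Submodule.span_induction with
      | mem y hy =>
        obtain ⟨β, rfl⟩ := hy
        exact hgen _ _
      | zero => simp
      | add y z hy1 hz1 hy hz =>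
        rw [map_add, hy (posHull_le_gsum (le_hull hy1)), hz (posHull_le_gsum (le_hull hz1)),
          add_zero]
      | smul c y hy1 hy => rw [map_smul, hy (posHull_le_gsum (le_hull hy1)), smul_zero]
    | zero => simp
    | add y z hy1 hz1 hy hz =>
      intro g
      rw [map_add, hy (posHull_le_gsum hy1), hz (posHull_le_gsum hz1), add_zero]
    | smul c y hy1 hy =>
      intro g
      rw [map_smul, hy (posHull_le_gsum hy1), smul_zero]
    | step a ha y hy1 hy =>
      obtain ⟨β, rfl⟩ := ha
      intro g
      cases g with
      | cartan f =>
        rw [hsymm]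
        exact hgs hne hy' (homog_le_gsum (S := {ψ : funX V | Pos ψ ∨ ψ = 0}) (Or.inr rfl)
          (homog_gen (.cartan f)))
      | pos α =>
        rw [hsymm]
        exact hgs hne hy' (homog_le_gsum (S := {ψ : funX V | Pos ψ ∨ ψ = 0}) (Or.inl (pos_cf α))
          (homog_gen (.pos α)))
      | neg α =>
        change D (kmGen V k (.neg α)) ⁅kmGen V k (.pos β), y⁆ = 0
        rw [hinv', hrel.cross, ← LinearMap.flip_apply, map_crossIn]
        have h0 := hy (posHull_le_gsum hy1)
        simp [crossIn, h0]
  have hn : ∀ y ∈ negHull (fun g => LieAlgebra.ad k _ (kmGen V k g)) (kmGen V k),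
      ∀ g, D (kmGen V k g) y = 0 := by
    have hne : ∀ φ ∈ {φ : funX V | Pos (-φ)}, ∀ ψ ∈ {ψ : funX V | Pos (-ψ) ∨ ψ = 0},
        φ + ψ ≠ 0 := by
      rintro φ hφ ψ (hψ | rfl)
      · have := (Pos.add hφ hψ.1).2
        rwa [← neg_add, neg_ne_zero] at this
      · rw [add_zero]
        exact neg_ne_zero.1 hφ.2
    intro y hy
    have hy' := negHull_le_gsum (k := k) hy
    induction hy using hull_induction with
    | base y hy =>
      intro g
      induction hy using Submodule.span_induction with
      | mem y hy =>
        obtain ⟨β, rfl⟩ := hy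
        exact hgen _ _
      | zero => simp
      | add y z hy1 hz1 hy hz =>
        rw [map_add, hy (negHull_le_gsum (le_hull hy1)), hz (negHull_le_gsum (le_hull hz1)),
          add_zero]
      | smul c y hy1 hy => rw [map_smul, hy (negHull_le_gsum (le_hull hy1)), smul_zero]
    | zero => simp
    | add y z hy1 hz1 hy hz =>
      intro g
      rw [map_add, hy (negHull_le_gsum hy1), hz (negHull_le_gsum hz1), add_zero]
    | smul c y hy1 hy =>
      intro g
      rw [map_smul, hy (negHull_le_gsum hy1), smul_zero]
    | step a ha y hy1 hy =>
      obtain ⟨β, rfl⟩ := ha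
      intro g
      cases g with
      | cartan f =>
        rw [hsymm]
        exact hgs hne hy' (homog_le_gsum (S := {ψ : funX V | Pos (-ψ) ∨ ψ = 0}) (Or.inr rfl)
          (homog_gen (.cartan f)))
      | neg α =>
        rw [hsymm]
        exact hgs hne hy' (homog_le_gsum (S := {ψ : funX V | Pos (-ψ) ∨ ψ = 0})
          (Or.inl (mem_neg_deg α)) (homog_gen (.neg α)))
      | pos α =>
        change D (kmGen V k (.pos α)) ⁅kmGen V k (.neg β), y⁆ = 0
        rw [hinv', ← lie_skew, map_neg, LinearMap.neg_apply, neg_neg, hrel.cross,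
          ← LinearMap.flip_apply, map_crossIn]
        have h0 := hy (negHull_le_gsum hy1)
        simp [crossIn, h0]
  have hall : ∀ g y, D (kmGen V k g) y = 0 := by
    intro g y
    obtain ⟨n, hn', h, hh, p, hp', rfl⟩ := exists_triangular hrel hs y
    rw [map_add, map_add, hn n hn' g, hp p hp' g, zero_add, add_zero]
    induction hh using Submodule.span_induction with
    | mem y hy =>
      obtain ⟨f, rfl⟩ := hy
      exact hgen _ _
    | zero => simp
    | add y z _ _ hy hz => rw [map_add, hy, hz, add_zero]
    | smul c y _ hy => rw [map_smul, hy, smul_zero]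
  have hker : LinearMap.ker D = ⊤ := by
    refine eq_top_of_stable hs (fun g => ?_) fun g x hx => ?_
    · exact LinearMap.mem_ker.2 (LinearMap.ext fun y => hall g y)
    · refine LinearMap.mem_ker.2 (LinearMap.ext fun y => ?_)
      rw [hinv, hall, LinearMap.zero_apply]
  exact LinearMap.ker_eq_top.1 hker

omit [T2Space X] [CharZero k] in
lemma eq_of_eq_on_xi {M : Type*} [AddCommGroup M] {F G : ContKM V k →+ M}
    (h : ∀ α, F (xi k α) = G (xi k α)) (f : funX V) :
    F (kmGen V k (.cartan f)) = G (kmGen V k (.cartan f)) := by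
  have hrel := satisfiesRel_kmGen V k
  induction f using funX_induction_interval with
  | interval α => exact h α
  | zero => rw [hrel.cartan_zero, map_zero, map_zero]
  | add f g hf hg => rw [hrel.add, map_add, map_add, hf, hg]
  | neg f hf => rw [hrel.cartan_neg, map_neg, map_neg, hf]

/-- The invariant form is unique. -/
lemma eulerExtension_unique (hV : EulerNondegenerate V) {B B' : LinearMap.BilinForm k (ContKM V k)}
    (h : IsEulerExtension V k B) (h' : IsEulerExtension V k B') : B' = B := by
  have key : ∀ g α, B' (kmGen V k g) (xi k α) = B (kmGen V k g) (xi k α) := by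
    intro g α
    cases g with
    | cartan f =>
      refine eq_of_eq_on_xi (F := (B'.flip (xi k α)).toAddMonoidHom)
        (G := (B.flip (xi k α)).toAddMonoidHom) (fun β => ?_) f
      exact (h'.xi_xi β α).trans (h.xi_xi β α).symm
    | pos β => exact (h'.xp_xi β α).trans (h.xp_xi β α).symm
    | neg β => exact (h'.xm_xi β α).trans (h.xm_xi β α).symm
  have key' : ∀ g f, B' (kmGen V k g) (kmGen V k (.cartan f)) =
      B (kmGen V k g) (kmGen V k (.cartan f)) := fun g f =>
    eq_of_eq_on_xi (F := (B' (kmGen V k g)).toAddMonoidHom)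
      (G := (B (kmGen V k g)).toAddMonoidHom) (key g) f
  have hpn : ∀ α β, B' (xp k α) (xm k β) = B (xp k α) (xm k β) := by
    intro α β
    by_cases hαβ : α = β
    · subst hαβ
      rw [h.xp_xm_self, h'.xp_xm_self]
    · rw [h.xp_xm_ne α β hαβ, h'.xp_xm_ne α β hαβ]
  rw [← sub_eq_zero]
  refine form_eq_zero hV (fun x y => ?_) (fun x y z => ?_) (fun g g' => ?_)
  · simp only [LinearMap.sub_apply, h.symm x y, h'.symm x y]
  · simp only [LinearMap.sub_apply, h.invariant, h'.invariant]
  · rw [LinearMap.sub_apply, LinearMap.sub_apply, sub_eq_zero]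
    cases g' with
    | cartan f => exact key' g f
    | pos β =>
      cases g with
      | cartan f =>
        rw [h.symm, h'.symm]
        exact key' _ f
      | pos α => exact (h'.xp_xp α β).trans (h.xp_xp α β).symm
      | neg α =>
        rw [h.symm, h'.symm]
        exact hpn β α
    | neg β =>
      cases g with
      | cartan f =>
        rw [h.symm, h'.symm]
        exact key' _ f
      | pos α => exact hpn α β
      | neg α => exact (h'.xm_xm α β).trans (h.xm_xm α β).symm

end Uniqueness

/-! ### The sign of a degree and the dual bracket -/

section Sign

variable {X : Type u} [TopologicalSpace X] {V : VertexSpace X} (k : Type v) [Field k]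

open scoped Classical in
/-- Half the sign of an element of `Fun(X)`; it is zero unless the element is positive or
negative. -/
def halfSign (φ : funX V) : k := if Pos φ then 2⁻¹ else if Pos (-φ) then -2⁻¹ else 0

variable {k}

lemma halfSign_pos {φ : funX V} (h : Pos φ) : halfSign k φ = 2⁻¹ := if_pos h

lemma halfSign_of_neg {φ : funX V} (h : Pos (-φ)) : halfSign k φ = -2⁻¹ := by
  rw [halfSign, if_neg fun h' => not_pos_neg h' h, if_pos h]

@[simp]
lemma halfSign_zero : halfSign k (0 : funX V) = 0 := by
  rw [halfSign, if_neg not_pos_zero, if_neg]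
  rw [neg_zero]
  exact not_pos_zero

@[simp]
lemma halfSign_neg (φ : funX V) : halfSign k (-φ) = -halfSign k φ := by
  by_cases hp : Pos φ
  · rw [halfSign_pos hp, halfSign_of_neg (by rwa [neg_neg])]
  by_cases hn : Pos (-φ)
  · rw [halfSign_pos hn, halfSign_of_neg hn, neg_neg]
  · rw [halfSign, halfSign, if_neg hp, if_neg hn, if_neg hn, if_neg (by rwa [neg_neg]), neg_zero]

/-- The degrees which are zero, positive or negative. -/
def Signed (φ : funX V) : Prop := φ = 0 ∨ Pos φ ∨ Pos (-φ)

lemma Signed.neg {φ : funX V} (h : Signed φ) : Signed (-φ) := by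
  rcases h with rfl | h | h
  · exact Or.inl neg_zero
  · exact Or.inr (Or.inr (by rwa [neg_neg]))
  · exact Or.inr (Or.inl h)

lemma Pos.neg_add {φ ψ : funX V} (h : Pos (-φ)) (h' : Pos (-ψ)) : Pos (-(φ + ψ)) := by
  rw [_root_.neg_add]
  exact h.add h'.1

/-- This is the modified Yang–Baxter equation for the operator of half the sign; the
exceptional case does not matter since elements of degree zero commute. -/
lemma halfSign_add [CharZero k] {φ ψ : funX V} (hφ : Signed φ) (hψ : Signed ψ)
    (h : ¬(φ = 0 ∧ ψ = 0)) :
    (halfSign k φ + halfSign k ψ) * halfSign k (φ + ψ) = halfSign k φ * halfSign k ψ + 4⁻¹ := by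
  rcases hφ with rfl | hφ | hφ <;> rcases hψ with rfl | hψ | hψ
  · exact absurd ⟨rfl, rfl⟩ h
  · rw [zero_add, halfSign_zero, halfSign_pos hψ]
    norm_num
  · rw [zero_add, halfSign_zero, halfSign_of_neg hψ]
    norm_num
  · rw [add_zero, halfSign_zero, halfSign_pos hφ]
    norm_num
  · rw [halfSign_pos hφ, halfSign_pos hψ, halfSign_pos (hφ.add hψ.1)]
    norm_num
  · rw [halfSign_pos hφ, halfSign_of_neg hψ]
    norm_num
  · rw [add_zero, halfSign_zero, halfSign_of_neg hφ]
    norm_num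
  · rw [halfSign_of_neg hφ, halfSign_pos hψ]
    norm_num
  · rw [halfSign_of_neg hφ, halfSign_of_neg hψ, halfSign_of_neg (hφ.neg_add hψ)]
    norm_num

lemma halfSign_add_ne_zero [CharZero k] {φ ψ : funX V} (hφ : Signed φ) (hψ : Signed ψ)
    (h : halfSign k φ + halfSign k ψ ≠ 0) :
    φ = 0 ∨ ψ = 0 ∨ (Pos φ ∧ Pos ψ) ∨ (Pos (-φ) ∧ Pos (-ψ)) := by
  rcases hφ with rfl | hφ | hφ
  · exact Or.inl rfl
  · rcases hψ with rfl | hψ | hψ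
    · exact Or.inr (Or.inl rfl)
    · exact Or.inr (Or.inr (Or.inl ⟨hφ, hψ⟩))
    · rw [halfSign_pos hφ, halfSign_of_neg hψ, add_neg_cancel] at h
      exact absurd rfl h
  · rcases hψ with rfl | hψ | hψ
    · exact Or.inr (Or.inl rfl)
    · rw [halfSign_of_neg hφ, halfSign_pos hψ, neg_add_cancel] at h
      exact absurd rfl h
    · exact Or.inr (Or.inr (Or.inr ⟨hφ, hψ⟩))

end Sign

section DualBracket

variable {X : Type u} [TopologicalSpace X] [T2Space X] {V : VertexSpace X}
variable {k : Type v} [Field k] [CharZero k] (hV : EulerNondegenerate V)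

include hV in
lemma signed_of_mem {φ : funX V} {x : ContKM V k} (hx : x ∈ comp V k φ) (h : x ≠ 0) : Signed φ :=
  (comp_trichotomy hV hx).resolve_left h

/-- The bracket `{a, b} = [R a, b] + [a, R b]`, where `R` is the operator of half the sign of the
degree. By means of the invariant form, it is dual to the cobracket. -/
def rBracket (a b : ContKM V k) : ContKM V k :=
  ⁅scale hV (halfSign k) a, b⁆ + ⁅a, scale hV (halfSign k) b⁆

lemma rBracket_apply {φ ψ : funX V} {a b : ContKM V k} (ha : a ∈ comp V k φ)
    (hb : b ∈ comp V k ψ) :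
    rBracket hV a b = (halfSign k φ + halfSign k ψ) • ⁅a, b⁆ := by
  rw [rBracket, scale_apply hV _ ha, scale_apply hV _ hb, smul_lie, lie_smul, add_smul]

lemma rBracket_swap (a b : ContKM V k) : rBracket hV b a = -rBracket hV a b := by
  rw [rBracket, rBracket, ← lie_skew, ← lie_skew b]
  abel

lemma rBracket_add_left (a a' b : ContKM V k) :
    rBracket hV (a + a') b = rBracket hV a b + rBracket hV a' b := by
  simp only [rBracket, map_add, add_lie]
  abel

lemma rBracket_add_right (a b b' : ContKM V k) :
    rBracket hV a (b + b') = rBracket hV a b + rBracket hV a b' := by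
  simp only [rBracket, map_add, lie_add]
  abel

lemma rBracket_zero_left (b : ContKM V k) : rBracket hV 0 b = 0 := by simp [rBracket]

lemma rBracket_zero_right (a : ContKM V k) : rBracket hV a 0 = 0 := by simp [rBracket]

lemma rBracket_mem {φ ψ : funX V} {a b : ContKM V k} (ha : a ∈ comp V k φ)
    (hb : b ∈ comp V k ψ) : rBracket hV a b ∈ comp V k (φ + ψ) := by
  rw [rBracket_apply hV ha hb]
  exact Submodule.smul_mem _ _ (comp_lie ha hb)

include hV in
/-- The modified Yang–Baxter equation. -/
lemma halfSign_smul_lie {φ ψ : funX V} {a b : ContKM V k} (ha : a ∈ comp V k φ)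
    (hb : b ∈ comp V k ψ) :
    ((halfSign k φ + halfSign k ψ) * halfSign k (φ + ψ)) • ⁅a, b⁆ =
      (halfSign k φ * halfSign k ψ + 4⁻¹) • ⁅a, b⁆ := by
  by_cases h0 : φ = 0 ∧ ψ = 0
  · obtain ⟨rfl, rfl⟩ := h0
    rw [lie_eq_zero_of_comp_zero hV ha hb, smul_zero, smul_zero]
  by_cases ha0 : a = 0
  · rw [ha0, zero_lie, smul_zero, smul_zero]
  by_cases hb0 : b = 0
  · rw [hb0, lie_zero, smul_zero, smul_zero]
  rw [halfSign_add (signed_of_mem hV ha ha0) (signed_of_mem hV hb hb0) h0]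

lemma rBracket_rBracket {φ ψ χ : funX V} {a b c : ContKM V k} (ha : a ∈ comp V k φ)
    (hb : b ∈ comp V k ψ) (hc : c ∈ comp V k χ) :
    rBracket hV a (rBracket hV b c) = (halfSign k φ * halfSign k ψ + halfSign k φ * halfSign k χ
      + halfSign k ψ * halfSign k χ + 4⁻¹) • ⁅a, ⁅b, c⁆⁆ := by
  rw [rBracket_apply hV ha (rBracket_mem hV hb hc), rBracket_apply hV hb hc, lie_smul, smul_smul]
  have h := congrArg (fun y => ⁅a, y⁆) (halfSign_smul_lie hV hb hc)
  simp only [lie_smul] at h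
  rw [add_mul, add_smul, mul_comm (halfSign k (ψ + χ)), h, ← add_smul]
  congr 1
  ring

lemma rBracket_jacobi {φ ψ χ : funX V} {a b c : ContKM V k} (ha : a ∈ comp V k φ)
    (hb : b ∈ comp V k ψ) (hc : c ∈ comp V k χ) :
    rBracket hV a (rBracket hV b c) + rBracket hV b (rBracket hV c a)
      + rBracket hV c (rBracket hV a b) = 0 := by
  rw [rBracket_rBracket hV ha hb hc, rBracket_rBracket hV hb hc ha, rBracket_rBracket hV hc ha hb]
  have h1 : halfSign k ψ * halfSign k χ + halfSign k ψ * halfSign k φ + halfSign k χ * halfSign k φ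
      + 4⁻¹ = halfSign k φ * halfSign k ψ + halfSign k φ * halfSign k χ
      + halfSign k ψ * halfSign k χ + 4⁻¹ := by ring
  have h2 : halfSign k χ * halfSign k φ + halfSign k χ * halfSign k ψ + halfSign k φ * halfSign k ψ
      + 4⁻¹ = halfSign k φ * halfSign k ψ + halfSign k φ * halfSign k χ
      + halfSign k ψ * halfSign k χ + 4⁻¹ := by ring
  rw [h1, h2, ← smul_add, ← smul_add, lie_jacobi, smul_zero]

/-- The identity dual to the cocycle condition. It uses that `halfSign` is odd. -/
lemma kmForm_lie_rBracket {χ χ' φ ψ : funX V} {x y a b : ContKM V k} (hx : x ∈ comp V k χ)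
    (hy : y ∈ comp V k χ') (ha : a ∈ comp V k φ) (hb : b ∈ comp V k ψ) :
    kmForm k hV ⁅x, y⁆ (rBracket hV a b) =
      -kmForm k hV y (rBracket hV ⁅x, a⁆ b) - kmForm k hV y (rBracket hV a ⁅x, b⁆)
        + kmForm k hV x (rBracket hV ⁅y, a⁆ b) + kmForm k hV x (rBracket hV a ⁅y, b⁆) := by
  by_cases h : χ + χ' + (φ + ψ) = 0
  · have e1 : kmForm k hV y ⁅⁅x, a⁆, b⁆ = -kmForm k hV ⁅x, a⁆ ⁅y, b⁆ := by
      rw [← kmForm_invariant, ← lie_skew, map_neg, LinearMap.neg_apply, kmForm_invariant]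
    have e2 : kmForm k hV y ⁅a, ⁅x, b⁆⁆ = kmForm k hV ⁅y, a⁆ ⁅x, b⁆ := (kmForm_invariant ..).symm
    have e3 : kmForm k hV x ⁅⁅y, a⁆, b⁆ = -kmForm k hV ⁅y, a⁆ ⁅x, b⁆ := by
      rw [← kmForm_invariant, ← lie_skew, map_neg, LinearMap.neg_apply, kmForm_invariant]
    have e4 : kmForm k hV x ⁅a, ⁅y, b⁆⁆ = kmForm k hV ⁅x, a⁆ ⁅y, b⁆ := (kmForm_invariant ..).symm
    have e5 : kmForm k hV ⁅x, y⁆ ⁅a, b⁆ =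
        kmForm k hV ⁅x, a⁆ ⁅y, b⁆ - kmForm k hV ⁅y, a⁆ ⁅x, b⁆ := by
      rw [kmForm_invariant, leibniz_lie, map_add, e3, e4]
      ring
    have s1 : halfSign k (χ' + ψ) = -halfSign k (χ + φ) := by
      rw [← halfSign_neg]
      congr 1
      rw [eq_neg_iff_add_eq_zero, ← h]
      abel
    have s2 : halfSign k (χ' + φ) = -halfSign k (χ + ψ) := by
      rw [← halfSign_neg]
      congr 1
      rw [eq_neg_iff_add_eq_zero, ← h]
      abel
    rw [rBracket_apply hV ha hb, rBracket_apply hV (comp_lie hx ha) hb,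
      rBracket_apply hV ha (comp_lie hx hb), rBracket_apply hV (comp_lie hy ha) hb,
      rBracket_apply hV ha (comp_lie hy hb), map_smul, map_smul, map_smul, map_smul, map_smul,
      e1, e2, e3, e4, e5, s1, s2]
    simp only [smul_eq_mul]
    ring
  · have h1 : χ' + (χ + φ + ψ) ≠ 0 := by rwa [show χ' + (χ + φ + ψ) = χ + χ' + (φ + ψ) by abel]
    have h2 : χ' + (φ + (χ + ψ)) ≠ 0 := by rwa [show χ' + (φ + (χ + ψ)) = χ + χ' + (φ + ψ) by abel]
    have h3 : χ + (χ' + φ + ψ) ≠ 0 := by rwa [show χ + (χ' + φ + ψ) = χ + χ' + (φ + ψ) by abel]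
    have h4 : χ + (φ + (χ' + ψ)) ≠ 0 := by rwa [show χ + (φ + (χ' + ψ)) = χ + χ' + (φ + ψ) by abel]
    rw [kmForm_degree hV h (comp_lie hx hy) (rBracket_mem hV ha hb),
      kmForm_degree hV h1 hy (rBracket_mem hV (comp_lie hx ha) hb),
      kmForm_degree hV h2 hy (rBracket_mem hV ha (comp_lie hx hb)),
      kmForm_degree hV h3 hx (rBracket_mem hV (comp_lie hy ha) hb),
      kmForm_degree hV h4 hx (rBracket_mem hV ha (comp_lie hy hb))]
    simp

end DualBracket

/-! ### Linear forms on tensor products -/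

section Separation

variable {k : Type v} [Field k]

/-- The tensor products of two separating families of linear forms are separating. -/
lemma tensor_eq_zero {M N : Type*} [AddCommGroup M] [Module k M] [AddCommGroup N] [Module k N]
    {ι κ : Type*} {F : ι → M →ₗ[k] k} {G : κ → N →ₗ[k] k} (hF : ∀ x, (∀ i, F i x = 0) → x = 0)
    (hG : ∀ y, (∀ j, G j y = 0) → y = 0) {t : M ⊗[k] N}
    (h : ∀ i j, (LinearMap.mul' k k ∘ₗ TensorProduct.map (F i) (G j)) t = 0) : t = 0 := by
  classical
  let b := Module.Basis.ofVectorSpace k N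
  let e := TensorProduct.equivFinsuppOfBasisRight (M := M) b
  have he : ∀ i, ∀ s : M ⊗[k] N,
      b.repr (TensorProduct.lid k N (LinearMap.rTensor N (F i) s)) =
        Finsupp.mapRange.linearMap (F i) (e s) := by
    intro i s
    induction s with
    | zero => simp
    | add s s' hs hs' => simp only [map_add, hs, hs']
    | tmul x y =>
      ext l
      simp [e, TensorProduct.equivFinsuppOfBasisRight_apply_tmul, mul_comm]
  have h1 : ∀ i, TensorProduct.lid k N (LinearMap.rTensor N (F i) t) = 0 := by
    intro i
    refine hG _ fun j => ?_
    rw [← h i j]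
    generalize t = s
    induction s with
    | zero => simp
    | add s s' hs hs' => simp only [map_add, hs, hs']
    | tmul x y => simp
  refine e.map_eq_zero_iff.1 (Finsupp.ext fun l => hF _ fun i => ?_)
  have h2 := he i t
  rw [h1, map_zero] at h2
  exact (DFunLike.congr_fun h2 l).symm

@[simp]
lemma tensorForm_tmul {L : Type*} [AddCommGroup L] [Module k L] (f g : L →ₗ[k] k) (x y : L) :
    tensorForm k f g (x ⊗ₜ y) = f x * g y := by
  simp [tensorForm]

lemma tensorForm_rTensor {L : Type*} [AddCommGroup L] [Module k L] (f g : L →ₗ[k] k)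
    (T : L →ₗ[k] L) (t : L ⊗[k] L) :
    tensorForm k f g (LinearMap.rTensor L T t) = tensorForm k (f ∘ₗ T) g t := by
  induction t with
  | zero => simp
  | add s s' hs hs' => simp only [map_add, hs, hs']
  | tmul x y => simp

lemma tensorForm_lTensor {L : Type*} [AddCommGroup L] [Module k L] (f g : L →ₗ[k] k)
    (T : L →ₗ[k] L) (t : L ⊗[k] L) :
    tensorForm k f g (LinearMap.lTensor L T t) = tensorForm k f (g ∘ₗ T) t := by
  induction t with
  | zero => simp
  | add s s' hs hs' => simp only [map_add, hs, hs']
  | tmul x y => simp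

lemma tensorForm_comm {L : Type*} [AddCommGroup L] [Module k L] (f g : L →ₗ[k] k)
    (t : L ⊗[k] L) :
    tensorForm k f g (TensorProduct.comm k L L t) = tensorForm k g f t := by
  induction t with
  | zero => simp
  | add s s' hs hs' => simp only [map_add, hs, hs']
  | tmul x y => simp [mul_comm]

lemma tensorForm_smul_smul {L : Type*} [AddCommGroup L] [Module k L] (c d : k) (f g : L →ₗ[k] k)
    (t : L ⊗[k] L) : tensorForm k (c • f) (d • g) t = c * d * tensorForm k f g t := by
  induction t with
  | zero => simp
  | add s s' hs hs' => rw [map_add, hs, hs', map_add, mul_add]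
  | tmul x y =>
    simp only [tensorForm_tmul, LinearMap.smul_apply, smul_eq_mul]
    ring

lemma tmul_mem_range {L : Type*} [AddCommGroup L] [Module k L] {S T : Submodule k L} {x y : L}
    (hx : x ∈ S) (hy : y ∈ T) :
    x ⊗ₜ[k] y ∈ LinearMap.range (TensorProduct.mapIncl S T) :=
  ⟨⟨x, hx⟩ ⊗ₜ ⟨y, hy⟩, rfl⟩

/-- Induction for elements of the tensor product of two subspaces. -/
lemma range_mapIncl_induction {L : Type*} [AddCommGroup L] [Module k L] {S T : Submodule k L}
    {P : L ⊗[k] L → Prop} (zero : P 0) (tmul : ∀ x ∈ S, ∀ y ∈ T, P (x ⊗ₜ y))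
    (add : ∀ s t, P s → P t → P (s + t)) {t : L ⊗[k] L}
    (ht : t ∈ LinearMap.range (TensorProduct.mapIncl S T)) : P t := by
  obtain ⟨t, rfl⟩ := ht
  induction t with
  | zero => rwa [map_zero]
  | add s t hs ht =>
    rw [map_add]
    exact add _ _ hs ht
  | tmul x y => exact tmul x x.2 y y.2

lemma map_mem_range_mapIncl {L : Type*} [AddCommGroup L] [Module k L] {S T S' T' : Submodule k L}
    (f : L ⊗[k] L →ₗ[k] L ⊗[k] L)
    (h : ∀ x ∈ S, ∀ y ∈ T, f (x ⊗ₜ y) ∈ LinearMap.range (TensorProduct.mapIncl S' T'))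
    {t : L ⊗[k] L} (ht : t ∈ LinearMap.range (TensorProduct.mapIncl S T)) :
    f t ∈ LinearMap.range (TensorProduct.mapIncl S' T') := by
  refine range_mapIncl_induction
    (P := fun t => f t ∈ LinearMap.range (TensorProduct.mapIncl S' T')) ?_ h
    (fun s t hs ht => ?_) ht
  · rw [map_zero]
    exact zero_mem _
  · rw [map_add]
    exact add_mem hs ht

end Separation

section FormTensor

variable {X : Type u} [TopologicalSpace X] [T2Space X] {V : VertexSpace X}
variable {k : Type v} [Field k] [CharZero k] (hV : EulerNondegenerate V)

/-- The linear form `x ⊗ y ↦ (x, a) (y, b)`. -/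
abbrev formTensor (a b : ContKM V k) : ContKM V k ⊗[k] ContKM V k →ₗ[k] k :=
  tensorForm k ((kmForm k hV).flip a) ((kmForm k hV).flip b)

lemma formTensor_tmul (a b x y : ContKM V k) :
    formTensor hV a b (x ⊗ₜ y) = kmForm k hV x a * kmForm k hV y b := tensorForm_tmul ..

lemma formTensor_add_left (a a' b : ContKM V k) (t : ContKM V k ⊗[k] ContKM V k) :
    formTensor hV (a + a') b t = formTensor hV a b t + formTensor hV a' b t := by
  induction t with
  | zero => simp
  | add s s' hs hs' =>
    rw [map_add, map_add, map_add, hs, hs']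
    ring
  | tmul x y => simp only [formTensor_tmul, map_add, add_mul]

lemma formTensor_add_right (a b b' : ContKM V k) (t : ContKM V k ⊗[k] ContKM V k) :
    formTensor hV a (b + b') t = formTensor hV a b t + formTensor hV a b' t := by
  induction t with
  | zero => simp
  | add s s' hs hs' =>
    rw [map_add, map_add, map_add, hs, hs']
    ring
  | tmul x y => simp only [formTensor_tmul, map_add, mul_add]

lemma flip_nondegenerate (x : ContKM V k) (h : ∀ a, (kmForm k hV).flip a x = 0) : x = 0 :=
  kmForm_nondegenerate hV h

lemma formTensor_eq_zero {φ ψ φ' ψ' : funX V} {t : ContKM V k ⊗[k] ContKM V k}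
    (ht : t ∈ LinearMap.range (TensorProduct.mapIncl (comp V k φ) (comp V k ψ)))
    {a b : ContKM V k} (ha : a ∈ comp V k φ') (hb : b ∈ comp V k ψ')
    (h : ¬(φ' = -φ ∧ ψ' = -ψ)) : formTensor hV a b t = 0 := by
  refine range_mapIncl_induction (P := fun t => formTensor hV a b t = 0) (map_zero _)
    (fun x hx y hy => ?_) (fun s t hs ht => by rw [map_add, hs, ht, add_zero]) ht
  rw [formTensor_tmul]
  by_cases h1 : φ' = -φ
  · have h2 : ψ + ψ' ≠ 0 := fun h2 => h ⟨h1, (neg_eq_of_add_eq_zero_right h2).symm⟩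
    rw [kmForm_degree hV h2 hy hb, mul_zero]
  · have h2 : φ + φ' ≠ 0 := fun h2 => h1 (neg_eq_of_add_eq_zero_right h2).symm
    rw [kmForm_degree hV h2 hx ha, zero_mul]

/-- A tensor of bidegree `(φ, ψ)` is determined by its pairings with the elements of the
opposite degrees. -/
lemma tensor_ext {φ ψ : funX V} {s t : ContKM V k ⊗[k] ContKM V k}
    (hs : s ∈ LinearMap.range (TensorProduct.mapIncl (comp V k φ) (comp V k ψ)))
    (ht : t ∈ LinearMap.range (TensorProduct.mapIncl (comp V k φ) (comp V k ψ)))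
    (h : ∀ a ∈ comp V k (-φ), ∀ b ∈ comp V k (-ψ), formTensor hV a b s = formTensor hV a b t) :
    s = t := by
  rw [← sub_eq_zero]
  refine tensor_eq_zero (flip_nondegenerate hV) (flip_nondegenerate hV) fun a b => ?_
  change formTensor hV a b (s - t) = 0
  induction a using comp_induction with
  | add a a' ha ha' => rw [formTensor_add_left, ha, ha', add_zero]
  | homog φ' a ha =>
    induction b using comp_induction with
    | add b b' hb hb' => rw [formTensor_add_right, hb, hb', add_zero]
    | homog ψ' b hb =>
      by_cases hd : φ' = -φ ∧ ψ' = -ψ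
      · obtain ⟨rfl, rfl⟩ := hd
        rw [map_sub, h a ha b hb, sub_self]
      · exact formTensor_eq_zero hV (sub_mem hs ht) ha hb hd

/-- The invariance of the form, on tensors. -/
lemma formTensor_rTensor_ad (x a b : ContKM V k) (t : ContKM V k ⊗[k] ContKM V k) :
    formTensor hV a b (LinearMap.rTensor _ (LieAlgebra.ad k (ContKM V k) x) t) =
      -formTensor hV ⁅x, a⁆ b t := by
  rw [formTensor, tensorForm_rTensor]
  induction t with
  | zero => simp
  | add s s' hs hs' =>
    rw [map_add, hs, hs', map_add]
    ring
  | tmul y z =>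
    simp only [tensorForm_tmul, LinearMap.comp_apply, LieAlgebra.ad_apply,
      LinearMap.BilinForm.flip_apply, kmForm_lie_left, neg_mul]

lemma formTensor_lTensor_ad (x a b : ContKM V k) (t : ContKM V k ⊗[k] ContKM V k) :
    formTensor hV a b (LinearMap.lTensor _ (LieAlgebra.ad k (ContKM V k) x) t) =
      -formTensor hV a ⁅x, b⁆ t := by
  rw [formTensor, tensorForm_lTensor]
  induction t with
  | zero => simp
  | add s s' hs hs' =>
    rw [map_add, hs, hs', map_add]
    ring
  | tmul y z =>
    simp only [tensorForm_tmul, LinearMap.comp_apply, LieAlgebra.ad_apply,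
      LinearMap.BilinForm.flip_apply, kmForm_lie_left, mul_neg]

lemma formTensor_adAct (χ : funX V) (x a b : ContKM V k)
    (t : funX V → funX V → ContKM V k ⊗[k] ContKM V k) (φ ψ : funX V) :
    formTensor hV a b (adAct k χ x t φ ψ) =
      -formTensor hV ⁅x, a⁆ b (t (φ - χ) ψ) - formTensor hV a ⁅x, b⁆ (t φ (ψ - χ)) := by
  rw [adAct, map_add, formTensor_rTensor_ad, formTensor_lTensor_ad, ← sub_eq_add_neg]

omit [T2Space X] [CharZero k] in
lemma adAct_mem {χ : funX V} {x : ContKM V k} (hx : x ∈ comp V k χ)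
    {t : funX V → funX V → ContKM V k ⊗[k] ContKM V k}
    (ht : ∀ φ ψ, t φ ψ ∈ LinearMap.range (TensorProduct.mapIncl (comp V k φ) (comp V k ψ)))
    (φ ψ : funX V) :
    adAct k χ x t φ ψ ∈ LinearMap.range (TensorProduct.mapIncl (comp V k φ) (comp V k ψ)) := by
  refine add_mem (map_mem_range_mapIncl _ (fun y hy z hz => ?_) (ht _ _))
    (map_mem_range_mapIncl _ (fun y hy z hz => ?_) (ht _ _))
  · rw [LinearMap.rTensor_tmul]
    refine tmul_mem_range ?_ hz
    have := comp_lie hx hy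
    rwa [add_sub_cancel] at this
  · rw [LinearMap.lTensor_tmul]
    refine tmul_mem_range hy ?_
    have := comp_lie hx hz
    rwa [add_sub_cancel] at this

end FormTensor

/-! ### The cobracket on generators -/

section Wedge

variable {X : Type u} [TopologicalSpace X] {V : VertexSpace X} {k : Type v} [Field k]

lemma wedge_of_ne {φ₀ ψ₀ φ ψ : funX V} (x y : ContKM V k) (h : ¬(φ = φ₀ ∧ ψ = ψ₀))
    (h' : ¬(φ = ψ₀ ∧ ψ = φ₀)) : wedge k φ₀ ψ₀ x y φ ψ = 0 := by
  rw [wedge, if_neg h, if_neg h', sub_zero, smul_zero]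

lemma wedge_left {φ ψ : funX V} (h : φ ≠ ψ) (x y : ContKM V k) :
    wedge k φ ψ x y φ ψ = (2⁻¹ : k) • x ⊗ₜ[k] y := by
  rw [wedge, if_pos ⟨rfl, rfl⟩, if_neg fun h' => h h'.1, sub_zero]

lemma wedge_right {φ ψ : funX V} (h : φ ≠ ψ) (x y : ContKM V k) :
    wedge k φ ψ x y ψ φ = -((2⁻¹ : k) • y ⊗ₜ[k] x) := by
  rw [wedge, if_neg fun h' => h h'.2, if_pos ⟨rfl, rfl⟩, zero_sub, smul_neg]

/-- A coordinate of the bracket of two elements vanishes if no pair of basis elements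
contributes. -/
lemma nb_apply_eq_zero {z z' : Interval V →₀ k} {α : Interval V}
    (h : ∀ β γ, IsSum β γ α → z β * z' γ = 0) : nb k z z' α = 0 := by
  have h1 : nb k z z' = z.sum fun β a => a • z'.sum fun γ b => b • nbBasis k β γ := by
    rw [nb, Finsupp.linearCombination_apply, Finsupp.sum, LinearMap.sum_apply]
    rfl
  rw [h1, Finsupp.sum, Finset.sum_apply']
  refine Finset.sum_eq_zero fun β _ => ?_
  rw [Finsupp.smul_apply, Finsupp.sum, Finset.sum_apply', Finset.smul_sum]
  refine Finset.sum_eq_zero fun γ _ => ?_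
  rw [Finsupp.smul_apply, smul_smul]
  by_cases hs : ∃ δ, IsSum β γ δ
  · obtain ⟨δ, hδ⟩ := hs
    rw [nbBasis_of_isSum hδ]
    by_cases hα : δ = α
    · subst hα
      rw [h β γ hδ, zero_smul]
    · rw [Finsupp.single_eq_of_ne (Ne.symm hα), smul_zero]
  · rw [nbBasis_of_not hs, Finsupp.zero_apply, smul_zero]

end Wedge

section Generators

variable {X : Type u} [TopologicalSpace X] {V : VertexSpace X}
variable {k : Type v} [Field k]

/-- The proposed value of the cobracket on the generator `x α` of degree `d α`, where `x` is
one of the families `x⁺` and `x⁻`. -/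
def genDelta (d : Interval V → funX V) (x : Interval V → ContKM V k) (α : Interval V) :
    funX V → funX V → ContKM V k ⊗[k] ContKM V k := fun φ ψ =>
  wedge k 0 (d α) (xi k α) (x α) φ ψ +
    ∑ᶠ p ∈ {p : Interval V × Interval V | IsSum p.1 p.2 α},
      (ca p.1 α : k) • wedge k (d p.1) (d p.2) (x p.1) (x p.2) φ ψ

variable {d : Interval V → funX V} {x : Interval V → ContKM V k}

/-- The two orders of a decomposition `β ⊕ γ = α` contribute the same, since `ω` is antisymmetric;
this cancels the factor `1 / 2` in `∧`. -/
lemma finsum_wedge_of_isSum [T2Space X] [CharZero k] (hd : Function.Injective d)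
    {α β γ : Interval V} (h : IsSum β γ α) :
    ∑ᶠ p ∈ {p : Interval V × Interval V | IsSum p.1 p.2 α},
      (ca p.1 α : k) • wedge k (d p.1) (d p.2) (x p.1) (x p.2) (d β) (d γ) =
        (om β γ : k) • x β ⊗ₜ[k] x γ := by
  have hne : d β ≠ d γ := hd.ne h.ne
  rw [finsum_mem_inter_support_eq' _ _ {(β, γ), (γ, β)}]
  · rw [finsum_mem_pair fun h' => h.ne (congrArg Prod.fst h'), wedge_left hne,
      wedge_right hne.symm, (ca_of_isSum h).1, (ca_of_isSum h.symm).1, om_swap β γ, Int.cast_neg,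
      neg_smul, smul_neg, neg_neg, ← smul_add, ← add_smul]
    norm_num
  · rintro ⟨β', γ'⟩ hp
    have h1 : (d β = d β' ∧ d γ = d γ') ∨ (d β = d γ' ∧ d γ = d β') := by
      by_contra! h'
      refine hp ?_
      change (ca β' α : k) • wedge k (d β') (d γ') (x β') (x γ') (d β) (d γ) = 0
      rw [wedge_of_ne _ _ (fun h1 => h'.1 h1.1 h1.2) fun h1 => h'.2 h1.1 h1.2, smul_zero]
    rcases h1 with ⟨h1, h2⟩ | ⟨h1, h2⟩
    · obtain rfl := hd h1
      obtain rfl := hd h2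
      exact iff_of_true h (Or.inl rfl)
    · obtain rfl := hd h1
      obtain rfl := hd h2
      exact iff_of_true h.symm (Or.inr rfl)

lemma finsum_wedge_of_not {α : Interval V} {φ ψ : funX V}
    (h : ¬∃ β γ, IsSum β γ α ∧ φ = d β ∧ ψ = d γ) :
    ∑ᶠ p ∈ {p : Interval V × Interval V | IsSum p.1 p.2 α},
      (ca p.1 α : k) • wedge k (d p.1) (d p.2) (x p.1) (x p.2) φ ψ = 0 := by
  refine finsum_mem_eq_zero_of_forall_eq_zero fun p hp => ?_
  rw [wedge_of_ne _ _ (fun h' => h ⟨p.1, p.2, hp, h'⟩) fun h' => h ⟨p.2, p.1, hp.symm, h'⟩,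
    smul_zero]

end Generators

section Delta

variable {X : Type u} [TopologicalSpace X] [T2Space X] {V : VertexSpace X}
variable {k : Type v} [Field k] [CharZero k] (hV : EulerNondegenerate V)

/-- The family `t` of tensors, with `t φ ψ` of bidegree `(φ, ψ)`, represents the linear form
`a ⊗ b ↦ (x, {a, b})`. -/
structure Represents (x : ContKM V k) (t : funX V → funX V → ContKM V k ⊗[k] ContKM V k) :
    Prop where
  mem : ∀ φ ψ, t φ ψ ∈ LinearMap.range (TensorProduct.mapIncl (comp V k φ) (comp V k ψ))
  form : ∀ φ ψ, ∀ a ∈ comp V k (-φ), ∀ b ∈ comp V k (-ψ),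
    formTensor hV a b (t φ ψ) = kmForm k hV x (rBracket hV a b)

variable {hV}

namespace Represents

lemma unique {x : ContKM V k} {s t : funX V → funX V → ContKM V k ⊗[k] ContKM V k}
    (hs : Represents hV x s) (ht : Represents hV x t) : s = t := by
  funext φ ψ
  exact tensor_ext hV (hs.mem φ ψ) (ht.mem φ ψ) fun a ha b hb =>
    (hs.form φ ψ a ha b hb).trans (ht.form φ ψ a ha b hb).symm

lemma zero : Represents hV (0 : ContKM V k) 0 where
  mem φ ψ := zero_mem _
  form φ ψ a _ b _ := by simp

lemma add {x y : ContKM V k} {s t : funX V → funX V → ContKM V k ⊗[k] ContKM V k}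
    (hs : Represents hV x s) (ht : Represents hV y t) : Represents hV (x + y) (s + t) where
  mem φ ψ := add_mem (hs.mem φ ψ) (ht.mem φ ψ)
  form φ ψ a ha b hb := by
    rw [map_add, LinearMap.add_apply, ← hs.form φ ψ a ha b hb, ← ht.form φ ψ a ha b hb, ← map_add]
    rfl

lemma smul {x : ContKM V k} {t : funX V → funX V → ContKM V k ⊗[k] ContKM V k} (c : k)
    (ht : Represents hV x t) : Represents hV (c • x) (c • t) where
  mem φ ψ := Submodule.smul_mem _ _ (ht.mem φ ψ)
  form φ ψ a ha b hb := by
    rw [map_smul, LinearMap.smul_apply, ← ht.form φ ψ a ha b hb, ← map_smul]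
    rfl

/-- The cocycle condition. -/
lemma lie {χ χ' : funX V} {x y : ContKM V k} (hx : x ∈ comp V k χ) (hy : y ∈ comp V k χ')
    {s t : funX V → funX V → ContKM V k ⊗[k] ContKM V k} (hs : Represents hV x s)
    (ht : Represents hV y t) :
    Represents hV ⁅x, y⁆ (adAct k χ x t - adAct k χ' y s) where
  mem φ ψ := sub_mem (adAct_mem hx ht.mem φ ψ) (adAct_mem hy hs.mem φ ψ)
  form φ ψ a ha b hb := by
    have e : ∀ φ χ : funX V, χ + -φ = -(φ - χ) := fun φ χ => by abel
    have h1 := comp_lie hx ha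
    have h2 := comp_lie hx hb
    have h3 := comp_lie hy ha
    have h4 := comp_lie hy hb
    rw [kmForm_lie_rBracket hV hx hy ha hb]
    rw [e] at h1 h2 h3 h4
    rw [← ht.form _ _ _ h1 _ hb, ← ht.form _ _ _ ha _ h2, ← hs.form _ _ _ h3 _ hb,
      ← hs.form _ _ _ ha _ h4]
    change formTensor hV a b (adAct k χ x t φ ψ - adAct k χ' y s φ ψ) = _
    rw [map_sub, formTensor_adAct, formTensor_adAct]
    ring

lemma degree {χ : funX V} {x : ContKM V k} (hx : x ∈ comp V k χ)
    {t : funX V → funX V → ContKM V k ⊗[k] ContKM V k} (ht : Represents hV x t) {φ ψ : funX V}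
    (h : φ + ψ ≠ χ) : t φ ψ = 0 := by
  refine tensor_ext hV (ht.mem φ ψ) (zero_mem _) fun a ha b hb => ?_
  rw [ht.form φ ψ a ha b hb, map_zero]
  refine kmForm_degree hV (fun h' => h ?_) hx (rBracket_mem hV ha hb)
  have h1 : χ - (φ + ψ) = 0 := by
    rw [← h']
    abel
  exact (sub_eq_zero.1 h1).symm

lemma mem_complTensor {χ : funX V} {x : ContKM V k} (hx : x ∈ comp V k χ)
    {t : funX V → funX V → ContKM V k ⊗[k] ContKM V k} (ht : Represents hV x t) :
    t ∈ ComplTensor V k := by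
  refine ⟨ht.mem, (Set.finite_singleton χ).subset ?_⟩
  rintro χ' ⟨φ, ψ, rfl, hne⟩
  by_contra h
  exact hne (ht.degree hx h)

/-- The generators of degree zero are represented by zero, since `halfSign` is odd. -/
lemma cartan (f : funX V) : Represents hV (kmGen V k (.cartan f)) 0 where
  mem φ ψ := zero_mem _
  form φ ψ a ha b hb := by
    change formTensor hV a b 0 = _
    rw [map_zero]
    by_cases h : φ + ψ = 0
    · rw [rBracket_apply hV ha hb, eq_neg_of_add_eq_zero_left h, halfSign_neg, halfSign_neg,
        neg_neg, add_neg_cancel, zero_smul, map_zero]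
    · refine (kmForm_degree hV (fun h' => h ?_) (homog_gen (.cartan f))
        (rBracket_mem hV ha hb)).symm
      change 0 + (-φ + -ψ) = 0 at h'
      rw [← neg_eq_zero, ← h']
      abel

end Represents

variable (hV) in
/-- The common properties of the families `x⁺` and `x⁻`: here `d` is the degree, and `e = ± 1 / 2`
is half the sign. -/
structure IsSignedFamily (d : Interval V → funX V) (x : Interval V → ContKM V k) (e : k) :
    Prop where
  injective : Function.Injective d
  mem : ∀ α, x α ∈ comp V k (d α)
  sign : ∀ α, halfSign k (d α) = e
  sq : e * e = 4⁻¹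
  weight : ∀ f α, e * (eulerSym V f (d α) : k) = 2⁻¹ * kmForm k hV (xi k α) (kmGen V k (.cartan f))
  bracket : ∀ φ ψ, halfSign k φ = e → halfSign k ψ = e → ∀ a ∈ comp V k (-φ), ∀ b ∈ comp V k (-ψ),
    ∃ z z' : Interval V →₀ k, (∀ β, kmForm k hV (x β) a = -(2 * e) * z β) ∧
      (∀ β, kmForm k hV (x β) b = -(2 * e) * z' β) ∧
      ∀ α, kmForm k hV (x α) ⁅a, b⁆ = -(2 * e) * nb k z z' α

omit [T2Space X] in
lemma halfSign_eq {φ : funX V} (h : halfSign k φ = 2⁻¹) : Pos φ := by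
  by_contra hp
  rw [halfSign, if_neg hp] at h
  split_ifs at h
  · have h1 : (2⁻¹ : k) + 2⁻¹ = 0 := by
      nth_rewrite 1 [← h]
      exact neg_add_cancel _
    norm_num at h1
  · norm_num at h

variable (hV k) in
lemma isSignedFamily_pos : IsSignedFamily hV cf (xp k : Interval V → ContKM V k) 2⁻¹ where
  injective := cf_injective
  mem := xp_mem
  sign α := halfSign_pos (pos_cf α)
  sq := by norm_num
  weight f α := by
    rw [kmForm_symm, xi, kmForm_gen]
    exact congrArg _ (nu_cartan _ _).symm
  bracket φ ψ hφ hψ a ha b hb := by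
    obtain ⟨z, z', h1, h2, h3⟩ := kmForm_pos_lie hV (φ := -φ) (ψ := -ψ)
      (by rw [neg_neg]; exact halfSign_eq hφ) (by rw [neg_neg]; exact halfSign_eq hψ) ha hb
    refine ⟨z, z', fun β => ?_, fun β => ?_, fun α => ?_⟩
    · rw [h1]
      ring
    · rw [h2]
      ring
    · rw [h3]
      ring

variable (hV k) in
lemma isSignedFamily_neg :
    IsSignedFamily hV (fun α => -cf α) (xm k : Interval V → ContKM V k) (-2⁻¹) where
  injective := neg_injective.comp cf_injective
  mem := xm_mem
  sign α := by rw [halfSign_neg, halfSign_pos (pos_cf α)]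
  sq := by norm_num
  weight f α := by
    rw [kmForm_symm, xi, kmForm_gen, eulerSym_neg_right, Int.cast_neg, neg_mul_neg]
    exact congrArg _ (nu_cartan _ _).symm
  bracket φ ψ hφ hψ a ha b hb := by
    obtain ⟨z, z', h1, h2, h3⟩ := kmForm_neg_lie hV (φ := -φ) (ψ := -ψ)
      (halfSign_eq (k := k) (by rw [halfSign_neg, hφ, neg_neg]))
      (halfSign_eq (k := k) (by rw [halfSign_neg, hψ, neg_neg])) ha hb
    refine ⟨z, z', fun β => ?_, fun β => ?_, fun α => ?_⟩
    · rw [h1]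
      ring
    · rw [h2]
      ring
    · rw [h3]
      ring

namespace IsSignedFamily

variable {d : Interval V → funX V} {x : Interval V → ContKM V k} {e : k}

lemma ne_zero (h : IsSignedFamily hV d x e) (α : Interval V) : d α ≠ 0 := by
  intro h0
  have h1 := h.sq
  rw [← h.sign α, h0, halfSign_zero] at h1
  norm_num at h1

lemma form_eq_zero (h : IsSignedFamily hV d x e) {α : Interval V} {φ : funX V} {a : ContKM V k}
    (ha : a ∈ comp V k (-φ)) (hne : d α ≠ φ) : kmForm k hV (x α) a = 0 :=
  kmForm_degree hV (fun h' => hne (add_neg_eq_zero.1 h')) (h.mem α) ha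

lemma coeff_ne_zero (h : IsSignedFamily hV d x e) : -(2 * e) ≠ 0 := by
  intro h0
  have h1 : e = 0 := by simpa using h0
  have h2 := h.sq
  rw [h1] at h2
  norm_num at h2

/-- The bracket of elements of degrees opposite to those of `x β` and `x γ`. -/
lemma form_lie_of_isSum (h : IsSignedFamily hV d x e) {α β γ : Interval V} (hs : IsSum β γ α)
    {a b : ContKM V k} (ha : a ∈ comp V k (-d β)) (hb : b ∈ comp V k (-d γ)) :
    -(2 * e) * kmForm k hV (x α) ⁅a, b⁆ =
      (om β γ : k) * (kmForm k hV (x β) a * kmForm k hV (x γ) b) := by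
  obtain ⟨z, z', h1, h2, h3⟩ := h.bracket _ _ (h.sign β) (h.sign γ) a ha b hb
  have hz : ∀ β', β' ≠ β → z β' = 0 := by
    intro β' hβ
    have h4 := h1 β'
    rw [h.form_eq_zero ha (h.injective.ne hβ)] at h4
    exact (mul_eq_zero.1 h4.symm).resolve_left h.coeff_ne_zero
  have hz' : ∀ γ', γ' ≠ γ → z' γ' = 0 := by
    intro γ' hγ
    have h4 := h2 γ'
    rw [h.form_eq_zero hb (h.injective.ne hγ)] at h4
    exact (mul_eq_zero.1 h4.symm).resolve_left h.coeff_ne_zero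
  have e1 : z = Finsupp.single β (z β) := by
    ext β'
    by_cases hβ : β' = β
    · rw [hβ, Finsupp.single_eq_same]
    · rw [hz β' hβ, Finsupp.single_eq_of_ne hβ]
  have e2 : z' = Finsupp.single γ (z' γ) := by
    ext γ'
    by_cases hγ : γ' = γ
    · rw [hγ, Finsupp.single_eq_same]
    · rw [hz' γ' hγ, Finsupp.single_eq_of_ne hγ]
  have e3 : nb k z z' α = z β * z' γ * om β γ := by
    rw [e1, e2, nb_single, nbBasis_of_isSum hs]
    simp
  rw [h1, h2, h3, e3]
  ring

lemma form_lie_of_not (h : IsSignedFamily hV d x e) {α : Interval V} {φ ψ : funX V}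
    (hφ : halfSign k φ = e) (hψ : halfSign k ψ = e)
    (hs : ¬∃ β γ, IsSum β γ α ∧ φ = d β ∧ ψ = d γ) {a b : ContKM V k} (ha : a ∈ comp V k (-φ))
    (hb : b ∈ comp V k (-ψ)) : kmForm k hV (x α) ⁅a, b⁆ = 0 := by
  obtain ⟨z, z', h1, h2, h3⟩ := h.bracket _ _ hφ hψ a ha b hb
  rw [h3, nb_apply_eq_zero, mul_zero]
  intro β γ hβγ
  by_cases hβ : φ = d β
  · have hγ : d γ ≠ ψ := fun hγ => hs ⟨β, γ, hβγ, hβ, hγ.symm⟩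
    have h4 := h2 γ
    rw [h.form_eq_zero hb hγ] at h4
    rw [(mul_eq_zero.1 h4.symm).resolve_left h.coeff_ne_zero, mul_zero]
  · have h4 := h1 β
    rw [h.form_eq_zero ha (Ne.symm hβ)] at h4
    rw [(mul_eq_zero.1 h4.symm).resolve_left h.coeff_ne_zero, zero_mul]

/-- The pairing with a bracket with an element of the Cartan subalgebra. -/
lemma form_lie_cartan (h : IsSignedFamily hV d x e) (α : Interval V) {a b : ContKM V k}
    (ha : a ∈ comp V k 0) (hb : b ∈ comp V k (-d α)) :
    -e * kmForm k hV (x α) ⁅a, b⁆ = 2⁻¹ * (kmForm k hV (xi k α) a * kmForm k hV (x α) b) := by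
  rw [comp_zero hV] at ha
  induction ha using Submodule.span_induction with
  | mem a ha =>
    obtain ⟨f, rfl⟩ := ha
    change -e * kmForm k hV (x α) ⁅kmGen V k (.cartan f), b⁆ = 2⁻¹ *
      (kmForm k hV (xi k α) (kmGen V k (.cartan f)) * kmForm k hV (x α) b)
    rw [comp_weight f hb, map_smul, smul_eq_mul, ← mul_assoc, ← mul_assoc, ← h.weight,
      eulerSym_neg_right, Int.cast_neg, neg_mul_neg]
  | zero => simp
  | add a a' _ _ ha ha' =>
    rw [add_lie, map_add, map_add, mul_add, ha, ha']
    ring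
  | smul c a _ ha =>
    rw [smul_lie, map_smul, map_smul, smul_eq_mul, smul_eq_mul, mul_left_comm, ha]
    ring

/-- The formula for the cobracket on the generators represents the dual of the bracket
`{a, b}`. -/
lemma represents (h : IsSignedFamily hV d x e) (α : Interval V) :
    Represents hV (x α) (genDelta d x α) := by
  have h0 := h.ne_zero α
  have hdd : ∀ β, halfSign k (d β) ≠ 0 := fun β h' => by
    have h1 := h.sq
    rw [← h.sign β, h'] at h1
    norm_num at h1
  have key : ∀ φ ψ, genDelta d x α φ ψ ∈
      LinearMap.range (TensorProduct.mapIncl (comp V k φ) (comp V k ψ)) ∧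
      ∀ a ∈ comp V k (-φ), ∀ b ∈ comp V k (-ψ),
        formTensor hV a b (genDelta d x α φ ψ) = kmForm k hV (x α) (rBracket hV a b) := by
    intro φ ψ
    by_cases h1 : φ = 0 ∧ ψ = d α
    · obtain ⟨rfl, rfl⟩ := h1
      have hg : genDelta d x α 0 (d α) = (2⁻¹ : k) • xi k α ⊗ₜ[k] x α := by
        rw [genDelta, wedge_left h0.symm, finsum_wedge_of_not, add_zero]
        rintro ⟨β, γ, -, hβ, -⟩
        exact h.ne_zero β hβ.symm
      rw [hg]
      refine ⟨Submodule.smul_mem _ _ (tmul_mem_range (xi_mem α) (h.mem α)), fun a ha b hb => ?_⟩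
      rw [rBracket_apply hV ha hb, halfSign_neg, halfSign_neg, halfSign_zero, h.sign, neg_zero,
        zero_add, map_smul, map_smul, formTensor_tmul, smul_eq_mul, smul_eq_mul]
      rw [neg_zero] at ha
      exact (h.form_lie_cartan α ha hb).symm
    by_cases h2 : φ = d α ∧ ψ = 0
    · obtain ⟨rfl, rfl⟩ := h2
      have hg : genDelta d x α (d α) 0 = -((2⁻¹ : k) • x α ⊗ₜ[k] xi k α) := by
        rw [genDelta, wedge_right h0.symm, finsum_wedge_of_not, add_zero]
        rintro ⟨β, γ, -, -, hγ⟩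
        exact h.ne_zero γ hγ.symm
      rw [hg]
      refine ⟨neg_mem (Submodule.smul_mem _ _ (tmul_mem_range (h.mem α) (xi_mem α))),
        fun a ha b hb => ?_⟩
      rw [rBracket_apply hV ha hb, halfSign_neg, halfSign_neg, halfSign_zero, h.sign, neg_zero,
        add_zero, map_smul, map_neg, map_smul, formTensor_tmul, smul_eq_mul, smul_eq_mul]
      rw [neg_zero] at hb
      rw [← lie_skew, map_neg, mul_neg, h.form_lie_cartan α hb ha,
        mul_comm (kmForm k hV (x α) a)]
    have hw : wedge k 0 (d α) (xi k α) (x α) φ ψ = 0 := wedge_of_ne _ _ h1 h2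
    by_cases h3 : ∃ β γ, IsSum β γ α ∧ φ = d β ∧ ψ = d γ
    · obtain ⟨β, γ, hs, rfl, rfl⟩ := h3
      have hg : genDelta d x α (d β) (d γ) = (om β γ : k) • x β ⊗ₜ[k] x γ := by
        rw [genDelta, hw, zero_add, finsum_wedge_of_isSum h.injective hs]
      rw [hg]
      refine ⟨Submodule.smul_mem _ _ (tmul_mem_range (h.mem β) (h.mem γ)), fun a ha b hb => ?_⟩
      rw [rBracket_apply hV ha hb, halfSign_neg, halfSign_neg, h.sign, h.sign, map_smul, map_smul,
        formTensor_tmul, smul_eq_mul, smul_eq_mul, ← h.form_lie_of_isSum hs ha hb]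
      ring
    · have hg : genDelta d x α φ ψ = 0 := by
        rw [genDelta, hw, zero_add, finsum_wedge_of_not h3]
      rw [hg]
      refine ⟨zero_mem _, fun a ha b hb => ?_⟩
      rw [map_zero, rBracket_apply hV ha hb, map_smul, smul_eq_mul]
      -- only pairs of degrees with the same sign as `d α` could contribute
      by_cases ha0 : a = 0
      · rw [ha0, zero_lie, map_zero, mul_zero]
      by_cases hb0 : b = 0
      · rw [hb0, lie_zero, map_zero, mul_zero]
      by_cases hd : d α + (-φ + -ψ) = 0
      swap
      · rw [kmForm_degree hV hd (h.mem α) (comp_lie ha hb), mul_zero]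
      by_cases hsg : halfSign k (-φ) + halfSign k (-ψ) = 0
      · rw [hsg, zero_mul]
      have hd' : d α = φ + ψ := by
        rw [← sub_eq_zero, ← hd]
        abel
      have hsame : halfSign k φ = e ∧ halfSign k ψ = e := by
        rcases halfSign_add_ne_zero (signed_of_mem hV ha ha0) (signed_of_mem hV hb hb0) hsg with
          h4 | h4 | ⟨h4, h5⟩ | ⟨h4, h5⟩
        · rw [neg_eq_zero] at h4
          exact absurd ⟨h4, by rw [hd', h4, zero_add]⟩ h1
        · rw [neg_eq_zero] at h4
          exact absurd ⟨by rw [hd', h4, add_zero], h4⟩ h2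
        · have h6 := h.sign α
          rw [hd', halfSign_of_neg (h4.neg_add h5)] at h6
          rw [halfSign_of_neg h4, halfSign_of_neg h5]
          exact ⟨h6, h6⟩
        · rw [neg_neg] at h4 h5
          have h6 := h.sign α
          rw [hd', halfSign_pos (h4.add h5.1)] at h6
          rw [halfSign_pos h4, halfSign_pos h5]
          exact ⟨h6, h6⟩
      rw [h.form_lie_of_not hsame.1 hsame.2 h3 ha hb, mul_zero]
  exact ⟨fun φ ψ => (key φ ψ).1, fun φ ψ => (key φ ψ).2⟩

end IsSignedFamily

/-! ### The cobracket -/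

variable (hV)

lemma exists_represents_of_isMonomial {φ : funX V} {x : ContKM V k}
    (hx : IsMonomial (kmGen V k) φ x) : ∃ t, Represents hV x t := by
  induction hx with
  | gen g =>
    cases g with
    | cartan f => exact ⟨_, Represents.cartan f⟩
    | pos α => exact ⟨_, (isSignedFamily_pos k hV).represents α⟩
    | neg α => exact ⟨_, (isSignedFamily_neg k hV).represents α⟩
  | lie hx hy ihx ihy =>
    obtain ⟨s, hs⟩ := ihx
    obtain ⟨t, ht⟩ := ihy
    exact ⟨_, Represents.lie (Submodule.subset_span hx) (Submodule.subset_span hy) hs ht⟩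

lemma exists_represents (x : ContKM V k) : ∃ t ∈ ComplTensor V k, Represents hV x t := by
  induction x using comp_induction with
  | add x y hx hy =>
    obtain ⟨s, hs, hs'⟩ := hx
    obtain ⟨t, ht, ht'⟩ := hy
    exact ⟨s + t, add_mem hs ht, hs'.add ht'⟩
  | homog φ x hx =>
    suffices h : ∃ t, Represents hV x t by
      obtain ⟨t, ht⟩ := h
      exact ⟨t, ht.mem_complTensor hx, ht⟩
    induction hx using Submodule.span_induction with
    | mem x hx => exact exists_represents_of_isMonomial hV hx
    | zero => exact ⟨0, Represents.zero⟩
    | add x y _ _ hx hy =>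
      obtain ⟨s, hs⟩ := hx
      obtain ⟨t, ht⟩ := hy
      exact ⟨_, hs.add ht⟩
    | smul c x _ hx =>
      obtain ⟨t, ht⟩ := hx
      exact ⟨_, ht.smul c⟩

/-- The cobracket of the continuum Kac–Moody algebra: it is dual to the bracket `{a, b}` with
respect to the invariant form. -/
def cobracket : ContKM V k →ₗ[k] ComplTensor V k where
  toFun x := ⟨(exists_represents hV x).choose, (exists_represents hV x).choose_spec.1⟩
  map_add' x y := Subtype.ext <| (exists_represents hV (x + y)).choose_spec.2.unique
    ((exists_represents hV x).choose_spec.2.add (exists_represents hV y).choose_spec.2)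
  map_smul' c x := Subtype.ext <| (exists_represents hV (c • x)).choose_spec.2.unique
    ((exists_represents hV x).choose_spec.2.smul c)

lemma represents_cobracket (x : ContKM V k) : Represents hV x (cobracket hV x).1 :=
  (exists_represents hV x).choose_spec.2

lemma hasGeneratorValues_cobracket : HasGeneratorValues k (cobracket (k := k) hV) where
  on_cartan α := Subtype.ext ((represents_cobracket hV _).unique (Represents.cartan (cf α)))
  on_pos α φ ψ := congrFun (congrFun ((represents_cobracket hV _).unique
    ((isSignedFamily_pos k hV).represents α)) φ) ψ
  on_neg α φ ψ := congrFun (congrFun ((represents_cobracket hV _).unique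
    ((isSignedFamily_neg k hV).represents α)) φ) ψ

lemma isCocycle_cobracket : IsCocycle k (cobracket (k := k) hV) := fun _ _ x hx y hy =>
  (represents_cobracket hV ⁅x, y⁆).unique
    (Represents.lie hx hy (represents_cobracket hV x) (represents_cobracket hV y))

omit [T2Space X] [CharZero k] in
/-- A cocycle is determined by its values on the generators. -/
lemma cocycle_unique {δ δ' : ContKM V k →ₗ[k] ComplTensor V k}
    (h : HasGeneratorValues k δ) (hc : IsCocycle k δ) (h' : HasGeneratorValues k δ')
    (hc' : IsCocycle k δ') : δ' = δ := by
  have hm : ∀ φ x, IsMonomial (kmGen V k) φ x → δ' x = δ x := by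
    intro φ x hx
    induction hx with
    | gen g =>
      cases g with
      | cartan f =>
        exact eq_of_eq_on_xi (F := δ'.toAddMonoidHom) (G := δ.toAddMonoidHom)
          (fun α => (h'.on_cartan α).trans (h.on_cartan α).symm) f
      | pos α =>
        exact Subtype.ext (funext fun φ => funext fun ψ =>
          (h'.on_pos α φ ψ).trans (h.on_pos α φ ψ).symm)
      | neg α =>
        exact Subtype.ext (funext fun φ => funext fun ψ =>
          (h'.on_neg α φ ψ).trans (h.on_neg α φ ψ).symm)
    | lie hx hy ihx ihy =>
      refine Subtype.ext ?_
      rw [hc' _ _ _ (Submodule.subset_span hx) _ (Submodule.subset_span hy),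
        hc _ _ _ (Submodule.subset_span hx) _ (Submodule.subset_span hy), ihx, ihy]
  refine LinearMap.ext fun x => ?_
  induction x using comp_induction with
  | add x y hx hy => rw [map_add, map_add, hx, hy]
  | homog φ x hx =>
    induction hx using Submodule.span_induction with
    | mem x hx => exact hm φ x hx
    | zero => rw [map_zero, map_zero]
    | add x y _ _ hx hy => rw [map_add, map_add, hx, hy]
    | smul c x _ hx => rw [map_smul, map_smul, hx]

open scoped Classical in
/-- The projection to the component of degree `φ`. -/
def proj (φ : funX V) : ContKM V k →ₗ[k] ContKM V k := scale hV fun ψ => if ψ = φ then 1 else 0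

lemma proj_of_mem {φ : funX V} {x : ContKM V k} (hx : x ∈ comp V k φ) : proj hV φ x = x := by
  rw [proj, scale_apply hV _ hx, if_pos rfl, one_smul]

lemma proj_of_ne {φ ψ : funX V} {x : ContKM V k} (hx : x ∈ comp V k ψ) (h : ψ ≠ φ) :
    proj hV φ x = 0 := by
  rw [proj, scale_apply hV _ hx, if_neg h, zero_smul]

lemma proj_mem (φ : funX V) (x : ContKM V k) : proj hV φ x ∈ comp V k φ := by
  induction x using comp_induction with
  | add x y hx hy =>
    rw [map_add]
    exact add_mem hx hy
  | homog ψ x hx =>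
    by_cases h : ψ = φ
    · subst h
      rwa [proj_of_mem hV hx]
    · rw [proj_of_ne hV hx h]
      exact zero_mem _

/-- The cobracket is dual to the bracket `{a, b}`, also for inhomogeneous elements. -/
lemma formTensor_cobracket (x a b : ContKM V k) (φ ψ : funX V) :
    formTensor hV a b ((cobracket hV x).1 φ ψ) =
      kmForm k hV x (rBracket hV (proj hV (-φ) a) (proj hV (-ψ) b)) := by
  have hr := represents_cobracket hV x
  induction a using comp_induction with
  | add a a' ha ha' => rw [formTensor_add_left, map_add, rBracket_add_left, map_add, ha, ha']
  | homog φ' a ha =>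
    induction b using comp_induction with
    | add b b' hb hb' => rw [formTensor_add_right, map_add, rBracket_add_right, map_add, hb, hb']
    | homog ψ' b hb =>
      by_cases h1 : φ' = -φ
      · by_cases h2 : ψ' = -ψ
        · subst h1
          subst h2
          rw [hr.form φ ψ a ha b hb, proj_of_mem hV ha, proj_of_mem hV hb]
        · rw [formTensor_eq_zero hV (hr.mem φ ψ) ha hb fun h => h2 h.2, proj_of_ne hV hb h2,
            rBracket_zero_right, map_zero]
      · rw [formTensor_eq_zero hV (hr.mem φ ψ) ha hb fun h => h1 h.1, proj_of_ne hV ha h1,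
          rBracket_zero_left, map_zero]

lemma cobracket_antisymm (x : ContKM V k) (φ ψ : funX V) :
    (cobracket hV x).1 φ ψ =
      -TensorProduct.comm k (ContKM V k) (ContKM V k) ((cobracket hV x).1 ψ φ) := by
  have hr := represents_cobracket hV x
  refine tensor_ext hV (hr.mem φ ψ) (neg_mem (map_mem_range_mapIncl
    (TensorProduct.comm k (ContKM V k) (ContKM V k)).toLinearMap (fun y hy z hz => ?_)
    (hr.mem ψ φ))) fun a ha b hb => ?_
  · exact tmul_mem_range hz hy
  · rw [map_neg, formTensor, tensorForm_comm, hr.form φ ψ a ha b hb, hr.form ψ φ b hb a ha,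
      rBracket_swap hV a b, map_neg, neg_neg]

/-- The linear form `x ⊗ (y ⊗ z) ↦ (x, a) (y, b) (z, c)`. -/
def formTensor₃ (a b c : ContKM V k) :
    ContKM V k ⊗[k] (ContKM V k ⊗[k] ContKM V k) →ₗ[k] k :=
  LinearMap.mul' k k ∘ₗ TensorProduct.map ((kmForm k hV).flip a) (formTensor hV b c)

lemma formTensor₃_tmul (a b c x y z : ContKM V k) :
    formTensor₃ hV a b c (x ⊗ₜ (y ⊗ₜ z)) =
      kmForm k hV x a * (kmForm k hV y b * kmForm k hV z c) := by
  rw [formTensor₃, LinearMap.comp_apply, TensorProduct.map_tmul, LinearMap.mul'_apply,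
    formTensor_tmul]
  rfl

lemma formTensor₃_cyc (a b c : ContKM V k)
    (t : ContKM V k ⊗[k] (ContKM V k ⊗[k] ContKM V k)) :
    formTensor₃ hV a b c (cyc k t) = formTensor₃ hV b c a t := by
  induction t with
  | zero => simp
  | add s t hs ht => simp only [map_add, hs, ht]
  | tmul x u =>
    induction u with
    | zero => simp
    | add s t hs ht => simp only [TensorProduct.tmul_add, map_add, hs, ht]
    | tmul y z =>
      have h : cyc k (x ⊗ₜ[k] (y ⊗ₜ[k] z)) = z ⊗ₜ[k] (x ⊗ₜ[k] y) := rfl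
      rw [h, formTensor₃_tmul, formTensor₃_tmul]
      ring

lemma formTensor₃_idTensorDelta (x a b c : ContKM V k) (φ₁ φ₂ φ₃ : funX V) :
    formTensor₃ hV a b c (idTensorDelta k (cobracket hV) x φ₁ φ₂ φ₃) =
      kmForm k hV x (rBracket hV (proj hV (-φ₁) a)
        (rBracket hV (proj hV (-φ₂) b) (proj hV (-φ₃) c))) := by
  have h1 : ∀ t : ContKM V k ⊗[k] ContKM V k,
      formTensor₃ hV a b c (LinearMap.lTensor _ (component k (cobracket hV) φ₂ φ₃) t) =
        formTensor hV a (rBracket hV (proj hV (-φ₂) b) (proj hV (-φ₃) c)) t := by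
    intro t
    induction t with
    | zero => simp
    | add s t hs ht => simp only [map_add, hs, ht]
    | tmul y z =>
      rw [formTensor_tmul, ← formTensor_cobracket]
      rfl
  rw [idTensorDelta, h1, formTensor_cobracket, proj_of_mem hV (φ := -(φ₂ + φ₃))]
  have h2 := rBracket_mem hV (proj_mem hV (-φ₂) b) (proj_mem hV (-φ₃) c)
  rwa [← neg_add] at h2

/-- The co-Jacobi identity is dual to the Jacobi identity for the bracket `{a, b}`. -/
lemma cobracket_coJacobi (x : ContKM V k) (φ₁ φ₂ φ₃ : funX V) :
    idTensorDelta k (cobracket hV) x φ₁ φ₂ φ₃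
      + cyc k (idTensorDelta k (cobracket hV) x φ₂ φ₃ φ₁)
      + cyc k (cyc k (idTensorDelta k (cobracket hV) x φ₃ φ₁ φ₂)) = 0 := by
  refine tensor_eq_zero (F := fun a => (kmForm k hV).flip a)
    (G := fun p : ContKM V k × ContKM V k => formTensor hV p.1 p.2) (flip_nondegenerate hV)
    (fun y hy => tensor_eq_zero (flip_nondegenerate hV) (flip_nondegenerate hV)
      fun i j => hy (i, j)) ?_
  rintro a ⟨b, c⟩
  change formTensor₃ hV a b c _ = 0
  rw [map_add, map_add, formTensor₃_cyc, formTensor₃_cyc, formTensor₃_cyc,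
    formTensor₃_idTensorDelta, formTensor₃_idTensorDelta, formTensor₃_idTensorDelta, ← map_add,
    ← map_add, rBracket_jacobi hV (proj_mem hV _ _) (proj_mem hV _ _) (proj_mem hV _ _), map_zero]

lemma isTopLieBialgebra_cobracket : IsTopLieBialgebra k (cobracket (k := k) hV) where
  degree_zero _ x hx _ _ h := (represents_cobracket hV x).degree hx h
  antisymm := cobracket_antisymm hV
  coJacobi := cobracket_coJacobi hV
  cocycle := isCocycle_cobracket hV

/-- The cobracket of an element with degree in `S` has components with degrees in `S`, provided that
`S` contains the summands of each of its elements that can have a non-zero coefficient. -/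
lemma isSubBialgebra_of_degrees {b : LieSubalgebra k (ContKM V k)} {S : Set (funX V)}
    (hb : b.toSubmodule = gsum k (kmGen V k) S)
    (hS : ∀ φ ψ : funX V, Signed φ → Signed ψ → halfSign k φ + halfSign k ψ ≠ 0 → φ + ψ ∈ S →
      φ ∈ S ∧ ψ ∈ S) : IsSubBialgebra k (cobracket hV) b := by
  intro x hx φ ψ
  have hx' : x ∈ gsum k (kmGen V k) S := hb ▸ hx
  refine gsum_induction (P := fun x => (cobracket hV x).1 φ ψ ∈
    LinearMap.range (TensorProduct.mapIncl b.toSubmodule b.toSubmodule)) (fun χ hχ x hx => ?_)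
    ?_ (fun x y hx hy => ?_) hx'
  · have hr := represents_cobracket hV x
    by_cases h : φ ∈ S ∧ ψ ∈ S
    · refine TensorProduct.range_mapIncl_mono ?_ ?_ (hr.mem φ ψ)
      · rw [hb]
        exact homog_le_gsum h.1
      · rw [hb]
        exact homog_le_gsum h.2
    · have h0 : (cobracket hV x).1 φ ψ = 0 := by
        by_cases hd : φ + ψ = χ
        swap
        · exact hr.degree hx hd
        refine tensor_ext hV (hr.mem φ ψ) (zero_mem _) fun a ha b hb => ?_
        rw [hr.form φ ψ a ha b hb, map_zero, rBracket_apply hV ha hb, map_smul, smul_eq_mul]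
        by_cases ha0 : a = 0
        · rw [ha0, zero_lie, map_zero, mul_zero]
        by_cases hb0 : b = 0
        · rw [hb0, lie_zero, map_zero, mul_zero]
        have h1 : halfSign k (-φ) + halfSign k (-ψ) = 0 := by
          by_contra hne
          rw [halfSign_neg, halfSign_neg, ← neg_add, neg_eq_zero] at hne
          have hφ := (signed_of_mem hV ha ha0).neg
          have hψ := (signed_of_mem hV hb hb0).neg
          rw [neg_neg] at hφ hψ
          exact h (hS φ ψ hφ hψ hne (hd ▸ hχ))
        rw [h1, zero_mul]
      rw [h0]
      exact zero_mem _
  · rw [map_zero]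
    exact zero_mem _
  · rw [map_add]
    exact add_mem hx hy

lemma isSubBialgebra_bPos : IsSubBialgebra k (cobracket hV) (bPos V k) := by
  refine isSubBialgebra_of_degrees hV (bPos_eq k hV) fun φ ψ hφ hψ h hs => ?_
  rcases halfSign_add_ne_zero hφ hψ h with rfl | rfl | ⟨h1, h2⟩ | ⟨h1, h2⟩
  · rw [zero_add] at hs
    exact ⟨nonNeg_zero, hs⟩
  · rw [add_zero] at hs
    exact ⟨hs, nonNeg_zero⟩
  · exact ⟨h1.1, h2.1⟩
  · have h3 := h1.neg_add h2
    exact absurd (NonNeg.eq_zero hs h3.1) (neg_ne_zero.1 h3.2)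

lemma isSubBialgebra_bNeg : IsSubBialgebra k (cobracket hV) (bNeg V k) := by
  refine isSubBialgebra_of_degrees hV (bNeg_eq k hV) fun φ ψ hφ hψ h hs => ?_
  rcases halfSign_add_ne_zero hφ hψ h with rfl | rfl | ⟨h1, h2⟩ | ⟨h1, h2⟩
  · rw [zero_add] at hs
    exact ⟨by rw [Set.mem_ofPred_eq, neg_zero]; exact nonNeg_zero, hs⟩
  · rw [add_zero] at hs
    exact ⟨hs, by rw [Set.mem_ofPred_eq, neg_zero]; exact nonNeg_zero⟩
  · have h3 := h1.add h2.1
    exact absurd (NonNeg.eq_zero h3.1 hs) h3.2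
  · exact ⟨h1.1, h2.1⟩

end Delta

/-! ### The pairing of the Borel subalgebras -/

section Coefficients

variable {X : Type u} [TopologicalSpace X] {V : VertexSpace X} (k : Type v) [Field k]

open scoped Classical in
/-- The factor between the invariant form and the pairing `κ` in degree `φ`. -/
def borelCoeff (φ : funX V) : k := if φ = 0 then -2 else if Pos φ then -1 else 0

/-- The factor of the canonical element in degree `φ`; it is inverse to `borelCoeff`. -/
def canonicalCoeff (φ : funX V) : k := -(2⁻¹ + halfSign k φ)

variable {k}

lemma borelCoeff_zero : borelCoeff k (0 : funX V) = -2 := if_pos rfl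

lemma borelCoeff_pos {φ : funX V} (h : Pos φ) : borelCoeff k φ = -1 := by
  rw [borelCoeff, if_neg h.2, if_pos h]

lemma borelCoeff_of_not {φ : funX V} (h : ¬NonNeg φ) : borelCoeff k φ = 0 := by
  rw [nonNeg_iff, not_or] at h
  rw [borelCoeff, if_neg h.1, if_neg h.2]

lemma canonicalCoeff_of_not [CharZero k] {φ : funX V} (h : ¬NonNeg φ) (hs : Signed φ) :
    canonicalCoeff k φ = 0 := by
  rw [nonNeg_iff, not_or] at h
  rw [canonicalCoeff, halfSign_of_neg ((hs.resolve_left h.1).resolve_left h.2), add_neg_cancel,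
    neg_zero]

lemma borelCoeff_mul_canonicalCoeff [CharZero k] {φ : funX V} (h : NonNeg φ) :
    borelCoeff k φ * canonicalCoeff k φ = 1 := by
  rcases nonNeg_iff.1 h with rfl | h
  · rw [borelCoeff_zero, canonicalCoeff, halfSign_zero]
    norm_num
  · rw [borelCoeff_pos h, canonicalCoeff, halfSign_pos h]
    norm_num

/-- The coefficients of `κ` turn the bracket into the bracket `{a, b}`. -/
lemma borelCoeff_add [CharZero k] {φ ψ : funX V} (hφ : NonNeg φ) (hψ : NonNeg ψ)
    (h : ¬(φ = 0 ∧ ψ = 0)) : borelCoeff k (φ + ψ) =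
      -(borelCoeff k φ * borelCoeff k ψ * (halfSign k φ + halfSign k ψ)) := by
  rcases nonNeg_iff.1 hφ with rfl | hφ <;> rcases nonNeg_iff.1 hψ with rfl | hψ
  · exact absurd ⟨rfl, rfl⟩ h
  · rw [zero_add, borelCoeff_zero, borelCoeff_pos hψ, halfSign_zero, halfSign_pos hψ]
    norm_num
  · rw [add_zero, borelCoeff_zero, borelCoeff_pos hφ, halfSign_zero, halfSign_pos hφ]
    norm_num
  · rw [borelCoeff_pos hφ, borelCoeff_pos hψ, borelCoeff_pos (hφ.add hψ.1), halfSign_pos hφ,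
      halfSign_pos hψ]
    norm_num

end Coefficients

section Pairing

variable {X : Type u} [TopologicalSpace X] [T2Space X] {V : VertexSpace X}
variable {k : Type v} [Field k] [CharZero k] (hV : EulerNondegenerate V)

lemma scale_mem_of_signed {S : Set (funX V)} {c : funX V → k}
    (h : ∀ φ ∉ S, Signed φ → c φ = 0) (x : ContKM V k) :
    scale hV c x ∈ gsum k (kmGen V k) S := by
  induction x using comp_induction with
  | add x x' hx hx' =>
    rw [map_add]
    exact add_mem hx hx'
  | homog φ x hx =>
    by_cases hx0 : x = 0
    · rw [hx0, map_zero]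
      exact zero_mem _
    by_cases hφ : φ ∈ S
    · exact homog_le_gsum hφ (scale_mem_comp hV c hx)
    · rw [scale_apply hV c hx, h φ hφ (signed_of_mem hV hx hx0), zero_smul]
      exact zero_mem _

lemma scale_eq_smul {S : Set (funX V)} {c : funX V → k} {a : k} (h : ∀ φ ∈ S, c φ = a)
    {x : ContKM V k} (hx : x ∈ gsum k (kmGen V k) S) : scale hV c x = a • x := by
  refine gsum_induction (P := fun x => scale hV c x = a • x) (fun φ hφ x hx => ?_) (by simp)
    (fun x y hx hy => by rw [map_add, smul_add, hx, hy]) hx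
  rw [scale_apply hV c hx, h φ hφ]

lemma scale_comm (c d : funX V → k) (x : ContKM V k) :
    scale hV c (scale hV d x) = scale hV d (scale hV c x) := by
  rw [scale_scale, scale_scale]
  congr 2
  exact funext fun φ => mul_comm _ _

include hV in
lemma mem_bPos_iff {x : ContKM V k} : x ∈ bPos V k ↔ x ∈ gsum k (kmGen V k) {φ | NonNeg φ} := by
  rw [← bPos_eq k hV]
  rfl

include hV in
lemma mem_bNeg_iff {x : ContKM V k} : x ∈ bNeg V k ↔ x ∈ gsum k (kmGen V k) {φ | NonNeg (-φ)} := by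
  rw [← bNeg_eq k hV]
  rfl

include hV in
lemma mem_nPos_iff {x : ContKM V k} : x ∈ nPos V k ↔ x ∈ gsum k (kmGen V k) {φ | Pos φ} := by
  rw [← nPos_eq k hV]
  rfl

include hV in
lemma mem_nNeg_iff {x : ContKM V k} : x ∈ nNeg V k ↔ x ∈ gsum k (kmGen V k) {φ | Pos (-φ)} := by
  rw [← nNeg_eq k hV]
  rfl

omit [T2Space X] [CharZero k] in
lemma cartan_le_gsum : cartan V k ≤ gsum k (kmGen V k) {0} := fun _ hx =>
  homog_le_gsum (Set.mem_singleton _) (zeroSpan_le_homog hx)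

/-- A sum of components pairs non-degenerately with the sum of the components of opposite
degrees. -/
lemma eq_zero_of_kmForm_gsum {S T : Set (funX V)} (h : ∀ φ ∈ S, -φ ∈ T) {x : ContKM V k}
    (hx : x ∈ gsum k (kmGen V k) S) (h0 : ∀ y ∈ gsum k (kmGen V k) T, kmForm k hV x y = 0) :
    x = 0 := by
  refine kmForm_nondegenerate hV fun y => ?_
  induction y using comp_induction with
  | add y z hy hz => rw [map_add, hy, hz, add_zero]
  | homog ψ y hy =>
    by_cases hψ : ψ ∈ T
    · exact h0 y (homog_le_gsum hψ hy)
    · refine kmForm_gsum hV (T := {ψ}) ?_ hx (homog_le_gsum (Set.mem_singleton _) hy)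
      rintro φ hφ _ rfl h'
      exact hψ (eq_neg_of_add_eq_zero_right h' ▸ h φ hφ)

lemma pairsNondegenerately_kmForm : PairsNondegenerately k (kmForm k hV)
    (bPos V k).toSubmodule (bNeg V k).toSubmodule := by
  rw [bPos_eq k hV, bNeg_eq k hV]
  refine ⟨fun x hx h => eq_zero_of_kmForm_gsum hV (fun φ hφ => ?_) hx h, fun y hy h =>
    eq_zero_of_kmForm_gsum hV (fun φ hφ => hφ) hy fun x hx => ?_⟩
  · rw [Set.mem_ofPred_eq, neg_neg]
    exact hφ
  · rw [kmForm_symm]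
    exact h x hx

/-- The pairing `κ` of the Borel subalgebras, as a form on the whole algebra. -/
def borelForm : LinearMap.BilinForm k (ContKM V k) := kmForm k hV ∘ₗ scale hV (borelCoeff k)

lemma borelForm_apply (x y : ContKM V k) :
    borelForm hV x y = kmForm k hV (scale hV (borelCoeff k) x) y := rfl

lemma scale_borelCoeff_canonicalCoeff {x : ContKM V k} (hx : x ∈ bPos V k) :
    scale hV (borelCoeff k) (scale hV (canonicalCoeff k) x) = x := by
  rw [scale_scale]
  refine (scale_eq_smul hV (a := 1) (fun φ hφ => ?_) ((mem_bPos_iff hV).1 hx)).trans (one_smul _ _)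
  exact borelCoeff_mul_canonicalCoeff hφ

lemma scale_canonicalCoeff_mem_bPos (x : ContKM V k) :
    scale hV (canonicalCoeff k) x ∈ bPos V k := by
  rw [mem_bPos_iff hV]
  exact scale_mem_of_signed hV (fun φ hφ hs => canonicalCoeff_of_not hφ hs) x

lemma isBorelPairing_borelForm : IsBorelPairing k (kmForm k hV) (borelForm hV) where
  cartan_cartan h hh h' _ := by
    rw [borelForm_apply, scale_eq_smul hV (S := {0}) (a := -2) _ (cartan_le_gsum hh), map_smul]
    · rfl
    · rintro _ rfl
      exact borelCoeff_zero
  pos_neg x hx y _ := by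
    rw [borelForm_apply, scale_eq_smul hV (a := -1) _ ((mem_nPos_iff hV).1 hx), neg_one_smul,
      map_neg, LinearMap.neg_apply]
    exact fun φ hφ => borelCoeff_pos hφ
  pos_cartan x hx h hh := by
    refine kmForm_gsum hV ?_ (scale_mem_gsum hV _ ((mem_nPos_iff hV).1 hx)) (cartan_le_gsum hh)
    rintro φ hφ _ rfl
    rw [add_zero]
    exact hφ.2
  cartan_neg h hh y hy := by
    refine kmForm_gsum hV ?_ (scale_mem_gsum hV _ (cartan_le_gsum hh)) ((mem_nNeg_iff hV).1 hy)
    rintro _ rfl φ hφ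
    rw [zero_add]
    exact neg_ne_zero.1 hφ.2
  left_neg y hy z := by
    rw [borelForm_apply, scale_eq_smul hV (a := 0) _ ((mem_nNeg_iff hV).1 hy), zero_smul, map_zero,
      LinearMap.zero_apply]
    intro φ hφ
    exact borelCoeff_of_not fun h => neg_ne_zero.1 hφ.2 (h.eq_zero hφ.1)
  right_pos z x hx := by
    refine kmForm_gsum hV (fun φ hφ ψ hψ => ?_) (scale_mem_of_signed hV
      (S := {φ | NonNeg φ}) (fun φ hφ _ => borelCoeff_of_not hφ) z) ((mem_nPos_iff hV).1 hx)
    rw [add_comm]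
    exact (Pos.add hψ hφ).2

include hV in
lemma mem_nNeg_or_cartan_or_nPos {φ : funX V} {x : ContKM V k} (hx : x ∈ comp V k φ) :
    x ∈ nNeg V k ∨ x ∈ cartan V k ∨ x ∈ nPos V k := by
  rcases comp_trichotomy hV hx with rfl | rfl | h | h
  · exact Or.inl (zero_mem _)
  · rw [comp_zero hV] at hx
    exact Or.inr (Or.inl hx)
  · exact Or.inr (Or.inr ((mem_nPos_iff hV).2 (homog_le_gsum h hx)))
  · exact Or.inl ((mem_nNeg_iff hV).2 (homog_le_gsum (S := {φ : funX V | Pos (-φ)}) h hx))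

include hV in
lemma borelPairing_unique {B κ κ' : LinearMap.BilinForm k (ContKM V k)}
    (h : IsBorelPairing k B κ) (h' : IsBorelPairing k B κ') : κ' = κ := by
  refine LinearMap.ext fun x => LinearMap.ext fun y => ?_
  induction x using comp_induction with
  | add x z hx hz => rw [map_add, map_add, LinearMap.add_apply, LinearMap.add_apply, hx, hz]
  | homog φ x hx =>
    induction y using comp_induction with
    | add y z hy hz => rw [map_add, map_add, hy, hz]
    | homog ψ y hy =>
      rcases mem_nNeg_or_cartan_or_nPos hV hy with hy | hy | hy
      · rcases mem_nNeg_or_cartan_or_nPos hV hx with hx | hx | hx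
        · rw [h.left_neg x hx, h'.left_neg x hx]
        · rw [h.cartan_neg x hx y hy, h'.cartan_neg x hx y hy]
        · rw [h.pos_neg x hx y hy, h'.pos_neg x hx y hy]
      · rcases mem_nNeg_or_cartan_or_nPos hV hx with hx | hx | hx
        · rw [h.left_neg x hx, h'.left_neg x hx]
        · rw [h.cartan_cartan x hx y hy, h'.cartan_cartan x hx y hy]
        · rw [h.pos_cartan x hx y hy, h'.pos_cartan x hx y hy]
      · rw [h.right_pos x y hy, h'.right_pos x y hy]

/-- The coefficients of `κ` are invertible on the degrees of the Borel subalgebra. -/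
lemma pairsNondegenerately_borelForm : PairsNondegenerately k (borelForm hV)
    (bPos V k).toSubmodule (bNeg V k).toSubmodule := by
  obtain ⟨h1, h2⟩ := pairsNondegenerately_kmForm (k := k) hV
  refine ⟨fun x hx h => ?_, fun y hy h => h2 y hy fun x hx => ?_⟩
  · have hx' : scale hV (borelCoeff k) x ∈ bPos V k := by
      rw [mem_bPos_iff hV]
      exact scale_mem_gsum hV _ ((mem_bPos_iff hV).1 hx)
    have h3 : scale hV (borelCoeff k) x = 0 := h1 _ hx' h
    rw [← scale_borelCoeff_canonicalCoeff hV hx, scale_comm, h3, map_zero]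
  · rw [← scale_borelCoeff_canonicalCoeff hV hx]
    exact h _ (scale_canonicalCoeff_mem_bPos hV x)

lemma borelForm_of_mem {φ : funX V} {x : ContKM V k} (hx : x ∈ comp V k φ) :
    borelForm hV x = borelCoeff k φ • (kmForm k hV).flip x := by
  refine LinearMap.ext fun y => ?_
  rw [borelForm_apply, scale_apply hV _ hx, map_smul, LinearMap.smul_apply, LinearMap.smul_apply,
    LinearMap.BilinForm.flip_apply, kmForm_symm]

lemma borelForm_flip_of_mem {φ : funX V} {y : ContKM V k} (hy : y ∈ comp V k φ) :
    (borelForm hV).flip y = borelCoeff k (-φ) • (kmForm k hV).flip y := by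
  refine LinearMap.ext fun x => ?_
  rw [LinearMap.BilinForm.flip_apply, borelForm_apply, scale_adjoint, scale_apply hV _ hy, map_smul,
    LinearMap.smul_apply, LinearMap.BilinForm.flip_apply]

include hV in
lemma eq_zero_or_mem_of_gsum {S : Set (funX V)} {φ : funX V} {x : ContKM V k}
    (hx : x ∈ gsum k (kmGen V k) S) (hφ : x ∈ comp V k φ) : x = 0 ∨ φ ∈ S := by
  by_cases h : φ ∈ S
  · exact Or.inr h
  · refine Or.inl ((Submodule.mem_bot k).1 ((disjoint_gsum (satisfiesRel_kmGen V k) hV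
      (S := S) (T := {φ}) ?_).le_bot ⟨hx, homog_le_gsum (Set.mem_singleton _) hφ⟩))
    exact Set.disjoint_singleton_right.2 h

include hV in
/-- The equality of coefficients fails only for two elements of degree zero, which commute. -/
lemma borelCoeff_smul_lie {φ ψ φ' ψ' : funX V} (hφ : NonNeg φ) (hψ : NonNeg ψ) {x y : ContKM V k}
    (hx : x ∈ comp V k φ') (hy : y ∈ comp V k ψ') (h1 : φ = 0 → φ' = 0) (h2 : ψ = 0 → ψ' = 0) :
    borelCoeff k (φ + ψ) • ⁅x, y⁆ =
      -(borelCoeff k φ * borelCoeff k ψ * (halfSign k φ + halfSign k ψ)) • ⁅x, y⁆ := by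
  by_cases h : φ = 0 ∧ ψ = 0
  · obtain rfl := h1 h.1
    obtain rfl := h2 h.2
    rw [lie_eq_zero_of_comp_zero hV hx hy, smul_zero, smul_zero]
  · rw [borelCoeff_add hφ hψ h]

/-- By duality both identities are statements about the bracket `{a, b}`, whose coefficients are
matched by those of `κ`. -/
lemma isLieBialgebraPairing_borelForm :
    IsLieBialgebraPairing k (cobracket hV) (borelForm (k := k) hV) := by
  constructor
  · intro φ ψ x hxb hx y hyb hy z _
    rcases eq_zero_or_mem_of_gsum hV ((mem_bPos_iff hV).1 hxb) hx with rfl | hφ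
    · simp [tensorForm]
    rcases eq_zero_or_mem_of_gsum hV ((mem_bPos_iff hV).1 hyb) hy with rfl | hψ
    · simp [tensorForm]
    have h1 := (represents_cobracket hV z).form (-φ) (-ψ) x (by rwa [neg_neg]) y (by rwa [neg_neg])
    have h2 := congrArg (fun w => kmForm k hV w z)
      (borelCoeff_smul_lie hV hφ hψ hx hy (fun h => h) fun h => h)
    simp only [map_smul, LinearMap.smul_apply, smul_eq_mul] at h2
    rw [borelForm_of_mem hV hx, borelForm_of_mem hV hy, tensorForm_smul_smul]
    refine Eq.trans ?_ (congrArg (fun t => -(borelCoeff k φ * borelCoeff k ψ * t)) h1.symm)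
    rw [borelForm_of_mem hV (comp_lie hx hy), LinearMap.smul_apply, LinearMap.BilinForm.flip_apply,
      smul_eq_mul, kmForm_symm hV z, h2, rBracket_apply hV hx hy, map_smul, smul_eq_mul,
      kmForm_symm hV z]
    ring
  · intro φ ψ y hyb hy z hzb hz x _
    rcases eq_zero_or_mem_of_gsum hV ((mem_bNeg_iff hV).1 hyb) hy with rfl | hφ
    · simp [tensorForm]
    rcases eq_zero_or_mem_of_gsum hV ((mem_bNeg_iff hV).1 hzb) hz with rfl | hψ
    · simp [tensorForm]
    have h1 := (represents_cobracket hV x).form (-φ) (-ψ) y (by rwa [neg_neg]) z (by rwa [neg_neg])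
    have h2 := congrArg (fun w => kmForm k hV x w)
      (borelCoeff_smul_lie hV hφ hψ hy hz neg_eq_zero.1 neg_eq_zero.1)
    simp only [map_smul, smul_eq_mul] at h2
    rw [borelForm_flip_of_mem hV hy, borelForm_flip_of_mem hV hz, tensorForm_smul_smul]
    refine Eq.trans ?_ (congrArg (fun t => borelCoeff k (-φ) * borelCoeff k (-ψ) * t) h1.symm)
    have h3 := LinearMap.congr_fun (borelForm_flip_of_mem hV (comp_lie hy hz)) x
    rw [LinearMap.BilinForm.flip_apply, LinearMap.smul_apply, LinearMap.BilinForm.flip_apply,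
      smul_eq_mul, neg_add, h2] at h3
    rw [h3, rBracket_apply hV hy hz, map_smul, smul_eq_mul, halfSign_neg, halfSign_neg]
    ring

end Pairing

/-! ### The canonical element -/

section CanonicalElement

variable {X : Type u} [TopologicalSpace X] [T2Space X] {V : VertexSpace X}
variable {k : Type v} [Field k] [CharZero k] (hV : EulerNondegenerate V)

/-- The contraction of the canonical element in the second tensor factor. -/
def contractRight : ContKM V k →ₗ[k] ContKM V k := scale hV (canonicalCoeff k)

/-- The contraction of the canonical element in the first tensor factor. -/
def contractLeft : ContKM V k →ₗ[k] ContKM V k := scale hV fun φ => canonicalCoeff k (-φ)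

/-- The canonical element of the pairing `κ`, as a bilinear form. -/
def canonicalElement : LinearMap.BilinForm k (ContKM V k) :=
  (kmForm k hV ∘ₗ contractRight hV).flip

lemma canonicalElement_apply (a b : ContKM V k) :
    canonicalElement hV a b = kmForm k hV (contractRight hV b) a := rfl

lemma canonicalElement_apply' (a b : ContKM V k) :
    canonicalElement hV a b = kmForm k hV (contractLeft hV a) b := by
  rw [canonicalElement_apply, contractRight, scale_adjoint, kmForm_symm]
  rfl

lemma contractLeft_mem_bNeg (x : ContKM V k) : contractLeft hV x ∈ bNeg V k := by
  rw [mem_bNeg_iff hV]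
  exact scale_mem_of_signed hV (fun φ hφ hs => canonicalCoeff_of_not hφ hs.neg) x

lemma contract_add (x : ContKM V k) : contractRight hV x + contractLeft hV x = -x := by
  induction x using comp_induction with
  | add x y hx hy =>
    rw [map_add, map_add, neg_add, ← hx, ← hy]
    abel
  | homog φ x hx =>
    rw [contractRight, contractLeft, scale_apply hV _ hx, scale_apply hV _ hx, ← add_smul,
      canonicalCoeff, canonicalCoeff, halfSign_neg, ← neg_one_smul k x]
    congr 1
    ring

lemma isCanonicalElement_canonicalElement :
    IsCanonicalElement k (kmForm k hV) (borelForm hV) (bPos V k).toSubmodule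
      (bNeg V k).toSubmodule (canonicalElement hV) where
  left_supp a h b := h _ (scale_canonicalCoeff_mem_bPos hV b)
  right_supp b h a := by
    rw [canonicalElement_apply']
    exact h _ (contractLeft_mem_bNeg hV a)
  canonical x _ y hy a b ha hb := by
    have hy' : y ∈ bNeg V k := hy
    rw [← hb y hy, canonicalElement_apply,
      ha (contractRight hV b) (scale_canonicalCoeff_mem_bPos hV b),
      borelForm_apply, contractRight, scale_scale, scale_adjoint, scale_eq_smul hV (a := 1) _
      ((mem_bNeg_iff hV).1 hy'), one_smul, kmForm_symm]
    exact fun φ hφ => borelCoeff_mul_canonicalCoeff hφ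

/-- On homogeneous elements, a canonical element is determined by its defining identity or vanishes
for reasons of degree. -/
lemma canonicalElement_unique {r r' : LinearMap.BilinForm k (ContKM V k)}
    (h : IsCanonicalElement k (kmForm k hV) (borelForm hV) (bPos V k).toSubmodule
      (bNeg V k).toSubmodule r)
    (h' : IsCanonicalElement k (kmForm k hV) (borelForm hV) (bPos V k).toSubmodule
      (bNeg V k).toSubmodule r') : r' = r := by
  refine LinearMap.ext fun a => LinearMap.ext fun b => ?_
  induction a using comp_induction with
  | add x z hx hz => rw [map_add, map_add, LinearMap.add_apply, LinearMap.add_apply, hx, hz]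
  | homog φ a ha =>
    induction b using comp_induction with
    | add y z hy hz => rw [map_add, map_add, hy, hz]
    | homog ψ b hb =>
      by_cases hφ : NonNeg (-φ)
      swap
      · have h0 : ∀ u ∈ (bPos V k).toSubmodule, kmForm k hV u a = 0 := by
          intro u hu
          rw [bPos_eq k hV] at hu
          refine kmForm_gsum hV (T := {φ}) ?_ hu (homog_le_gsum (Set.mem_singleton _) ha)
          rintro χ hχ _ rfl h1
          exact hφ (eq_neg_of_add_eq_zero_left h1 ▸ hχ)
        rw [h.left_supp a h0, h'.left_supp a h0]
      by_cases hψ : NonNeg ψ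
      swap
      · have h0 : ∀ v ∈ (bNeg V k).toSubmodule, kmForm k hV v b = 0 := by
          intro v hv
          rw [bNeg_eq k hV] at hv
          refine kmForm_gsum hV (T := {ψ}) ?_ hv (homog_le_gsum (Set.mem_singleton _) hb)
          rintro χ hχ _ rfl h1
          exact hψ ((neg_eq_of_add_eq_zero_right h1).symm ▸ hχ)
        rw [h.right_supp b h0, h'.right_supp b h0]
      -- both forms are represented by elements of the Borel subalgebras
      have e1 : ∀ u ∈ (bPos V k).toSubmodule,
          kmForm k hV u a = borelForm hV u (contractLeft hV a) := by
        intro u _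
        rw [borelForm_apply, scale_adjoint, contractLeft, scale_scale, scale_apply hV _ ha,
          borelCoeff_mul_canonicalCoeff hφ, one_smul]
      have e2 : ∀ v ∈ (bNeg V k).toSubmodule,
          kmForm k hV v b = borelForm hV (contractRight hV b) v := by
        intro v _
        rw [borelForm_apply, contractRight, scale_scale, scale_apply hV _ hb,
          borelCoeff_mul_canonicalCoeff hψ, one_smul, kmForm_symm]
      rw [h.canonical _ (scale_canonicalCoeff_mem_bPos hV b) _
          (contractLeft_mem_bNeg hV a) a b e1 e2,
        h'.canonical _ (scale_canonicalCoeff_mem_bPos hV b) _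
          (contractLeft_mem_bNeg hV a) a b e1 e2]

lemma canonicalElement_add_swap (a b : ContKM V k) :
    canonicalElement hV a b + canonicalElement hV b a = -kmForm k hV a b := by
  rw [canonicalElement_apply' hV a b, canonicalElement_apply hV b a, ← LinearMap.add_apply,
    ← map_add, add_comm, contract_add, map_neg, LinearMap.neg_apply]

/-- The classical Yang–Baxter equation, which is equivalent to the modified one for the operator of
half the sign. -/
lemma canonicalElement_yangBaxter (a b c : ContKM V k) :
    kmForm k hV ⁅contractRight hV b, contractRight hV c⁆ a
      + kmForm k hV ⁅contractLeft hV a, contractRight hV c⁆ b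
      + kmForm k hV ⁅contractLeft hV a, contractLeft hV b⁆ c = 0 := by
  induction a using comp_induction with
  | add a a' h h' =>
    simp only [map_add, add_lie, LinearMap.add_apply]
    linear_combination h + h'
  | homog φ a ha =>
    induction b using comp_induction with
    | add b b' h h' =>
      simp only [map_add, add_lie, lie_add, LinearMap.add_apply]
      linear_combination h + h'
    | homog ψ b hb =>
      induction c using comp_induction with
      | add c c' h h' =>
        simp only [map_add, lie_add, LinearMap.add_apply]
        linear_combination h + h'
      | homog χ c hc =>
        have e1 : kmForm k hV ⁅a, c⁆ b = -kmForm k hV ⁅b, c⁆ a := by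
          rw [kmForm_invariant, ← lie_skew, map_neg, kmForm_symm]
        have e2 : kmForm k hV ⁅a, b⁆ c = kmForm k hV ⁅b, c⁆ a := by
          rw [kmForm_invariant, kmForm_symm]
        simp only [contractRight, contractLeft]
        rw [scale_apply hV _ ha, scale_apply hV _ hb, scale_apply hV _ hb, scale_apply hV _ hc]
        simp only [smul_lie, lie_smul, map_smul, LinearMap.smul_apply, smul_eq_mul, e1, e2,
          canonicalCoeff, halfSign_neg]
        by_cases hd : ψ + χ + φ = 0
        · have h1 := congrArg (fun y => kmForm k hV y a) (halfSign_smul_lie hV hb hc)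
          simp only [map_smul, LinearMap.smul_apply, smul_eq_mul] at h1
          rw [eq_neg_of_add_eq_zero_left hd, halfSign_neg] at h1
          linear_combination -h1
        · rw [kmForm_degree hV hd (comp_lie hb hc) ha]
          ring

lemma isQuasiTriangular_canonicalElement :
    IsQuasiTriangular k (kmForm k hV) (cobracket hV) (canonicalElement hV) where
  invariant x a b := by
    rw [canonicalElement_add_swap, canonicalElement_add_swap, kmForm_lie_left]
    ring
  yangBaxter := ⟨contractRight hV, contractLeft hV, canonicalElement_apply hV,
    canonicalElement_apply' hV, canonicalElement_yangBaxter hV⟩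
  coboundary x φ ψ a ha b hb := by
    have e1 : kmForm k hV b ⁅x, a⁆ = kmForm k hV x ⁅a, b⁆ := by
      rw [kmForm_symm, kmForm_invariant]
    have e2 : kmForm k hV a ⁅x, b⁆ = -kmForm k hV x ⁅a, b⁆ := by
      rw [kmForm_symm, kmForm_invariant, ← lie_skew, map_neg]
    refine ((represents_cobracket hV x).form φ ψ a ha b hb).trans ?_
    rw [canonicalElement_apply, canonicalElement_apply' hV a, contractRight, contractLeft,
      scale_apply hV _ ha, scale_apply hV _ hb, rBracket_apply hV ha hb]
    simp only [map_smul, LinearMap.smul_apply, smul_eq_mul, e1, e2, canonicalCoeff, halfSign_neg]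
    ring

end CanonicalElement

end ContinuumKM

end

theorem mainTheorem1 {X : Type*} [TopologicalSpace X] [T2Space X]
    (V : ContinuumKM.VertexSpace X) (hV : ContinuumKM.EulerNondegenerate V)
    (k : Type*) [Field k] [CharZero k] :
    ∃ B : LinearMap.BilinForm k (ContinuumKM.ContKM V k),
      -- the Euler form extends uniquely to an invariant symmetric form, which is non-degenerate
      ContinuumKM.IsEulerExtension V k B ∧
      (∀ B', ContinuumKM.IsEulerExtension V k B' → B' = B) ∧
      (∀ x, (∀ y, B x y = 0) → x = 0) ∧
      ∃ δ : ContinuumKM.ContKM V k →ₗ[k] ContinuumKM.ComplTensor V k,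
        -- the cobracket: values on generators, uniqueness, Lie bialgebra axioms, Borel subalgebras
        ContinuumKM.HasGeneratorValues k δ ∧
        (∀ δ' : ContinuumKM.ContKM V k →ₗ[k] ContinuumKM.ComplTensor V k,
          ContinuumKM.HasGeneratorValues k δ' → ContinuumKM.IsCocycle k δ' → δ' = δ) ∧
        ContinuumKM.IsTopLieBialgebra k δ ∧
        ContinuumKM.IsSubBialgebra k δ (ContinuumKM.bPos V k) ∧
        ContinuumKM.IsSubBialgebra k δ (ContinuumKM.bNeg V k) ∧
        -- the pairing of the Borel subalgebras and the canonical element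
        ContinuumKM.PairsNondegenerately k B
          (ContinuumKM.bPos V k).toSubmodule (ContinuumKM.bNeg V k).toSubmodule ∧
        ∃ κ : LinearMap.BilinForm k (ContinuumKM.ContKM V k),
          ContinuumKM.IsBorelPairing k B κ ∧
          (∀ κ', ContinuumKM.IsBorelPairing k B κ' → κ' = κ) ∧
          ContinuumKM.PairsNondegenerately k κ
            (ContinuumKM.bPos V k).toSubmodule (ContinuumKM.bNeg V k).toSubmodule ∧
          ContinuumKM.IsLieBialgebraPairing k δ κ ∧
          ∃ r : LinearMap.BilinForm k (ContinuumKM.ContKM V k),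
            ContinuumKM.IsCanonicalElement k B κ
              (ContinuumKM.bPos V k).toSubmodule (ContinuumKM.bNeg V k).toSubmodule r ∧
            (∀ r', ContinuumKM.IsCanonicalElement k B κ
              (ContinuumKM.bPos V k).toSubmodule (ContinuumKM.bNeg V k).toSubmodule r' → r' = r) ∧
            ContinuumKM.IsQuasiTriangular k B δ r := by
  exact ⟨ContinuumKM.kmForm k hV, ContinuumKM.isEulerExtension_kmForm hV,
    fun _ h => ContinuumKM.eulerExtension_unique hV (ContinuumKM.isEulerExtension_kmForm hV) h,
    fun _ h => ContinuumKM.kmForm_nondegenerate hV h,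
    ContinuumKM.cobracket hV, ContinuumKM.hasGeneratorValues_cobracket hV,
    fun _ h hc => ContinuumKM.cocycle_unique (ContinuumKM.hasGeneratorValues_cobracket hV)
      (ContinuumKM.isCocycle_cobracket hV) h hc,
    ContinuumKM.isTopLieBialgebra_cobracket hV, ContinuumKM.isSubBialgebra_bPos hV,
    ContinuumKM.isSubBialgebra_bNeg hV, ContinuumKM.pairsNondegenerately_kmForm hV,
    ContinuumKM.borelForm hV, ContinuumKM.isBorelPairing_borelForm hV,
    fun _ h => ContinuumKM.borelPairing_unique hV (ContinuumKM.isBorelPairing_borelForm hV) h,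
    ContinuumKM.pairsNondegenerately_borelForm hV, ContinuumKM.isLieBialgebraPairing_borelForm hV,
    ContinuumKM.canonicalElement hV, ContinuumKM.isCanonicalElement_canonicalElement hV,
    fun _ h => ContinuumKM.canonicalElement_unique hV
      (ContinuumKM.isCanonicalElement_canonicalElement hV) h,
    ContinuumKM.isQuasiTriangular_canonicalElement hV⟩
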